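/- Let $L\ge 2$ be an integer and let $\mathcal G=\bigoplus_{j\ge 0}\mathbb Z/L^4\mathbb Z$ be the four-dimensional hierarchical lattice, with points $x=(\dots,x_2,x_1,x_0)$, balls $\mathcal G_k=\{x: x_j=0 \text{ for } j\ge k\}$, norm $|0|=0$, $|x|=L^{p}$ with $p=\min\{k:x\in\mathcal G_k\}$ for $x\neq 0$, and scaling map $L^{-1}x=(\dots,x_3,x_2,x_1)$. Let $\omega(t)$ be the hierarchical Lévy process started at $0$: it jumps at rate $r=\frac{1-L^{-4}}{1-L^{-6}}$, and a jump is from $x$ to $y\ne x$ with probability proportional to $|x-y|^{-6}$. Fix $N\ge 1$, put $\Lambda=\mathcal G_N$ and $\Lambda/L=\mathcal G_{N-1}$, and let $\mathbb E_0^\Lambda$ denote expectation for the process killed on first exit from $\Lambda$. With $\tau_y=\int_0^T 1_{\omega(t)=y}\,dt$ the generalized Green's function is $$G_g^\Lambda(\beta,x)=\int_0^\infty e^{-\beta T}\,\mathbb E_0^\Lambda\Big(\prod_{y\in\Lambda}g(\tau_y)\,1_{\omega(T)=x}\Big)\,dT ,$$ and $(\mathcal S U)(x)=L^{-2}U(L^{-1}x)$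 for functions $U$ on the lattice. Differential forms. On $\mathbb C^\Lambda$ put $\psi_x\bar\psi_y=(2\pi i)^{-1}d\phi_x\wedge d\bar\phi_y$, $\tau_x=\phi_x\bar\phi_x+\psi_x\bar\psi_x$, and $f(\tau_x)=f(|\phi_x|^2)+f'(|\phi_x|^2)\psi_x\bar\psi_x$. Let $\Gamma(\beta,x)=\frac1{1+\beta}(1_{\mathcal G_0}(x)-L^{-4}1_{\mathcal G_1}(x))$, let $\Xi\subset\mathbb C^\Lambda$ be the space of fields whose sum over every coset of $\mathcal G_1$ is $0$, and let $\mu_\Gamma=e^{-S_A}$, $S_A=\sum\zeta_xA_{xy}\bar\zeta_y+(2\pi i)^{-1}\sum A_{xy}\,d\zeta_x\wedge d\bar\zeta_y$, be the Gaussian form on $\Xi$, where $A$ is the inverse of $\Gamma(\beta)$ on $\Xi$. For a form $u$ on $\mathbb C^\Lambda$ let $\mathbb T_\beta u=\mathcal S(\mu_\Gamma * u)$, where $(\mu_\Gamma*u)(\phi)=\int_\Xi\mu_\Gamma(\zeta)\,u(\phi+\zeta)$ (integration of forms over the fibre $\Xi$, with $d\zeta\wedge d\bar\zeta=-2i\,du\,dv$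 for $\zeta=u+iv$) and $\mathcal S$ on forms is the pullback along $\mathbb C^{\Lambda/L}\to\mathbb C^{\Lambda}$, $(\mathcal S\phi)_x=L^{-1}\phi_{L^{-1}x}$. Hypotheses. Let $\beta\in\mathbb C$, $\beta\neq-1$, and let $g:[0,\infty)\to\mathbb C$ be smooth with $g(0)=1$. Assume that for some real $\kappa$ with $\operatorname{Re}\beta+\kappa>-rL^{-2N}$ every derivative $g^{(k)}$, $k\ge 0$, satisfies $g^{(k)}(t)=O(e^{-\kappa t})$ on $[0,\infty)$. (For example $g(t)=e^{-\lambda t^2}$ with $\operatorname{Re}\lambda>0$ and any $\beta\neq-1$; or $g$ bounded with bounded derivatives and $\operatorname{Re}\beta>-rL^{-2N}$.) Proposition. There are a number $\nu'\in\mathbb C$ and a smooth function $g'=T_\beta g$ on $[0,\infty)$, both unique, such that $$g'(\tau)=e^{\nu'\tau}\,\mathbb T_\beta\Big(\prod_{y\in\mathcal G_1}g(\tau_y)\Big)\quad\text{as forms on }\mathbb C=\mathbb C^{\mathcal G_0},\qquad g'(t)=1+O(t^2)\ \text{ as } t\to0 .$$ With $\beta'=L^2\beta+\nu'$, for every $x\in\Lambda$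 with $|x|>L$ the integrals defining $G_g^\Lambda(\beta,x)$ and $G_{g'}^{\Lambda/L}(\beta',L^{-1}x)$ converge absolutely and $$G_g^{\Lambda}(\beta,x)=\mathcal S\,G_{g'}^{\Lambda/L}(\beta',x)=L^{-2}\,G_{g'}^{\Lambda/L}(\beta',L^{-1}x).$$ -/

import Mathlib

open MeasureTheory ProbabilityTheory
open scoped ContDiff

/-! ### The hierarchical lattice -/

/-- The four dimensional hierarchical lattice `𝒢`: the direct sum of countably many copies of
`ℤ/n`, with `n = L ^ 4`. A point is `x = (…, x₂, x₁, x₀)` with finitely many nonzero entries. -/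
abbrev Hier (L : ℕ) : Type := ℕ →₀ ZMod (L ^ 4)

namespace Hier

/-- The ball `𝒢_N = {x : x_j = 0 for all j ≥ N}`, which has `L ^ (4 N)` points. -/
def ball (L N : ℕ) : Set (Hier L) := {x | ∀ j, N ≤ j → x j = 0}

/-- The ultrametric norm: `|0| = 0`, and `|x| = L ^ p` with `p = min {k : x ∈ 𝒢_k}` for `x ≠ 0`. -/
noncomputable def hnorm {L : ℕ} (x : Hier L) : ℝ :=
  if x = 0 then 0 else (L : ℝ) ^ sInf {k : ℕ | x ∈ ball L k}

/-- The scaling map `x ↦ L⁻¹ x`, that is `(…, x₂, x₁, x₀) ↦ (…, x₃, x₂, x₁)`. -/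
noncomputable def down {L : ℕ} (x : Hier L) : Hier L :=
  Finsupp.comapDomain (fun j => j + 1) x (add_left_injective 1).injOn

lemma down_mem_ball {L N : ℕ} {x : Hier L} (hx : x ∈ ball L (N + 1)) : down x ∈ ball L N := by
  intro j hj
  exact hx (j + 1) (by omega)

/-- The scaling map as a map from `Λ = 𝒢_{N+1}` to `Λ/L = 𝒢_N`. -/
noncomputable def ballDown {L N : ℕ} (x : ball L (N + 1)) : ball L N :=
  ⟨down x.1, down_mem_ball x.2⟩

lemma zero_mem_ball (L N : ℕ) : (0 : Hier L) ∈ ball L N := fun _ _ => rfl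

lemma ball_restrict_injective (L N : ℕ) :
    Function.Injective (fun (x : ball L N) (j : Fin N) => x.1 j) := by
  intro x y h
  apply Subtype.ext
  ext j
  by_cases hj : j < N
  · exact congrFun h ⟨j, hj⟩
  · rw [x.2 j (not_lt.mp hj), y.2 j (not_lt.mp hj)]

instance ball_finite (L N : ℕ) [L.AtLeastTwo] : Finite (ball L N) :=
  haveI : NeZero (L ^ 4) := ⟨pow_ne_zero 4 (NeZero.ne L)⟩
  Finite.of_injective _ (ball_restrict_injective L N)

noncomputable instance ball_fintype (L N : ℕ) [L.AtLeastTwo] : Fintype (ball L N) :=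
  Fintype.ofFinite _

noncomputable instance ball_decEq (L N : ℕ) : DecidableEq (ball L N) := Classical.decEq _

lemma card_ball_le (L N : ℕ) [L.AtLeastTwo] : Nat.card (ball L N) ≤ L ^ (4 * N) := by
  have : NeZero (L ^ 4) := ⟨pow_ne_zero 4 (NeZero.ne L)⟩
  have h := Nat.card_le_card_of_injective _ (ball_restrict_injective L N)
  simpa [Nat.card_eq_fintype_card, ZMod.card, pow_mul] using h

instance measurableSpace (L : ℕ) : MeasurableSpace (Hier L) := ⊤

/-! ### The hierarchical Lévy process -/

/-- The unnormalized jump law `x ↦ |x| ^ (-6)` for `x ≠ 0`, and no jump to the same point. -/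
noncomputable def jumpWeight {L : ℕ} (x : Hier L) : ENNReal :=
  if x = 0 then 0 else ENNReal.ofReal ((hnorm x ^ 6)⁻¹)

lemma exists_mem_ball {L : ℕ} (x : Hier L) : ∃ k, x ∈ ball L k := by
  refine ⟨x.support.sup (fun j => j + 1), fun j hj => ?_⟩
  by_contra h
  have h1 : j + 1 ≤ x.support.sup (fun j => j + 1) :=
    Finset.le_sup (f := fun j => j + 1) (Finsupp.mem_support_iff.mpr h)
  omega

lemma tsum_jumpWeight_ne_zero (L : ℕ) [L.AtLeastTwo] :
    ∑' x : Hier L, jumpWeight x ≠ 0 := by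
  have h2 : 2 ≤ L := Nat.AtLeastTwo.prop
  have : Fact (1 < L ^ 4) := ⟨Nat.one_lt_pow (by norm_num) (by omega)⟩
  have hx : (Finsupp.single 0 1 : Hier L) ≠ 0 := by simp
  intro h
  have h0 := ENNReal.tsum_eq_zero.mp h (Finsupp.single 0 1)
  have hL : (0 : ℝ) < L := by exact_mod_cast (by omega : 0 < L)
  simp only [jumpWeight, hnorm, if_neg hx] at h0
  have hp := ENNReal.ofReal_eq_zero.mp h0
  have : 0 < (((L : ℝ) ^ sInf {k : ℕ | (Finsupp.single 0 1 : Hier L) ∈ ball L k}) ^ 6)⁻¹ := by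
    positivity
  linarith

lemma jumpWeight_le {L : ℕ} [L.AtLeastTwo] (x : Hier L) :
    jumpWeight x ≤ ∑' k : ℕ, (ball L k).indicator
      (fun _ => ENNReal.ofReal ((((L : ℝ) ^ k) ^ 6)⁻¹)) x := by
  by_cases hx : x = 0
  · simp [jumpWeight, hx]
  · have hm : x ∈ ball L (sInf {k : ℕ | x ∈ ball L k}) :=
      Nat.sInf_mem (s := {k : ℕ | x ∈ ball L k}) (exists_mem_ball x)
    refine le_trans ?_ (ENNReal.le_tsum (sInf {k : ℕ | x ∈ ball L k}))
    rw [Set.indicator_of_mem hm]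
    simp [jumpWeight, hnorm, hx]

lemma tsum_jumpWeight_ne_top (L : ℕ) [L.AtLeastTwo] :
    ∑' x : Hier L, jumpWeight x ≠ ⊤ := by
  have h2 : 2 ≤ L := Nat.AtLeastTwo.prop
  have hL : (1 : ℝ) < L := by exact_mod_cast (by omega : 1 < L)
  have hL0 : (0 : ℝ) < L := by linarith
  have hb : ∀ k : ℕ, ∑' x : Hier L, (ball L k).indicator
      (fun _ => ENNReal.ofReal ((((L : ℝ) ^ k) ^ 6)⁻¹)) x
        ≤ ENNReal.ofReal ((((L : ℝ) ^ 2)⁻¹) ^ k) := by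
    intro k
    rw [← tsum_subtype (ball L k) (fun _ => ENNReal.ofReal ((((L : ℝ) ^ k) ^ 6)⁻¹)),
      ENNReal.tsum_const, ENat.card_eq_coe_natCard]
    have hc : ((Nat.card (ball L k) : ℕ∞) : ENNReal) ≤ ENNReal.ofReal ((L : ℝ) ^ (4 * k)) := by
      rw [← Nat.cast_pow, ENNReal.ofReal_natCast]
      exact_mod_cast card_ball_le L k
    refine le_trans (mul_le_mul_left hc _) ?_
    rw [← ENNReal.ofReal_mul (by positivity)]
    apply ENNReal.ofReal_le_ofReal
    apply le_of_eq
    rw [inv_pow, ← pow_mul, ← pow_mul]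
    field_simp
    rw [← pow_add]
    congr 1
    ring
  have hle : ∑' x : Hier L, jumpWeight x ≤ ∑' k : ℕ, ENNReal.ofReal ((((L : ℝ) ^ 2)⁻¹) ^ k) := by
    calc ∑' x : Hier L, jumpWeight x
        ≤ ∑' x : Hier L, ∑' k : ℕ, (ball L k).indicator
            (fun _ => ENNReal.ofReal ((((L : ℝ) ^ k) ^ 6)⁻¹)) x :=
          ENNReal.tsum_le_tsum jumpWeight_le
      _ = ∑' k : ℕ, ∑' x : Hier L, (ball L k).indicator
            (fun _ => ENNReal.ofReal ((((L : ℝ) ^ k) ^ 6)⁻¹)) x := ENNReal.tsum_comm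
      _ ≤ _ := ENNReal.tsum_le_tsum hb
  refine ne_top_of_le_ne_top ?_ hle
  have hs : Summable (fun k : ℕ => (((L : ℝ) ^ 2)⁻¹) ^ k) :=
    summable_geometric_of_lt_one (by positivity) (inv_lt_one_of_one_lt₀ (by nlinarith))
  rw [← ENNReal.ofReal_tsum_of_nonneg (fun k => by positivity) hs]
  exact ENNReal.ofReal_ne_top

/-- The law `q` of a jump: the probability of jumping from `x` to `x + z` is proportional to
`|z| ^ (-6)`. -/
noncomputable def jumpLaw (L : ℕ) [L.AtLeastTwo] : PMF (Hier L) :=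
  PMF.normalize jumpWeight (tsum_jumpWeight_ne_zero L) (tsum_jumpWeight_ne_top L)

/-- The jump rate `r`, for which the potential in infinite volume at `β = 0` is `|x| ^ (-2)`,
`x ≠ 0`. -/
noncomputable def jumpRate (L : ℕ) : ℝ := (1 - ((L : ℝ) ^ 4)⁻¹) / (1 - ((L : ℝ) ^ 6)⁻¹)

lemma jumpRate_pos (L : ℕ) [L.AtLeastTwo] : 0 < jumpRate L := by
  have h2 : 2 ≤ L := Nat.AtLeastTwo.prop
  have hL : (1 : ℝ) < L := by exact_mod_cast (by omega : 1 < L)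
  have h4 : ((L : ℝ) ^ 4)⁻¹ < 1 := inv_lt_one_of_one_lt₀ (one_lt_pow₀ hL (by norm_num))
  have h6 : ((L : ℝ) ^ 6)⁻¹ < 1 := inv_lt_one_of_one_lt₀ (one_lt_pow₀ hL (by norm_num))
  exact div_pos (by linarith) (by linarith)

/-- The sample space: `(p i).1` is the waiting time before jump number `i`, and
`(p i).2` is the displacement of that jump, `i = 0, 1, 2, …`. -/
abbrev Sample (L : ℕ) : Type := ℕ → ℝ × Hier L

/-- The law of the process started at `0`: waiting times are exponential with rate `r`, jumps have
law `q`, and all of them are independent. -/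
noncomputable def pathLaw (L : ℕ) [L.AtLeastTwo] : Measure (Sample L) :=
  haveI : IsProbabilityMeasure (expMeasure (jumpRate L)) :=
    isProbabilityMeasure_expMeasure (jumpRate_pos L)
  Measure.infinitePi fun _ : ℕ => (expMeasure (jumpRate L)).prod (jumpLaw L).toMeasure

/-- The number of jumps up to time `t`. -/
noncomputable def jumpCount {L : ℕ} (p : Sample L) (t : ℝ) : ℕ :=
  sInf {n : ℕ | t < ∑ i ∈ Finset.range (n + 1), (p i).1}

/-- The position `ω(t)` of the hierarchical Lévy process, with `ω(0) = 0`. -/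
noncomputable def position {L : ℕ} (p : Sample L) (t : ℝ) : Hier L :=
  ∑ i ∈ Finset.range (jumpCount p t), (p i).2

/-- The local time `τ_y^T = ∫_0^T 1_{ω(t) = y} dt`. -/
noncomputable def localTime {L : ℕ} (p : Sample L) (T : ℝ) (y : Hier L) : ℝ :=
  volume.real {t : ℝ | t ∈ Set.Icc 0 T ∧ position p t = y}

/-- The integrand of the finite volume Green's function, at time `T` and sample path `p`: it is
`e^{-β T} (∏_{y ∈ Λ} g(τ_y)) 1_{ω(T) = x}` if the process has not left `Λ = 𝒢_N` (where it is
killed on first exit) up to time `T`, and `0` otherwise. -/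
noncomputable def greenIntegrand (L N : ℕ) [L.AtLeastTwo] (g : ℝ → ℂ) (β : ℂ) (x : Hier L)
    (T : ℝ) (p : Sample L) : ℂ :=
  open Classical in
  if (∀ t ∈ Set.Icc (0 : ℝ) T, position p t ∈ ball L N) ∧ position p T = x then
    Complex.exp (-β * T) * ∏ y : ball L N, g (localTime p T y)
  else 0

/-- The finite volume Green's function
`G_g^Λ(β, x) = ∫_0^∞ e^{-β T} E_0^Λ (g^Λ 1_{ω(T) = x}) dT` with `Λ = 𝒢_N`. -/
noncomputable def green (L N : ℕ) [L.AtLeastTwo] (g : ℝ → ℂ) (β : ℂ) (x : Hier L) : ℂ :=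
  ∫ T in Set.Ioi (0 : ℝ), ∫ p, greenIntegrand L N g β x T p ∂(pathLaw L)

/-- Absolute convergence of the double integral that defines `green`. -/
def GreenConverges (L N : ℕ) [L.AtLeastTwo] (g : ℝ → ℂ) (β : ℂ) (x : Hier L) : Prop :=
  Integrable (fun p : ℝ × Sample L => greenIntegrand L N g β x p.1 p.2)
    ((volume.restrict (Set.Ioi (0 : ℝ))).prod (pathLaw L))

/-- Scaling of functions on the lattice: `(𝒮 U)(x) = L⁻² U(L⁻¹ x)`. -/
noncomputable def scaleFun {L : ℕ} (U : Hier L → ℂ) (x : Hier L) : ℂ :=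
  ((L : ℂ) ^ 2)⁻¹ * U (down x)

/-! ### Complex differential forms on a real vector space -/

section Forms

variable {E F : Type*} [AddCommGroup E] [Module ℝ E] [AddCommGroup F] [Module ℝ F]

/-- The exterior algebra of complex valued real-linear functionals on `E`: the values at a point
of complex differential forms on `E`. Multiplication is the wedge product. -/
abbrev Ext (E : Type*) [AddCommGroup E] [Module ℝ E] : Type _ := ExteriorAlgebra ℂ (E →ₗ[ℝ] ℂ)

/-- Complex differential forms (of mixed degree) on `E`. -/
abbrev DForm (E : Type*) [AddCommGroup E] [Module ℝ E] : Type _ := E → Ext E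

/-- The constant one-form `dw` of a real-linear function `w : E → ℂ`. -/
noncomputable def dOf (w : E →ₗ[ℝ] ℂ) : Ext E := ExteriorAlgebra.ι ℂ w

/-- Precomposition with `f : E → F`, as a map of (complexified) dual spaces. -/
noncomputable def dualMap (f : E →ₗ[ℝ] F) : (F →ₗ[ℝ] ℂ) →ₗ[ℂ] (E →ₗ[ℝ] ℂ) where
  toFun w := w ∘ₗ f
  map_add' _ _ := rfl
  map_smul' _ _ := rfl

/-- Pullback of forms along a linear map. -/
noncomputable def pullback (f : E →ₗ[ℝ] F) (u : DForm F) : DForm E :=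
  fun v => ExteriorAlgebra.map (dualMap f) (u (f v))

/-- The interior product with a vector `e : E`. -/
noncomputable def interiorProd (e : E) : Module.End ℂ (Ext E) :=
  CliffordAlgebra.contractLeft
    ({ toFun := fun w => w e, map_add' := fun _ _ => rfl, map_smul' := fun _ _ => rfl } :
      Module.Dual ℂ (E →ₗ[ℝ] ℂ))

/-- `v` is the integral of the vector valued function `f`, tested against linear functionals. -/
def IsVecIntegral {X V : Type*} [MeasurableSpace X] [AddCommGroup V] [Module ℂ V]
    (μ : Measure X) (f : X → V) (v : V) : Prop :=
  ∀ l : Module.Dual ℂ V, Integrable (fun x => l (f x)) μ ∧ ∫ x, l (f x) ∂μ = l v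

/-- The integral of a vector valued function, or `0` if it is not integrable. -/
noncomputable def vecIntegral {X V : Type*} [MeasurableSpace X] [AddCommGroup V] [Module ℂ V]
    (μ : Measure X) (f : X → V) : V :=
  open Classical in
  if h : ∃ v, IsVecIntegral μ f v then h.choose else 0

/-- Integration of a form on `E × F` over the fibres `{v} × F`, where `F` is a finite dimensional
complex vector space with its orientation as a complex manifold. In complex linear coordinates
`z = (z_1, …, z_k)` on `F` given by a basis `b` one contracts with
`b_1, i b_1, b_2, i b_2, …, b_k, i b_k` in this order, restricts to `E`, and integrates over
`z ∈ ℂ^k` with Lebesgue measure. The result does not depend on the basis. Only the part of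
full degree in the fibre directions contributes, and `dz ∧ dz̄` integrates as `-2 i du dv` for
`z = u + i v`. -/
noncomputable def fibreIntegral {E F : Type*} [AddCommGroup E] [Module ℝ E]
    [AddCommGroup F] [Module ℂ F] [Module.Finite ℂ F] [Module ℝ F] (u : DForm (E × F)) :
    DForm E := fun v =>
  let b := Module.finBasis ℂ F
  let contractAll : Module.End ℂ (Ext (E × F)) :=
    ((List.ofFn fun j => interiorProd ((0 : E), Complex.I • b j) * interiorProd ((0 : E), b j)).prod)
  vecIntegral (volume : Measure (Fin (Module.finrank ℂ F) → ℂ)) fun z =>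
    ExteriorAlgebra.map (dualMap (LinearMap.inl ℝ E F)) (contractAll (u (v, ∑ j, z j • b j)))

end Forms

/-! ### The renormalization group map -/

/-- The manifold `ℂ^Λ` with `Λ = 𝒢_N`. -/
abbrev Field (L N : ℕ) : Type := ball L N → ℂ

/-- The coordinate `φ_x` on `ℂ^Λ`. -/
noncomputable def coord {L N : ℕ} (x : ball L N) : Field L N →ₗ[ℝ] ℂ := LinearMap.proj x

/-- The coordinate `φ̄_x` on `ℂ^Λ`. -/
noncomputable def coordBar {L N : ℕ} (x : ball L N) : Field L N →ₗ[ℝ] ℂ :=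
  Complex.conjAe.toLinearMap ∘ₗ coord x

/-- The covariance `Γ(β, x - y)`, with
`Γ(β, x) = (1 + β)⁻¹ (1_{𝒢_0}(x) - L⁻⁴ 1_{𝒢_1}(x))`. -/
noncomputable def gammaCov (L N : ℕ) (β : ℂ) : Matrix (ball L N) (ball L N) ℂ :=
  open Classical in
  fun x y => (1 + β)⁻¹ *
    ((if x.1 - y.1 ∈ ball L 0 then 1 else 0)
      - ((L : ℂ) ^ 4)⁻¹ * (if x.1 - y.1 ∈ ball L 1 then 1 else 0))

/-- The space `Ξ` of fluctuation fields: the orthogonal complement in `ℂ^Λ`, `Λ = 𝒢_{N+1}`, of the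
fields that are constant on the cosets `x + 𝒢_1`; these are the fibres of `x ↦ L⁻¹ x`. -/
def fluct (L N : ℕ) [L.AtLeastTwo] : Submodule ℂ (Field L (N + 1)) where
  carrier := {ζ | ∀ c : ball L N, ∑ x with ballDown x = c, ζ x = 0}
  add_mem' := by
    intro a b ha hb c
    simp [Finset.sum_add_distrib, ha c, hb c]
  zero_mem' := by
    intro c
    simp
  smul_mem' := by
    intro r a ha c
    simp [← Finset.mul_sum, ha c]

lemma down_eq_iff {L : ℕ} (x y : Hier L) : down x = down y ↔ x - y ∈ ball L 1 := by
  constructor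
  · intro h j hj
    obtain ⟨i, rfl⟩ : ∃ i, j = i + 1 := ⟨j - 1, by omega⟩
    have := DFunLike.congr_fun h i
    simp only [down, Finsupp.comapDomain_apply] at this
    simp [this]
  · intro h
    ext i
    have := h (i + 1) (by omega)
    simp only [down, Finsupp.comapDomain_apply]
    simpa [sub_eq_zero] using this

lemma sub_mem_ball_zero {L : ℕ} (x y : Hier L) : x - y ∈ ball L 0 ↔ x = y := by
  constructor
  · intro h
    ext j
    simpa [sub_eq_zero] using h j (Nat.zero_le j)
  · rintro rfl
    simpa using zero_mem_ball L 0

/-- On `Ξ` the covariance `Γ(β)` is multiplication by `(1 + β)⁻¹`. -/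
lemma gammaCov_mulVec (L N : ℕ) [L.AtLeastTwo] (β : ℂ) (ζ : Field L (N + 1))
    (hζ : ζ ∈ fluct L N) :
    (gammaCov L (N + 1) β).mulVec ζ = (1 + β)⁻¹ • ζ := by
  classical
  funext x
  have h1 : ∑ y : ball L (N + 1), (if x.1 - y.1 ∈ ball L 1 then ζ y else 0) = 0 := by
    have := hζ (ballDown x)
    rw [Finset.sum_filter] at this
    refine Eq.trans ?_ this
    refine Finset.sum_congr rfl fun y _ => ?_
    have hiff : x.1 - y.1 ∈ ball L 1 ↔ ballDown y = ballDown x := by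
      rw [← down_eq_iff, eq_comm, ballDown, ballDown, Subtype.mk.injEq]
    simp only [hiff]
  have h0 : ∑ y : ball L (N + 1), (if x.1 - y.1 ∈ ball L 0 then ζ y else 0) = ζ x := by
    simp only [sub_mem_ball_zero, ← Subtype.ext_iff]
    simp
  have hexp : (gammaCov L (N + 1) β).mulVec ζ x
      = (1 + β)⁻¹ * (∑ y : ball L (N + 1), (if x.1 - y.1 ∈ ball L 0 then ζ y else 0)
        - ((L : ℂ) ^ 4)⁻¹ * ∑ y : ball L (N + 1), (if x.1 - y.1 ∈ ball L 1 then ζ y else 0)) := by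
    simp only [Matrix.mulVec, dotProduct, gammaCov, Finset.mul_sum, ← Finset.sum_sub_distrib]
    refine Finset.sum_congr rfl fun y _ => ?_
    split_ifs <;> ring
  rw [hexp, h0, h1]
  simp

/-- `Γ(β)` as a linear operator on its invariant subspace `Ξ`. -/
noncomputable def gammaOp (L N : ℕ) [L.AtLeastTwo] (β : ℂ) : Module.End ℂ (fluct L N) :=
  (Matrix.toLin' (gammaCov L (N + 1) β)).restrict fun ζ hζ => by
    rw [Matrix.toLin'_apply, gammaCov_mulVec L N β ζ hζ]
    exact (fluct L N).smul_mem _ hζ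

/-- The inverse `A` of `Γ(β)` on `Ξ`, where `Γ(β)` is invertible for `β ≠ -1`. -/
noncomputable def gammaInv (L N : ℕ) [L.AtLeastTwo] (β : ℂ) : Module.End ℂ (fluct L N) :=
  Ring.inverse (gammaOp L N β)

/-- The Gaussian form `μ_Γ = exp (-S_A)` on `Ξ`, where `A` is the inverse of `Γ` on `Ξ` and
`S_A = ∑_x (A ζ)_x ζ̄_x + (2 π i)⁻¹ ∑_x d(A ζ)_x ∧ d ζ̄_x`. The exponential series of the two-form
terminates, as forms of degree above the real dimension vanish. -/
noncomputable def gaussForm (L N : ℕ) [L.AtLeastTwo] (β : ℂ) : DForm (fluct L N) := fun ζ =>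
  let incl : fluct L N →ₗ[ℝ] Field L (N + 1) := (fluct L N).subtype.restrictScalars ℝ
  let A : fluct L N →ₗ[ℝ] fluct L N := (gammaInv L N β).restrictScalars ℝ
  let s : Ext (fluct L N) := (2 * Real.pi * Complex.I)⁻¹ •
    ∑ x, dOf (coord x ∘ₗ incl ∘ₗ A) * dOf (coordBar x ∘ₗ incl)
  Complex.exp (-∑ x, (A ζ).1 x * (starRingEnd ℂ) (ζ.1 x)) •
    ∑ k ∈ Finset.range (Module.finrank ℝ (fluct L N) + 1), ((k.factorial : ℂ))⁻¹ • (-s) ^ k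

/-- `(μ_Γ * u)(φ) = ∫_Ξ μ_Γ(ζ) u(φ + ζ)`, where `u(φ + ζ)` is the pullback of `u` by
`(φ, ζ) ↦ φ + ζ`. -/
noncomputable def gaussConv (L N : ℕ) [L.AtLeastTwo] (β : ℂ) (u : DForm (Field L (N + 1))) :
    DForm (Field L (N + 1)) :=
  let incl : fluct L N →ₗ[ℝ] Field L (N + 1) := (fluct L N).subtype.restrictScalars ℝ
  fibreIntegral (F := fluct L N)
    (pullback (LinearMap.snd ℝ (Field L (N + 1)) (fluct L N)) (gaussForm L N β) *
      pullback (LinearMap.coprod LinearMap.id incl) u)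

/-- The scaling map of fields `ℂ^{Λ/L} → ℂ^Λ`, `(𝒮 φ)_x = L⁻¹ φ_{L⁻¹ x}`. -/
noncomputable def scaleField (L N : ℕ) : Field L N →ₗ[ℝ] Field L (N + 1) where
  toFun φ x := (L : ℂ)⁻¹ * φ (ballDown x)
  map_add' φ ψ := by
    funext x
    simp [mul_add]
  map_smul' c φ := by
    funext x
    simp [mul_left_comm]

/-- The renormalization group transformation `𝕋_β u = 𝒮 (μ_{Γ(β)} * u)`, from forms on `ℂ^Λ`,
`Λ = 𝒢_{N+1}`, to forms on `ℂ^{Λ/L}`, `Λ/L = 𝒢_N`. -/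
noncomputable def rgForm (L N : ℕ) [L.AtLeastTwo] (β : ℂ) (u : DForm (Field L (N + 1))) :
    DForm (Field L N) :=
  pullback (scaleField L N) (gaussConv L N β u)

/-- The form `g(τ_x)`, where `τ_x = φ_x φ̄_x + ψ_x ψ̄_x` and
`ψ_x ψ̄_x = (2 π i)⁻¹ dφ_x ∧ dφ̄_x`, given by the terminating Taylor series
`g(τ_x) = g(|φ_x|²) + g'(|φ_x|²) ψ_x ψ̄_x`. Only the values of `g` on `[0, ∞)` matter. -/
noncomputable def tauForm {L N : ℕ} (g : ℝ → ℂ) (x : ball L N) : DForm (Field L N) := fun φ =>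
  algebraMap ℂ _ (g (Complex.normSq (φ x))) +
    (derivWithin g (Set.Ici 0) (Complex.normSq (φ x)) * (2 * Real.pi * Complex.I)⁻¹) •
      (dOf (coord x) * dOf (coordBar x))

lemma commute_twoForm {M : Type*} [AddCommGroup M] [Module ℂ M] (a b c d : M) :
    Commute (ExteriorAlgebra.ι ℂ a * ExteriorAlgebra.ι ℂ b)
      (ExteriorAlgebra.ι ℂ c * ExteriorAlgebra.ι ℂ d) := by
  have sw : ∀ x y : M, ExteriorAlgebra.ι ℂ x * ExteriorAlgebra.ι ℂ y
      = -(ExteriorAlgebra.ι ℂ y * ExteriorAlgebra.ι ℂ x) := fun x y =>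
    eq_neg_of_add_eq_zero_left (ExteriorAlgebra.ι_add_mul_swap x y)
  have key : ∀ x : M, Commute (ExteriorAlgebra.ι ℂ x)
      (ExteriorAlgebra.ι ℂ c * ExteriorAlgebra.ι ℂ d) := by
    intro x
    rw [commute_iff_eq, ← mul_assoc, sw x c, neg_mul, mul_assoc, sw x d, mul_neg, neg_neg,
      mul_assoc]
  exact (key a).mul_left (key b)

lemma commute_tauForm {L N : ℕ} (g : ℝ → ℂ) (x y : ball L N) :
    Commute (tauForm g x) (tauForm g y) := by
  rw [commute_iff_eq]
  funext φ
  change Commute (tauForm g x φ) (tauForm g y φ)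
  refine Commute.add_left (Algebra.commutes _ _) (Commute.add_right ?_ ?_)
  · exact (Algebra.commutes _ _).symm
  · exact ((commute_twoForm _ _ _ _).smul_left _).smul_right _

/-- The form `g^Λ = ∏_{x ∈ Λ} g(τ_x)` on `ℂ^Λ`, `Λ = 𝒢_N`. -/
noncomputable def tauProd (L N : ℕ) [L.AtLeastTwo] (g : ℝ → ℂ) : DForm (Field L N) :=
  Finset.univ.noncommProd (fun x : ball L N => tauForm g x)
    fun x _ y _ _ => commute_tauForm g x y

/-- `g' = T_β g`, with the constant `ν'` that goes with it: `g'` is a smooth function on `[0, ∞)`,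
`g'(τ) = e^{ν' τ} 𝕋_β g^{𝒢_1}` as forms on `ℂ^{𝒢_0}`, where `𝒢_0` is a single site, and
`g'(t) = 1 + O(t²)` as `t → 0`. -/
structure IsRGStep (L : ℕ) [L.AtLeastTwo] (β : ℂ) (g : ℝ → ℂ) (ν' : ℂ) (g' : ℝ → ℂ) : Prop where
  smooth : ContDiffOn ℝ ∞ g' (Set.Ici 0)
  form_eq : tauForm g' ⟨0, zero_mem_ball L 0⟩ =
    tauForm (fun t : ℝ => Complex.exp (ν' * t)) ⟨0, zero_mem_ball L 0⟩ *
      rgForm L 0 β (tauProd L 1 g)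
  normalized : (fun t : ℝ => g' t - 1) =O[nhdsWithin 0 (Set.Ici 0)] fun t : ℝ => t ^ 2

end Hier

/-! Both sides are linear in the product of the g(τ_y), so everything reduces to exponentials. The
decay hypothesis lets g(t) be written on the half line as ∫ ρ(x) e^{-c(x)t} dx with Re c(x) = κ' for
a κ' < κ, with as many moments of ρ as wanted (`exists_laplace_representation`). The product over
sites then becomes an integral over independent rates v_y, one for each site.

For fixed rates both objects are finite dimensional. Expanding in the number of jumps, the Green's
function is an entry of the inverse of the generator killed outside the ball plus the potential β +
v_y (`hasSum_integral_stepWeight`, `green_eq_integral`). The rows of the generator on 𝒢_N sum to r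
L^{-2N}, and the lower bound on Re β + κ makes the expansion geometric and the matrix diagonally
dominant. On the side of forms, Γ is the scalar (1+β)⁻¹ on Ξ, so the integral over Ξ is Gaussian
with rates D_y = 1 + β + v_y under a constraint on the sum of the fields. With H = (∑ D_y⁻¹)⁻¹ its
value is e^{-v'τ}, v' = L⁶ H - (1+β) L² (`rgForm_tauProd`, `blockRate`). There is no prefactor,
because the weights H / D_i of the individual sites add up to one.

The same v' arises from the resolvent. The generator Q satisfies Q(z) = 1_{z=0} - L⁻⁴ 1_{z∈𝒢_1} +
L⁻⁶ Q(L⁻¹z) (`generator_eq`). Solving the resolvent equation site by site and summing over a block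
leaves an equation for the block sums alone, which is the resolvent equation on the coarser lattice
with potential L⁶ H - L² = L²β + v' (`sum_inv_killedMatrix`). After averaging over the rates,
permutations inside blocks make all L⁸ entries between two different blocks equal; the blocks of 0
and x differ because |x| > L, and L⁶ / L⁸ is the factor L⁻² (`integral_inv_killedMatrix_succ`).

It remains to normalize. If h is the superposition of the e^{-v't}, then h(0) = g(0)^{L⁴} = 1, and
ν' = -h'(0) is the only constant for which e^{ν't} h(t) has no linear term. This factor moves ν'
from the rates to β' and changes no resolvent. A form h(τ) determines h on [0, ∞), so h does not
depend on the chosen representation of g; taking ρ with more and more moments shows that h is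
smooth. -/

section LaplaceRepresentation

/-! ### Smooth decaying functions on the half line as superpositions of exponentials. -/

open Set Filter Topology

/-- The density `r ^ m e ^ {-r} / m!` of the gamma distribution. -/
noncomputable def gammaKernel (m : ℕ) (r : ℝ) : ℝ := r ^ m / m.factorial * Real.exp (-r)

lemma gammaKernel_nonneg (m : ℕ) {r : ℝ} (hr : 0 ≤ r) : 0 ≤ gammaKernel m r := by
  unfold gammaKernel; positivity

lemma continuous_gammaKernel (m : ℕ) : Continuous (gammaKernel m) := by
  unfold gammaKernel; fun_prop

lemma gammaKernel_le_exp (m : ℕ) {r : ℝ} (hr : 0 ≤ r) :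
    gammaKernel m r ≤ 2 ^ m * Real.exp (-(r / 2)) := by
  have h := Real.pow_div_factorial_le_exp (x := r / 2) (by linarith) m
  have : r ^ m / m.factorial = 2 ^ m * ((r / 2) ^ m / m.factorial) := by
    rw [div_pow]; field_simp
  rw [gammaKernel, this, mul_assoc]
  gcongr
  calc (r / 2) ^ m / m.factorial * Real.exp (-r) ≤ Real.exp (r / 2) * Real.exp (-r) := by gcongr
    _ = _ := by rw [← Real.exp_add]; ring_nf

lemma hasDerivAt_gammaKernel_succ (m : ℕ) (r : ℝ) :
    HasDerivAt (gammaKernel (m + 1)) (gammaKernel m r - gammaKernel (m + 1) r) r := by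
  have h1 : HasDerivAt (fun r : ℝ => r ^ (m + 1) / (m + 1).factorial)
      (((m + 1 : ℕ) : ℝ) * r ^ m / (m + 1).factorial) r := by
    simpa using (hasDerivAt_pow (m + 1) r).div_const ((m + 1).factorial : ℝ)
  have h2 : HasDerivAt (fun r : ℝ => Real.exp (-r)) (-Real.exp (-r)) r := by
    simpa using (hasDerivAt_neg r).exp
  refine (HasDerivAt.congr_deriv (h1.mul h2) ?_)
  simp only [gammaKernel, Nat.factorial_succ]
  push_cast
  field_simp
  ring

lemma hasDerivAt_gammaKernel_zero (r : ℝ) :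
    HasDerivAt (gammaKernel 0) (-gammaKernel 0 r) r := by
  have h2 : HasDerivAt (fun r : ℝ => Real.exp (-r)) (-Real.exp (-r)) r := by
    simpa using (hasDerivAt_neg r).exp
  have : gammaKernel 0 = fun r : ℝ => Real.exp (-r) := by funext r; simp [gammaKernel]
  rw [this]; exact h2

lemma tendsto_gammaKernel_atTop (m : ℕ) : Tendsto (gammaKernel m) atTop (𝓝 0) := by
  have h : Tendsto (fun r : ℝ => 2 ^ m * Real.exp (-(r / 2))) atTop (𝓝 (2 ^ m * 0)) := by
    refine Tendsto.const_mul _ (Real.tendsto_exp_neg_atTop_nhds_zero.comp ?_)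
    exact tendsto_id.atTop_div_const (by norm_num)
  rw [mul_zero] at h
  refine tendsto_of_tendsto_of_tendsto_of_le_of_le' tendsto_const_nhds h ?_ ?_
  · filter_upwards [eventually_ge_atTop 0] with r hr using gammaKernel_nonneg m hr
  · filter_upwards [eventually_ge_atTop 0] with r hr using gammaKernel_le_exp m hr

lemma integrableOn_gammaKernel (m : ℕ) : IntegrableOn (gammaKernel m) (Ioi 0) := by
  have h : IntegrableOn (fun r : ℝ => 2 ^ m * Real.exp ((-(1 / 2)) * r)) (Ioi 0) :=
    (integrableOn_exp_mul_Ioi (by norm_num) 0).const_mul _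
  refine Integrable.mono' h (continuous_gammaKernel m).aestronglyMeasurable ?_
  filter_upwards [ae_restrict_mem measurableSet_Ioi] with r hr
  rw [Real.norm_of_nonneg (gammaKernel_nonneg m (le_of_lt hr))]
  refine (gammaKernel_le_exp m (le_of_lt hr)).trans_eq ?_
  ring_nf

lemma gammaKernel_le_const (m : ℕ) {r : ℝ} (hr : 0 ≤ r) : gammaKernel m r ≤ 2 ^ m := by
  refine (gammaKernel_le_exp m hr).trans ?_
  have : Real.exp (-(r / 2)) ≤ 1 := Real.exp_le_one_iff.mpr (by linarith)
  nlinarith [pow_pos (two_pos : (0 : ℝ) < 2) m]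

lemma norm_cexp_imag_mul (y r : ℝ) : ‖Complex.exp (-(y * r : ℝ) * Complex.I)‖ = 1 := by
  have := Complex.norm_exp_ofReal_mul_I (-(y * r))
  simpa using this

/-- Integrating the derivative of the kernel of index `m + 1` times the oscillating factor gives no
boundary terms, so each step in `m` contributes one factor (1 + iy)⁻¹. -/
lemma integral_gammaKernel_mul_cexp (m : ℕ) (y : ℝ) :
    ∫ r in Ioi (0 : ℝ), (gammaKernel m r : ℂ) * Complex.exp (-(y * r : ℝ) * Complex.I)
      = ((1 + y * Complex.I : ℂ) ^ (m + 1))⁻¹ := by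
  have hy : (1 + y * Complex.I : ℂ) ≠ 0 := by
    intro h; have := congrArg Complex.re h; simp at this
  have hE : ∀ r : ℝ, HasDerivAt (fun r : ℝ => Complex.exp (-(y * r : ℝ) * Complex.I))
      (-(y * Complex.I) * Complex.exp (-(y * r : ℝ) * Complex.I)) r := by
    intro r
    have h0 : HasDerivAt (fun r : ℝ => -((y * r : ℝ) : ℂ) * Complex.I) (-(y * Complex.I)) r := by
      have : HasDerivAt (fun r : ℝ => ((y * r : ℝ) : ℂ)) (y : ℂ) r := by
        have := ((hasDerivAt_id r).const_mul y).ofReal_comp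
        simpa using this
      have := (this.neg).mul_const Complex.I
      simpa using this
    have := h0.cexp
    rw [mul_comm] at this
    exact this
  have hint : ∀ m, IntegrableOn
      (fun r : ℝ => (gammaKernel m r : ℂ) * Complex.exp (-(y * r : ℝ) * Complex.I)) (Ioi 0) := by
    intro m
    refine Integrable.mono' (integrableOn_gammaKernel m) ?_ ?_
    · have := continuous_gammaKernel m
      exact Continuous.aestronglyMeasurable (by fun_prop)
    · filter_upwards [ae_restrict_mem measurableSet_Ioi] with r hr
      rw [norm_mul, norm_cexp_imag_mul, mul_one, Complex.norm_real,
        Real.norm_of_nonneg (gammaKernel_nonneg m (le_of_lt hr))]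
  have hlim : ∀ m, Tendsto
      (fun r : ℝ => (gammaKernel m r : ℂ) * Complex.exp (-(y * r : ℝ) * Complex.I)) atTop (𝓝 0) := by
    intro m
    rw [tendsto_zero_iff_norm_tendsto_zero]
    have := (tendsto_gammaKernel_atTop m).norm
    rw [norm_zero] at this
    refine this.congr fun r => ?_
    rw [norm_mul, norm_cexp_imag_mul, mul_one, Complex.norm_real]
  have hcont : ∀ m, Continuous
      (fun r : ℝ => (gammaKernel m r : ℂ) * Complex.exp (-(y * r : ℝ) * Complex.I)) := by
    intro m
    have := continuous_gammaKernel m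
    fun_prop
  induction m with
  | zero =>
    have h := integral_Ioi_of_hasDerivAt_of_tendsto (a := 0) (hcont 0).continuousWithinAt
      (f' := fun r => -(1 + y * Complex.I) *
        ((gammaKernel 0 r : ℂ) * Complex.exp (-(y * r : ℝ) * Complex.I)))
      (fun r _ => by
        refine ((hasDerivAt_gammaKernel_zero r).ofReal_comp.mul (hE r)).congr_deriv ?_
        push_cast; ring)
      ((hint 0).const_mul _) (hlim 0)
    rw [integral_const_mul] at h
    simp only [gammaKernel, pow_zero, Nat.factorial_zero, Nat.cast_one, div_one, one_mul, neg_zero,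
      Real.exp_zero, mul_zero, Complex.ofReal_zero, zero_mul, Complex.exp_zero, Complex.ofReal_one,
      mul_one] at h ⊢
    rw [zero_add, pow_one, ← one_div, eq_div_iff hy]
    linear_combination -h
  | succ m ih =>
    have h := integral_Ioi_of_hasDerivAt_of_tendsto (a := 0) (hcont (m + 1)).continuousWithinAt
      (f' := fun r => ((gammaKernel m r : ℂ) * Complex.exp (-(y * r : ℝ) * Complex.I)) -
        (1 + y * Complex.I) *
        ((gammaKernel (m + 1) r : ℂ) * Complex.exp (-(y * r : ℝ) * Complex.I)))
      (fun r _ => by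
        refine ((hasDerivAt_gammaKernel_succ m r).ofReal_comp.mul (hE r)).congr_deriv ?_
        push_cast; ring)
      ((hint m).sub ((hint (m + 1)).const_mul _)) (hlim (m + 1))
    rw [integral_sub (hint m) ((hint (m + 1)).const_mul _), integral_const_mul, ih] at h
    have h0 : gammaKernel (m + 1) 0 = 0 := by simp [gammaKernel]
    rw [h0] at h
    simp only [Complex.ofReal_zero, zero_mul, sub_zero] at h
    rw [pow_succ (1 + y * Complex.I : ℂ) (m + 1), mul_inv, eq_mul_inv_iff_mul_eq₀ hy]
    linear_combination -h

/-- Fourier inversion is applied from index `m + 1` on: the kernel of index 0 jumps at the origin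
and its transform is not integrable. -/
lemma fourierInv_gammaKernel (m : ℕ) (r : ℝ) :
    ∫ x : ℝ, Complex.exp ((2 * Real.pi * x * r : ℝ) * Complex.I) *
        ((1 + (2 * Real.pi * x : ℝ) * Complex.I : ℂ) ^ (m + 2))⁻¹
      = (Ioi (0 : ℝ)).indicator (fun r => (gammaKernel (m + 1) r : ℂ)) r := by
  set f : ℝ → ℂ := (Ioi (0 : ℝ)).indicator (fun r => (gammaKernel (m + 1) r : ℂ)) with hf
  have hfi : Integrable f := by
    rw [hf, integrable_indicator_iff measurableSet_Ioi]
    exact (integrableOn_gammaKernel (m + 1)).ofReal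
  have hfc : Continuous f := by
    have : f = fun r => (gammaKernel (m + 1) (max r 0) : ℂ) := by
      funext r
      rw [hf]
      by_cases hr : r ∈ Ioi (0 : ℝ)
      · rw [indicator_of_mem hr, max_eq_left (le_of_lt hr)]
      · rw [indicator_of_notMem hr, max_eq_right (not_lt.mp hr)]
        simp [gammaKernel]
    rw [this]
    have := continuous_gammaKernel (m + 1)
    fun_prop
  have hF : FourierTransform.fourier f
      = fun x : ℝ => ((1 + (2 * Real.pi * x : ℝ) * Complex.I : ℂ) ^ (m + 2))⁻¹ := by
    funext x
    rw [Real.fourier_real_eq_integral_exp_smul, ← integral_gammaKernel_mul_cexp,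
      ← integral_indicator measurableSet_Ioi]
    congr 1
    funext v
    by_cases hv : v ∈ Ioi (0 : ℝ)
    · rw [hf, indicator_of_mem hv, indicator_of_mem hv, smul_eq_mul, mul_comm]
      congr 2
      push_cast; ring
    · rw [hf, indicator_of_notMem hv, indicator_of_notMem hv, smul_zero]
  have hFi : Integrable (FourierTransform.fourier f) := by
    rw [hF]
    refine Integrable.mono' (g := fun x : ℝ => (1 + x ^ 2)⁻¹) integrable_inv_one_add_sq ?_ ?_
    · refine Continuous.aestronglyMeasurable (Continuous.inv₀ (by fun_prop) fun x => ?_)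
      refine pow_ne_zero _ fun h => ?_
      have := congrArg Complex.re h; simp at this
    · refine Eventually.of_forall fun x => ?_
      have h2 : 1 + x ^ 2 ≤ ‖(1 + (2 * Real.pi * x : ℝ) * Complex.I : ℂ)‖ ^ 2 := by
        rw [← Complex.normSq_eq_norm_sq, ← Complex.ofReal_one, Complex.normSq_add_mul_I]
        have h4 : 1 ≤ (2 * Real.pi) ^ 2 := by nlinarith [Real.pi_gt_three]
        nlinarith [mul_nonneg (sub_nonneg.mpr h4) (sq_nonneg x)]
      have h1 : 1 ≤ ‖(1 + (2 * Real.pi * x : ℝ) * Complex.I : ℂ)‖ := by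
        have := Complex.abs_re_le_norm (1 + (2 * Real.pi * x : ℝ) * Complex.I : ℂ)
        simpa using this
      rw [norm_inv, norm_pow]
      refine inv_anti₀ (by positivity) (h2.trans ?_)
      exact pow_le_pow_right₀ h1 (by omega)
  have := congrFun (hfc.fourierInv_fourier_eq hfi hFi) r
  rw [hF, Real.fourierInv_eq'] at this
  rw [← this]
  congr 1
  funext x
  rw [smul_eq_mul]
  congr 3
  simp
  ring

end LaplaceRepresentation

section LaplaceRepresentation

open Set Filter Topology

/-- By `hW` and `hsucc`, `W (m + 1) k` is (1 - d/dt) applied to `W m k`, and the gamma kernel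
inverts (1 - d/dt)^{m+1} on decaying functions. Only values to the right of `t` enter, so nothing
has to be extended to negative times. -/
lemma integral_Ioi_gammaKernel_mul (κ ε : ℝ) (hε : 0 < ε) (W : ℕ → ℕ → ℝ → ℂ)
    (hW : ∀ m k t, 0 ≤ t →
      HasDerivWithinAt (W m k) (κ * W m k t + W m (k + 1) t) (Ici 0) t)
    (hsucc : ∀ m k t, W (m + 1) k t = (1 - κ) * W m k t - W m (k + 1) t)
    (hb : ∀ m k, ∃ C, ∀ t, 0 ≤ t → ‖W m k t‖ ≤ C * Real.exp (-ε * t))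
    (m k : ℕ) {t : ℝ} (ht : 0 ≤ t) :
    ∫ s in Ioi t, (gammaKernel m (s - t) : ℂ) * W (m + 1) k s = W 0 k t := by
  have hWd : ∀ m k s, t < s → HasDerivAt (W m k) (W m k s - W (m + 1) k s) s := by
    intro m k s hs
    refine ((hW m k s (ht.trans hs.le)).hasDerivAt (Ici_mem_nhds (ht.trans_lt hs))).congr_deriv ?_
    rw [hsucc]; ring
  have hcont : ∀ m k, ContinuousOn (W m k) (Ici t) := fun m k s hs =>
    ((hW m k s (ht.trans hs)).continuousWithinAt).mono (Ici_subset_Ici.mpr ht)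
  have hint : ∀ m m' k, IntegrableOn (fun s => (gammaKernel m (s - t) : ℂ) * W m' k s) (Ioi t) := by
    intro m m' k
    obtain ⟨C, hC⟩ := hb m' k
    have h : IntegrableOn (fun s : ℝ => 2 ^ m * C * Real.exp (-ε * s)) (Ioi t) :=
      (integrableOn_exp_mul_Ioi (by linarith) t).const_mul _
    refine Integrable.mono' h ?_ ?_
    · have := continuous_gammaKernel m
      exact ((by fun_prop : ContinuousOn (fun s => (gammaKernel m (s - t) : ℂ)) (Ioi t)).mul
        ((hcont m' k).mono Ioi_subset_Ici_self)).aestronglyMeasurable measurableSet_Ioi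
    · filter_upwards [ae_restrict_mem measurableSet_Ioi] with s hs
      have hs' : 0 ≤ s - t := sub_nonneg.mpr (le_of_lt hs)
      rw [norm_mul, Complex.norm_real, Real.norm_of_nonneg (gammaKernel_nonneg m hs'), mul_assoc]
      exact mul_le_mul (gammaKernel_le_const m hs') (hC s (ht.trans (le_of_lt hs)))
        (norm_nonneg _) (by positivity)
  have hlim : ∀ m m' k, Tendsto (fun s => (gammaKernel m (s - t) : ℂ) * W m' k s) atTop (𝓝 0) := by
    intro m m' k
    obtain ⟨C, hC⟩ := hb m' k
    have h : Tendsto (fun s : ℝ => 2 ^ m * (C * Real.exp (-(ε * s)))) atTop (𝓝 (2 ^ m * (C * 0))) :=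
      ((Real.tendsto_exp_neg_atTop_nhds_zero.comp
        (tendsto_id.const_mul_atTop hε)).const_mul C).const_mul _
    rw [mul_zero, mul_zero] at h
    refine squeeze_zero_norm' ?_ h
    filter_upwards [eventually_ge_atTop t] with s hs
    have hs' : 0 ≤ s - t := sub_nonneg.mpr hs
    rw [norm_mul, Complex.norm_real, Real.norm_of_nonneg (gammaKernel_nonneg m hs'), ← neg_mul]
    exact mul_le_mul (gammaKernel_le_const m hs') (hC s (ht.trans hs)) (norm_nonneg _)
      (by positivity)
  have hKcont : ∀ m m' k, ContinuousWithinAt (fun s => (gammaKernel m (s - t) : ℂ) * W m' k s)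
      (Ici t) t := by
    intro m m' k
    have := continuous_gammaKernel m
    exact ((by fun_prop : Continuous (fun s => (gammaKernel m (s - t) : ℂ))).continuousWithinAt).mul
      (hcont m' k t self_mem_Ici)
  induction m with
  | zero =>
    have h := integral_Ioi_of_hasDerivAt_of_tendsto (hKcont 0 0 k)
      (f' := fun s => -((gammaKernel 0 (s - t) : ℂ) * W (0 + 1) k s))
      (fun s hs => by
        have h1 : HasDerivAt (fun s => gammaKernel 0 (s - t)) (-gammaKernel 0 (s - t)) s :=
          (hasDerivAt_gammaKernel_zero (s - t)).comp_sub_const s t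
        refine (h1.ofReal_comp.mul (hWd 0 k s hs)).congr_deriv ?_
        push_cast; ring)
      (hint 0 _ k).neg (hlim 0 0 k)
    rw [integral_neg] at h
    have h0 : gammaKernel 0 (t - t) = 1 := by simp [gammaKernel]
    rw [h0, Complex.ofReal_one, one_mul, zero_sub, neg_inj] at h
    exact h
  | succ m ih =>
    have h := integral_Ioi_of_hasDerivAt_of_tendsto (hKcont (m + 1) (m + 1) k)
      (f' := fun s => (gammaKernel m (s - t) : ℂ) * W (m + 1) k s -
        (gammaKernel (m + 1) (s - t) : ℂ) * W (m + 1 + 1) k s)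
      (fun s hs => by
        have h1 : HasDerivAt (fun s => gammaKernel (m + 1) (s - t))
          (gammaKernel m (s - t) - gammaKernel (m + 1) (s - t)) s :=
          (hasDerivAt_gammaKernel_succ m (s - t)).comp_sub_const s t
        refine (h1.ofReal_comp.mul (hWd (m + 1) k s hs)).congr_deriv ?_
        push_cast; ring)
      ((hint m _ k).sub (hint (m + 1) _ k)) (hlim (m + 1) (m + 1) k)
    rw [integral_sub (hint m _ k) (hint (m + 1) _ k), ih] at h
    have h0 : gammaKernel (m + 1) (t - t) = 0 := by simp [gammaKernel]
    rw [h0, Complex.ofReal_zero, zero_mul, sub_zero] at h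
    exact (sub_eq_zero.mp h).symm

/-- The exponent of the exponential with frequency `x` and decay rate `κ`. -/
noncomputable def laplaceExponent (κ x : ℝ) : ℂ := κ + (2 * Real.pi * x : ℝ) * Complex.I

lemma laplaceExponent_re (κ x : ℝ) : (laplaceExponent κ x).re = κ := by
  simp [laplaceExponent]

lemma continuous_laplaceExponent (κ : ℝ) : Continuous (laplaceExponent κ) := by
  unfold laplaceExponent; fun_prop

lemma one_add_abs_le_norm (x : ℝ) : (1 + |x|) / 2 ≤ ‖laplaceExponent 1 x‖ := by
  have h2 : ((1 + |x|) / 2) ^ 2 ≤ ‖laplaceExponent 1 x‖ ^ 2 := by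
    rw [laplaceExponent, ← Complex.normSq_eq_norm_sq, Complex.normSq_add_mul_I]
    have h4 : 1 ≤ (2 * Real.pi) ^ 2 := by nlinarith [Real.pi_gt_three]
    nlinarith [mul_nonneg (sub_nonneg.mpr h4) (sq_nonneg x), sq_abs x, sq_nonneg (|x| - 1)]
  exact (le_abs_self _).trans (abs_le_of_sq_le_sq h2 (norm_nonneg _))

/-- A smooth function on the half line whose derivatives all decay like `e ^ {-κ t}` is a
superposition of exponentials on the line of decay rate `κ' < κ`, with rapidly decaying weight. -/
theorem exists_laplace_representation {κ κ' : ℝ} (hκ : κ' < κ) (G : ℕ → ℝ → ℂ)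
    (hG : ∀ k t, 0 ≤ t → HasDerivWithinAt (G k) (G (k + 1) t) (Ici 0) t)
    (hb : ∀ k, ∃ C, ∀ t, 0 ≤ t → ‖G k t‖ ≤ C * Real.exp (-κ * t)) (K : ℕ) :
    ∃ ρ : ℝ → ℂ, AEStronglyMeasurable ρ ∧ Integrable (fun x => (1 + |x|) ^ K * ‖ρ x‖) ∧
      ∀ t, 0 ≤ t → G 0 t = ∫ x, ρ x * Complex.exp (-laplaceExponent κ' x * t) := by
  -- `W m k` is (1 - d/dt)^m applied to e^{κ't} G_k. It is written out in terms of the `G k`, so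
  -- that `hb` bounds all of them.
  let W : ℕ → ℕ → ℝ → ℂ := fun m => Nat.rec (fun k t => Complex.exp (κ' * t) * G k t)
    (fun _ V k t => (1 - κ') * V k t - V (k + 1) t) m
  have hW0 : ∀ k t, W 0 k t = Complex.exp (κ' * t) * G k t := fun _ _ => rfl
  have hsucc : ∀ m k t, W (m + 1) k t = (1 - κ') * W m k t - W m (k + 1) t := fun _ _ _ => rfl
  have hW : ∀ m k t, 0 ≤ t →
      HasDerivWithinAt (W m k) (κ' * W m k t + W m (k + 1) t) (Ici 0) t := by
    intro m
    induction m with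
    | zero =>
      intro k t ht
      have h1 : HasDerivAt (fun t : ℝ => Complex.exp (κ' * t)) (Complex.exp (κ' * t) * κ') t := by
        have : HasDerivAt (fun t : ℝ => (κ' : ℂ) * t) κ' t := by
          simpa using ((hasDerivAt_id t).ofReal_comp).const_mul (κ' : ℂ)
        exact this.cexp
      refine (h1.hasDerivWithinAt.mul (hG k t ht)).congr_deriv ?_
      rw [hW0, hW0]; ring
    | succ m ih =>
      intro k t ht
      refine (((ih k t ht).const_mul (1 - κ' : ℂ)).sub (ih (k + 1) t ht)).congr_deriv ?_
      rw [hsucc, hsucc]; ring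
  have hWb : ∀ m k, ∃ C, ∀ t, 0 ≤ t → ‖W m k t‖ ≤ C * Real.exp (-(κ - κ') * t) := by
    intro m
    induction m with
    | zero =>
      intro k
      obtain ⟨C, hC⟩ := hb k
      refine ⟨C, fun t ht => ?_⟩
      rw [hW0, norm_mul, ← Complex.ofReal_mul, Complex.norm_exp_ofReal]
      calc Real.exp (κ' * t) * ‖G k t‖ ≤ Real.exp (κ' * t) * (C * Real.exp (-κ * t)) := by
            gcongr; exact hC t ht
        _ = C * (Real.exp (κ' * t) * Real.exp (-κ * t)) := by ring
        _ = _ := by rw [← Real.exp_add]; ring_nf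
    | succ m ih =>
      intro k
      obtain ⟨C1, h1⟩ := ih k
      obtain ⟨C2, h2⟩ := ih (k + 1)
      refine ⟨‖(1 - κ' : ℂ)‖ * C1 + C2, fun t ht => ?_⟩
      rw [hsucc]
      refine (norm_sub_le _ _).trans ?_
      rw [norm_mul, add_mul, mul_assoc]
      exact add_le_add (mul_le_mul_of_nonneg_left (h1 t ht) (norm_nonneg _)) (h2 t ht)
  -- The `K + 2` applications of 1 - d/dt are paid back as a factor (1 + 2πix)^{-(K+2)}: `K` powers
  -- for the moments and two for integrability.
  set w : ℝ → ℂ := W (K + 1 + 1) 0 with hw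
  have hwc : ContinuousOn w (Ioi 0) := fun s hs =>
    ((hW (K + 1 + 1) 0 s (le_of_lt hs)).continuousWithinAt).mono Ioi_subset_Ici_self
  have hwi : IntegrableOn w (Ioi 0) := by
    obtain ⟨C, hC⟩ := hWb (K + 1 + 1) 0
    refine Integrable.mono' (g := fun s => C * Real.exp (-(κ - κ') * s))
      ((integrableOn_exp_mul_Ioi (by linarith) 0).const_mul _)
      (hwc.aestronglyMeasurable measurableSet_Ioi) ?_
    filter_upwards [ae_restrict_mem measurableSet_Ioi] with s hs using hC s (le_of_lt hs)
  have hne : ∀ x : ℝ, laplaceExponent 1 x ≠ 0 := fun x h => by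
    have := congrArg Complex.re h
    rw [laplaceExponent_re] at this
    simp at this
  set k : ℝ → ℂ := fun x => (laplaceExponent 1 x ^ (K + 2))⁻¹ with hk
  have hkc : Continuous k :=
    ((continuous_laplaceExponent 1).pow _).inv₀ fun x => pow_ne_zero _ (hne x)
  have hkb : ∀ x, (1 + |x|) ^ K * ‖k x‖ ≤ 2 ^ (K + 2) * (1 + x ^ 2)⁻¹ := by
    intro x
    have h1 : ((1 + |x|) / 2) ^ (K + 2) ≤ ‖laplaceExponent 1 x‖ ^ (K + 2) :=
      pow_le_pow_left₀ (by positivity) (one_add_abs_le_norm x) _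
    have h3 : 1 + x ^ 2 ≤ (1 + |x|) ^ 2 := by nlinarith [abs_nonneg x, sq_abs x]
    rw [hk]
    simp only [norm_inv, norm_pow]
    calc (1 + |x|) ^ K * (‖laplaceExponent 1 x‖ ^ (K + 2))⁻¹
        ≤ (1 + |x|) ^ K * (((1 + |x|) / 2) ^ (K + 2))⁻¹ := by gcongr
      _ = 2 ^ (K + 2) * ((1 + |x|) ^ 2)⁻¹ := by
          have : (1 + |x|) ≠ 0 := by positivity
          rw [div_pow, inv_div, pow_add (1 + |x|)]
          field_simp
      _ ≤ _ := by gcongr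
  have hki' : Integrable (fun x => (1 + |x|) ^ K * ‖k x‖) := by
    refine Integrable.mono' (integrable_inv_one_add_sq.const_mul (2 ^ (K + 2)))
      (Continuous.aestronglyMeasurable (by fun_prop)) (Eventually.of_forall fun x => ?_)
    rw [Real.norm_of_nonneg (by positivity)]
    exact hkb x
  have hki : Integrable k := by
    refine Integrable.mono' hki' hkc.aestronglyMeasurable (Eventually.of_forall fun x => ?_)
    have : 1 ≤ (1 + |x|) ^ K := one_le_pow₀ (by linarith [abs_nonneg x])
    nlinarith [norm_nonneg (k x)]
  have hjoint : ∀ t : ℝ, Integrable (fun p : ℝ × ℝ => (k p.1 * w p.2) *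
      Complex.exp ((2 * Real.pi * p.1 * (p.2 - t) : ℝ) * Complex.I))
      (volume.prod (volume.restrict (Ioi 0))) := by
    intro t
    refine (hki.mul_prod hwi).mul_bdd (c := 1) (Continuous.aestronglyMeasurable (by fun_prop))
      (Eventually.of_forall fun p => (Complex.norm_exp_ofReal_mul_I _).le)
  have hsplit : ∀ x s t : ℝ, Complex.exp ((2 * Real.pi * x * (s - t) : ℝ) * Complex.I)
      = Complex.exp ((2 * Real.pi * x * (s - 0) : ℝ) * Complex.I) *
        Complex.exp (-((2 * Real.pi * x : ℝ) * Complex.I) * t) := by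
    intro x s t
    rw [← Complex.exp_add]
    congr 1
    push_cast; ring
  -- The weight is `k` times a Fourier integral of `w`, hence bounded by |k(x)| times the L¹ norm of
  -- `w`.
  refine ⟨fun x => ∫ s in Ioi (0 : ℝ), (k x * w s) *
    Complex.exp ((2 * Real.pi * x * (s - 0) : ℝ) * Complex.I), ?_, ?_, ?_⟩
  · exact (hjoint 0).aestronglyMeasurable.integral_prod_right'
  · refine Integrable.mono' (hki'.mul_const (∫ s in Ioi (0 : ℝ), ‖w s‖)) ?_ ?_
    · exact (Continuous.aestronglyMeasurable (by fun_prop)).mul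
        (hjoint 0).aestronglyMeasurable.integral_prod_right'.norm
    · refine Eventually.of_forall fun x => ?_
      rw [Real.norm_of_nonneg (by positivity), mul_assoc, ← integral_const_mul]
      gcongr
      refine (norm_integral_le_integral_norm _).trans_eq ?_
      congr 1
      funext s
      rw [norm_mul, norm_mul, Complex.norm_exp_ofReal_mul_I, mul_one]
  · intro t ht
    have h1 := integral_Ioi_gammaKernel_mul κ' (κ - κ') (by linarith) W hW hsucc hWb (K + 1) 0 ht
    have h2 : G 0 t = Complex.exp (-(κ' * t)) * W 0 0 t := by
      rw [hW0, ← mul_assoc, ← Complex.exp_add, neg_add_cancel, Complex.exp_zero, one_mul]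
    have h3 : ∫ s in Ioi t, (gammaKernel (K + 1) (s - t) : ℂ) * w s
        = ∫ s in Ioi (0 : ℝ), ∫ x, (k x * w s) *
          Complex.exp ((2 * Real.pi * x * (s - t) : ℝ) * Complex.I) := by
      have h4 : ∀ s, ∫ x, (k x * w s) * Complex.exp ((2 * Real.pi * x * (s - t) : ℝ) * Complex.I)
          = (Ioi t).indicator (fun s => (gammaKernel (K + 1) (s - t) : ℂ) * w s) s := by
        intro s
        have h5 := fourierInv_gammaKernel K (s - t)
        have h6 : (Ioi t).indicator (fun s => (gammaKernel (K + 1) (s - t) : ℂ) * w s) s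
            = (Ioi (0 : ℝ)).indicator (fun r => (gammaKernel (K + 1) r : ℂ)) (s - t) * w s := by
          by_cases hs : t < s
          · rw [indicator_of_mem (show s ∈ Ioi t from hs),
              indicator_of_mem (show s - t ∈ Ioi (0 : ℝ) from sub_pos.mpr hs)]
          · rw [indicator_of_notMem (show s ∉ Ioi t from hs),
              indicator_of_notMem (show s - t ∉ Ioi (0 : ℝ) from fun h => hs (sub_pos.mp h)),
              zero_mul]
        rw [h6, ← h5, ← integral_mul_const]
        congr 1
        funext x
        rw [hk]
        simp only [laplaceExponent, Complex.ofReal_one]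
        ring
      simp_rw [h4]
      rw [integral_indicator measurableSet_Ioi, Measure.restrict_restrict measurableSet_Ioi]
      congr 2
      rw [inter_eq_left.mpr (Ioi_subset_Ioi ht)]
    rw [h2, ← h1, h3, ← integral_integral_swap (hjoint t), ← integral_const_mul]
    congr 1
    funext x
    rw [← integral_const_mul, ← integral_mul_const]
    congr 1
    funext s
    have h7 : Complex.exp (-laplaceExponent κ' x * t) = Complex.exp (-(κ' * t)) *
        Complex.exp (-((2 * Real.pi * x : ℝ) * Complex.I) * t) := by
      rw [← Complex.exp_add, laplaceExponent]
      congr 1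
      ring
    rw [h7, hsplit x s t]
    ring

end LaplaceRepresentation

/-! ### Gaussian integrals on complex space. -/

section ComplexGaussian

lemma integrable_cexp_neg_mul_normSq {D : ℂ} (hD : 0 < D.re) :
    Integrable (fun w : ℂ => Complex.exp (-D * Complex.normSq w)) := by
  have h := GaussianFourier.integrable_cexp_neg_mul_sq_norm_add (V := ℂ) hD 0 0
  refine h.congr (Filter.Eventually.of_forall fun w => ?_)
  simp [Complex.normSq_eq_norm_sq]

/-- Completing the square. Since ℂ has real dimension two, the normalization π / (A + D) enters
without a square root. -/
lemma integral_cexp_neg_normSq_sub_mul {A D : ℂ} (hA : 0 < A.re) (hD : 0 < D.re) (u : ℂ) :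
    ∫ w : ℂ, Complex.exp (-A * Complex.normSq (u - w)) *
        (D / Real.pi * Complex.exp (-D * Complex.normSq w))
      = D / (A + D) * Complex.exp (-(A * D / (A + D)) * Complex.normSq u) := by
  have hb : 0 < (A + D).re := by rw [Complex.add_re]; linarith
  have hne : A + D ≠ 0 := fun h => by rw [h] at hb; simp at hb
  have h := GaussianFourier.integral_cexp_neg_mul_sq_norm_add (V := ℂ) hb (2 * A) u
  have hpi : (Real.pi : ℂ) ≠ 0 := by exact_mod_cast Real.pi_ne_zero
  have h1 : ∀ w : ℂ, Complex.exp (-A * Complex.normSq (u - w)) *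
        (D / Real.pi * Complex.exp (-D * Complex.normSq w))
      = D / Real.pi * Complex.exp (-A * Complex.normSq u) *
        Complex.exp (-(A + D) * ‖w‖ ^ 2 + 2 * A * (inner ℝ u w : ℝ)) := by
    intro w
    rw [mul_left_comm, ← Complex.exp_add, mul_assoc, ← Complex.exp_add]
    congr 2
    have : (Complex.normSq (u - w) : ℂ)
        = Complex.normSq u - 2 * (inner ℝ u w : ℝ) + Complex.normSq w := by
      have := norm_sub_sq_real u w
      rw [← Complex.normSq_eq_norm_sq, ← Complex.normSq_eq_norm_sq, ← Complex.normSq_eq_norm_sq]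
        at this
      rw [this]; push_cast; ring
    rw [this, ← Complex.ofReal_pow, ← Complex.normSq_eq_norm_sq]
    ring
  simp_rw [h1]
  rw [integral_const_mul, h, Complex.finrank_real_complex]
  have h2 : ((2 : ℕ) : ℂ) / 2 = 1 := by norm_num
  rw [h2, Complex.cpow_one, ← Complex.ofReal_pow, ← Complex.normSq_eq_norm_sq]
  rw [mul_comm (Real.pi / (A + D) : ℂ), mul_assoc, ← mul_assoc (Complex.exp _), ← Complex.exp_add,
    mul_comm (Complex.exp _), ← mul_assoc]
  congr 1
  · field_simp
  · congr 1
    field_simp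
    ring

lemma inv_re_pos {z : ℂ} (hz : 0 < z.re) : 0 < (z⁻¹).re := by
  rw [Complex.inv_re]
  exact div_pos hz (Complex.normSq_pos.mpr fun h => by rw [h] at hz; simp at hz)

/-- Convolution of Gaussians on `ℂ`. -/
lemma integral_cexp_neg_normSq_sub_sum_mul {k : ℕ} {A : ℂ} (hA : 0 < A.re) (D : Fin k → ℂ)
    (hD : ∀ j, 0 < (D j).re) (u : ℂ) :
    ∫ w : Fin k → ℂ, Complex.exp (-A * Complex.normSq (u - ∑ j, w j)) *
        ∏ j, (D j / Real.pi * Complex.exp (-D j * Complex.normSq (w j)))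
      = (A⁻¹ + ∑ j, (D j)⁻¹)⁻¹ / A *
        Complex.exp (-(A⁻¹ + ∑ j, (D j)⁻¹)⁻¹ * Complex.normSq u) := by
  have hA0 : A ≠ 0 := fun h => by rw [h] at hA; simp at hA
  induction k generalizing u with
  | zero =>
    have : (volume : Measure (Fin 0 → ℂ)).real Set.univ = 1 := by
      rw [measureReal_def, volume_pi, Measure.pi_univ]; simp
    simp [div_self hA0, this]
  | succ k ih =>
    -- Inverse rates add under convolution: after the last `k` integrations a Gaussian of rate `V`
    -- in `u - w 0` is left.
    set V : ℂ := (A⁻¹ + ∑ j : Fin k, (D j.succ)⁻¹)⁻¹ with hV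
    have hVinv : 0 < (A⁻¹ + ∑ j : Fin k, (D j.succ)⁻¹).re := by
      rw [Complex.add_re, Complex.re_sum]
      exact add_pos_of_pos_of_nonneg (inv_re_pos hA)
        (Finset.sum_nonneg fun j _ => (inv_re_pos (hD j.succ)).le)
    have hVre : 0 < V.re := inv_re_pos hVinv
    have hV0 : V ≠ 0 := fun h => by rw [h] at hVre; simp at hVre
    have hD0 : D 0 ≠ 0 := fun h => by have := hD 0; rw [h] at this; simp at this
    have hint : Integrable (fun w : Fin (k + 1) → ℂ =>
        Complex.exp (-A * Complex.normSq (u - ∑ j, w j)) *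
        ∏ j, (D j / Real.pi * Complex.exp (-D j * Complex.normSq (w j)))) := by
      refine (Integrable.fintype_prod (𝕜 := ℂ) (f := fun (j : Fin (k + 1)) (z : ℂ) =>
        D j / Real.pi * Complex.exp (-D j * Complex.normSq z))
        fun j => (integrable_cexp_neg_mul_normSq (hD j)).const_mul _).bdd_mul (c := 1) ?_ ?_
      · refine Continuous.aestronglyMeasurable ?_
        have := Complex.continuous_normSq
        fun_prop
      · refine Filter.Eventually.of_forall fun w => ?_
        rw [Complex.norm_exp, Real.exp_le_one_iff]
        simp only [neg_mul, Complex.neg_re, Complex.re_mul_ofReal]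
        nlinarith [Complex.normSq_nonneg (u - ∑ j, w j),
          mul_nonneg hA.le (Complex.normSq_nonneg (u - ∑ j, w j))]
    have hmp := (volume_preserving_piFinSuccAbove (fun _ : Fin (k + 1) => ℂ) 0).symm
    rw [← hmp.integral_comp' (g := fun w : Fin (k + 1) → ℂ =>
        Complex.exp (-A * Complex.normSq (u - ∑ j, w j)) *
        ∏ j, (D j / Real.pi * Complex.exp (-D j * Complex.normSq (w j))))]
    have hint2 := (hmp.integrable_comp_emb (MeasurableEquiv.measurableEmbedding _)).mpr hint
    rw [Measure.volume_eq_prod] at hint2 ⊢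
    refine (integral_prod _ hint2).trans ?_
    have hinner : ∀ z : ℂ, (∫ w : Fin k → ℂ, (Complex.exp (-A * Complex.normSq (u -
          ∑ j, ((MeasurableEquiv.piFinSuccAbove (fun _ : Fin (k + 1) => ℂ) 0).symm (z, w)) j)) *
        ∏ j, (D j / Real.pi * Complex.exp (-D j * Complex.normSq
          (((MeasurableEquiv.piFinSuccAbove (fun _ : Fin (k + 1) => ℂ) 0).symm (z, w)) j)))))
        = V / A * (Complex.exp (-V * Complex.normSq (u - z)) *
          (D 0 / Real.pi * Complex.exp (-D 0 * Complex.normSq z))) := by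
      intro z
      have := ih (fun j => D j.succ) (fun j => hD j.succ) (u - z)
      rw [← hV] at this
      rw [← mul_assoc, ← this, ← integral_mul_const]
      congr 1
      funext w
      simp only [MeasurableEquiv.piFinSuccAbove_symm_apply, Fin.insertNthEquiv, Fin.sum_univ_succ,
        Fin.prod_univ_succ, Equiv.coe_fn_mk, Fin.insertNth_zero', Fin.cons_zero, Fin.cons_succ]
      rw [sub_add_eq_sub_sub]
      ring
    refine (integral_congr_ae (Filter.Eventually.of_forall hinner)).trans ?_
    rw [integral_const_mul, integral_cexp_neg_normSq_sub_mul hVre (hD 0)]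
    have hsum : A⁻¹ + ∑ j, (D j)⁻¹ = V⁻¹ + (D 0)⁻¹ := by
      rw [Fin.sum_univ_succ, hV, inv_inv]; ring
    have hVD : V + D 0 ≠ 0 := fun h => by
      have h2 := congrArg Complex.re h
      rw [Complex.add_re, Complex.zero_re] at h2
      linarith [hD 0]
    have hc : (V⁻¹ + (D 0)⁻¹)⁻¹ = V * D 0 / (V + D 0) := by
      rw [inv_add_inv hV0 hD0, inv_div]
    rw [hsum, hc]
    rw [← mul_assoc]
    congr 1
    field_simp

end ComplexGaussian

/-! ### Regularity of superpositions of exponentials. -/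

section Superposition

open Set Filter Topology

variable {Ω : Type*} [MeasurableSpace Ω] {μ : Measure Ω}

/-- The superposition `∫ ρ e^{-c t}` of exponentials. -/
noncomputable def expSuperposition (μ : Measure Ω) (ρ c : Ω → ℂ) (t : ℝ) : ℂ :=
  ∫ q, ρ q * Complex.exp (-c q * t) ∂μ

lemma norm_cexp_neg_mul_le {c : ℂ} {M : ℝ} (hM : M ≤ c.re) {t : ℝ} (ht : 0 ≤ t) :
    ‖Complex.exp (-c * t)‖ ≤ Real.exp (-M * t) := by
  rw [Complex.norm_exp, Complex.re_mul_ofReal, Complex.neg_re]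
  exact Real.exp_le_exp.mpr (by nlinarith)

lemma integrable_expSuperposition {ρ c : Ω → ℂ} (hc : AEStronglyMeasurable c μ) {M : ℝ}
    (hM : ∀ q, M ≤ (c q).re) (hρ : Integrable ρ μ) {t : ℝ} (ht : 0 ≤ t) :
    Integrable (fun q => ρ q * Complex.exp (-c q * t)) μ := by
  refine hρ.mul_bdd (c := Real.exp (-M * t)) ?_
    (Eventually.of_forall fun q => norm_cexp_neg_mul_le (hM q) ht)
  exact Complex.continuous_exp.comp_aestronglyMeasurable (hc.neg.mul_const _)

/-- The rates have real part bounded only from below, so the integral may diverge at negative times.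
Each exponential is therefore continued to the left of 0 by its tangent line, after which two-sided
differentiation under the integral applies. -/
lemma hasDerivWithinAt_expSuperposition {ρ c : Ω → ℂ} (hc : AEStronglyMeasurable c μ) {M : ℝ}
    (hM : ∀ q, M ≤ (c q).re) (hρ : Integrable ρ μ) (hcρ : Integrable (fun q => -c q * ρ q) μ)
    {t : ℝ} (ht : 0 ≤ t) :
    HasDerivWithinAt (expSuperposition μ ρ c) (expSuperposition μ (fun q => -c q * ρ q) c t)
      (Ici 0) t := by
  let E : ℂ → ℝ → ℂ := fun z s => if 0 ≤ s then Complex.exp (-z * s) else 1 - z * s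
  let E' : ℂ → ℝ → ℂ := fun z s => if 0 ≤ s then -z * Complex.exp (-z * s) else -z
  have hexp : ∀ (z : ℂ) (s : ℝ), HasDerivAt (fun s : ℝ => Complex.exp (-z * s))
      (-z * Complex.exp (-z * s)) s := by
    intro z s
    have h1 : HasDerivAt (fun s : ℝ => -z * (s : ℂ)) (-z) s := by
      simpa using ((hasDerivAt_id s).ofReal_comp).const_mul (-z)
    rw [mul_comm]
    exact h1.cexp
  have hlin : ∀ (z : ℂ) (s : ℝ), HasDerivAt (fun s : ℝ => 1 - z * (s : ℂ)) (-z) s := by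
    intro z s
    simpa using (((hasDerivAt_id s).ofReal_comp).const_mul z).const_sub 1
  have hE : ∀ z s, HasDerivAt (E z) (E' z s) s := by
    intro z s
    rcases lt_trichotomy s 0 with hs | rfl | hs
    · have : E' z s = -z := if_neg (not_le.mpr hs)
      rw [this]
      refine (hlin z s).congr_of_eventuallyEq ?_
      filter_upwards [Iio_mem_nhds hs] with r hr
      exact if_neg (not_le.mpr hr)
    · have h0 : E' z 0 = -z := by simp [E']
      have hl : HasDerivWithinAt (E z) (-z) (Iic 0) 0 := by
        refine (hlin z 0).hasDerivWithinAt.congr (fun r hr => ?_) ?_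
        · rcases (show r ≤ 0 from hr).lt_or_eq with h | rfl
          · exact if_neg (not_le.mpr h)
          · simp [E]
        · simp [E]
      have hr : HasDerivWithinAt (E z) (-z) (Ici 0) 0 := by
        have := (hexp z 0).hasDerivWithinAt (s := Ici 0)
        simp only [Complex.ofReal_zero, mul_zero, Complex.exp_zero, mul_one] at this
        exact this.congr (fun r hr => if_pos hr) (if_pos le_rfl)
      rw [h0, ← hasDerivWithinAt_univ, ← Iic_union_Ici (a := (0 : ℝ))]
      exact hl.union hr
    · have : E' z s = -z * Complex.exp (-z * s) := if_pos hs.le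
      rw [this]
      refine (hexp z s).congr_of_eventuallyEq ?_
      filter_upwards [Ioi_mem_nhds hs] with r hr
      exact if_pos (le_of_lt hr)
  have hEpos : ∀ s, 0 ≤ s → expSuperposition μ ρ c s = ∫ q, ρ q * E (c q) s ∂μ := by
    intro s hs
    simp only [expSuperposition, E, if_pos hs]
  have hmain := hasDerivAt_integral_of_dominated_loc_of_deriv_le (μ := μ)
    (F := fun s q => ρ q * E (c q) s) (F' := fun s q => ρ q * E' (c q) s) (x₀ := t)
    (s := Iio (t + 1)) (bound := fun q => ‖-c q * ρ q‖ * Real.exp (|M| * (t + 1)))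
    (Iio_mem_nhds (by linarith)) ?_ ?_ ?_ ?_ ?_ ?_
  · refine ((hmain.2.hasDerivWithinAt (s := Ici 0)).congr (fun s hs => hEpos s hs)
      (hEpos t ht)).congr_deriv ?_
    simp only [expSuperposition, E', if_pos ht]
    congr 1
    funext q
    ring
  · refine Eventually.of_forall fun s => hρ.1.mul ?_
    by_cases hs : 0 ≤ s
    · simp only [E, if_pos hs]
      exact Complex.continuous_exp.comp_aestronglyMeasurable (hc.neg.mul_const _)
    · simp only [E, if_neg hs]
      exact aestronglyMeasurable_const.sub (hc.mul_const _)
  · simp only [E, if_pos ht]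
    exact integrable_expSuperposition hc hM hρ ht
  · simp only [E', if_pos ht]
    exact hρ.1.mul (hc.neg.mul
      (Complex.continuous_exp.comp_aestronglyMeasurable (hc.neg.mul_const _)))
  · refine Eventually.of_forall fun q s hs => ?_
    by_cases h0 : 0 ≤ s
    · simp only [E', if_pos h0]
      rw [← mul_assoc, mul_comm (ρ q), norm_mul]
      gcongr
      refine (norm_cexp_neg_mul_le (hM q) h0).trans (Real.exp_le_exp.mpr ?_)
      have hs' : s < t + 1 := hs
      nlinarith [neg_le_abs M, abs_nonneg M]
    · simp only [E', if_neg h0]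
      rw [mul_comm (ρ q)]
      exact le_mul_of_one_le_right (norm_nonneg _)
        (Real.one_le_exp (mul_nonneg (abs_nonneg _) (by linarith)))
  · exact hcρ.norm.mul_const _
  · exact Eventually.of_forall fun q s _ => (hE (c q) s).const_mul (ρ q)

/-- Every derivative brings down a factor -c and costs one moment. The additional moment makes the
last derivative differentiable, hence continuous. -/
lemma contDiffOn_expSuperposition {c : Ω → ℂ} (hc : AEStronglyMeasurable c μ) {M : ℝ}
    (hM : ∀ q, M ≤ (c q).re) (K : ℕ) (ρ : Ω → ℂ)
    (hρ : ∀ j, j ≤ K + 1 → Integrable (fun q => (-c q) ^ j * ρ q) μ) :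
    ContDiffOn ℝ K (expSuperposition μ ρ c) (Ici 0) := by
  have h0 : ∀ {K : ℕ} {ρ : Ω → ℂ}, (∀ j, j ≤ K + 1 → Integrable (fun q => (-c q) ^ j * ρ q) μ) →
      ∀ t, 0 ≤ t → HasDerivWithinAt (expSuperposition μ ρ c)
        (expSuperposition μ (fun q => -c q * ρ q) c t) (Ici 0) t := by
    intro K ρ hρ t ht
    refine hasDerivWithinAt_expSuperposition hc hM ?_ ?_ ht
    · simpa using hρ 0 (by omega)
    · simpa using hρ 1 (by omega)
  induction K generalizing ρ with
  | zero =>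
    rw [Nat.cast_zero, contDiffOn_zero]
    exact fun t ht => (h0 hρ t ht).continuousWithinAt
  | succ K ih =>
    have hu : UniqueDiffOn ℝ (Ici (0 : ℝ)) := uniqueDiffOn_Ici 0
    rw [Nat.cast_add, Nat.cast_one, contDiffOn_succ_iff_derivWithin hu]
    refine ⟨fun t ht => (h0 hρ t ht).differentiableWithinAt, by simp, ?_⟩
    refine (ih (fun q => -c q * ρ q) fun j hj => ?_).congr fun t ht =>
      (h0 hρ t ht).derivWithin (hu t ht)
    have := hρ (j + 1) (by omega)
    simpa only [pow_succ, mul_assoc] using this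

end Superposition

/-! ### Harmonic means of complex numbers in a half plane. -/

section HarmonicMean

variable {ι : Type*} [Fintype ι]

lemma sum_inv_re_pos [Nonempty ι] {D : ι → ℂ} (hD : ∀ i, 0 < (D i).re) :
    0 < (∑ i, (D i)⁻¹).re := by
  rw [Complex.re_sum]
  exact Finset.sum_pos (fun i _ => inv_re_pos (hD i)) Finset.univ_nonempty

lemma sum_inv_ne_zero [Nonempty ι] {D : ι → ℂ} (hD : ∀ i, 0 < (D i).re) :
    ∑ i, (D i)⁻¹ ≠ 0 := fun h => by
  have := sum_inv_re_pos hD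
  rw [h] at this
  simp at this

/-- The harmonic mean preserves half planes `δ ≤ Re z`. -/
lemma le_re_harmonicMean [Nonempty ι] {δ : ℝ} (hδ : 0 < δ) {D : ι → ℂ} (hD : ∀ i, δ ≤ (D i).re) :
    δ ≤ ((Fintype.card ι : ℂ) * (∑ i, (D i)⁻¹)⁻¹).re := by
  have hD0 : ∀ i, 0 < (D i).re := fun i => hδ.trans_le (hD i)
  set S := ∑ i, (D i)⁻¹ with hS
  have hSre : 0 < S.re := sum_inv_re_pos hD0
  have hS0 : 0 < Complex.normSq S := Complex.normSq_pos.mpr fun h => by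
    rw [h] at hSre; simp at hSre
  -- The half plane Re D ≥ δ is the disc Re D⁻¹ ≥ δ |D⁻¹|² in the inverse variable; this form passes
  -- to the sum by the Cauchy–Schwarz inequality.
  have h1 : ∀ i, δ * ‖(D i)⁻¹‖ ^ 2 ≤ ((D i)⁻¹).re := by
    intro i
    have hpos : 0 < Complex.normSq (D i) := Complex.normSq_pos.mpr fun h => by
      have := hD0 i; rw [h] at this; simp at this
    rw [Complex.inv_re, norm_inv, inv_pow, ← Complex.normSq_eq_norm_sq, div_eq_mul_inv]
    exact mul_le_mul_of_nonneg_right (hD i) (inv_nonneg.mpr hpos.le)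
  have h2 : ‖S‖ ^ 2 ≤ Fintype.card ι * ∑ i, ‖(D i)⁻¹‖ ^ 2 := by
    calc ‖S‖ ^ 2 ≤ (∑ i, ‖(D i)⁻¹‖) ^ 2 := by
          gcongr; exact norm_sum_le _ _
      _ ≤ _ := by 
          have := sq_sum_le_card_mul_sum_sq (s := Finset.univ) (f := fun i => ‖(D i)⁻¹‖)
          simpa using this
  have h3 : δ * Complex.normSq S ≤ Fintype.card ι * S.re := by
    rw [Complex.normSq_eq_norm_sq]
    calc δ * ‖S‖ ^ 2 ≤ δ * (Fintype.card ι * ∑ i, ‖(D i)⁻¹‖ ^ 2) := by gcongr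
      _ = Fintype.card ι * ∑ i, δ * ‖(D i)⁻¹‖ ^ 2 := by rw [← Finset.mul_sum]; ring
      _ ≤ Fintype.card ι * ∑ i, ((D i)⁻¹).re := by
          exact mul_le_mul_of_nonneg_left (Finset.sum_le_sum fun i _ => h1 i) (Nat.cast_nonneg _)
      _ = _ := by rw [hS, Complex.re_sum]
  rw [← Complex.ofReal_natCast, Complex.re_ofReal_mul, Complex.inv_re, ← mul_div_assoc,
    le_div_iff₀ hS0]
  exact h3

/-- All the inverses have positive real part, so one of them bounds the sum from below. The bound
involves a single rate, so that later only the moments at one site of the block are needed. -/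
lemma norm_inv_sum_inv_le {δ : ℝ} (hδ : 0 < δ) {D : ι → ℂ} (hD : ∀ i, δ ≤ (D i).re) (i₀ : ι) :
    ‖(∑ i, (D i)⁻¹)⁻¹‖ ≤ ‖D i₀‖ ^ 2 / δ := by
  have hD0 : ∀ i, 0 < (D i).re := fun i => hδ.trans_le (hD i)
  have hne : D i₀ ≠ 0 := fun h => by have := hD0 i₀; rw [h] at this; simp at this
  have h1 : δ / ‖D i₀‖ ^ 2 ≤ ‖∑ i, (D i)⁻¹‖ := by
    refine le_trans ?_ (Complex.re_le_norm _)
    rw [Complex.re_sum]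
    refine le_trans ?_ (Finset.single_le_sum (f := fun i => ((D i)⁻¹).re)
      (fun i _ => (inv_re_pos (hD0 i)).le) (Finset.mem_univ i₀))
    rw [Complex.inv_re, Complex.normSq_eq_norm_sq]
    gcongr
    exact hD i₀
  rw [norm_inv, ← inv_div]
  exact inv_anti₀ (by positivity) h1

end HarmonicMean

/-! ### Contractions in the exterior algebra. -/

section ExteriorContraction

open ExteriorAlgebra

variable {V W : Type*} [AddCommGroup V] [Module ℂ V] [AddCommGroup W] [Module ℂ W]

/-- The interior product on an exterior algebra with a linear functional. -/
noncomputable def contract (d : Module.Dual ℂ V) : Module.End ℂ (ExteriorAlgebra ℂ V) :=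
  CliffordAlgebra.contractLeft d

lemma contract_ι_mul (d : Module.Dual ℂ V) (a : V) (x : ExteriorAlgebra ℂ V) :
    contract d (ι ℂ a * x) = d a • x - ι ℂ a * contract d x :=
  CliffordAlgebra.contractLeft_ι_mul (Q := (0 : QuadraticForm ℂ V)) d a x

lemma contract_algebraMap (d : Module.Dual ℂ V) (r : ℂ) :
    contract d (algebraMap ℂ (ExteriorAlgebra ℂ V) r) = 0 :=
  CliffordAlgebra.contractLeft_algebraMap (Q := (0 : QuadraticForm ℂ V)) d r

lemma contract_ι_mul_of_eq_zero {d : Module.Dual ℂ V} {a : V} (h : d a = 0)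
    (x : ExteriorAlgebra ℂ V) : contract d (ι ℂ a * x) = -(ι ℂ a * contract d x) := by
  rw [contract_ι_mul, h, zero_smul, zero_sub]

/-- Both sides vanish on scalars and obey the Leibniz rule `contract_ι_mul`. -/
lemma map_contract (f : V →ₗ[ℂ] W) (d : Module.Dual ℂ W) (x : ExteriorAlgebra ℂ V) :
    ExteriorAlgebra.map f (contract (d ∘ₗ f) x) = contract d (ExteriorAlgebra.map f x) := by
  induction x using CliffordAlgebra.left_induction with
  | algebraMap r =>
    rw [contract_algebraMap, map_zero, AlgHom.commutes, contract_algebraMap]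
  | add x y hx hy => rw [map_add, map_add, map_add, map_add, hx, hy]
  | ι_mul x m hx =>
    change ExteriorAlgebra.map f (contract (d ∘ₗ f) (ι ℂ m * x)) =
      contract d (ExteriorAlgebra.map f (ι ℂ m * x))
    rw [contract_ι_mul, map_sub, map_smul, map_mul, map_mul, map_apply_ι, hx, contract_ι_mul]
    rfl

lemma contract_mem_pow (d : Module.Dual ℂ V) (m : ℕ) {x : ExteriorAlgebra ℂ V}
    (hx : x ∈ LinearMap.range (ι ℂ : V →ₗ[ℂ] _) ^ (m + 1)) :
    contract d x ∈ LinearMap.range (ι ℂ : V →ₗ[ℂ] _) ^ m := by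
  induction m generalizing x with
  | zero =>
    rw [zero_add, pow_one] at hx
    obtain ⟨a, rfl⟩ := hx
    have h1 : contract d (1 : ExteriorAlgebra ℂ V) = 0 := by
      rw [← map_one (algebraMap ℂ (ExteriorAlgebra ℂ V)), contract_algebraMap]
    rw [pow_zero, ← mul_one (ι ℂ a), contract_ι_mul, h1, mul_zero, sub_zero]
    exact Submodule.smul_mem _ _ (Submodule.one_le.mp le_rfl)
  | succ m ih =>
    rw [pow_succ'] at hx
    induction hx using Submodule.mul_induction_on' with
    | mem_mul_mem a ha y hy =>
      obtain ⟨a, rfl⟩ := ha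
      rw [contract_ι_mul]
      refine Submodule.sub_mem _ (Submodule.smul_mem _ _ hy) ?_
      rw [pow_succ']
      exact Submodule.mul_mem_mul ⟨a, rfl⟩ (ih hy)
    | add x _ y _ hx hy => rw [map_add]; exact Submodule.add_mem _ hx hy

lemma contract_eq_zero_of_mem_pow_zero (d : Module.Dual ℂ V) {x : ExteriorAlgebra ℂ V}
    (hx : x ∈ LinearMap.range (ι ℂ : V →ₗ[ℂ] _) ^ 0) : contract d x = 0 := by
  rw [pow_zero, Submodule.mem_one] at hx
  obtain ⟨r, rfl⟩ := hx
  exact contract_algebraMap d r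

/-- Iterated contraction with the pairs `d j, d' j`. -/
noncomputable def contractPairs {k : ℕ} (d d' : Fin k → Module.Dual ℂ V) :
    Module.End ℂ (ExteriorAlgebra ℂ V) :=
  (List.ofFn fun j => contract (d' j) * contract (d j)).prod

lemma contractPairs_succ {k : ℕ} (d d' : Fin (k + 1) → Module.Dual ℂ V)
    (x : ExteriorAlgebra ℂ V) :
    contractPairs d d' x = contract (d' 0) (contract (d 0)
      (contractPairs (fun j => d j.succ) (fun j => d' j.succ) x)) := by
  simp [contractPairs, List.ofFn_succ]

lemma contractPairs_zero (d d' : Fin 0 → Module.Dual ℂ V) (x : ExteriorAlgebra ℂ V) :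
    contractPairs d d' x = x := by
  simp [contractPairs]

lemma contractPairs_mem_pow {k : ℕ} (d d' : Fin k → Module.Dual ℂ V) (m : ℕ)
    {x : ExteriorAlgebra ℂ V} (hx : x ∈ LinearMap.range (ι ℂ : V →ₗ[ℂ] _) ^ (m + 2 * k)) :
    contractPairs d d' x ∈ LinearMap.range (ι ℂ : V →ₗ[ℂ] _) ^ m := by
  induction k generalizing m with
  | zero => rw [contractPairs_zero]; simpa using hx
  | succ k ih =>
    rw [contractPairs_succ]
    refine contract_mem_pow _ _ (contract_mem_pow _ _ (ih _ _ _ ?_))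
    convert hx using 2
    ring

/-- There are more contractions than degrees: the innermost `m` pairs already reduce the form to a
scalar, which the next contraction kills. -/
lemma contractPairs_eq_zero {k : ℕ} (d d' : Fin k → Module.Dual ℂ V) {m : ℕ} (hm : m < k)
    {x : ExteriorAlgebra ℂ V} (hx : x ∈ LinearMap.range (ι ℂ : V →ₗ[ℂ] _) ^ (2 * m)) :
    contractPairs d d' x = 0 := by
  induction k with
  | zero => omega
  | succ k ih =>
    rw [contractPairs_succ]
    by_cases h : m < k
    · rw [ih _ _ h, map_zero, map_zero]
    · have hmk : m = k := by omega
      subst hmk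
      have h0 := contractPairs_mem_pow (fun j => d j.succ) (fun j => d' j.succ) 0
        (by simpa using hx)
      rw [contract_eq_zero_of_mem_pow_zero _ h0, map_zero]

lemma map_contractPairs {k : ℕ} (f : V →ₗ[ℂ] W) (d d' : Fin k → Module.Dual ℂ W)
    (x : ExteriorAlgebra ℂ V) :
    ExteriorAlgebra.map f (contractPairs (fun j => d j ∘ₗ f) (fun j => d' j ∘ₗ f) x)
      = contractPairs d d' (ExteriorAlgebra.map f x) := by
  induction k with
  | zero => rw [contractPairs_zero, contractPairs_zero]
  | succ k ih =>
    rw [contractPairs_succ, contractPairs_succ, map_contract, map_contract,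
      ih (fun j => d j.succ) (fun j => d' j.succ)]

/-- A one-form that the functionals do not see anticommutes with each contraction; contractions come
in pairs, so the signs cancel. -/
lemma contractPairs_ι_mul {k : ℕ} (d d' : Fin k → Module.Dual ℂ V) {a : V}
    (h : ∀ j, d j a = 0) (h' : ∀ j, d' j a = 0) (x : ExteriorAlgebra ℂ V) :
    contractPairs d d' (ι ℂ a * x) = ι ℂ a * contractPairs d d' x := by
  induction k with
  | zero => rw [contractPairs_zero, contractPairs_zero]
  | succ k ih =>
    rw [contractPairs_succ, contractPairs_succ,
      ih (fun j => d j.succ) (fun j => d' j.succ) (fun j => h j.succ) (fun j => h' j.succ),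
      contract_ι_mul_of_eq_zero (h 0), map_neg, contract_ι_mul_of_eq_zero (h' 0), neg_neg]

/-- Here `p j` and `q j` play the parts of dz_j and dz̄_j, and `d j`, `d' j` those of evaluation at
e_j and i e_j. Each pair gives -i - i = -2i, the normalization of dz ∧ dz̄. -/
lemma contractPairs_dual {k : ℕ} (d d' : Fin k → Module.Dual ℂ V) (p q : Fin k → V)
    (h1 : ∀ i j, d j (p i) = if i = j then 1 else 0)
    (h2 : ∀ i j, d j (q i) = if i = j then 1 else 0)
    (h3 : ∀ i j, d' j (p i) = if i = j then Complex.I else 0)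
    (h4 : ∀ i j, d' j (q i) = if i = j then -Complex.I else 0) :
    contractPairs d d' (List.ofFn fun j => ι ℂ (p j) * ι ℂ (q j)).prod
      = algebraMap ℂ _ ((-2 * Complex.I) ^ k) := by
  induction k with
  | zero => rw [contractPairs_zero]; simp
  | succ k ih =>
    rw [contractPairs_succ, List.ofFn_succ, List.prod_cons, mul_assoc,
      contractPairs_ι_mul, contractPairs_ι_mul,
      ih (fun j => d j.succ) (fun j => d' j.succ) (fun j => p j.succ) (fun j => q j.succ)]
    · rw [contract_ι_mul, contract_ι_mul, contract_algebraMap, h1, h2, if_pos rfl,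
        mul_zero, sub_zero, one_smul, one_smul, map_sub, contract_ι_mul, contract_ι_mul,
        contract_algebraMap, mul_zero, mul_zero, sub_zero, sub_zero, h4, if_pos rfl,
        h3, if_pos rfl, ← sub_smul, Algebra.smul_def, ← map_mul, pow_succ]
      congr 1
      ring
    · intro i j; simpa [Fin.succ_inj] using h1 i.succ j.succ
    · intro i j; simpa [Fin.succ_inj] using h2 i.succ j.succ
    · intro i j; simpa [Fin.succ_inj] using h3 i.succ j.succ
    · intro i j; simpa [Fin.succ_inj] using h4 i.succ j.succ
    · intro j; rw [h2, if_neg (Fin.succ_ne_zero j).symm]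
    · intro j; rw [h4, if_neg (Fin.succ_ne_zero j).symm]
    · intro j; rw [h1, if_neg (Fin.succ_ne_zero j).symm]
    · intro j; rw [h3, if_neg (Fin.succ_ne_zero j).symm]

lemma ι_mul_ιMulti_comm {k : ℕ} (a : V) (x : Fin k → V) :
    ι ℂ a * ιMulti ℂ k x = ((-1 : ℂ) ^ k) • (ιMulti ℂ k x * ι ℂ a) := by
  induction k with
  | zero => simp
  | succ k ih =>
    have hx : ιMulti ℂ (k + 1) x = ι ℂ (x 0) * ιMulti ℂ k (fun j => x j.succ) := by
      rw [ιMulti_succ_apply]; rfl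
    have sw : ι ℂ a * ι ℂ (x 0) = -(ι ℂ (x 0) * ι ℂ a) :=
      eq_neg_of_add_eq_zero_left (ι_add_mul_swap a (x 0))
    rw [hx, ← mul_assoc, sw, neg_mul, mul_assoc, ih, mul_smul_comm, pow_succ, mul_neg, mul_one,
      neg_smul, mul_assoc]

/-- Sorting the factors costs a sign that depends on `k` only. Its value is irrelevant, since it
enters both sides of the change of variables formula. -/
lemma prod_ι_mul_ι_eq (k : ℕ) : ∃ ε : ℂ, ∀ x y : Fin k → V,
    (List.ofFn fun j => ι ℂ (x j) * ι ℂ (y j)).prod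
      = ε • (ιMulti ℂ k x * ιMulti ℂ k y) := by
  induction k with
  | zero => exact ⟨1, fun x y => by simp⟩
  | succ k ih =>
    obtain ⟨ε, hε⟩ := ih
    refine ⟨ε * (-1) ^ k, fun x y => ?_⟩
    have hx : ∀ x : Fin (k + 1) → V,
        ιMulti ℂ (k + 1) x = ι ℂ (x 0) * ιMulti ℂ k (fun j => x j.succ) := fun x => by
      rw [ιMulti_succ_apply]; rfl
    rw [List.ofFn_succ, List.prod_cons, hε, hx x, hx y, mul_smul_comm, mul_smul, mul_assoc,
      mul_assoc (ι ℂ (x 0)), ← mul_assoc (ι ℂ (y 0)), ι_mul_ιMulti_comm, smul_mul_assoc,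
      mul_smul_comm, mul_assoc]

/-- Both sides are alternating in the rows of `B`, and such a map is determined by its value on the
standard basis. -/
lemma ιMulti_linearCombination {k : ℕ} (B : Matrix (Fin k) (Fin k) ℂ) (p : Fin k → V) :
    ιMulti ℂ k (fun j => ∑ i, B j i • p i) = B.det • ιMulti ℂ k p := by
  have h : (ιMulti ℂ k).compLinearMap (Fintype.linearCombination ℂ p)
      = (LinearMap.toSpanSingleton ℂ _ (ιMulti ℂ k p)).compAlternatingMap
        Matrix.detRowAlternating := by
    refine Module.Basis.ext_alternating (Pi.basisFun ℂ (Fin k)) fun v hv => ?_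
    have key : ∀ f : (Fin k → ℂ) [⋀^Fin k]→ₗ[ℂ] ExteriorAlgebra ℂ V,
        (f fun i => Pi.basisFun ℂ (Fin k) (v i)) = Equiv.Perm.sign
          (Equiv.ofBijective v (Finite.injective_iff_bijective.mp hv)) •
            f (Pi.basisFun ℂ (Fin k)) := fun f =>
      f.map_perm (Pi.basisFun ℂ (Fin k))
        (Equiv.ofBijective v (Finite.injective_iff_bijective.mp hv))
    rw [key, key]
    congr 1
    have h1 : Matrix.detRowAlternating (R := ℂ) (fun i => Pi.basisFun ℂ (Fin k) i) = 1 := by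
      have : (fun i => Pi.basisFun ℂ (Fin k) i) = (1 : Matrix (Fin k) (Fin k) ℂ) := by
        funext i j
        simp [Pi.single_apply, Matrix.one_apply, eq_comm]
      rw [this]
      exact Matrix.det_one
    rw [AlternatingMap.compLinearMap_apply, LinearMap.compAlternatingMap_apply, h1]
    simp [Fintype.linearCombination_apply, Pi.single_apply]
  have h2 := congrArg (fun f => f B) h
  exact h2

/-- The change of variables formula for products of `(1,1)`-forms. -/
lemma prod_ι_mul_ι_linearCombination {k : ℕ} (B C : Matrix (Fin k) (Fin k) ℂ) (p q : Fin k → V) :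
    (List.ofFn fun j => ι ℂ (∑ i, B j i • p i) * ι ℂ (∑ i, C j i • q i)).prod
      = (B.det * C.det) • (List.ofFn fun j => ι ℂ (p j) * ι ℂ (q j)).prod := by
  obtain ⟨ε, hε⟩ := prod_ι_mul_ι_eq (V := V) k
  rw [hε, hε, ιMulti_linearCombination, ιMulti_linearCombination, smul_mul_smul_comm, smul_comm]

/-- The commutative algebra generated by products of two one-forms. -/
noncomputable def evenAlg (V : Type*) [AddCommGroup V] [Module ℂ V] :
    Subalgebra ℂ (ExteriorAlgebra ℂ V) :=
  Algebra.adjoin ℂ {x | ∃ a b : V, x = ι ℂ a * ι ℂ b}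

instance : IsMulCommutative (evenAlg V) :=
  Algebra.isMulCommutative_adjoin ℂ (by
    rintro _ ⟨a, b, rfl⟩ _ ⟨c, d, rfl⟩
    exact Hier.commute_twoForm a b c d)

open scoped IsMulCommutative in
noncomputable instance : CommRing (evenAlg V) := inferInstance

/-- The product of two one-forms as an element of the commutative algebra `evenAlg V`. -/
noncomputable def twoForm (a b : V) : evenAlg V :=
  ⟨ι ℂ a * ι ℂ b, Algebra.subset_adjoin ⟨a, b, rfl⟩⟩

lemma coe_twoForm (a b : V) : (twoForm a b : ExteriorAlgebra ℂ V) = ι ℂ a * ι ℂ b := rfl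

lemma twoForm_sq (a b : V) : twoForm a b * twoForm a b = 0 := by
  apply Subtype.ext
  change ι ℂ a * ι ℂ b * (ι ℂ a * ι ℂ b) = 0
  have sw : ι ℂ b * ι ℂ a = -(ι ℂ a * ι ℂ b) :=
    eq_neg_of_add_eq_zero_left (ι_add_mul_swap b a)
  rw [mul_assoc, ← mul_assoc (ι ℂ b), sw, neg_mul, mul_neg, mul_assoc, ι_sq_zero, mul_zero,
    mul_zero, neg_zero]

lemma twoForm_mul_eq_zero_left (a b c : V) : twoForm a b * twoForm a c = 0 := by
  apply Subtype.ext
  change ι ℂ a * ι ℂ b * (ι ℂ a * ι ℂ c) = 0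
  have sw : ι ℂ b * ι ℂ a = -(ι ℂ a * ι ℂ b) :=
    eq_neg_of_add_eq_zero_left (ι_add_mul_swap b a)
  rw [mul_assoc, ← mul_assoc (ι ℂ b), sw, neg_mul, mul_neg, ← mul_assoc, ← mul_assoc, ι_sq_zero,
    zero_mul, zero_mul, neg_zero]

lemma twoForm_mul_eq_zero_right (a b c : V) : twoForm a b * twoForm c b = 0 := by
  apply Subtype.ext
  change ι ℂ a * ι ℂ b * (ι ℂ c * ι ℂ b) = 0
  have sw : ι ℂ b * ι ℂ c = -(ι ℂ c * ι ℂ b) :=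
    eq_neg_of_add_eq_zero_left (ι_add_mul_swap b c)
  rw [mul_assoc, ← mul_assoc (ι ℂ b), sw, neg_mul, mul_neg, mul_assoc, ι_sq_zero, mul_zero,
    mul_zero, neg_zero]

lemma prod_twoForm_mem_pow {ι' : Type*} (s : Finset ι') (a b : ι' → V) :
    ((∏ i ∈ s, twoForm (a i) (b i) : evenAlg V) : ExteriorAlgebra ℂ V)
      ∈ LinearMap.range (ι ℂ : V →ₗ[ℂ] _) ^ (2 * s.card) := by
  classical
  induction s using Finset.induction_on with
  | empty => simp [Submodule.mem_one]
  | insert i s hi ih =>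
    rw [Finset.prod_insert hi, Finset.card_insert_of_notMem hi, mul_add, mul_one, add_comm,
      pow_add, pow_two]
    exact Submodule.mul_mem_mul (Submodule.mul_mem_mul ⟨a i, rfl⟩ ⟨b i, rfl⟩) ih

end ExteriorContraction

/-- The exponential series of a sum of commuting elements of square zero. -/
lemma sum_pow_div_factorial_eq_prod {A ι : Type*} [CommRing A] [Algebra ℂ A] (s : Finset ι)
    (x : ι → A) (hx : ∀ i, x i * x i = 0) (m : ℕ) (hm : s.card ≤ m) :
    ∑ k ∈ Finset.range (m + 1), ((k.factorial : ℂ))⁻¹ • (∑ i ∈ s, x i) ^ k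
      = ∏ i ∈ s, (1 + x i) := by
  classical
  induction s using Finset.induction_on generalizing m with
  | empty =>
    rw [Finset.sum_empty, Finset.prod_empty, Finset.sum_range_succ', Finset.sum_eq_zero]
    · simp
    · intro k _; simp
  | insert i s hi ih =>
    rw [Finset.card_insert_of_notMem hi] at hm
    obtain ⟨m, rfl⟩ : ∃ m', m = m' + 1 := ⟨m - 1, by omega⟩
    rw [Finset.prod_insert hi, Finset.sum_insert hi]
    set S := ∑ i ∈ s, x i
    -- Since `x i` squares to zero, the binomial expansion stops at the linear term.
    have hpow : ∀ k, (x i + S) ^ (k + 1) = S ^ (k + 1) + ((k + 1 : ℕ) : ℂ) • (x i * S ^ k) := by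
      intro k
      induction k with
      | zero => simp [add_comm]
      | succ k ihk =>
        rw [pow_succ, ihk, Algebra.smul_def, Algebra.smul_def]
        push_cast
        have := hx i
        linear_combination ((k : A) + 1) * S ^ k * this
    rw [add_mul, one_mul]
    -- The induction hypothesis holds at every sufficiently large truncation. Order `m + 1` is used
    -- next to the factor 1 and order `m` next to `x i`, so that the degrees match.
    conv_rhs => rw [← ih (m + 1) (by omega)]; arg 2; rw [ih (m + 1) (by omega), ← ih m (by omega)]
    rw [Finset.sum_range_succ', Finset.sum_range_succ' _ (m + 1), Finset.mul_sum]
    have : ∀ k, (((k + 1).factorial : ℂ))⁻¹ • (x i + S) ^ (k + 1)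
        = (((k + 1).factorial : ℂ))⁻¹ • S ^ (k + 1) + x i * (((k.factorial : ℂ))⁻¹ • S ^ k) := by
      intro k
      rw [hpow, smul_add, smul_smul, mul_smul_comm]
      congr 2
      have h1 : ((k + 1 : ℕ) : ℂ) ≠ 0 := by exact_mod_cast Nat.succ_ne_zero k
      have h2 : (k.factorial : ℂ) ≠ 0 := by exact_mod_cast k.factorial_ne_zero
      rw [Nat.factorial_succ, Nat.cast_mul]
      field_simp
    simp only [this, Finset.sum_add_distrib]
    simp only [pow_zero]
    abel

/-! ### The commutative algebra of even forms and contractions of products of (1,1)-forms. -/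

section ExteriorContraction

open ExteriorAlgebra

variable {V W : Type*} [AddCommGroup V] [Module ℂ V] [AddCommGroup W] [Module ℂ W]

/-- The homomorphism of even algebras induced by a linear map. -/
noncomputable def evenMap (f : V →ₗ[ℂ] W) : evenAlg V →ₐ[ℂ] evenAlg W :=
  ((ExteriorAlgebra.map f).comp (evenAlg V).val).codRestrict (evenAlg W) (by
    have h : evenAlg V ≤ (evenAlg W).comap (ExteriorAlgebra.map f) := by
      refine Algebra.adjoin_le ?_
      rintro _ ⟨a, b, rfl⟩
      refine Algebra.subset_adjoin ⟨f a, f b, ?_⟩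
      change ExteriorAlgebra.map f (ι ℂ a * ι ℂ b) = _
      rw [map_mul, map_apply_ι, map_apply_ι]
    exact fun x => h x.2)

lemma coe_evenMap (f : V →ₗ[ℂ] W) (x : evenAlg V) :
    (evenMap f x : ExteriorAlgebra ℂ W) = ExteriorAlgebra.map f x := rfl

lemma evenMap_twoForm (f : V →ₗ[ℂ] W) (a b : V) :
    evenMap f (twoForm a b) = twoForm (f a) (f b) := by
  apply Subtype.ext
  rw [coe_evenMap, coe_twoForm, coe_twoForm, map_mul, map_apply_ι, map_apply_ι]

lemma twoForm_add_left (a a' b : V) : twoForm (a + a') b = twoForm a b + twoForm a' b :=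
  Subtype.ext (by simp [coe_twoForm, add_mul])

lemma twoForm_add_right (a b b' : V) : twoForm a (b + b') = twoForm a b + twoForm a b' :=
  Subtype.ext (by simp [coe_twoForm, mul_add])

lemma twoForm_smul_left (c : ℂ) (a b : V) : twoForm (c • a) b = c • twoForm a b :=
  Subtype.ext (by simp [coe_twoForm])

lemma twoForm_smul_right (c : ℂ) (a b : V) : twoForm a (c • b) = c • twoForm a b :=
  Subtype.ext (by simp [coe_twoForm])

lemma twoForm_sum_left {ι' : Type*} (s : Finset ι') (a : ι' → V) (b : V) :
    twoForm (∑ i ∈ s, a i) b = ∑ i ∈ s, twoForm (a i) b :=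
  Subtype.ext (by simp [coe_twoForm, Finset.sum_mul])

lemma twoForm_sum_right {ι' : Type*} (s : Finset ι') (a : V) (b : ι' → V) :
    twoForm a (∑ i ∈ s, b i) = ∑ i ∈ s, twoForm a (b i) :=
  Subtype.ext (by simp [coe_twoForm, Finset.mul_sum])

lemma twoForm_mul_prod_eq_zero_left {ι' : Type*} {s : Finset ι'} {i : ι'} (hi : i ∈ s)
    (x y : ι' → V) (c : V) : twoForm (x i) c * ∏ j ∈ s, twoForm (x j) (y j) = 0 := by
  classical
  rw [← Finset.mul_prod_erase s _ hi, ← mul_assoc, twoForm_mul_eq_zero_left, zero_mul]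

lemma twoForm_mul_prod_eq_zero_right {ι' : Type*} {s : Finset ι'} {i : ι'} (hi : i ∈ s)
    (x y : ι' → V) (c : V) : twoForm c (y i) * ∏ j ∈ s, twoForm (x j) (y j) = 0 := by
  classical
  rw [← Finset.mul_prod_erase s _ hi, ← mul_assoc, twoForm_mul_eq_zero_right, zero_mul]

/-- One factor of a product of `(1,1)`-forms may be replaced by the sum over all factors. -/
lemma prod_twoForm_eq_sum_mul_prod_erase {ι' : Type*} [Fintype ι'] [DecidableEq ι']
    (x y : ι' → V) (i : ι') :
    ∏ j, twoForm (x j) (y j)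
      = twoForm (∑ j, x j) (∑ j, y j) * ∏ j ∈ Finset.univ.erase i, twoForm (x j) (y j) := by
  rw [← Finset.mul_prod_erase Finset.univ _ (Finset.mem_univ i),
    ← Finset.add_sum_erase Finset.univ x (Finset.mem_univ i),
    ← Finset.add_sum_erase Finset.univ y (Finset.mem_univ i), twoForm_add_left,
    twoForm_add_right, twoForm_sum_left, twoForm_sum_right, add_mul, add_mul, Finset.sum_mul,
    Finset.sum_mul, Finset.sum_eq_zero, Finset.sum_eq_zero, add_zero, add_zero]
  · intro j hj
    exact twoForm_mul_prod_eq_zero_left hj x y _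
  · intro j hj
    exact twoForm_mul_prod_eq_zero_right hj x y _

/-- Contraction of a product of functions of `(1,1)`-forms in all directions but one. -/
lemma contractPairs_prod_add {k : ℕ} (d d' : Fin k → Module.Dual ℂ V) {ι' : Type*} [Fintype ι']
    [DecidableEq ι'] (hcard : Fintype.card ι' = k + 1) (x y : ι' → V) (p q : V)
    (hp : ∀ j, d j p = 0) (hp' : ∀ j, d' j p = 0) (hq : ∀ j, d j q = 0) (hq' : ∀ j, d' j q = 0)
    (hx : ∑ i, x i = p) (hy : ∑ i, y i = q) (J : ι' → ℂ)
    (hJ : ∀ i, contractPairs d d'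
      ((∏ j ∈ Finset.univ.erase i, twoForm (x j) (y j) : evenAlg V) : ExteriorAlgebra ℂ V)
        = algebraMap ℂ _ (J i)) (α γ : ι' → ℂ) (i₀ : ι') :
    contractPairs d d' ((∏ i, (algebraMap ℂ (evenAlg V) (α i) + γ i • twoForm (x i) (y i)) :
        evenAlg V) : ExteriorAlgebra ℂ V)
      = algebraMap ℂ _ (∑ i, α i * (∏ j ∈ Finset.univ.erase i, γ j) * J i)
        + ((∏ j, γ j) * J i₀) • (ι ℂ p * ι ℂ q) := by
  set Z : Finset ι' → evenAlg V := fun S => ∏ j ∈ Finset.univ \ S, twoForm (x j) (y j) with hZ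
  have hexp : (∏ i, (algebraMap ℂ (evenAlg V) (α i) + γ i • twoForm (x i) (y i)))
      = ∑ S ∈ Finset.univ.powerset,
        ((∏ i ∈ S, α i) * ∏ j ∈ Finset.univ \ S, γ j) • Z S := by
    rw [Finset.prod_add]
    refine Finset.sum_congr rfl fun S _ => ?_
    rw [← map_prod, mul_smul, Algebra.smul_def (∏ i ∈ S, α i)]
    congr 1
    simp only [Algebra.smul_def, Finset.prod_mul_distrib, map_prod, hZ]
  rw [hexp]
  have hcoe : ((∑ S ∈ Finset.univ.powerset,
        ((∏ i ∈ S, α i) * ∏ j ∈ Finset.univ \ S, γ j) • Z S : evenAlg V) : ExteriorAlgebra ℂ V)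
      = ∑ S ∈ Finset.univ.powerset,
        ((∏ i ∈ S, α i) * ∏ j ∈ Finset.univ \ S, γ j) • (Z S : ExteriorAlgebra ℂ V) := by
    simp
  rw [hcoe, map_sum]
  simp only [map_smul]
  -- `S` is the set of sites that contribute their scalar part. With `k + 1` sites and `k` complex
  -- directions, the terms with two or more scalar sites have too low a degree to survive.
  have hsub : insert ∅ (Finset.univ.image fun i : ι' => ({i} : Finset ι'))
      ⊆ (Finset.univ : Finset ι').powerset := fun S _ => by simp
  rw [← Finset.sum_subset hsub, Finset.sum_insert, Finset.sum_image]
  · rw [add_comm]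
    congr 1
    · rw [map_sum]
      refine Finset.sum_congr rfl fun i _ => ?_
      have : Z {i} = ∏ j ∈ Finset.univ.erase i, twoForm (x j) (y j) := by
        rw [hZ]; simp only [Finset.sdiff_singleton_eq_erase]
      rw [this, hJ, Finset.prod_singleton, Finset.sdiff_singleton_eq_erase, Algebra.smul_def,
        ← map_mul]
    -- If every site contributes its two-form, one of them may be replaced by the two-form of the
    -- sums, which passes through the contractions. Any site `i₀` will do.
    · have : Z ∅ = twoForm p q * ∏ j ∈ Finset.univ.erase i₀, twoForm (x j) (y j) := by
        rw [hZ, ← hx, ← hy, ← prod_twoForm_eq_sum_mul_prod_erase]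
        simp only [Finset.sdiff_empty]
      rw [this, MulMemClass.coe_mul, coe_twoForm, mul_assoc, contractPairs_ι_mul d d' hp hp',
        contractPairs_ι_mul d d' hq hq', hJ, Finset.prod_empty, one_mul, Finset.sdiff_empty,
        mul_smul, ← mul_assoc, ← Algebra.commutes, ← Algebra.smul_def]
  · intro a _ b _ h
    exact Finset.singleton_injective h
  · simp [eq_comm]
  · intro S _ hS
    have h2 : 2 ≤ S.card := by
      by_contra h
      have h01 : S.card = 0 ∨ S.card = 1 := by omega
      rcases h01 with h0 | h1
      · exact hS (by simp [Finset.card_eq_zero.mp h0])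
      · obtain ⟨i, rfl⟩ := Finset.card_eq_one.mp h1
        exact hS (by simp)
    have hc : (Finset.univ \ S).card = k + 1 - S.card := by
      rw [Finset.card_sdiff_of_subset (Finset.subset_univ S), Finset.card_univ, hcard]
    rw [contractPairs_eq_zero d d' (m := (Finset.univ \ S).card) (by
      have := S.card_le_univ; omega) (prod_twoForm_mem_pow _ _ _), smul_zero]

/-- The contraction of a `(k,k)`-form in `k` complex directions can be computed after restriction
to these directions, and is then a squared determinant. -/
lemma contractPairs_prod_twoForm_eq {k : ℕ} (f : V →ₗ[ℂ] W) (d d' : Fin k → Module.Dual ℂ W)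
    (p q : Fin k → W)
    (h1 : ∀ i j, d j (p i) = if i = j then 1 else 0)
    (h2 : ∀ i j, d j (q i) = if i = j then 1 else 0)
    (h3 : ∀ i j, d' j (p i) = if i = j then Complex.I else 0)
    (h4 : ∀ i j, d' j (q i) = if i = j then -Complex.I else 0)
    {ι' : Type*} (s : Finset ι') (σ : Fin k ≃ s) (x y : ι' → V)
    (B : Matrix (Fin k) (Fin k) ℂ)
    (hx : ∀ j, f (x (σ j)) = ∑ i, B j i • p i)
    (hy : ∀ j, f (y (σ j)) = ∑ i, (starRingEnd ℂ) (B j i) • q i) :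
    contractPairs (fun j => d j ∘ₗ f) (fun j => d' j ∘ₗ f)
      ((∏ j ∈ s, twoForm (x j) (y j) : evenAlg V) : ExteriorAlgebra ℂ V)
        = algebraMap ℂ _ ((Complex.normSq B.det : ℂ) * (-2 * Complex.I) ^ k) := by
  have hcard : s.card = k := by
    have := Fintype.card_congr σ
    simpa using this.symm
  have hmem := prod_twoForm_mem_pow s x y
  rw [hcard, ← zero_add (2 * k)] at hmem
  -- The form has degree exactly `2 * k`, so its contraction is a scalar. Scalars are not changed by
  -- restriction along `f`, hence the computation can be done in `W`.
  have hdeg := contractPairs_mem_pow (fun j => d j ∘ₗ f) (fun j => d' j ∘ₗ f) 0 hmem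
  rw [pow_zero, Submodule.mem_one] at hdeg
  obtain ⟨c, hc⟩ := hdeg
  rw [← hc]
  congr 1
  have hm := map_contractPairs f d d'
    ((∏ j ∈ s, twoForm (x j) (y j) : evenAlg V) : ExteriorAlgebra ℂ V)
  rw [← hc, AlgHom.commutes, ← coe_evenMap, map_prod] at hm
  have hprod : ∏ j ∈ s, evenMap f (twoForm (x j) (y j))
      = (List.ofFn fun j => evenMap f (twoForm (x (σ j)) (y (σ j)))).prod := by
    rw [List.prod_ofFn, ← Finset.prod_coe_sort, ← Equiv.prod_comp σ]
  have hlist : ((List.ofFn fun j => evenMap f (twoForm (x (σ j)) (y (σ j)))).prod :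
        ExteriorAlgebra ℂ W)
      = (List.ofFn fun j => ι ℂ (∑ i, B j i • p i) *
          ι ℂ (∑ i, (B.map (starRingEnd ℂ)) j i • q i)).prod := by
    change (evenAlg W).val _ = _
    rw [map_list_prod, List.map_ofFn]
    congr 2
    funext j
    simp only [Function.comp_apply, evenMap_twoForm, hx, hy, Subalgebra.coe_val, coe_twoForm,
      Matrix.map_apply]
  rw [hprod, hlist, prod_ι_mul_ι_linearCombination,
    contractPairs, map_smul] at hm
  have hdual := contractPairs_dual d d' p q h1 h2 h3 h4
  rw [contractPairs] at hdual
  rw [hdual, Algebra.smul_def, ← map_mul] at hm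
  have := (algebraMap_leftInverse (R := ℂ) W).injective hm
  rw [this]
  congr 1
  have hdet : (B.map (starRingEnd ℂ)).det = (starRingEnd ℂ) B.det := by
    rw [RingHom.map_det]; rfl
  rw [hdet, Complex.mul_conj]

end ExteriorContraction

/-! ### The lattice and the self-similarity of the generator. -/

namespace Hier

section Lattice

variable {L : ℕ}

/-- The point `(…, X₁, X₀, a)` of the lattice. -/
noncomputable def cons (a : ZMod (L ^ 4)) (X : Hier L) : Hier L :=
  Finsupp.single 0 a + Finsupp.embDomain ⟨fun j => j + 1, add_left_injective 1⟩ X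

lemma cons_zero (a : ZMod (L ^ 4)) (X : Hier L) : cons a X 0 = a := by
  have : (Finsupp.embDomain ⟨fun j => j + 1, add_left_injective 1⟩ X : Hier L) 0 = 0 :=
    Finsupp.embDomain_of_notMem_range _ _ _ (by simp)
  simp [cons, this]

lemma cons_succ (a : ZMod (L ^ 4)) (X : Hier L) (j : ℕ) : cons a X (j + 1) = X j := by
  have : (Finsupp.embDomain ⟨fun j => j + 1, add_left_injective 1⟩ X : Hier L) (j + 1) = X j :=
    Finsupp.embDomain_apply_self ⟨fun j : ℕ => j + 1, add_left_injective 1⟩ X j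
  simp [cons, this]

lemma down_apply (x : Hier L) (j : ℕ) : down x j = x (j + 1) := rfl

lemma down_cons (a : ZMod (L ^ 4)) (X : Hier L) : down (cons a X) = X := by
  ext j; rw [down_apply, cons_succ]

lemma cons_down (x : Hier L) : cons (x 0) (down x) = x := by
  ext j
  cases j with
  | zero => rw [cons_zero]
  | succ j => rw [cons_succ, down_apply]

lemma down_sub (x y : Hier L) : down (x - y) = down x - down y := by
  ext j; simp [down_apply]

lemma down_zero : down (0 : Hier L) = 0 := by
  ext j; simp [down_apply]

/-- A point is determined by its last coordinate and its image under the scaling map. -/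
noncomputable def consEquiv (L : ℕ) : ZMod (L ^ 4) × Hier L ≃ Hier L where
  toFun p := cons p.1 p.2
  invFun x := (x 0, down x)
  left_inv p := by ext1 <;> simp [cons_zero, down_cons]
  right_inv x := cons_down x

lemma mem_ball_succ_iff {N : ℕ} (x : Hier L) : x ∈ ball L (N + 1) ↔ down x ∈ ball L N := by
  refine ⟨down_mem_ball, fun h j hj => ?_⟩
  obtain ⟨i, rfl⟩ : ∃ i, j = i + 1 := ⟨j - 1, by omega⟩
  exact h i (by omega)

lemma mem_ball_zero_iff (x : Hier L) : x ∈ ball L 0 ↔ x = 0 := by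
  refine ⟨fun h => ?_, fun h => h ▸ zero_mem_ball L 0⟩
  ext j
  exact h j (Nat.zero_le j)

instance subsingleton_ball_zero (L : ℕ) : Subsingleton (ball L 0) :=
  ⟨fun x y => Subtype.ext (((mem_ball_zero_iff _).mp x.2).trans ((mem_ball_zero_iff _).mp y.2).symm)⟩

/-- The ball `𝒢_{N+1}` as a union of cosets of `𝒢_1`. -/
noncomputable def ballEquiv (L N : ℕ) : ZMod (L ^ 4) × ball L N ≃ ball L (N + 1) where
  toFun p := ⟨cons p.1 p.2.1, by rw [mem_ball_succ_iff, down_cons]; exact p.2.2⟩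
  invFun x := (x.1 0, ballDown x)
  left_inv p := by
    ext1
    · exact cons_zero _ _
    · exact Subtype.ext (down_cons _ _)
  right_inv x := Subtype.ext (cons_down x.1)

lemma ballDown_ballEquiv {N : ℕ} (a : ZMod (L ^ 4)) (X : ball L N) :
    ballDown (ballEquiv L N (a, X)) = X := Subtype.ext (down_cons _ _)

lemma ballDown_eq_iff {N : ℕ} (x y : ball L (N + 1)) :
    ballDown x = ballDown y ↔ down (x.1 - y.1) = 0 := by
  rw [down_sub, sub_eq_zero, ballDown, ballDown, Subtype.mk.injEq]

instance neZero_pow_four (L : ℕ) [L.AtLeastTwo] : NeZero (L ^ 4) :=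
  ⟨pow_ne_zero 4 (NeZero.ne L)⟩

lemma sInf_ball_cons_of_ne_zero (a : ZMod (L ^ 4)) {X : Hier L} (hX : X ≠ 0) :
    sInf {k : ℕ | cons a X ∈ ball L k} = sInf {k : ℕ | X ∈ ball L k} + 1 := by
  have hm : X ∈ ball L (sInf {k : ℕ | X ∈ ball L k}) :=
    Nat.sInf_mem (s := {k : ℕ | X ∈ ball L k}) (exists_mem_ball X)
  refine IsLeast.csInf_eq ⟨?_, fun k hk => ?_⟩
  · change cons a X ∈ ball L _
    rw [mem_ball_succ_iff, down_cons]
    exact hm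
  · have hk' : cons a X ∈ ball L k := hk
    cases k with
    | zero =>
      rw [mem_ball_zero_iff] at hk'
      exact absurd (by rw [← down_cons a X, hk', down_zero]) hX
    | succ k =>
      rw [mem_ball_succ_iff, down_cons] at hk'
      exact Nat.succ_le_succ (Nat.sInf_le hk')

variable [L.AtLeastTwo]

lemma one_lt_cast (L : ℕ) [L.AtLeastTwo] : (1 : ℝ) < L := by
  have h2 : 2 ≤ L := Nat.AtLeastTwo.prop
  exact_mod_cast (by omega : 1 < L)

lemma sum_ball_succ {M : Type*} [AddCommMonoid M] (N : ℕ) (f : ball L (N + 1) → M) :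
    ∑ x, f x = ∑ X : ball L N, ∑ a : ZMod (L ^ 4), f (ballEquiv L N (a, X)) := by
  rw [← (ballEquiv L N).sum_comp, Fintype.sum_prod_type, Finset.sum_comm]

lemma card_ball_succ (N : ℕ) :
    Fintype.card (ball L (N + 1)) = L ^ 4 * Fintype.card (ball L N) := by
  rw [← Fintype.card_congr (ballEquiv L N), Fintype.card_prod, ZMod.card]

lemma card_ball_one : Fintype.card (ball L 1) = L ^ 4 := by
  have : Fintype.card (ball L 0) = 1 :=
    Fintype.card_eq_one_iff.mpr ⟨⟨0, zero_mem_ball L 0⟩, fun y => Subsingleton.elim _ _⟩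
  rw [card_ball_succ, this, mul_one]

omit [L.AtLeastTwo] in
-- Over X ≠ 0 the norm is multiplied by L. Over X = 0, whose own weight is zero, the nonzero points
-- have norm L and form a separate term.
lemma jumpWeight_cons (a : ZMod (L ^ 4)) (X : Hier L) :
    jumpWeight (cons a X) = (if X = 0 ∧ a ≠ 0 then ENNReal.ofReal (((L : ℝ) ^ 6)⁻¹) else 0)
      + ENNReal.ofReal (((L : ℝ) ^ 6)⁻¹) * jumpWeight X := by
  by_cases hX : X = 0
  · subst hX
    by_cases ha : a = 0
    · subst ha
      have : (cons 0 0 : Hier L) = 0 := by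
        ext j; cases j with
        | zero => rw [cons_zero]; rfl
        | succ j => rw [cons_succ]; rfl
      simp [jumpWeight, this]
    · have hne : (cons a 0 : Hier L) ≠ 0 := fun h => ha (by rw [← cons_zero a 0, h]; rfl)
      have h1 : sInf {k : ℕ | (cons a 0 : Hier L) ∈ ball L k} = 1 := by
        refine IsLeast.csInf_eq ⟨?_, fun k hk => ?_⟩
        · change cons a 0 ∈ ball L (0 + 1)
          rw [mem_ball_succ_iff, down_cons]
          exact zero_mem_ball L 0
        · rcases Nat.eq_zero_or_pos k with rfl | h
          · exact absurd ((mem_ball_zero_iff _).mp hk) hne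
          · exact h
      simp [jumpWeight, hne, hnorm, h1, ha]
  · have hne : cons a X ≠ 0 := fun h => hX (by rw [← down_cons a X, h, down_zero])
    have : jumpWeight X = ENNReal.ofReal ((((L : ℝ) ^ sInf {k : ℕ | X ∈ ball L k}) ^ 6)⁻¹) := by
      simp [jumpWeight, hnorm, hX]
    rw [this, ← ENNReal.ofReal_mul (by positivity)]
    simp only [jumpWeight, hnorm, if_neg hne, sInf_ball_cons_of_ne_zero a hX, hX, false_and,
      if_false, zero_add]
    congr 1
    rw [← mul_inv, ← mul_pow, ← pow_succ']

/-- The total jump weight. -/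
noncomputable def totalWeight (L : ℕ) : ℝ := (∑' x : Hier L, jumpWeight x).toReal

/-- In the sum of `jumpWeight_cons` over the last coordinate, L⁴ - 1 points lie over 0 and the other
terms scale by L⁴ · L⁻⁶. -/
lemma totalWeight_recursion (L : ℕ) [L.AtLeastTwo] :
    totalWeight L = ((L : ℝ) ^ 4 - 1) * ((L : ℝ) ^ 6)⁻¹ + ((L : ℝ) ^ 2)⁻¹ * totalWeight L := by
  have hL := one_lt_cast L
  have h4 : 1 ≤ (L : ℝ) ^ 4 := one_le_pow₀ hL.le
  have h : ∑' x : Hier L, jumpWeight x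
      = ENNReal.ofReal (((L : ℝ) ^ 4 - 1) * ((L : ℝ) ^ 6)⁻¹) +
        ENNReal.ofReal (((L : ℝ) ^ 2)⁻¹) * ∑' x : Hier L, jumpWeight x := by
    have h1 : ∑' x : Hier L, jumpWeight x = ∑' X : Hier L, ∑ a : ZMod (L ^ 4),
        jumpWeight (cons a X) := by
      rw [← (consEquiv L).tsum_eq, ENNReal.tsum_prod', ENNReal.tsum_comm]
      refine tsum_congr fun X => ?_
      rw [tsum_fintype]
      rfl
    have h2 : ∀ X : Hier L, ∑ a : ZMod (L ^ 4), jumpWeight (cons a X)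
        = (if X = 0 then ENNReal.ofReal (((L : ℝ) ^ 4 - 1) * ((L : ℝ) ^ 6)⁻¹) else 0)
          + ENNReal.ofReal (((L : ℝ) ^ 2)⁻¹) * jumpWeight X := by
      intro X
      simp only [jumpWeight_cons, Finset.sum_add_distrib, Finset.sum_const, Finset.card_univ,
        ZMod.card, nsmul_eq_mul, ← mul_assoc]
      congr 1
      · by_cases hX : X = 0
        · simp only [hX, true_and, if_true]
          rw [← Finset.sum_filter, Finset.sum_const, nsmul_eq_mul]
          have hc : (Finset.univ.filter fun a : ZMod (L ^ 4) => a ≠ 0).card = L ^ 4 - 1 := by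
            rw [Finset.filter_ne', Finset.card_erase_of_mem (Finset.mem_univ _), Finset.card_univ,
              ZMod.card]
          rw [hc, ← ENNReal.ofReal_natCast, ← ENNReal.ofReal_mul (by positivity),
            Nat.cast_sub (Nat.one_le_pow _ _ (by exact_mod_cast (by linarith : (0 : ℝ) < L)))]
          push_cast; rfl
        · simp [hX]
      · congr 1
        rw [← ENNReal.ofReal_natCast, ← ENNReal.ofReal_mul (by positivity)]
        congr 1
        push_cast
        field_simp
    refine h1.trans ((tsum_congr h2).trans ?_)
    rw [ENNReal.tsum_add, ENNReal.tsum_mul_left, tsum_ite_eq]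
  have h3 := congrArg ENNReal.toReal h
  rw [ENNReal.toReal_add ENNReal.ofReal_ne_top
    (ENNReal.mul_ne_top ENNReal.ofReal_ne_top (tsum_jumpWeight_ne_top L)), ENNReal.toReal_mul,
    ENNReal.toReal_ofReal (mul_nonneg (by linarith) (by positivity)),
    ENNReal.toReal_ofReal (by positivity)] at h3
  exact h3

/-- The rate of jumps by `z`. -/
noncomputable def rate (z : Hier L) : ℝ := jumpRate L * (jumpLaw L z).toReal

lemma jumpLaw_toReal (z : Hier L) :
    (jumpLaw L z).toReal = (jumpWeight z).toReal * (totalWeight L)⁻¹ := by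
  rw [jumpLaw, PMF.normalize_apply, ENNReal.toReal_mul, ENNReal.toReal_inv, totalWeight]

/-- The generator of the process, as a function of the displacement. -/
noncomputable def generator (z : Hier L) : ℝ :=
  open Classical in (if z = 0 then jumpRate L else 0) - rate z

/-- The left side is the rate of a jump to a given other point of 𝒢_1. The value on the right is
what `generator_eq` demands at such a point, where the rescaled generator is evaluated at 0. -/
lemma jumpRate_mul_inv_totalWeight (L : ℕ) [L.AtLeastTwo] :
    jumpRate L * (totalWeight L)⁻¹ * ((L : ℝ) ^ 6)⁻¹
      = ((L : ℝ) ^ 4)⁻¹ - ((L : ℝ) ^ 6)⁻¹ * jumpRate L := by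
  have hL := one_lt_cast L
  have hL0 : (0 : ℝ) < L := by linarith
  have h2 : (1 : ℝ) < (L : ℝ) ^ 2 := one_lt_pow₀ hL (by norm_num)
  have h4 : (1 : ℝ) < (L : ℝ) ^ 4 := one_lt_pow₀ hL (by norm_num)
  have h6 : (1 : ℝ) < (L : ℝ) ^ 6 := one_lt_pow₀ hL (by norm_num)
  have hZ : totalWeight L = ((L : ℝ) ^ 4 - 1) / ((L : ℝ) ^ 4 * ((L : ℝ) ^ 2 - 1)) := by
    have := totalWeight_recursion L
    rw [eq_div_iff (by nlinarith)]
    field_simp at this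
    have h3 : ((L : ℝ) ^ 4 - 1) + (L : ℝ) ^ 4 * totalWeight L = (L : ℝ) ^ 6 * totalWeight L := by
      have hr : (L : ℝ) ^ 2 ≠ 0 := by positivity
      linear_combination -this
    linear_combination -h3
  rw [hZ, jumpRate, inv_div]
  have e1 : (L : ℝ) ^ 4 - 1 ≠ 0 := by linarith
  have e2 : (L : ℝ) ^ 6 - 1 ≠ 0 := by linarith
  field_simp
  ring

/-- The single-scale part is (1 + β) Γ(β), and the rest is a rescaled copy of the generator; this
self-similarity is what makes the renormalization step exact. At the origin it is the equation r (1
- L⁻⁶) = 1 - L⁻⁴, at the other points of 𝒢_1 it is `jumpRate_mul_inv_totalWeight`, and elsewhere it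
is the scaling of the jump weights. -/
lemma generator_eq (z : Hier L) :
    open Classical in
    generator z = (if z = 0 then 1 else 0) - ((L : ℝ) ^ 4)⁻¹ * (if down z = 0 then 1 else 0)
      + ((L : ℝ) ^ 6)⁻¹ * generator (down z) := by
  classical
  obtain ⟨⟨a, X⟩, rfl⟩ := (consEquiv L).surjective z
  have hL := one_lt_cast L
  have hL0 : (0 : ℝ) < L := by linarith
  have h6 : (1 : ℝ) < (L : ℝ) ^ 6 := one_lt_pow₀ hL (by norm_num)
  have hr : jumpRate L * (1 - ((L : ℝ) ^ 6)⁻¹) = 1 - ((L : ℝ) ^ 4)⁻¹ := by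
    rw [jumpRate, div_mul_cancel₀]
    have := inv_lt_one_of_one_lt₀ h6
    linarith
  have hkey := jumpRate_mul_inv_totalWeight L
  change generator (cons a X) = (if cons a X = 0 then 1 else 0)
    - ((L : ℝ) ^ 4)⁻¹ * (if down (cons a X) = 0 then 1 else 0)
      + ((L : ℝ) ^ 6)⁻¹ * generator (down (cons a X))
  have hzero : cons a X = 0 ↔ X = 0 ∧ a = 0 := by
    constructor
    · intro h
      exact ⟨by rw [← down_cons a X, h, down_zero], by rw [← cons_zero a X, h]; rfl⟩
    · rintro ⟨rfl, rfl⟩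
      ext j; cases j with
        | zero => rw [cons_zero]; rfl
        | succ j => rw [cons_succ]; rfl
  have hw : (jumpWeight (cons a X)).toReal
      = (if X = 0 ∧ a ≠ 0 then ((L : ℝ) ^ 6)⁻¹ else 0)
        + ((L : ℝ) ^ 6)⁻¹ * (jumpWeight X).toReal := by
    rw [jumpWeight_cons, ENNReal.toReal_add, ENNReal.toReal_mul,
      ENNReal.toReal_ofReal (by positivity)]
    · split_ifs
      · rw [ENNReal.toReal_ofReal (by positivity)]
      · simp
    · split_ifs <;> simp
    · exact ENNReal.mul_ne_top ENNReal.ofReal_ne_top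
        (ne_top_of_le_ne_top (tsum_jumpWeight_ne_top L) (ENNReal.le_tsum X))
  rw [down_cons]
  simp only [generator, rate, jumpLaw_toReal, hw, hzero]
  by_cases hX : X = 0
  · by_cases ha : a = 0
    · have h0 : (jumpWeight (0 : Hier L)).toReal = 0 := by simp [jumpWeight]
      simp only [hX, ha, h0]
      simp
      linear_combination hr
    · have h0 : (jumpWeight (0 : Hier L)).toReal = 0 := by simp [jumpWeight]
      simp only [hX, ha, h0]
      simp [ha]
      linear_combination -hkey
  · simp only [hX]
    simp
    ring

lemma rate_nonneg (z : Hier L) : 0 ≤ rate z :=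
  mul_nonneg (jumpRate_pos L).le ENNReal.toReal_nonneg

/-- The single-scale part of `generator_eq` sums to 1 - L⁻⁴ L⁴ = 0, and each scale contributes L⁴
L⁻⁶ = L⁻². The value is the rate of leaving the ball, the same from each of its points. -/
lemma sum_generator_ball (N : ℕ) (x : ball L N) :
    ∑ y : ball L N, generator (x.1 - y.1) = jumpRate L * ((L : ℝ) ^ (2 * N))⁻¹ := by
  classical
  induction N with
  | zero =>
    have hy : ∀ y : ball L 0, generator (x.1 - y.1) = jumpRate L := by
      intro y
      have : x.1 - y.1 = 0 := by rw [Subsingleton.elim x y, sub_self]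
      rw [this, generator, rate, jumpLaw_toReal]
      simp [jumpWeight]
    simp only [hy, Finset.sum_const, Finset.card_univ]
    have : Fintype.card (ball L 0) = 1 :=
      Fintype.card_eq_one_iff.mpr ⟨⟨0, zero_mem_ball L 0⟩, fun y => Subsingleton.elim _ _⟩
    simp [this]
  | succ N ih =>
    have hL0 : (0 : ℝ) < L := by linarith [one_lt_cast L]
    simp only [generator_eq (x.1 - _), Finset.sum_add_distrib, Finset.sum_sub_distrib,
      ← Finset.mul_sum]
    have h1 : ∑ y : ball L (N + 1), (if x.1 - y.1 = 0 then (1 : ℝ) else 0) = 1 := by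
      simp [sub_eq_zero, Subtype.ext_iff.symm]
    have h2 : ∑ y : ball L (N + 1), (if down (x.1 - y.1) = 0 then (1 : ℝ) else 0)
        = (L : ℝ) ^ 4 := by
      simp only [← ballDown_eq_iff]
      rw [sum_ball_succ]
      simp only [ballDown_ballEquiv, Finset.sum_const, Finset.card_univ, ZMod.card]
      simp
    have h3 : ∑ y : ball L (N + 1), generator (down (x.1 - y.1))
        = (L : ℝ) ^ 4 * (jumpRate L * ((L : ℝ) ^ (2 * N))⁻¹) := by
      rw [← ih (ballDown x), sum_ball_succ, Finset.mul_sum]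
      refine Finset.sum_congr rfl fun X _ => ?_
      have : ∀ a : ZMod (L ^ 4), generator (down (x.1 - (ballEquiv L N (a, X)).1))
          = generator ((ballDown x).1 - X.1) := by
        intro a
        rw [down_sub]
        congr 2
        exact down_cons _ _
      simp only [this, Finset.sum_const, Finset.card_univ, ZMod.card, nsmul_eq_mul]
      push_cast; rfl
    rw [h1, h2, h3]
    field_simp
    ring

lemma rate_neg (z : Hier L) : rate (-z) = rate z := by
  have hb : ∀ k, -z ∈ ball L k ↔ z ∈ ball L k := fun k => by simp [ball]
  simp only [rate, jumpLaw_toReal, jumpWeight, hnorm, neg_eq_zero, hb]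

lemma rate_zero : rate (0 : Hier L) = 0 := by
  simp [rate, jumpLaw_toReal, jumpWeight]

lemma sum_rate_ball (N : ℕ) (x : ball L N) :
    ∑ y : ball L N, rate (y.1 - x.1) = jumpRate L * (1 - ((L : ℝ) ^ (2 * N))⁻¹) := by
  classical
  have h := sum_generator_ball N x
  simp only [generator, Finset.sum_sub_distrib, sub_eq_zero, ← Subtype.ext_iff,
    Finset.sum_ite_eq, Finset.mem_univ, if_true] at h
  have h2 : ∀ y : ball L N, rate (y.1 - x.1) = rate (x.1 - y.1) := fun y => by
    rw [← rate_neg, neg_sub]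
  simp only [h2]
  linear_combination -h

end Lattice

end Hier

/-! ### Exponential waiting times. -/

section ExponentialLaw

open Set

lemma expMeasure_eq_withDensity (r : ℝ) :
    expMeasure r = (volume.restrict (Ioi 0)).withDensity
      (fun s => ENNReal.ofReal (r * Real.exp (-(r * s)))) := by
  have h : expMeasure r = volume.withDensity (exponentialPDF r) := rfl
  rw [h, ← withDensity_indicator measurableSet_Ioi]
  refine withDensity_congr_ae ?_
  have h0 : ∀ᵐ s : ℝ, s ≠ 0 := by simp [ae_iff]
  filter_upwards [h0] with s hs
  rw [exponentialPDF_eq]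
  rcases lt_or_gt_of_ne hs with h | h
  · rw [if_neg (not_le.2 h), indicator_of_notMem (by simpa using h.le), ENNReal.ofReal_zero]
  · rw [if_pos h.le, indicator_of_mem (by simpa using h)]

lemma integral_expMeasure {r : ℝ} (hr : 0 < r) (f : ℝ → ℂ) :
    ∫ s, f s ∂expMeasure r = ∫ s in Ioi (0 : ℝ), (r * Complex.exp (-(r * s))) * f s := by
  rw [expMeasure_eq_withDensity r, integral_withDensity_eq_integral_toReal_smul (by fun_prop)
    (by simp)]
  refine integral_congr_ae (Filter.Eventually.of_forall fun s => ?_)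
  simp only
  rw [ENNReal.toReal_ofReal (by positivity)]
  simp

lemma integrable_cexp_expMeasure {r : ℝ} (hr : 0 < r) {u : ℂ} (hu : 0 < r + u.re) :
    Integrable (fun s : ℝ => Complex.exp (-u * s)) (expMeasure r) := by
  rw [expMeasure_eq_withDensity r, integrable_withDensity_iff_integrable_smul' (by fun_prop)
    (by simp)]
  have h := (integrableOn_exp_mul_complex_Ioi (a := -(r + u))
    (by simp only [Complex.neg_re, Complex.add_re, Complex.ofReal_re]; linarith) 0).const_mul (r : ℂ)
  refine h.congr (Filter.Eventually.of_forall fun s => ?_)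
  simp only
  rw [ENNReal.toReal_ofReal (by positivity), Complex.real_smul, Complex.ofReal_mul,
    Complex.ofReal_exp, mul_assoc, ← Complex.exp_add]
  congr 2
  push_cast
  ring

lemma integral_cexp_expMeasure {r : ℝ} (hr : 0 < r) {u : ℂ} (hu : 0 < r + u.re) :
    ∫ s, Complex.exp (-u * s) ∂expMeasure r = r / (r + u) := by
  have hne : (r + u : ℂ) ≠ 0 := fun h => by
    have := congrArg Complex.re h
    simp at this
    linarith
  rw [integral_expMeasure hr]
  have h := integral_exp_mul_complex_Ioi (a := -(r + u))
    (by simp only [Complex.neg_re, Complex.add_re, Complex.ofReal_re]; linarith) 0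
  simp only [Complex.ofReal_zero, mul_zero, Complex.exp_zero] at h
  calc ∫ s in Ioi (0 : ℝ), (r * Complex.exp (-(r * s))) * Complex.exp (-u * s)
      = ∫ s in Ioi (0 : ℝ), (r : ℂ) * Complex.exp (-(r + u) * s) := by
        refine integral_congr_ae (Filter.Eventually.of_forall fun s => ?_)
        simp only
        rw [mul_assoc, ← Complex.exp_add]
        congr 2
        ring
    _ = _ := by
        rw [integral_const_mul, h, neg_div_neg_eq, mul_one_div]

lemma lintegral_exp_expMeasure {r : ℝ} (hr : 0 < r) {b : ℝ} (hb : 0 < r + b) :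
    ∫⁻ s, ENNReal.ofReal (Real.exp (-b * s)) ∂expMeasure r = ENNReal.ofReal (r / (r + b)) := by
  have h1 := integrable_cexp_expMeasure hr (u := b) (by simpa using hb)
  have h2 := integral_cexp_expMeasure hr (u := b) (by simpa using hb)
  have h3 : Integrable (fun s : ℝ => Real.exp (-b * s)) (expMeasure r) := by
    refine h1.re.congr (Filter.Eventually.of_forall fun s => ?_)
    simp only [RCLike.re_to_complex]
    exact_mod_cast Complex.ofReal_re (Real.exp (-b * s))
  rw [← ofReal_integral_eq_lintegral_ofReal h3
    (Filter.Eventually.of_forall fun s => (Real.exp_pos _).le)]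
  congr 1
  have h4 : ((∫ s, Real.exp (-b * s) ∂expMeasure r : ℝ) : ℂ) = ((r / (r + b) : ℝ) : ℂ) := by
    rw [← integral_complex_ofReal]
    push_cast
    exact h2
  exact_mod_cast h4

lemma ae_pos_expMeasure (r : ℝ) : ∀ᵐ s ∂expMeasure r, 0 < s := by
  rw [expMeasure_eq_withDensity r]
  exact (withDensity_absolutelyContinuous _ _).ae_le (ae_restrict_mem measurableSet_Ioi)

lemma expMeasure_Ioi {r : ℝ} (hr : 0 < r) {T : ℝ} (hT : 0 ≤ T) :
    (expMeasure r).real (Ioi T) = Real.exp (-(r * T)) := by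
  have := isProbabilityMeasure_expMeasure hr
  have h1 := cdf_expMeasure_eq hr T
  rw [if_pos hT, cdf_eq_real] at h1
  rw [← compl_Iic, measureReal_compl measurableSet_Iic, probReal_univ, h1]
  ring

end ExponentialLaw

/-! ### Path space and the first step. -/

namespace Hier

variable {L : ℕ}

instance : DiscreteMeasurableSpace (Hier L) := ⟨fun _ => trivial⟩

instance [L.AtLeastTwo] : Countable (Hier L) := by
  have : Countable (ZMod (L ^ 4)) := Finite.to_countable
  infer_instance

section Paths

variable [L.AtLeastTwo]

instance : IsProbabilityMeasure (expMeasure (jumpRate L)) :=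
  isProbabilityMeasure_expMeasure (jumpRate_pos L)

/-- The law of a waiting time and the subsequent jump. -/
noncomputable def stepLaw (L : ℕ) [L.AtLeastTwo] : Measure (ℝ × Hier L) :=
  (expMeasure (jumpRate L)).prod (jumpLaw L).toMeasure

instance : IsProbabilityMeasure (stepLaw L) := by
  unfold stepLaw
  infer_instance

lemma pathLaw_eq : pathLaw L = Measure.infinitePi fun _ : ℕ => stepLaw L := rfl

instance : IsProbabilityMeasure (pathLaw L) := by
  rw [pathLaw_eq]
  infer_instance

/-- The path that makes the step `a` first and continues with `p`. -/
def pathCons (a : ℝ × Hier L) (p : Sample L) : Sample L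
  | 0 => a
  | i + 1 => p i

/-- The path after the first step. -/
def pathTail (p : Sample L) : Sample L := fun i => p (i + 1)

omit [L.AtLeastTwo] in
lemma pathCons_pathTail (p : Sample L) : pathCons (p 0) (pathTail p) = p := by
  funext i
  cases i <;> rfl

omit [L.AtLeastTwo] in
lemma measurable_pathTail : Measurable (pathTail (L := L)) :=
  measurable_pi_lambda _ fun i => measurable_pi_apply (i + 1)

omit [L.AtLeastTwo] in
lemma measurable_pathCons : Measurable fun q : (ℝ × Hier L) × Sample L => pathCons q.1 q.2 := by
  refine measurable_pi_lambda _ fun i => ?_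
  cases i with
  | zero => exact measurable_fst
  | succ i => exact (measurable_pi_apply i).comp measurable_snd

/-- The steps are independent and identically distributed; it suffices to compare measures of
cylinder sets. -/
lemma measurePreserving_pathCons :
    MeasurePreserving (fun q : (ℝ × Hier L) × Sample L => pathCons q.1 q.2)
      ((stepLaw L).prod (pathLaw L)) (pathLaw L) := by
  classical
  refine ⟨measurable_pathCons, ?_⟩
  rw [pathLaw_eq]
  refine Measure.eq_infinitePi _ fun s t ht => ?_
  obtain ⟨M, hM⟩ : ∃ M, s ⊆ Finset.range (M + 1) :=
    ⟨s.sup id, fun i hi => Finset.mem_range.2 (Nat.lt_succ_of_le (Finset.le_sup (f := id) hi))⟩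
  set t' : ℕ → Set (ℝ × Hier L) := fun i => if i ∈ s then t i else Set.univ with ht'
  have htm : ∀ i, MeasurableSet (t' i) := by
    intro i
    simp only [ht']
    split_ifs
    exacts [ht i, MeasurableSet.univ]
  have hprod : ∏ i ∈ s, stepLaw L (t i) = ∏ i ∈ Finset.range (M + 1), stepLaw L (t' i) := by
    rw [← Finset.prod_subset hM]
    · exact Finset.prod_congr rfl fun i hi => by simp [ht', hi]
    · intro i _ hi
      simp [ht', hi]
  rw [hprod, Measure.map_apply measurable_pathCons (MeasurableSet.pi s.countable_toSet
    fun i _ => ht i), Finset.prod_range_succ']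
  have hpre : (fun q : (ℝ × Hier L) × Sample L => pathCons q.1 q.2) ⁻¹' (Set.pi s t)
      = t' 0 ×ˢ Set.pi (Finset.range M) (fun i => t' (i + 1)) := by
    ext ⟨a, p⟩
    simp only [Set.mem_preimage, Set.mem_pi, Set.mem_prod, Finset.mem_coe, ht', Finset.mem_range]
    constructor
    · intro h
      refine ⟨?_, fun i _ => ?_⟩
      · split_ifs with h0
        exacts [h 0 h0, trivial]
      · split_ifs with h0
        exacts [h (i + 1) h0, trivial]
    · rintro ⟨h0, h1⟩ i hi
      cases i with
      | zero =>
        rw [if_pos hi] at h0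
        exact h0
      | succ i =>
        have := h1 i (by have := Finset.mem_range.1 (hM hi); omega)
        rw [if_pos hi] at this
        exact this
  rw [hpre, Measure.prod_prod, Measure.infinitePi_pi _ fun i _ => htm (i + 1), mul_comm]

/-- The product of Lebesgue measure in the time variable and the law of the paths. -/
noncomputable def timePathLaw (L : ℕ) [L.AtLeastTwo] : Measure (ℝ × Sample L) :=
  (volume : Measure ℝ).prod (pathLaw L)

instance : SigmaFinite (timePathLaw L) := by
  unfold timePathLaw
  infer_instance

/-- A first step `a` followed by the path `p` up to time `T`. -/
def firstStep (q : (ℝ × Hier L) × (ℝ × Sample L)) : ℝ × Sample L :=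
  (q.2.1 + q.1.1, pathCons q.1 q.2.2)

/-- Time ranges over all of ℝ, so that translation invariance makes the shift by the waiting time
measure preserving. The restriction to nonnegative times is left to the integrands. -/
lemma measurePreserving_firstStep :
    MeasurePreserving (firstStep (L := L)) ((stepLaw L).prod (timePathLaw L))
      (timePathLaw L) := by
  have h1 : MeasurePreserving
      (fun q : (ℝ × Hier L) × (ℝ × Sample L) => (q.1, (q.2.1 + q.1.1, q.2.2)))
      ((stepLaw L).prod (timePathLaw L)) ((stepLaw L).prod (timePathLaw L)) := by
    refine (MeasurePreserving.id (stepLaw L)).skew_product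
      (g := fun (a : ℝ × Hier L) (q : ℝ × Sample L) => (q.1 + a.1, q.2)) (by fun_prop)
      (Filter.Eventually.of_forall fun a => ?_)
    exact ((measurePreserving_add_right volume a.1).prod (MeasurePreserving.id _)).map_eq
  have h2 : MeasurePreserving
      (fun q : (ℝ × Hier L) × (ℝ × Sample L) => (q.2.1, (q.1, q.2.2)))
      ((stepLaw L).prod (timePathLaw L)) (volume.prod ((stepLaw L).prod (pathLaw L))) := by
    have e1 := (measurePreserving_prodAssoc (stepLaw L) (volume : Measure ℝ) (pathLaw L)).symm
    have e2 := (Measure.measurePreserving_swap (μ := stepLaw L) (ν := (volume : Measure ℝ))).prod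
      (MeasurePreserving.id (pathLaw L))
    have e3 := measurePreserving_prodAssoc (volume : Measure ℝ) (stepLaw L) (pathLaw L)
    exact e3.comp (e2.comp e1)
  have h3 := (MeasurePreserving.id (volume : Measure ℝ)).prod (measurePreserving_pathCons (L := L))
  exact h3.comp (h2.comp h1)

end Paths

end Hier

/-! ### Pathwise decomposition at the first jump. -/

namespace Hier

variable {L : ℕ}

section Pathwise

open Set

/-- Paths with positive waiting times and finitely many jumps in every bounded time interval. -/
structure IsRegularPath (p : Sample L) : Prop where
  pos : ∀ i, 0 < (p i).1
  unbounded : ∀ t : ℝ, ∃ n, t < ∑ i ∈ Finset.range (n + 1), (p i).1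

lemma sum_range_pathCons {M : Type*} [AddCommMonoid M] (f : ℝ × Hier L → M) (a : ℝ × Hier L)
    (p : Sample L) (n : ℕ) :
    ∑ i ∈ Finset.range (n + 1), f (pathCons a p i) = (∑ i ∈ Finset.range n, f (p i)) + f a :=
  Finset.sum_range_succ' _ _

lemma IsRegularPath.tail {p : Sample L} (hp : IsRegularPath p) : IsRegularPath (pathTail p) := by
  refine ⟨fun i => hp.pos (i + 1), fun t => ?_⟩
  obtain ⟨n, hn⟩ := hp.unbounded (t + (p 0).1)
  rw [Finset.sum_range_succ'] at hn
  refine ⟨n, ?_⟩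
  rw [Finset.sum_range_succ]
  have := hp.pos (n + 1)
  simp only [pathTail]
  linarith

lemma jumpCount_pathCons_of_lt (a : ℝ × Hier L) (p : Sample L) {t : ℝ} (h : t < a.1) :
    jumpCount (pathCons a p) t = 0 := by
  refine Nat.sInf_eq_zero.2 (Or.inl ?_)
  simpa [pathCons] using h

lemma jumpCount_pathCons_of_le (a : ℝ × Hier L) {p : Sample L} (hp : IsRegularPath p) {t : ℝ}
    (h : a.1 ≤ t) : jumpCount (pathCons a p) t = jumpCount p (t - a.1) + 1 := by
  have key : ∀ n, t < ∑ i ∈ Finset.range (n + 1 + 1), (pathCons a p i).1 ↔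
      t - a.1 < ∑ i ∈ Finset.range (n + 1), (p i).1 := fun n => by
    rw [sum_range_pathCons Prod.fst, sub_lt_iff_lt_add]
  -- The shift by one needs a nonempty set of jump numbers, since `sInf ∅ = 0`; this is what
  -- `IsRegularPath.unbounded` provides.
  have h1 : 1 ≤ sInf {n : ℕ | t < ∑ i ∈ Finset.range (n + 1), (pathCons a p i).1} := by
    rw [Nat.one_le_iff_ne_zero]
    intro h0
    rcases Nat.sInf_eq_zero.1 h0 with h0 | h0
    · have : t < a.1 := by simpa [pathCons] using h0
      linarith
    · obtain ⟨n, hn⟩ := hp.unbounded (t - a.1)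
      exact (h0 ▸ ((key n).2 hn : n + 1 ∈ {n : ℕ | t < ∑ i ∈ Finset.range (n + 1),
        (pathCons a p i).1}) : n + 1 ∈ (∅ : Set ℕ))
  have h2 := Nat.sInf_add h1
  simp only [key] at h2
  exact h2.symm

lemma position_pathCons_of_lt (a : ℝ × Hier L) (p : Sample L) {t : ℝ} (h : t < a.1) :
    position (pathCons a p) t = 0 := by
  simp [position, jumpCount_pathCons_of_lt a p h]

lemma position_pathCons_of_le (a : ℝ × Hier L) {p : Sample L} (hp : IsRegularPath p) {t : ℝ}
    (h : a.1 ≤ t) : position (pathCons a p) t = a.2 + position p (t - a.1) := by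
  rw [position, jumpCount_pathCons_of_le a hp h, sum_range_pathCons Prod.snd, add_comm, position]

lemma localTime_pathCons_of_lt (a : ℝ × Hier L) (p : Sample L) {T : ℝ} (hT : 0 ≤ T)
    (h : T < a.1) (y : Hier L) :
    localTime (pathCons a p) T y = if y = 0 then T else 0 := by
  have hset : {t : ℝ | t ∈ Icc 0 T ∧ position (pathCons a p) t = y}
      = if y = 0 then Icc 0 T else ∅ := by
    ext t
    simp only [mem_ofPred_eq]
    constructor
    · rintro ⟨ht, rfl⟩
      rw [position_pathCons_of_lt a p (ht.2.trans_lt h), if_pos rfl]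
      exact ht
    · split_ifs with hy
      · exact fun ht => ⟨ht, by rw [position_pathCons_of_lt a p (ht.2.trans_lt h), hy]⟩
      · exact fun ht => ht.elim
  rw [localTime, hset]
  split_ifs
  · simp [hT]
  · simp

lemma localTime_pathCons_of_le (a : ℝ × Hier L) {p : Sample L} (hp : IsRegularPath p)
    (ha : 0 ≤ a.1) {T : ℝ} (h : a.1 ≤ T) (y : Hier L) :
    localTime (pathCons a p) T y
      = (if y = 0 then a.1 else 0) + localTime p (T - a.1) (y - a.2) := by
  have hset : {t : ℝ | t ∈ Icc 0 T ∧ position (pathCons a p) t = y}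
      = (if y = 0 then Ico 0 a.1 else ∅) ∪ (fun t => t + a.1) ''
        {t : ℝ | t ∈ Icc 0 (T - a.1) ∧ position p t = y - a.2} := by
    ext t
    simp only [mem_ofPred_eq, mem_union, mem_image]
    constructor
    · rintro ⟨ht, rfl⟩
      rcases lt_or_ge t a.1 with hlt | hge
      · left
        rw [position_pathCons_of_lt a p hlt, if_pos rfl]
        exact ⟨ht.1, hlt⟩
      · right
        refine ⟨t - a.1, ⟨⟨by linarith, by linarith [ht.2]⟩, ?_⟩, by ring⟩
        rw [position_pathCons_of_le a hp hge]
        abel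
    · rintro (ht | ⟨t, ⟨ht, hpos⟩, rfl⟩)
      · split_ifs at ht with hy
        · exact ⟨⟨ht.1, by linarith [ht.2]⟩, by rw [position_pathCons_of_lt a p ht.2, hy]⟩
        · exact ht.elim
      · refine ⟨⟨by linarith [ht.1], by linarith [ht.2]⟩, ?_⟩
        rw [position_pathCons_of_le a hp (by linarith [ht.1]), add_sub_cancel_right, hpos]
        abel
  have hmeas : MeasurableSet (if y = 0 then Ico 0 a.1 else ∅) := by
    split_ifs
    exacts [measurableSet_Ico, MeasurableSet.empty]
  have hdisj : Disjoint (if y = 0 then Ico 0 a.1 else ∅) ((fun t => t + a.1) ''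
        {t : ℝ | t ∈ Icc 0 (T - a.1) ∧ position p t = y - a.2}) := by
    rw [Set.disjoint_left]
    rintro t ht ⟨t', ⟨ht', -⟩, rfl⟩
    split_ifs at ht
    · linarith [ht.2, ht'.1]
    · exact ht
  have hfin : volume {t : ℝ | t ∈ Icc 0 (T - a.1) ∧ position p t = y - a.2} ≠ ⊤ :=
    measure_ne_top_of_subset (fun t ht => ht.1) measure_Icc_lt_top.ne
  have himg : volume ((fun t => t + a.1) ''
      {t : ℝ | t ∈ Icc 0 (T - a.1) ∧ position p t = y - a.2})
      = volume {t : ℝ | t ∈ Icc 0 (T - a.1) ∧ position p t = y - a.2} := by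
    rw [image_add_right, measure_preimage_add_right]
  rw [localTime, hset, measureReal_union' hdisj hmeas (by split_ifs <;> simp) (by rwa [himg]),
    localTime]
  congr 1
  · split_ifs
    · simp [ha]
    · simp
  · rw [measureReal_def, himg, measureReal_def]

/-- The contribution `1_{ω(T) = x} e^{-β T - ∑ w_y τ_y}` of a path that starts at `x₀` and stays
in the ball up to time `T`. -/
noncomputable def pathWeight [L.AtLeastTwo] (N : ℕ) (x : Hier L) (β : ℂ) (w : Hier L → ℂ)
    (x₀ : Hier L) (T : ℝ) (p : Sample L) : ℂ :=
  open Classical in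
  if (∀ t ∈ Icc (0 : ℝ) T, x₀ + position p t ∈ ball L N) ∧ x₀ + position p T = x then
    Complex.exp (-β * T - ∑ y : ball L N, w y * localTime p T (y - x₀))
  else 0

/-- The part of `pathWeight` with exactly `k` jumps, by recursion over the first jump. -/
noncomputable def stepWeight (N : ℕ) (x : Hier L) (u : Hier L → ℂ) :
    ℕ → Hier L → ℝ → Sample L → ℂ
  | 0, x₀, T, p => open Classical in
    if 0 ≤ T ∧ T < (p 0).1 ∧ x₀ = x then Complex.exp (-u x₀ * T) else 0
  | k + 1, x₀, T, p => open Classical in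
    if x₀ ∈ ball L N ∧ 0 ≤ (p 0).1 then
      Complex.exp (-u x₀ * (p 0).1) *
        stepWeight N x u k (x₀ + (p 0).2) (T - (p 0).1) (pathTail p)
    else 0

lemma stepWeight_of_neg (N : ℕ) (x : Hier L) (u : Hier L → ℂ) (k : ℕ) (x₀ : Hier L) {T : ℝ}
    (hT : T < 0) (p : Sample L) : stepWeight N x u k x₀ T p = 0 := by
  induction k generalizing x₀ T p with
  | zero => rw [stepWeight, if_neg fun h => absurd h.1 (not_le.2 hT)]
  | succ k ih =>
    rw [stepWeight]
    split_ifs with h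
    · rw [ih _ (by linarith [h.2]), mul_zero]
    · rfl

/-- A wrong `k` leads either to a negative remaining time or to one that is not smaller than the
next waiting time. Hence a sum over `k` has a single term on each regular path. -/
lemma stepWeight_of_ne_jumpCount (N : ℕ) (x : Hier L) (u : Hier L → ℂ) {k : ℕ} (x₀ : Hier L)
    {T : ℝ} {p : Sample L} (hp : IsRegularPath p) (hk : jumpCount p T ≠ k) :
    stepWeight N x u k x₀ T p = 0 := by
  induction k generalizing x₀ T p with
  | zero =>
    rw [stepWeight, if_neg]
    rintro ⟨-, h, -⟩
    refine hk ?_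
    rw [← pathCons_pathTail p]
    exact jumpCount_pathCons_of_lt _ _ h
  | succ k ih =>
    rw [stepWeight]
    split_ifs with h
    · rcases lt_or_ge T (p 0).1 with hlt | hge
      · rw [stepWeight_of_neg _ _ _ _ _ (by linarith), mul_zero]
      · rw [ih _ hp.tail, mul_zero]
        intro h'
        refine hk ?_
        rw [← pathCons_pathTail p, jumpCount_pathCons_of_le _ hp.tail hge, h']
    · rfl

/-- Until the first jump local time accumulates at `x₀` only; afterwards the path starts afresh from
the point it has jumped to, with the remaining time. -/
lemma pathWeight_eq_stepWeight [L.AtLeastTwo] {N : ℕ} {x : Hier L} (hx : x ∈ ball L N) (β : ℂ)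
    (w : Hier L → ℂ) (x₀ : Hier L) {T : ℝ} (hT : 0 ≤ T) {p : Sample L} (hp : IsRegularPath p) :
    pathWeight N x β w x₀ T p
      = stepWeight N x (fun y => β + w y) (jumpCount p T) x₀ T p := by
  obtain ⟨k, hk⟩ : ∃ k, jumpCount p T = k := ⟨_, rfl⟩
  induction k generalizing x₀ T p with
  | zero =>
    have hlt : T < (p 0).1 := by
      by_contra hge
      rw [← pathCons_pathTail p, jumpCount_pathCons_of_le _ hp.tail (not_lt.1 hge)] at hk
      omega
    have hpos : ∀ t ∈ Icc 0 T, position p t = 0 := fun t ht => by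
      rw [← pathCons_pathTail p]
      exact position_pathCons_of_lt _ _ (ht.2.trans_lt hlt)
    have hloc : ∀ y, localTime p T y = if y = 0 then T else 0 := fun y => by
      rw [← pathCons_pathTail p]
      exact localTime_pathCons_of_lt _ _ hT hlt y
    rw [hk, stepWeight, pathWeight, hpos T ⟨hT, le_rfl⟩, add_zero]
    by_cases hx0 : x₀ = x
    · subst hx0
      rw [if_pos ⟨fun t ht => by rwa [hpos t ht, add_zero], rfl⟩, if_pos ⟨hT, hlt, rfl⟩]
      congr 1
      have : ∑ y : ball L N, w y * (localTime p T (y - x₀) : ℂ) = w x₀ * T := by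
        rw [Finset.sum_eq_single (⟨x₀, hx⟩ : ball L N)]
        · simp [hloc]
        · intro y _ hy
          rw [hloc, if_neg, Complex.ofReal_zero, mul_zero]
          intro h
          exact hy (Subtype.ext (sub_eq_zero.1 h))
        · simp
      rw [this]
      ring
    · rw [if_neg fun h => hx0 h.2, if_neg fun h => hx0 h.2.2]
  | succ k ih =>
    have hge : (p 0).1 ≤ T := by
      by_contra hlt
      rw [← pathCons_pathTail p, jumpCount_pathCons_of_lt _ _ (not_le.1 hlt)] at hk
      omega
    have hk' : jumpCount (pathTail p) (T - (p 0).1) = k := by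
      rw [← pathCons_pathTail p, jumpCount_pathCons_of_le _ hp.tail hge,
        Nat.add_right_cancel_iff] at hk
      exact hk
    have hpos : ∀ t, (p 0).1 ≤ t → position p t = (p 0).2 + position (pathTail p) (t - (p 0).1) :=
      fun t ht => by
        conv_lhs => rw [← pathCons_pathTail p]
        exact position_pathCons_of_le _ hp.tail ht
    have hpos0 : ∀ t, t < (p 0).1 → position p t = 0 := fun t ht => by
      rw [← pathCons_pathTail p]
      exact position_pathCons_of_lt _ _ ht
    have hloc : ∀ y, localTime p T y
        = (if y = 0 then (p 0).1 else 0) + localTime (pathTail p) (T - (p 0).1) (y - (p 0).2) :=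
      fun y => by
        conv_lhs => rw [← pathCons_pathTail p]
        exact localTime_pathCons_of_le _ hp.tail (hp.pos 0).le hge y
    rw [hk, stepWeight, ← hk', ← ih _ (sub_nonneg.2 hge) hp.tail hk']
    have hiff : ((∀ t ∈ Icc 0 T, x₀ + position p t ∈ ball L N) ∧ x₀ + position p T = x) ↔
        x₀ ∈ ball L N ∧ (∀ t ∈ Icc 0 (T - (p 0).1),
          x₀ + (p 0).2 + position (pathTail p) t ∈ ball L N) ∧
          x₀ + (p 0).2 + position (pathTail p) (T - (p 0).1) = x := by
      rw [hpos T hge, add_assoc x₀]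
      constructor
      · rintro ⟨h1, h2⟩
        refine ⟨?_, fun t ht => ?_, h2⟩
        · simpa [hpos0 0 (hp.pos 0)] using h1 0 ⟨le_rfl, hT⟩
        · have := h1 (t + (p 0).1) ⟨by linarith [ht.1, hp.pos 0], by linarith [ht.2]⟩
          rwa [hpos _ (by linarith [ht.1]), add_sub_cancel_right, ← add_assoc] at this
      · rintro ⟨h0, h1, h2⟩
        refine ⟨fun t ht => ?_, h2⟩
        rcases lt_or_ge t (p 0).1 with h | h
        · rwa [hpos0 t h, add_zero]
        · rw [hpos t h, ← add_assoc]
          exact h1 _ ⟨by linarith, by linarith [ht.2]⟩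
    by_cases h0 : x₀ ∈ ball L N
    · rw [if_pos ⟨h0, (hp.pos 0).le⟩, pathWeight, pathWeight]
      by_cases h1 : (∀ t ∈ Icc 0 (T - (p 0).1),
          x₀ + (p 0).2 + position (pathTail p) t ∈ ball L N) ∧
          x₀ + (p 0).2 + position (pathTail p) (T - (p 0).1) = x
      · rw [if_pos (hiff.2 ⟨h0, h1⟩), if_pos h1, ← Complex.exp_add]
        congr 1
        have : ∑ y : ball L N, w y * (localTime p T (y - x₀) : ℂ) = w x₀ * (p 0).1 +
            ∑ y : ball L N, w y * (localTime (pathTail p) (T - (p 0).1)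
              (y - (x₀ + (p 0).2)) : ℂ) := by
          simp only [hloc, Complex.ofReal_add, mul_add, Finset.sum_add_distrib, sub_sub]
          congr 1
          rw [Finset.sum_eq_single (⟨x₀, h0⟩ : ball L N)]
          · simp
          · intro y _ hy
            rw [if_neg, Complex.ofReal_zero, mul_zero]
            intro h
            exact hy (Subtype.ext (sub_eq_zero.1 h))
          · simp
        rw [this]
        push_cast
        ring
      · rw [if_neg fun h => h1 (hiff.1 h).2, if_neg h1, mul_zero]
    · rw [if_neg fun h => h0 h.1, pathWeight, if_neg fun h => h0 (hiff.1 h).1]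

end Pathwise

end Hier

/-! ### Almost sure regularity of paths and measurability of the weights. -/

namespace Hier

variable {L : ℕ} [L.AtLeastTwo]

section RandomPaths

open Set

lemma lintegral_prod_exp_neg_waiting (n : ℕ) :
    ∫⁻ p, ∏ i ∈ Finset.range n, ENNReal.ofReal (Real.exp (-(p i).1)) ∂pathLaw L
      = ENNReal.ofReal (jumpRate L / (jumpRate L + 1)) ^ n := by
  induction n with
  | zero => simp
  | succ n ih =>
    have h1 := measurePreserving_pathCons (L := L)
    have hm : ∀ n, Measurable fun p : Sample L =>
        ∏ i ∈ Finset.range n, ENNReal.ofReal (Real.exp (-(p i).1)) := by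
      intro n
      fun_prop
    rw [← h1.lintegral_comp (hm (n + 1))]
    simp only [Finset.prod_range_succ', pathCons]
    have h2 : ∫⁻ a, ENNReal.ofReal (Real.exp (-a.1)) ∂stepLaw L
        = ENNReal.ofReal (jumpRate L / (jumpRate L + 1)) := by
      rw [stepLaw, lintegral_prod _ (by fun_prop)]
      simp only [lintegral_const, measure_univ, mul_one]
      rw [← lintegral_exp_expMeasure (jumpRate_pos L) (b := 1) (by linarith [jumpRate_pos L])]
      simp
    rw [lintegral_prod _ (by fun_prop)]
    simp only [lintegral_mul_const' _ _ ENNReal.ofReal_ne_top, ih]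
    rw [lintegral_const_mul _ (by fun_prop), h2, pow_succ]

/-- The expectation of e^{-(s_1+…+s_n)} is θⁿ with θ = r / (r + 1) < 1. So the infimum over n of
these exponentials vanishes almost surely, which says that the jump times are unbounded. -/
lemma ae_isRegularPath : ∀ᵐ p ∂pathLaw L, IsRegularPath p := by
  have hpos : ∀ᵐ p ∂pathLaw L, ∀ i, 0 < (p i).1 := by
    rw [ae_all_iff]
    intro i
    have h1 : MeasurePreserving (fun p : Sample L => p i) (pathLaw L) (stepLaw L) :=
      measurePreserving_eval_infinitePi _ i
    have h2 : MeasurePreserving (Prod.fst : ℝ × Hier L → ℝ) (stepLaw L)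
      (expMeasure (jumpRate L)) := measurePreserving_fst
    exact (h2.comp h1).quasiMeasurePreserving.ae (ae_pos_expMeasure _)
  have hr := jumpRate_pos L
  have hθ : ENNReal.ofReal (jumpRate L / (jumpRate L + 1)) < 1 := by
    rw [ENNReal.ofReal_lt_one, div_lt_one (by linarith)]
    linarith
  have hinf : ∀ᵐ p ∂pathLaw L,
      ⨅ n, ∏ i ∈ Finset.range n, ENNReal.ofReal (Real.exp (-(p i).1)) = 0 := by
    have hm : Measurable fun p : Sample L =>
        ⨅ n, ∏ i ∈ Finset.range n, ENNReal.ofReal (Real.exp (-(p i).1)) :=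
      Measurable.iInf fun n => by fun_prop
    refine (lintegral_eq_zero_iff hm).1 (le_antisymm ?_ bot_le)
    refine ge_of_tendsto' (ENNReal.tendsto_pow_atTop_nhds_zero_of_lt_one hθ) fun n => ?_
    rw [← lintegral_prod_exp_neg_waiting]
    exact lintegral_mono fun p => iInf_le _ n
  filter_upwards [hpos, hinf] with p hp hp'
  refine ⟨hp, fun t => ?_⟩
  have h1 : ⨅ n, ∏ i ∈ Finset.range n, ENNReal.ofReal (Real.exp (-(p i).1))
      < ENNReal.ofReal (Real.exp (-t)) := by
    rw [hp']
    exact ENNReal.ofReal_pos.2 (Real.exp_pos _)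
  obtain ⟨n, hn⟩ := iInf_lt_iff.1 h1
  refine ⟨n, ?_⟩
  rw [← ENNReal.ofReal_prod_of_nonneg fun i _ => (Real.exp_pos _).le, ← Real.exp_sum,
    ENNReal.ofReal_lt_ofReal_iff (Real.exp_pos _), Real.exp_lt_exp, Finset.sum_neg_distrib,
    neg_lt_neg_iff] at hn
  rw [Finset.sum_range_succ]
  linarith [hp n]

omit [L.AtLeastTwo] in
lemma stepWeight_firstStep (N : ℕ) (x : Hier L) (u : Hier L → ℂ) (k : ℕ) (x₀ : Hier L)
    (q : (ℝ × Hier L) × (ℝ × Sample L)) :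
    stepWeight N x u (k + 1) x₀ (firstStep q).1 (firstStep q).2 =
      open Classical in if x₀ ∈ ball L N ∧ 0 ≤ q.1.1 then
        Complex.exp (-u x₀ * q.1.1) * stepWeight N x u k (x₀ + q.1.2) q.2.1 q.2.2 else 0 := by
  have e : (firstStep q).1 - ((firstStep q).2 0).1 = q.2.1 := add_sub_cancel_right _ _
  by_cases h : x₀ ∈ ball L N ∧ 0 ≤ q.1.1
  · have h' : x₀ ∈ ball L N ∧ 0 ≤ ((firstStep q).2 0).1 := h
    rw [stepWeight, if_pos h', if_pos h, e]
    rfl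
  · have h' : ¬(x₀ ∈ ball L N ∧ 0 ≤ ((firstStep q).2 0).1) := h
    rw [stepWeight, if_neg h', if_neg h]

/-- The recursion makes joint measurability in parameters, time, path and starting point accessible,
and spares a direct treatment of local times as functions of the path. -/
lemma measurable_stepWeight {P : Type*} [MeasurableSpace P] (N : ℕ) (x : Hier L)
    {u : P → Hier L → ℂ} (hu : ∀ y, Measurable fun o => u o y) (k : ℕ) :
    Measurable fun q : (P × (ℝ × Sample L)) × Hier L =>
      stepWeight N x (u q.1.1) k q.2 q.1.2.1 q.1.2.2 := by
  induction k with
  | zero =>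
    refine measurable_from_prod_countable_left fun y => ?_
    simp only [stepWeight]
    refine Measurable.ite ?_ ?_ measurable_const
    · have h1 : MeasurableSet {q : P × (ℝ × Sample L) | 0 ≤ q.2.1} :=
        measurableSet_le measurable_const (by fun_prop)
      have h2 : MeasurableSet {q : P × (ℝ × Sample L) | q.2.1 < (q.2.2 0).1} :=
        measurableSet_lt (by fun_prop) (by fun_prop)
      exact h1.inter (h2.inter (MeasurableSet.const _))
    · have h1 : Measurable fun q : P × (ℝ × Sample L) => u q.1 y := (hu y).comp measurable_fst
      fun_prop
  | succ k ih =>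
    refine measurable_from_prod_countable_left fun y => ?_
    simp only [stepWeight]
    refine Measurable.ite ?_ ?_ measurable_const
    · have h1 : MeasurableSet {q : P × (ℝ × Sample L) | 0 ≤ (q.2.2 0).1} :=
        measurableSet_le measurable_const (by fun_prop)
      exact (MeasurableSet.const _).inter h1
    · have h1 : Measurable fun q : P × (ℝ × Sample L) => u q.1 y := (hu y).comp measurable_fst
      refine Measurable.mul (by fun_prop) ?_
      have h2 : Measurable fun q : P × (ℝ × Sample L) =>
          ((q.1, (q.2.1 - (q.2.2 0).1, pathTail q.2.2)), y + (q.2.2 0).2) := by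
        refine Measurable.prodMk (Measurable.prodMk measurable_fst (Measurable.prodMk (by fun_prop)
          (measurable_pathTail.comp (by fun_prop)))) ?_
        exact (measurable_of_countable fun z => y + z).comp
          (measurable_snd.comp ((measurable_pi_apply 0).comp (by fun_prop)))
      exact ih.comp h2

lemma measurable_stepWeight_right (N : ℕ) (x : Hier L) (u : Hier L → ℂ) (k : ℕ) (x₀ : Hier L) :
    Measurable fun q : ℝ × Sample L => stepWeight N x u k x₀ q.1 q.2 :=
  (measurable_stepWeight (P := Unit) N x (u := fun _ => u) (fun _ => measurable_const) k).comp
    (f := fun q : ℝ × Sample L => (((), q), x₀)) (by fun_prop)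

end RandomPaths

end Hier

/-! ### Bounds for the expansion in the number of jumps. -/

namespace Hier

variable {L : ℕ} [L.AtLeastTwo]

section Resolvent

open Set

lemma pathLaw_first_gt {T : ℝ} (hT : 0 ≤ T) :
    pathLaw L {p | T < (p 0).1} = ENNReal.ofReal (Real.exp (-(jumpRate L * T))) := by
  have h1 : MeasurePreserving (fun p : Sample L => p 0) (pathLaw L) (stepLaw L) :=
    measurePreserving_eval_infinitePi _ 0
  have h2 : MeasurePreserving (Prod.fst : ℝ × Hier L → ℝ) (stepLaw L)
    (expMeasure (jumpRate L)) := measurePreserving_fst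
  have h3 := (h2.comp h1).measure_preimage (s := Ioi T) measurableSet_Ioi.nullMeasurableSet
  rw [← expMeasure_Ioi (jumpRate_pos L) hT, ofReal_measureReal, ← h3]
  rfl

lemma add_mem_ball_sum {M : Type*} [AddCommMonoid M] {N : ℕ} {f : Hier L → M}
    (hf : ∀ y, y ∉ ball L N → f y = 0) (x₀ z : Hier L) :
    f (x₀ + z) = ∑ y : ball L N, ({y.1 - x₀} : Set (Hier L)).indicator (fun _ => f y) z := by
  classical
  have h : ∀ y : ball L N, ({y.1 - x₀} : Set (Hier L)).indicator (fun _ => f y) z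
      = if x₀ + z = y then f (x₀ + z) else 0 := by
    intro y
    by_cases hy : x₀ + z = y
    · rw [if_pos hy, indicator_of_mem (by simp [← hy]), hy]
    · rw [if_neg hy, indicator_of_notMem]
      rintro rfl
      exact hy (by abel)
  simp only [h]
  by_cases hz : x₀ + z ∈ ball L N
  · rw [Finset.sum_eq_single (⟨x₀ + z, hz⟩ : ball L N)]
    · simp
    · intro y _ hy
      rw [if_neg fun h => hy (Subtype.ext h.symm)]
    · simp
  · rw [hf _ hz]
    simp

lemma integral_jumpLaw {N : ℕ} {f : Hier L → ℂ} (hf : ∀ y, y ∉ ball L N → f y = 0)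
    (x₀ : Hier L) :
    (jumpRate L : ℂ) * ∫ z, f (x₀ + z) ∂(jumpLaw L).toMeasure
      = ∑ y : ball L N, (rate (y.1 - x₀) : ℂ) * f y := by
  simp only [add_mem_ball_sum hf x₀]
  rw [integral_finsetSum _ fun y _ => (integrable_const _).indicator (measurableSet_singleton _),
    Finset.mul_sum]
  refine Finset.sum_congr rfl fun y _ => ?_
  rw [integral_indicator_const _ (measurableSet_singleton _), measureReal_def,
    PMF.toMeasure_apply_singleton _ _ (measurableSet_singleton _), rate, Complex.real_smul]
  push_cast
  ring

/-- From any point of the ball, a jump stays inside with probability 1 - L^{-2N}, by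
`sum_rate_ball`. -/
lemma lintegral_jumpLaw_le {N : ℕ} {f : Hier L → ENNReal} (hf : ∀ y, y ∉ ball L N → f y = 0)
    {c : ENNReal} (hc : ∀ y, f y ≤ c) {x₀ : Hier L} (hx₀ : x₀ ∈ ball L N) :
    ∫⁻ z, f (x₀ + z) ∂(jumpLaw L).toMeasure
      ≤ ENNReal.ofReal (1 - ((L : ℝ) ^ (2 * N))⁻¹) * c := by
  simp only [add_mem_ball_sum hf x₀]
  rw [lintegral_finsetSum _ fun y _ => measurable_of_countable _]
  calc ∑ y : ball L N, ∫⁻ z, ({y.1 - x₀} : Set (Hier L)).indicator (fun _ => f y) z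
        ∂(jumpLaw L).toMeasure
      ≤ ∑ y : ball L N, jumpLaw L (y.1 - x₀) * c := by
        refine Finset.sum_le_sum fun y _ => ?_
        rw [lintegral_indicator_const (measurableSet_singleton _),
          PMF.toMeasure_apply_singleton _ _ (measurableSet_singleton _), mul_comm]
        exact mul_le_mul_right (hc y) _
    _ = _ := by
        rw [← Finset.sum_mul]
        congr 1
        have h := sum_rate_ball N ⟨x₀, hx₀⟩
        simp only [rate, ← Finset.mul_sum] at h
        rw [← mul_left_cancel₀ (jumpRate_pos L).ne' h, ENNReal.ofReal_sum_of_nonneg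
          fun _ _ => ENNReal.toReal_nonneg]
        exact Finset.sum_congr rfl fun y _ =>
          (ENNReal.ofReal_toReal (PMF.apply_ne_top _ _)).symm

omit [L.AtLeastTwo] in
lemma stepWeight_of_notMem {N : ℕ} {x : Hier L} (hx : x ∈ ball L N) (u : Hier L → ℂ) (k : ℕ)
    {x₀ : Hier L} (hx₀ : x₀ ∉ ball L N) (T : ℝ) (p : Sample L) :
    stepWeight N x u k x₀ T p = 0 := by
  cases k with
  | zero => rw [stepWeight, if_neg (by rintro ⟨-, -, rfl⟩; exact hx₀ hx)]
  | succ k => rw [stepWeight, if_neg (by rintro ⟨h, -⟩; exact hx₀ h)]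

/-- The contraction factor of a jump inside the ball. -/
noncomputable def jumpFactor (L N : ℕ) (b : ℝ) : ℝ :=
  jumpRate L / (jumpRate L + b) * (1 - ((L : ℝ) ^ (2 * N))⁻¹)

lemma jumpRate_add_pos {N : ℕ} {b : ℝ} (hb : 0 < b + jumpRate L * ((L : ℝ) ^ (2 * N))⁻¹) :
    0 < jumpRate L + b := by
  have h1 : ((L : ℝ) ^ (2 * N))⁻¹ ≤ 1 := inv_le_one_of_one_le₀ (one_le_pow₀ (one_lt_cast L).le)
  nlinarith [jumpRate_pos L]

lemma one_sub_inv_nonneg (L N : ℕ) [L.AtLeastTwo] : 0 ≤ 1 - ((L : ℝ) ^ (2 * N))⁻¹ :=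
  sub_nonneg.2 (inv_le_one_of_one_le₀ (one_le_pow₀ (one_lt_cast L).le))

lemma jumpFactor_nonneg {N : ℕ} {b : ℝ} (hb : 0 < b + jumpRate L * ((L : ℝ) ^ (2 * N))⁻¹) :
    0 ≤ jumpFactor L N b :=
  mul_nonneg (div_nonneg (jumpRate_pos L).le (jumpRate_add_pos hb).le) (one_sub_inv_nonneg L N)

/-- Cleared of its denominator this is r (1 - L^{-2N}) < r + b, that is, `hb`. -/
lemma jumpFactor_lt_one {N : ℕ} {b : ℝ} (hb : 0 < b + jumpRate L * ((L : ℝ) ^ (2 * N))⁻¹) :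
    jumpFactor L N b < 1 := by
  have h := jumpRate_add_pos hb
  rw [jumpFactor, div_mul_eq_mul_div, div_lt_one h]
  linarith

lemma enorm_cexp_neg_mul_le {u : ℂ} {b s : ℝ} (hu : b ≤ u.re) (hs : 0 ≤ s) :
    ‖Complex.exp (-u * s)‖ₑ ≤ ENNReal.ofReal (Real.exp (-b * s)) := by
  rw [← ofReal_norm, Complex.norm_exp]
  refine ENNReal.ofReal_le_ofReal (Real.exp_le_exp.2 ?_)
  simp only [Complex.re_mul_ofReal, Complex.neg_re]
  nlinarith

lemma lintegral_enorm_stepWeight_zero_le (N : ℕ) (x : Hier L) {u : Hier L → ℂ} {b : ℝ}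
    (hb : 0 < jumpRate L + b) (x₀ : Hier L) (hu : b ≤ (u x₀).re) :
    ∫⁻ q, ‖stepWeight N x u 0 x₀ q.1 q.2‖ₑ ∂timePathLaw L
      ≤ ENNReal.ofReal (jumpRate L + b)⁻¹ := by
  have hr := jumpRate_pos L
  rw [timePathLaw, lintegral_prod _ (measurable_stepWeight_right N x u 0 x₀).enorm.aemeasurable]
  have hpt : ∀ T : ℝ, ∫⁻ p, ‖stepWeight N x u 0 x₀ T p‖ₑ ∂pathLaw L
      ≤ (Ici (0 : ℝ)).indicator (fun T => ENNReal.ofReal (Real.exp (-b * T)) *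
        ENNReal.ofReal (Real.exp (-(jumpRate L * T)))) T := by
    intro T
    by_cases hT : 0 ≤ T
    · rw [indicator_of_mem (by exact hT), ← pathLaw_first_gt hT,
        ← lintegral_indicator_const (measurableSet_lt measurable_const (by fun_prop))]
      refine lintegral_mono fun p => ?_
      simp only [stepWeight]
      split_ifs with h
      · rw [indicator_of_mem (by exact h.2.1)]
        exact enorm_cexp_neg_mul_le hu hT
      · simp
    · rw [indicator_of_notMem (by exact hT)]
      simp [stepWeight, hT]
  refine (lintegral_mono hpt).trans ?_
  rw [lintegral_indicator measurableSet_Ici, setLIntegral_congr Ioi_ae_eq_Ici.symm]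
  have h := lintegral_exp_expMeasure hr hb
  rw [expMeasure_eq_withDensity, lintegral_withDensity_eq_lintegral_mul _ (by fun_prop)
    (by fun_prop)] at h
  have h2 : ENNReal.ofReal (jumpRate L) * ∫⁻ T in Ioi (0 : ℝ), ENNReal.ofReal (Real.exp (-b * T)) *
        ENNReal.ofReal (Real.exp (-(jumpRate L * T)))
      = ENNReal.ofReal (jumpRate L) * ENNReal.ofReal (jumpRate L + b)⁻¹ := by
    rw [← ENNReal.ofReal_mul hr.le, ← div_eq_mul_inv, ← h, ← lintegral_const_mul _ (by fun_prop)]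
    refine lintegral_congr fun T => ?_
    simp only [Pi.mul_apply]
    rw [ENNReal.ofReal_mul hr.le]
    ring
  exact ((ENNReal.mul_right_inj (ENNReal.ofReal_pos.2 hr).ne' ENNReal.ofReal_ne_top).1 h2).le

/-- Each jump costs r / (r + b) for the waiting time and 1 - L^{-2N} for staying inside the ball;
the final stay contributes (r + b)⁻¹. -/
lemma lintegral_enorm_stepWeight_le {N : ℕ} {x : Hier L} (hx : x ∈ ball L N) {u : Hier L → ℂ}
    {b : ℝ} (hb : 0 < b + jumpRate L * ((L : ℝ) ^ (2 * N))⁻¹)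
    (hu : ∀ y ∈ ball L N, b ≤ (u y).re) (k : ℕ) (x₀ : Hier L) :
    ∫⁻ q, ‖stepWeight N x u k x₀ q.1 q.2‖ₑ ∂timePathLaw L
      ≤ ENNReal.ofReal ((jumpRate L + b)⁻¹ * jumpFactor L N b ^ k) := by
  have hr := jumpRate_add_pos hb
  by_cases hx₀ : x₀ ∈ ball L N
  swap
  · simp [stepWeight_of_notMem hx u k hx₀]
  induction k generalizing x₀ with
  | zero =>
    rw [pow_zero, mul_one]
    exact lintegral_enorm_stepWeight_zero_le N x hr x₀ (hu x₀ hx₀)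
  | succ k ih =>
    have hm := fun k y => (measurable_stepWeight_right N x u k y).enorm
    have hc := (hm (k + 1) x₀).comp (measurePreserving_firstStep (L := L)).measurable
    simp only [Function.comp_def] at hc
    rw [← measurePreserving_firstStep.lintegral_comp (hm _ x₀), lintegral_prod _ hc.aemeasurable]
    set E : Hier L → ENNReal := fun y =>
      ∫⁻ q, ‖stepWeight N x u k y q.1 q.2‖ₑ ∂timePathLaw L with hE
    have h1 : ∀ a : ℝ × Hier L, ∫⁻ q, ‖stepWeight N x u (k + 1) x₀ (firstStep (a, q)).1
        (firstStep (a, q)).2‖ₑ ∂timePathLaw L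
        ≤ ENNReal.ofReal (Real.exp (-b * a.1)) * E (x₀ + a.2) := by
      intro a
      simp only [stepWeight_firstStep]
      by_cases h : x₀ ∈ ball L N ∧ 0 ≤ a.1
      · simp only [if_pos h, enorm_mul]
        rw [lintegral_const_mul _ (hm k _)]
        exact mul_le_mul_left (enorm_cexp_neg_mul_le (hu x₀ h.1) h.2) _
      · simp only [if_neg h, enorm_zero, lintegral_zero, zero_le]
    refine (lintegral_mono h1).trans ?_
    rw [stepLaw, lintegral_prod_mul (f := fun s : ℝ => ENNReal.ofReal (Real.exp (-b * s)))
      (g := fun z => E (x₀ + z)) (by fun_prop) (measurable_of_countable _).aemeasurable,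
      lintegral_exp_expMeasure (jumpRate_pos L) hr]
    have h2 := lintegral_jumpLaw_le (f := E) (N := N)
      (fun y hy => by simp [hE, stepWeight_of_notMem hx u k hy])
      (c := ENNReal.ofReal ((jumpRate L + b)⁻¹ * jumpFactor L N b ^ k)) (fun y => by
        by_cases hy : y ∈ ball L N
        · exact ih y hy
        · simp [hE, stepWeight_of_notMem hx u k hy]) hx₀
    refine (mul_le_mul_right h2 _).trans (le_of_eq ?_)
    rw [← ENNReal.ofReal_mul (one_sub_inv_nonneg L N), ← ENNReal.ofReal_mul (div_nonneg
      (jumpRate_pos L).le hr.le)]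
    congr 1
    rw [pow_succ, jumpFactor]
    ring

lemma integrable_stepWeight {N : ℕ} {x : Hier L} (hx : x ∈ ball L N) {u : Hier L → ℂ}
    {b : ℝ} (hb : 0 < b + jumpRate L * ((L : ℝ) ^ (2 * N))⁻¹)
    (hu : ∀ y ∈ ball L N, b ≤ (u y).re) (k : ℕ) (x₀ : Hier L) :
    Integrable (fun q => stepWeight N x u k x₀ q.1 q.2) (timePathLaw L) :=
  ⟨(measurable_stepWeight_right N x u k x₀).aestronglyMeasurable,
    (lintegral_enorm_stepWeight_le hx hb hu k x₀).trans_lt ENNReal.ofReal_lt_top⟩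

lemma integral_norm_stepWeight_le {N : ℕ} {x : Hier L} (hx : x ∈ ball L N) {u : Hier L → ℂ}
    {b : ℝ} (hb : 0 < b + jumpRate L * ((L : ℝ) ^ (2 * N))⁻¹)
    (hu : ∀ y ∈ ball L N, b ≤ (u y).re) (k : ℕ) (x₀ : Hier L) :
    ∫ q, ‖stepWeight N x u k x₀ q.1 q.2‖ ∂timePathLaw L
      ≤ (jumpRate L + b)⁻¹ * jumpFactor L N b ^ k := by
  rw [integral_norm_eq_lintegral_enorm
    (measurable_stepWeight_right N x u k x₀).aestronglyMeasurable]
  exact ENNReal.toReal_le_of_le_ofReal (mul_nonneg (inv_nonneg.2 (jumpRate_add_pos hb).le)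
    (pow_nonneg (jumpFactor_nonneg hb) k)) (lintegral_enorm_stepWeight_le hx hb hu k x₀)

end Resolvent

end Hier

/-! ### The resolvent of the killed process. -/

namespace Hier

variable {L : ℕ} [L.AtLeastTwo]

section Resolvent

open Set

lemma integral_stepWeight_zero {N : ℕ} {x : Hier L} {u : Hier L → ℂ} {x₀ : Hier L}
    (hi : Integrable (fun q => stepWeight N x u 0 x₀ q.1 q.2) (timePathLaw L))
    (hu : 0 < jumpRate L + (u x₀).re) :
    (jumpRate L + u x₀) * ∫ q, stepWeight N x u 0 x₀ q.1 q.2 ∂timePathLaw L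
      = open Classical in if x₀ = x then 1 else 0 := by
  classical
  have hr := jumpRate_pos L
  have hne : (jumpRate L + u x₀ : ℂ) ≠ 0 := fun h => by
    have := congrArg Complex.re h
    simp at this
    linarith
  by_cases hx : x₀ = x
  swap
  · simp [stepWeight, hx]
  rw [if_pos hx, timePathLaw, integral_prod _ hi]
  have hpt : ∀ T : ℝ, ∫ p, stepWeight N x u 0 x₀ T p ∂pathLaw L
      = (Ici (0 : ℝ)).indicator (fun T : ℝ => Complex.exp (-(jumpRate L * T)) *
        Complex.exp (-u x₀ * T)) T := by
    intro T
    by_cases hT : 0 ≤ T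
    · rw [indicator_of_mem (by exact hT)]
      have h1 : ∀ p : Sample L, stepWeight N x u 0 x₀ T p
          = {p : Sample L | T < (p 0).1}.indicator (fun _ => Complex.exp (-u x₀ * T)) p := by
        intro p
        simp only [stepWeight]
        by_cases h : T < (p 0).1
        · rw [if_pos ⟨hT, h, hx⟩, indicator_of_mem (by exact h)]
        · rw [if_neg fun h' => h h'.2.1, indicator_of_notMem (by exact h)]
      simp only [h1]
      rw [integral_indicator_const _ (measurableSet_lt measurable_const (by fun_prop)),
        measureReal_def, pathLaw_first_gt hT, ENNReal.toReal_ofReal (Real.exp_pos _).le,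
        Complex.real_smul]
      push_cast
      rfl
    · rw [indicator_of_notMem (by exact hT)]
      simp [stepWeight, hT]
  simp only [hpt]
  rw [integral_indicator measurableSet_Ici, setIntegral_congr_set Ioi_ae_eq_Ici.symm]
  have h := integral_cexp_expMeasure hr hu
  rw [integral_expMeasure hr] at h
  simp only [mul_assoc] at h
  rw [integral_const_mul] at h
  have hr' : (jumpRate L : ℂ) ≠ 0 := by exact_mod_cast hr.ne'
  rw [div_eq_mul_inv] at h
  rw [mul_left_cancel₀ hr' h, mul_inv_cancel₀ hne]

/-- First step analysis: waiting time, displacement and remaining path are independent, and the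
waiting time integrates to r / (r + u(x₀)). -/
lemma integral_stepWeight_succ {N : ℕ} {x : Hier L} (hx : x ∈ ball L N) {u : Hier L → ℂ} {k : ℕ}
    {x₀ : Hier L} (hx₀ : x₀ ∈ ball L N)
    (hi : Integrable (fun q => stepWeight N x u (k + 1) x₀ q.1 q.2) (timePathLaw L))
    (hu : 0 < jumpRate L + (u x₀).re) :
    (jumpRate L + u x₀) * ∫ q, stepWeight N x u (k + 1) x₀ q.1 q.2 ∂timePathLaw L
      = ∑ y : ball L N, (rate (y.1 - x₀) : ℂ) *
        ∫ q, stepWeight N x u k y q.1 q.2 ∂timePathLaw L := by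
  classical
  have hr := jumpRate_pos L
  have hne : (jumpRate L + u x₀ : ℂ) ≠ 0 := fun h => by
    have := congrArg Complex.re h
    simp at this
    linarith
  set U : Hier L → ℂ := fun y => ∫ q, stepWeight N x u k y q.1 q.2 ∂timePathLaw L with hU
  have hm := measurable_stepWeight_right N x u (k + 1) x₀
  have hp := measurePreserving_firstStep (L := L)
  have h1 : ∫ q, stepWeight N x u (k + 1) x₀ q.1 q.2 ∂timePathLaw L
      = ∫ a, ∫ q, stepWeight N x u (k + 1) x₀ (firstStep (a, q)).1 (firstStep (a, q)).2
        ∂timePathLaw L ∂stepLaw L := by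
    conv_lhs => rw [← hp.map_eq]
    rw [integral_map hp.measurable.aemeasurable hm.aestronglyMeasurable]
    exact integral_prod _ (hp.integrable_comp_of_integrable hi)
  have h2 : ∀ᵐ a ∂stepLaw L, ∫ q, stepWeight N x u (k + 1) x₀ (firstStep (a, q)).1
      (firstStep (a, q)).2 ∂timePathLaw L
        = Complex.exp (-u x₀ * a.1) * U (x₀ + a.2) := by
    have hpos : ∀ᵐ a ∂stepLaw L, 0 < a.1 :=
      (measurePreserving_fst (μ := expMeasure (jumpRate L))
        (ν := (jumpLaw L).toMeasure)).quasiMeasurePreserving.ae (ae_pos_expMeasure _)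
    filter_upwards [hpos] with a ha
    simp only [stepWeight_firstStep, if_pos (And.intro hx₀ ha.le)]
    rw [integral_const_mul]
  rw [h1, integral_congr_ae h2, stepLaw, integral_prod_mul (fun s : ℝ => Complex.exp (-u x₀ * s))
    (fun z => U (x₀ + z)), integral_cexp_expMeasure hr hu, ← integral_jumpLaw (f := U) (N := N)
      (fun y hy => by simp [hU, stepWeight_of_notMem hx u k hy]) x₀]
  field_simp

/-- The generator of the process killed outside the ball, plus a potential. -/
noncomputable def killedMatrix (N : ℕ) (u : ball L N → ℂ) : Matrix (ball L N) (ball L N) ℂ :=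
  Matrix.of fun x y => (generator (x.1 - y.1) : ℂ) + if x = y then u x else 0

lemma generator_of_ne {z : Hier L} (hz : z ≠ 0) : generator z = -rate z := by
  simp [generator, hz]

lemma generator_zero : generator (0 : Hier L) = jumpRate L := by
  simp [generator, rate_zero]

/-- Strict diagonal dominance: the off-diagonal entries of a row have total modulus r (1 - L^{-2N}),
while the diagonal entry has real part at least r + b. -/
lemma det_killedMatrix_ne_zero {N : ℕ} {u : ball L N → ℂ} {b : ℝ}
    (hb : 0 < b + jumpRate L * ((L : ℝ) ^ (2 * N))⁻¹) (hu : ∀ y, b ≤ (u y).re) :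
    (killedMatrix N u).det ≠ 0 := by
  refine det_ne_zero_of_sum_row_lt_diag fun x => ?_
  have h1 : ∑ y ∈ Finset.univ.erase x, ‖killedMatrix N u x y‖
      = jumpRate L * (1 - ((L : ℝ) ^ (2 * N))⁻¹) := by
    rw [← sum_rate_ball N x, ← Finset.add_sum_erase _ _ (Finset.mem_univ x), sub_self, rate_zero,
      zero_add]
    refine Finset.sum_congr rfl fun y hy => ?_
    have hne := (Finset.ne_of_mem_erase hy).symm
    rw [killedMatrix, Matrix.of_apply, if_neg hne, generator_of_ne
      (fun h => hne (Subtype.ext (sub_eq_zero.1 h))), ← rate_neg (y.1 - x.1), neg_sub]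
    simp [abs_of_nonneg (rate_nonneg _)]
  have h2 : jumpRate L + b ≤ ‖killedMatrix N u x x‖ := by
    refine le_trans ?_ (Complex.re_le_norm _)
    simp only [killedMatrix, Matrix.of_apply, sub_self, generator_zero, if_true, Complex.add_re,
      Complex.ofReal_re]
    linarith [hu x]
  rw [h1]
  linarith

/-- The sum over all jump numbers of `∫ stepWeight` is the resolvent. -/
lemma hasSum_integral_stepWeight {N : ℕ} (x x₀ : ball L N) {u : Hier L → ℂ}
    {b : ℝ} (hb : 0 < b + jumpRate L * ((L : ℝ) ^ (2 * N))⁻¹)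
    (hu : ∀ y ∈ ball L N, b ≤ (u y).re) :
    HasSum (fun k => ∫ q, stepWeight N x u k x₀ q.1 q.2 ∂timePathLaw L)
      ((killedMatrix N fun y => u y)⁻¹ x₀ x) := by
  classical
  have hr := jumpRate_add_pos hb
  have hi := integrable_stepWeight x.2 hb hu
  have hs : ∀ y : ball L N, Summable fun k => ∫ q, stepWeight N x u k y q.1 q.2 ∂timePathLaw L := by
    intro y
    refine Summable.of_norm_bounded ((summable_geometric_of_lt_one (jumpFactor_nonneg hb)
      (jumpFactor_lt_one hb)).mul_left (jumpRate L + b)⁻¹) fun k => ?_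
    exact (norm_integral_le_integral_norm _).trans (integral_norm_stepWeight_le x.2 hb hu k y)
  set R : ball L N → ℂ := fun y => ∑' k, ∫ q, stepWeight N x u k y q.1 q.2 ∂timePathLaw L with hR
  have hu' : ∀ y : ball L N, 0 < jumpRate L + (u y).re := fun y => by linarith [hu y y.2]
  -- Summed over the number of jumps, the first step equations become a linear system for `R`, whose
  -- matrix is `killedMatrix` and whose right side is the unit vector at `x`.
  have hRec : ∀ y : ball L N, (jumpRate L + u y) * R y
      = (if y = x then 1 else 0) + ∑ z : ball L N, (rate (z.1 - y.1) : ℂ) * R z := by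
    intro y
    simp only [hR]
    rw [(hs y).tsum_eq_zero_add, mul_add, integral_stepWeight_zero (hi 0 y) (hu' y), ← tsum_mul_left]
    simp only [integral_stepWeight_succ x.2 y.2 (hi _ y) (hu' y)]
    rw [Summable.tsum_finsetSum fun z _ => (hs z).mul_left _]
    simp only [tsum_mul_left]
    congr 1
    simp only [Subtype.ext_iff]
  have hmul : (killedMatrix N fun y => u y).mulVec R = Pi.single x 1 := by
    funext y
    have h1 : ∀ z : ball L N, killedMatrix N (fun y => u y) y z * R z
        = (if y = z then (jumpRate L + u y) * R y else 0) - (rate (z.1 - y.1) : ℂ) * R z := by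
      intro z
      by_cases h : y = z
      · subst h
        simp [killedMatrix, generator_zero, rate_zero]
      · rw [killedMatrix, Matrix.of_apply, if_neg h, if_neg h, generator_of_ne
          (fun h' => h (Subtype.ext (sub_eq_zero.1 h'))), ← rate_neg (z.1 - y.1), neg_sub]
        push_cast
        ring
    simp only [Matrix.mulVec, dotProduct, h1, Finset.sum_sub_distrib, Finset.sum_ite_eq,
      Finset.mem_univ, if_true, hRec]
    rw [add_sub_cancel_right, Pi.single_apply]
  have hdet := det_killedMatrix_ne_zero hb (u := fun y : ball L N => u y) fun y => hu y y.2
  have hinv : (killedMatrix N fun y => u y)⁻¹ x₀ x = R x₀ := by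
    have h2 : (killedMatrix N fun y => u y)⁻¹.mulVec (Pi.single x 1) = R := by
      rw [← hmul, Matrix.mulVec_mulVec, Matrix.nonsing_inv_mul _ (Ne.isUnit hdet),
        Matrix.one_mulVec]
    rw [← h2, Matrix.mulVec_single_one]
    rfl
  rw [hinv]
  exact (hs x₀).hasSum

end Resolvent

end Hier

/-! ### Green's functions of mixtures of exponentials. -/

namespace Hier

variable {L : ℕ} [L.AtLeastTwo]

section GreenFunction

open Set

lemma norm_cexp_neg_mul_le_norm {u : ℂ} {b s : ℝ} (hu : b ≤ u.re) (hs : 0 ≤ s) :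
    ‖Complex.exp (-u * s)‖ ≤ ‖Complex.exp (-(b : ℂ) * s)‖ := by
  rw [Complex.norm_exp, Complex.norm_exp]
  refine Real.exp_le_exp.2 ?_
  simp only [Complex.re_mul_ofReal, Complex.neg_re, Complex.ofReal_re]
  nlinarith

omit [L.AtLeastTwo] in
-- The majorant has a constant real potential, so it serves all the rates of a mixture at once.
lemma norm_stepWeight_le {N : ℕ} {x : Hier L} (hx : x ∈ ball L N) {u : Hier L → ℂ} {b : ℝ}
    (hu : ∀ y ∈ ball L N, b ≤ (u y).re) (k : ℕ) (x₀ : Hier L) (T : ℝ) (p : Sample L) :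
    ‖stepWeight N x u k x₀ T p‖ ≤ ‖stepWeight N x (fun _ => b) k x₀ T p‖ := by
  induction k generalizing x₀ T p with
  | zero =>
    simp only [stepWeight]
    split_ifs with h
    · obtain ⟨h1, -, rfl⟩ := h
      exact norm_cexp_neg_mul_le_norm (hu _ hx) h1
    · simp
  | succ k ih =>
    simp only [stepWeight]
    split_ifs with h
    · rw [norm_mul, norm_mul]
      exact mul_le_mul (norm_cexp_neg_mul_le_norm (hu _ h.1) h.2) (ih _ _ _) (norm_nonneg _)
        (norm_nonneg _)
    · simp

lemma ae_isRegularPath_timePathLaw : ∀ᵐ q ∂timePathLaw L, IsRegularPath q.2 :=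
  (Measure.quasiMeasurePreserving_snd (μ := (volume : Measure ℝ)) (ν := pathLaw L)).ae
    ae_isRegularPath

omit [L.AtLeastTwo] in
lemma hasSum_stepWeight (N : ℕ) (x : Hier L) (u : Hier L → ℂ) (x₀ : Hier L) (T : ℝ) {p : Sample L}
    (hp : IsRegularPath p) : HasSum (fun k => stepWeight N x u k x₀ T p)
      (stepWeight N x u (jumpCount p T) x₀ T p) :=
  hasSum_single _ fun _ hk => stepWeight_of_ne_jumpCount N x u x₀ hp hk.symm

lemma summable_integral_norm_stepWeight {N : ℕ} {x : Hier L} (hx : x ∈ ball L N) {u : Hier L → ℂ}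
    {b : ℝ} (hb : 0 < b + jumpRate L * ((L : ℝ) ^ (2 * N))⁻¹)
    (hu : ∀ y ∈ ball L N, b ≤ (u y).re) (x₀ : Hier L) :
    Summable fun k => ∫ q, ‖stepWeight N x u k x₀ q.1 q.2‖ ∂timePathLaw L :=
  Summable.of_nonneg_of_le (fun _ => integral_nonneg fun _ => norm_nonneg _)
    (fun k => integral_norm_stepWeight_le hx hb hu k x₀)
    ((summable_geometric_of_lt_one (jumpFactor_nonneg hb) (jumpFactor_lt_one hb)).mul_left _)

lemma integral_stepWeight_jumpCount {N : ℕ} (x x₀ : ball L N) {u : Hier L → ℂ}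
    {b : ℝ} (hb : 0 < b + jumpRate L * ((L : ℝ) ^ (2 * N))⁻¹)
    (hu : ∀ y ∈ ball L N, b ≤ (u y).re) :
    ∫ q, stepWeight N x u (jumpCount q.2 q.1) x₀ q.1 q.2 ∂timePathLaw L
      = (killedMatrix N fun y => u y)⁻¹ x₀ x := by
  have h1 := hasSum_integral_of_summable_integral_norm (fun k => integrable_stepWeight x.2 hb hu k x₀)
    (summable_integral_norm_stepWeight x.2 hb hu x₀)
  rw [(hasSum_integral_stepWeight x x₀ hb hu).unique h1]
  refine integral_congr_ae ?_
  filter_upwards [ae_isRegularPath_timePathLaw] with q hq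
  exact (hasSum_stepWeight N x u x₀ q.1 hq).tsum_eq.symm

section Mixture

variable {Ω : Type*} [MeasurableSpace Ω] {μ : Measure Ω} [SigmaFinite μ] {ρ v : Ω → ℂ} {N : ℕ}

/-- A field of parameters on the ball, extended by zero. -/
noncomputable def extendPotential (v : Ω → ℂ) (o : ball L N → Ω) (y : Hier L) : ℂ :=
  open Classical in if h : y ∈ ball L N then v (o ⟨y, h⟩) else 0

omit [L.AtLeastTwo] [MeasurableSpace Ω] in
lemma extendPotential_coe (o : ball L N → Ω) (y : ball L N) :
    extendPotential v o y = v (o y) := by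
  rw [extendPotential, dif_pos y.2]

omit [L.AtLeastTwo] in
lemma measurable_extendPotential (hv : Measurable v) (y : Hier L) :
    Measurable fun o : ball L N → Ω => extendPotential v o y := by
  unfold extendPotential
  split_ifs
  · fun_prop
  · exact measurable_const

/-- This is the hypothesis of Fubini's theorem for rates against time and path. Measurability comes
from writing the integrand almost everywhere as the limit of the sums over jump numbers, and the
norms are summed by a geometric series that is uniform in the rates. -/
lemma integrable_prod_mul_stepWeight (hρ : Integrable ρ μ) (hv : Measurable v) {κ : ℝ}
    (hκ : ∀ o, κ ≤ (v o).re) {β : ℂ}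
    (hb : 0 < β.re + κ + jumpRate L * ((L : ℝ) ^ (2 * N))⁻¹) (x : ball L N) (x₀ : Hier L) :
    Integrable (fun q : (ball L N → Ω) × (ℝ × Sample L) => (∏ y, ρ (q.1 y)) *
      stepWeight N x (fun y => β + extendPotential v q.1 y) (jumpCount q.2.2 q.2.1) x₀
        q.2.1 q.2.2) ((Measure.pi fun _ => μ).prod (timePathLaw L)) := by
  have hre : ∀ (o : ball L N → Ω) (y), y ∈ ball L N →
      β.re + κ ≤ (β + extendPotential v o y).re := by
    intro o y hy
    rw [Complex.add_re, extendPotential_coe o ⟨y, hy⟩]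
    linarith [hκ (o ⟨y, hy⟩)]
  have hP : Integrable (fun o : ball L N → Ω => ∏ y, ρ (o y)) (Measure.pi fun _ => μ) :=
    Integrable.fintype_prod fun _ => hρ
  have hG := integrable_stepWeight x.2 (u := fun _ => ((β.re + κ : ℝ) : ℂ)) hb
    (fun y _ => by simp)
  set F : ℕ → (ball L N → Ω) × (ℝ × Sample L) → ℂ := fun k q => (∏ y, ρ (q.1 y)) *
    stepWeight N x (fun y => β + extendPotential v q.1 y) k x₀ q.2.1 q.2.2 with hF
  have hFm : ∀ k, AEStronglyMeasurable (F k) ((Measure.pi fun _ => μ).prod (timePathLaw L)) := by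
    intro k
    refine AEStronglyMeasurable.mul hP.aestronglyMeasurable.comp_fst ?_
    have h1 := measurable_stepWeight N x.1 (P := ball L N → Ω)
      (u := fun o y => β + extendPotential v o y)
      (fun y => (measurable_extendPotential hv y).const_add β) k
    exact (h1.comp (f := fun q : (ball L N → Ω) × (ℝ × Sample L) => (q, x₀))
      (by fun_prop)).aestronglyMeasurable
  have hFle : ∀ k q, ‖F k q‖ ≤ ‖∏ y, ρ (q.1 y)‖ *
      ‖stepWeight N x.1 (fun _ => ((β.re + κ : ℝ) : ℂ)) k x₀ q.2.1 q.2.2‖ := by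
    intro k q
    rw [hF, norm_mul]
    exact mul_le_mul_of_nonneg_left (norm_stepWeight_le x.2 (hre q.1) k x₀ _ _) (norm_nonneg _)
  have hFi : ∀ k, Integrable (F k) ((Measure.pi fun _ => μ).prod (timePathLaw L)) := fun k =>
    (hP.norm.mul_prod (hG k x₀).norm).mono' (hFm k) (Filter.Eventually.of_forall (hFle k))
  have hsum : Summable fun k => ∫ q, ‖F k q‖ ∂((Measure.pi fun _ => μ).prod (timePathLaw L)) := by
    refine Summable.of_nonneg_of_le (fun k => integral_nonneg fun q => norm_nonneg _) (fun k => ?_)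
      ((summable_integral_norm_stepWeight x.2 (u := fun _ => ((β.re + κ : ℝ) : ℂ)) hb
        (fun y _ => by simp) x₀).mul_left
        (∫ o, ‖∏ y, ρ (o y)‖ ∂(Measure.pi fun _ : ball L N => μ)))
    rw [← integral_prod_mul]
    exact integral_mono (hFi k).norm (hP.norm.mul_prod (hG k x₀).norm) (hFle k)
  have hreg : ∀ᵐ q ∂((Measure.pi fun _ : ball L N => μ).prod (timePathLaw L)),
      IsRegularPath q.2.2 :=
    Measure.quasiMeasurePreserving_snd.ae ae_isRegularPath_timePathLaw
  have hlim : ∀ᵐ q ∂((Measure.pi fun _ : ball L N => μ).prod (timePathLaw L)),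
      HasSum (fun k => F k q) ((∏ y, ρ (q.1 y)) *
      stepWeight N x (fun y => β + extendPotential v q.1 y) (jumpCount q.2.2 q.2.1) x₀
        q.2.1 q.2.2) := by
    filter_upwards [hreg] with q hq
    exact (hasSum_stepWeight N x.1 _ x₀ q.2.1 hq).mul_left _
  refine ⟨?_, ?_⟩
  · refine aestronglyMeasurable_of_tendsto_ae Filter.atTop
      (f := fun n q => ∑ k ∈ Finset.range n, F k q) (fun n => ?_) ?_
    · exact Finset.aestronglyMeasurable_fun_sum _ fun k _ => hFm k
    · filter_upwards [hlim] with q hq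
      exact hq.tendsto_sum_nat
  · have h1 : ∀ᵐ q ∂((Measure.pi fun _ : ball L N => μ).prod (timePathLaw L)),
        ‖(∏ y, ρ (q.1 y)) * stepWeight N x (fun y => β + extendPotential v q.1 y)
          (jumpCount q.2.2 q.2.1) x₀ q.2.1 q.2.2‖ₑ ≤ ∑' k, ‖F k q‖ₑ :=
      Filter.Eventually.of_forall fun q => ENNReal.le_tsum (f := fun k => ‖F k q‖ₑ)
        (jumpCount q.2.2 q.2.1)
    refine (lintegral_mono_ae h1).trans_lt ?_
    rw [lintegral_tsum fun k => (hFm k).enorm]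
    have h2 : ∀ k, ∫⁻ q, ‖F k q‖ₑ ∂((Measure.pi fun _ => μ).prod (timePathLaw L))
        = ENNReal.ofReal (∫ q, ‖F k q‖ ∂((Measure.pi fun _ => μ).prod (timePathLaw L))) := fun k =>
      (ofReal_integral_norm_eq_lintegral_enorm (hFi k)).symm
    simp only [h2]
    rw [← ENNReal.ofReal_tsum_of_nonneg (fun k => integral_nonneg fun q => norm_nonneg _) hsum]
    exact ENNReal.ofReal_lt_top

/-- A product of one-variable integrals is an integral over the product space, and the exponents
combine to β T + ∑ v_y τ_y. The exponentials thus become a site-dependent potential. -/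
lemma greenIntegrand_eq_integral {g : ℝ → ℂ}
    (hg : ∀ t, 0 ≤ t → g t = ∫ o, ρ o * Complex.exp (-v o * t) ∂μ) (β : ℂ) (x : ball L N) {T : ℝ}
    (hT : 0 ≤ T) {p : Sample L} (hp : IsRegularPath p) :
    greenIntegrand L N g β x T p = ∫ o : ball L N → Ω, (∏ y, ρ (o y)) *
      stepWeight N x (fun y => β + extendPotential v o y) (jumpCount p T) 0 T p
        ∂(Measure.pi fun _ => μ) := by
  have hiff : ((∀ t ∈ Icc 0 T, 0 + position p t ∈ ball L N) ∧ 0 + position p T = x.1) ↔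
      (∀ t ∈ Icc 0 T, position p t ∈ ball L N) ∧ position p T = x.1 := by simp only [zero_add]
  simp only [← pathWeight_eq_stepWeight x.2 β _ 0 hT hp]
  by_cases h : (∀ t ∈ Icc 0 T, position p t ∈ ball L N) ∧ position p T = x.1
  · have h1 : ∀ y : ball L N, g (localTime p T y)
        = ∫ o, ρ o * Complex.exp (-v o * localTime p T y) ∂μ := fun y => hg _ measureReal_nonneg
    simp only [pathWeight, if_pos (hiff.2 h), sub_zero]
    rw [greenIntegrand, if_pos h]
    simp only [h1]
    rw [← integral_fintype_prod_eq_prod (μ := fun _ : ball L N => μ)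
      (f := fun (y : ball L N) o => ρ o * Complex.exp (-v o * localTime p T y)), ← integral_const_mul]
    refine integral_congr_ae (Filter.Eventually.of_forall fun o => ?_)
    simp only [extendPotential_coe]
    rw [Finset.prod_mul_distrib, ← Complex.exp_sum, sub_eq_add_neg, Complex.exp_add]
    simp only [neg_mul, Finset.sum_neg_distrib]
    ring
  · rw [greenIntegrand, if_neg h]
    simp only [pathWeight, if_neg (mt hiff.1 h)]
    simp

omit [MeasurableSpace Ω] in
lemma integral_prod_mul_stepWeight {κ : ℝ} (hκ : ∀ o, κ ≤ (v o).re) {β : ℂ}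
    (hb : 0 < β.re + κ + jumpRate L * ((L : ℝ) ^ (2 * N))⁻¹) (x x₀ : ball L N)
    (o : ball L N → Ω) :
    ∫ q, (∏ y, ρ (o y)) * stepWeight N x (fun y => β + extendPotential v o y)
        (jumpCount q.2 q.1) x₀ q.1 q.2 ∂timePathLaw L
      = (∏ y, ρ (o y)) * (killedMatrix N fun y => β + v (o y))⁻¹ x₀ x := by
  rw [integral_const_mul, integral_stepWeight_jumpCount x x₀ hb]
  · simp only [extendPotential_coe]
  · intro y hy
    rw [Complex.add_re, extendPotential_coe o ⟨y, hy⟩]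
    linarith [hκ (o ⟨y, hy⟩)]

lemma integrable_prod_mul_inv_killedMatrix (hρ : Integrable ρ μ) (hv : Measurable v) {κ : ℝ}
    (hκ : ∀ o, κ ≤ (v o).re) {β : ℂ}
    (hb : 0 < β.re + κ + jumpRate L * ((L : ℝ) ^ (2 * N))⁻¹) (x₀ x : ball L N) :
    Integrable (fun o : ball L N → Ω => (∏ y, ρ (o y)) *
      (killedMatrix N fun y => β + v (o y))⁻¹ x₀ x) (Measure.pi fun _ => μ) := by
  refine (integrable_prod_mul_stepWeight hρ hv hκ hb x x₀).integral_prod_left.congr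
    (Filter.Eventually.of_forall fun o => ?_)
  exact integral_prod_mul_stepWeight hκ hb x x₀ o

/-- The Green's function of a mixture of exponentials is the mixture of the resolvents. -/
theorem green_eq_integral (hρ : Integrable ρ μ) (hv : Measurable v) {κ : ℝ}
    (hκ : ∀ o, κ ≤ (v o).re) {β : ℂ}
    (hb : 0 < β.re + κ + jumpRate L * ((L : ℝ) ^ (2 * N))⁻¹) {g : ℝ → ℂ}
    (hg : ∀ t, 0 ≤ t → g t = ∫ o, ρ o * Complex.exp (-v o * t) ∂μ) (x : ball L N) :
    GreenConverges L N g β x ∧ green L N g β x = ∫ o : ball L N → Ω, (∏ y, ρ (o y)) *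
      (killedMatrix N fun y => β + v (o y))⁻¹ ⟨0, zero_mem_ball L N⟩ x
        ∂(Measure.pi fun _ => μ) := by
  set F : (ball L N → Ω) → ℝ × Sample L → ℂ := fun o q => (∏ y, ρ (o y)) *
      stepWeight N x (fun y => β + extendPotential v o y) (jumpCount q.2 q.1) 0 q.1 q.2 with hF
  have hFi : Integrable (Function.uncurry F) ((Measure.pi fun _ => μ).prod (timePathLaw L)) :=
    integrable_prod_mul_stepWeight hρ hv hκ hb x 0
  have hrestr : (volume.restrict (Ioi (0 : ℝ))).prod (pathLaw L)
      = (timePathLaw L).restrict (Ioi 0 ×ˢ univ) := by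
    rw [timePathLaw, ← Measure.prod_restrict, Measure.restrict_univ]
  have hmeas : MeasurableSet (Ioi (0 : ℝ) ×ˢ (univ : Set (Sample L))) :=
    measurableSet_Ioi.prod MeasurableSet.univ
  have hae : ∀ᵐ q ∂(timePathLaw L).restrict (Ioi 0 ×ˢ univ),
      greenIntegrand L N g β x q.1 q.2 = ∫ o, F o q ∂(Measure.pi fun _ => μ) := by
    filter_upwards [ae_restrict_of_ae ae_isRegularPath_timePathLaw, ae_restrict_mem hmeas]
      with q hq hT
    exact greenIntegrand_eq_integral hg β x (le_of_lt (by exact hT.1)) hq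
  have hconv : GreenConverges L N g β x := by
    rw [GreenConverges, hrestr]
    exact (hFi.integral_prod_right.restrict).congr (hae.mono fun q hq => hq.symm)
  refine ⟨hconv, ?_⟩
  -- The weights vanish at negative times, so the time integral may be extended to ℝ, where the
  -- resolvent formula is available.
  have h0 : ∀ᵐ q ∂timePathLaw L, q ∉ Ioi 0 ×ˢ univ → ∫ o, F o q ∂(Measure.pi fun _ => μ) = 0 := by
    have hne : ∀ᵐ q ∂timePathLaw L, q.1 ≠ 0 :=
      (Measure.quasiMeasurePreserving_fst (μ := (volume : Measure ℝ)) (ν := pathLaw L)).ae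
        (p := fun t => t ≠ 0) (by simp [ae_iff])
    filter_upwards [hne] with q hq hq'
    have hT : q.1 < 0 := lt_of_le_of_ne (not_lt.1 fun h => hq' ⟨h, trivial⟩) hq
    simp [hF, stepWeight_of_neg _ _ _ _ _ hT]
  calc green L N g β x
      = ∫ q, greenIntegrand L N g β x q.1 q.2 ∂(volume.restrict (Ioi (0 : ℝ))).prod (pathLaw L) :=
        (integral_prod _ hconv).symm
    _ = ∫ q, ∫ o, F o q ∂(Measure.pi fun _ => μ) ∂timePathLaw L := by
        rw [hrestr, integral_congr_ae hae]
        exact setIntegral_eq_integral_of_ae_compl_eq_zero h0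
    _ = ∫ o, ∫ q, F o q ∂timePathLaw L ∂(Measure.pi fun _ => μ) :=
        (integral_integral_swap hFi).symm
    _ = _ := by
        refine integral_congr_ae (Filter.Eventually.of_forall fun o => ?_)
        exact integral_prod_mul_stepWeight hκ hb x ⟨0, zero_mem_ball L N⟩ o

end Mixture

end GreenFunction

end Hier

/-! ### Affine changes of variables on complex space. -/

section ChangeOfVariables

variable {k : ℕ}

/-- The real determinant of a complex linear map is the squared modulus of its complex determinant.
-/
lemma map_add_mulVec_volume (B : Matrix (Fin k) (Fin k) ℂ) (hB : B.det ≠ 0) (u : Fin k → ℂ) :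
    Measure.map (fun z : Fin k → ℂ => u + B.mulVec z) volume
      = ENNReal.ofReal (Complex.normSq B.det)⁻¹ • volume := by
  have hdet : LinearMap.det ((Matrix.toLin' B).restrictScalars ℝ) = Complex.normSq B.det := by
    rw [LinearMap.det_restrictScalars, LinearMap.det_toLin', Algebra.norm_complex_apply]
  have hpos : 0 < Complex.normSq B.det := Complex.normSq_pos.mpr hB
  have h1 := Measure.map_linearMap_addHaar_eq_smul_addHaar (volume : Measure (Fin k → ℂ))
    (f := (Matrix.toLin' B).restrictScalars ℝ) (by rw [hdet]; exact hpos.ne')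
  rw [hdet, abs_of_pos (inv_pos.2 hpos)] at h1
  have hm : Measurable fun z : Fin k → ℂ => B.mulVec z :=
    (Continuous.matrix_mulVec continuous_const continuous_id).measurable
  have h2 : (fun z : Fin k → ℂ => u + B.mulVec z) = (fun z => u + z) ∘ fun z => B.mulVec z := rfl
  rw [h2, ← Measure.map_map (measurable_const_add u) hm]
  have h3 : Measure.map (fun z : Fin k → ℂ => B.mulVec z) volume
      = ENNReal.ofReal (Complex.normSq B.det)⁻¹ • volume := h1
  rw [h3, Measure.map_smul, map_add_left_eq_self]

lemma measurableEmbedding_add_mulVec (B : Matrix (Fin k) (Fin k) ℂ) (hB : B.det ≠ 0)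
    (u : Fin k → ℂ) : MeasurableEmbedding fun z : Fin k → ℂ => u + B.mulVec z := by
  have hc : Continuous fun z : Fin k → ℂ => u + B.mulVec z :=
    continuous_const.add (Continuous.matrix_mulVec continuous_const continuous_id)
  refine hc.measurableEmbedding fun z z' h => ?_
  exact Matrix.mulVec_injective_of_isUnit ((Matrix.isUnit_iff_isUnit_det _).2 (Ne.isUnit hB))
    (add_left_cancel h)

lemma integral_comp_add_mulVec (B : Matrix (Fin k) (Fin k) ℂ) (hB : B.det ≠ 0) (u : Fin k → ℂ)
    (H : (Fin k → ℂ) → ℂ) :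
    (Complex.normSq B.det : ℂ) * ∫ z, H (u + B.mulVec z) = ∫ w, H w := by
  rw [← (measurableEmbedding_add_mulVec B hB u).integral_map, map_add_mulVec_volume B hB,
    integral_smul_measure, ENNReal.toReal_ofReal (inv_nonneg.2 (Complex.normSq_nonneg _)),
    Complex.real_smul, ← mul_assoc, ← Complex.ofReal_mul,
    mul_inv_cancel₀ (Complex.normSq_pos.mpr hB).ne', Complex.ofReal_one, one_mul]

lemma integrable_comp_add_mulVec (B : Matrix (Fin k) (Fin k) ℂ) (hB : B.det ≠ 0) (u : Fin k → ℂ)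
    {H : (Fin k → ℂ) → ℂ} (hH : Integrable H) : Integrable fun z => H (u + B.mulVec z) := by
  have h := (measurableEmbedding_add_mulVec B hB u).integrable_map_iff (g := H) (μ := volume)
  rw [map_add_mulVec_volume B hB] at h
  exact h.1 (hH.smul_measure ENNReal.ofReal_ne_top)

end ChangeOfVariables

/-! ### Gaussian integrals of mixtures under a constraint on the sum. -/

section GaussianMixture

open Set

variable {Ω : Type*} [MeasurableSpace Ω] {μ : Measure Ω} [SigmaFinite μ]
  {ι : Type*} [Fintype ι] [DecidableEq ι] {k : ℕ} {i : ι}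

lemma prod_eq_mul_prod_equiv {M : Type*} [CommMonoid M] (σ : Fin k ≃ Finset.univ.erase i)
    (f : ι → M) : ∏ y, f y = f i * ∏ j, f (σ j) := by
  rw [← Finset.mul_prod_erase _ _ (Finset.mem_univ i), Equiv.prod_comp σ fun y => f y,
    Finset.prod_coe_sort]

lemma sum_eq_add_sum_equiv {M : Type*} [AddCommMonoid M] (σ : Fin k ≃ Finset.univ.erase i)
    (f : ι → M) : ∑ y, f y = f i + ∑ j, f (σ j) := by
  rw [← Finset.add_sum_erase _ _ (Finset.mem_univ i), Equiv.sum_comp σ fun y => f y,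
    Finset.sum_coe_sort]

lemma equiv_erase_ne (σ : Fin k ≃ Finset.univ.erase i) (j : Fin k) : (σ j : ι) ≠ i :=
  Finset.ne_of_mem_erase (σ j).2

variable {D ρ ρ₀ : Ω → ℂ} {δ : ℝ}

lemma integrable_mul_prod_equiv (σ : Fin k ≃ Finset.univ.erase i) (hρ₀ : Integrable ρ₀ μ)
    (hρ : Integrable ρ μ) :
    Integrable (fun o : ι → Ω => ρ₀ (o i) * ∏ j, ρ (o (σ j))) (Measure.pi fun _ => μ) := by
  have h : Integrable (fun o : ι → Ω => ∏ y, (if y = i then ρ₀ else ρ) (o y))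
      (Measure.pi fun _ => μ) := by
    refine Integrable.fintype_prod (f := fun y => if y = i then ρ₀ else ρ) fun y => ?_
    split_ifs
    exacts [hρ₀, hρ]
  refine h.congr (Filter.Eventually.of_forall fun o => ?_)
  simp only
  rw [prod_eq_mul_prod_equiv σ, if_pos rfl]
  simp only [if_neg (equiv_erase_ne σ _)]

lemma integral_mul_prod_equiv (σ : Fin k ≃ Finset.univ.erase i) (f : Ω → ℂ) (g : Fin k → Ω → ℂ) :
    ∫ o : ι → Ω, f (o i) * ∏ j, g j (o (σ j)) ∂(Measure.pi fun _ => μ)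
      = (∫ q, f q ∂μ) * ∏ j, ∫ q, g j q ∂μ := by
  set F : ι → Ω → ℂ := fun y => if h : y ∈ Finset.univ.erase i then g (σ.symm ⟨y, h⟩) else f with hF
  have h1 : F i = f := by simp [hF]
  have h2 : ∀ j, F (σ j) = g j := fun j => by
    rw [hF]
    simp only [(σ j).2, dite_true]
    simp
  have h := integral_fintype_prod_eq_prod (μ := fun _ : ι => μ) F
  rw [prod_eq_mul_prod_equiv σ, h1] at h
  simp only [h2] at h
  rw [← h]
  refine integral_congr_ae (Filter.Eventually.of_forall fun o => ?_)
  simp only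
  rw [prod_eq_mul_prod_equiv σ, h1]
  simp only [h2]

lemma integrable_prod_exp_neg_normSq (hδ : 0 < δ) :
    Integrable fun w : Fin k → ℂ => ∏ j, Real.exp (-δ * Complex.normSq (w j)) := by
  have h := integrable_cexp_neg_mul_normSq (D := δ) (by simpa using hδ)
  refine Integrable.fintype_prod (f := fun _ w => Real.exp (-δ * Complex.normSq w)) fun _ => ?_
  refine h.norm.congr (Filter.Eventually.of_forall fun w => ?_)
  simp only [Complex.norm_exp]
  simp

/-- A Gaussian integral over `k` of `k + 1` variables with fixed sum `u`, for mixtures of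
Gaussians. -/
lemma integral_prod_expSuperposition (hD : Measurable D) (hδ : 0 < δ) (hDδ : ∀ q, δ ≤ (D q).re)
    (hρ₀ : Integrable ρ₀ μ) (hDρ : Integrable (fun q => -D q * ρ q) μ)
    (σ : Fin k ≃ Finset.univ.erase i) (u : ℂ) :
    Integrable (fun o : ι → Ω => (ρ₀ (o i) * ∏ j, ρ (o (σ j))) *
      ((∑ y, (D (o y))⁻¹)⁻¹ / D (o i) * Complex.exp (-(∑ y, (D (o y))⁻¹)⁻¹ * Complex.normSq u)))
      (Measure.pi fun _ => μ) ∧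
    (-(Real.pi : ℂ)⁻¹) ^ k * ∫ w : Fin k → ℂ,
      expSuperposition μ ρ₀ D (Complex.normSq (u - ∑ j, w j)) *
        ∏ j, expSuperposition μ (fun q => -D q * ρ q) D (Complex.normSq (w j))
    = ∫ o : ι → Ω, (ρ₀ (o i) * ∏ j, ρ (o (σ j))) *
      ((∑ y, (D (o y))⁻¹)⁻¹ / D (o i) * Complex.exp (-(∑ y, (D (o y))⁻¹)⁻¹ * Complex.normSq u))
        ∂(Measure.pi fun _ => μ) := by
  have hD0 : ∀ q, 0 < (D q).re := fun q => hδ.trans_le (hDδ q)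
  set Q : (Fin k → ℂ) × (ι → Ω) → ℂ := fun p =>
    Complex.exp (-D (p.2 i) * Complex.normSq (u - ∑ j, p.1 j)) *
      ∏ j, Complex.exp (-D (p.2 (σ j)) * Complex.normSq (p.1 j)) with hQ
  set R : (ι → Ω) → ℂ := fun o => ρ₀ (o i) * ∏ j, (-D (o (σ j)) * ρ (o (σ j))) with hR
  have hRi : Integrable R (Measure.pi fun _ => μ) :=
    integrable_mul_prod_equiv (ρ := fun q => -D q * ρ q) σ hρ₀ hDρ
  have hQm : Measurable Q := by
    have h1 : Continuous fun w : Fin k → ℂ => (Complex.normSq (u - ∑ j, w j) : ℂ) :=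
      Complex.continuous_ofReal.comp (Complex.continuous_normSq.comp (by fun_prop))
    have h2 : ∀ j, Continuous fun w : Fin k → ℂ => (Complex.normSq (w j) : ℂ) := fun j =>
      Complex.continuous_ofReal.comp (Complex.continuous_normSq.comp (by fun_prop))
    have h3 : Measurable fun p : (Fin k → ℂ) × (ι → Ω) =>
        Complex.exp (-D (p.2 i) * Complex.normSq (u - ∑ j, p.1 j)) := by
      have := h1.measurable
      fun_prop
    have h4 : ∀ j, Measurable fun p : (Fin k → ℂ) × (ι → Ω) =>
        Complex.exp (-D (p.2 (σ j)) * Complex.normSq (p.1 j)) := fun j => by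
      have := (h2 j).measurable
      fun_prop
    exact h3.mul (Finset.measurable_fun_prod _ fun j _ => h4 j)
  have hQle : ∀ p, ‖Q p‖ ≤ ∏ j, Real.exp (-δ * Complex.normSq (p.1 j)) := by
    intro p
    have h1 := norm_cexp_neg_mul_le (hD0 (p.2 i)).le (Complex.normSq_nonneg (u - ∑ j, p.1 j))
    rw [neg_zero, zero_mul, Real.exp_zero] at h1
    have h2 : ‖∏ j, Complex.exp (-D (p.2 (σ j)) * Complex.normSq (p.1 j))‖
        ≤ ∏ j, Real.exp (-δ * Complex.normSq (p.1 j)) := by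
      rw [norm_prod]
      exact Finset.prod_le_prod (fun _ _ => norm_nonneg _) fun j _ =>
        norm_cexp_neg_mul_le (hDδ _) (Complex.normSq_nonneg _)
    have h3 := mul_le_mul h1 h2 (norm_nonneg _) zero_le_one
    rw [one_mul, ← norm_mul] at h3
    exact h3
  -- The `k` free variables have Gaussian decay with rate δ uniformly in the rates, and the factor
  -- that carries the constraint has modulus at most one.
  have hint : Integrable (fun p : (Fin k → ℂ) × (ι → Ω) => R p.2 * Q p)
      ((volume : Measure (Fin k → ℂ)).prod (Measure.pi fun _ => μ)) := by
    have hG := (integrable_prod_exp_neg_normSq (k := k) hδ).mul_prod hRi.norm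
    have hm : AEStronglyMeasurable (fun p : (Fin k → ℂ) × (ι → Ω) => R p.2)
        ((volume : Measure (Fin k → ℂ)).prod (Measure.pi fun _ => μ)) :=
      hRi.aestronglyMeasurable.comp_snd
    refine hG.mono' (hm.mul hQm.aestronglyMeasurable) (Filter.Eventually.of_forall fun p => ?_)
    rw [norm_mul, mul_comm]
    exact mul_le_mul_of_nonneg_right (hQle p) (norm_nonneg _)
  have hleft : ∀ w : Fin k → ℂ, ∫ o, R o * Q (w, o) ∂(Measure.pi fun _ => μ)
      = expSuperposition μ ρ₀ D (Complex.normSq (u - ∑ j, w j)) *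
        ∏ j, expSuperposition μ (fun q => -D q * ρ q) D (Complex.normSq (w j)) := by
    intro w
    simp only [expSuperposition]
    rw [← integral_mul_prod_equiv σ]
    refine integral_congr_ae (Filter.Eventually.of_forall fun o => ?_)
    simp only [hR, hQ, Finset.prod_mul_distrib]
    ring
  have hright : ∀ o : ι → Ω, (-(Real.pi : ℂ)⁻¹) ^ k * ∫ w : Fin k → ℂ, R o * Q (w, o)
      = (ρ₀ (o i) * ∏ j, ρ (o (σ j))) * ((∑ y, (D (o y))⁻¹)⁻¹ / D (o i) *
        Complex.exp (-(∑ y, (D (o y))⁻¹)⁻¹ * Complex.normSq u)) := by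
    intro o
    have h := integral_cexp_neg_normSq_sub_sum_mul (hD0 (o i)) (fun j => D (o (σ j)))
      (fun j => hD0 _) u
    rw [← sum_eq_add_sum_equiv σ fun y => (D (o y))⁻¹] at h
    rw [← h, ← integral_const_mul, ← integral_const_mul]
    refine integral_congr_ae (Filter.Eventually.of_forall fun w => ?_)
    simp only [hR, hQ, Finset.prod_mul_distrib, Finset.prod_div_distrib, Finset.prod_neg,
      Finset.prod_const, Finset.card_univ, Fintype.card_fin]
    rw [neg_pow (Real.pi : ℂ)⁻¹, inv_pow]
    -- The signs of the factors -D at the `k` free sites cancel those of (-π⁻¹)^k.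
    have h1 : ((-1 : ℂ) ^ k) * (-1) ^ k = 1 := by rw [← mul_pow]; simp
    linear_combination (((Real.pi : ℂ) ^ k)⁻¹ * ρ₀ (o i) * (∏ j, D (o (σ j))) *
      (∏ j, ρ (o (σ j))) * Complex.exp (-D (o i) * Complex.normSq (u - ∑ j, w j)) *
      ∏ j, Complex.exp (-D (o (σ j)) * Complex.normSq (w j))) * h1
  refine ⟨?_, ?_⟩
  · have h := hint.integral_prod_right.const_mul ((-(Real.pi : ℂ)⁻¹) ^ k)
    simp only [hright] at h
    exact h
  · simp only [← hleft, ← hright]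
    rw [integral_const_mul, integral_integral_swap hint]

end GaussianMixture

/-! ### The fluctuation fields of one block. -/

namespace Hier

section Fluctuations

variable {L : ℕ} [L.AtLeastTwo]

lemma one_add_ne_zero {β : ℂ} (hβ : β ≠ -1) : 1 + β ≠ 0 := fun h =>
  hβ (eq_neg_of_add_eq_zero_right h)

/-- On Ξ the covariance is the scalar (1 + β)⁻¹. The assumption β ≠ -1 keeps `Ring.inverse` away
from its default value 0. -/
lemma gammaInv_eq {β : ℂ} (hβ : β ≠ -1) (N : ℕ) :
    gammaInv L N β = (1 + β) • (1 : Module.End ℂ (fluct L N)) := by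
  have ha := one_add_ne_zero hβ
  have h1 : gammaOp L N β = (1 + β)⁻¹ • (1 : Module.End ℂ (fluct L N)) := by
    refine LinearMap.ext fun ζ => Subtype.ext ?_
    exact gammaCov_mulVec L N β ζ.1 ζ.2
  have h2 : gammaOp L N β * ((1 + β) • (1 : Module.End ℂ (fluct L N))) = 1 := by
    rw [h1, smul_mul_smul_comm, inv_mul_cancel₀ ha, one_smul, one_mul]
  have h3 : ((1 + β) • (1 : Module.End ℂ (fluct L N))) * gammaOp L N β = 1 := by
    rw [h1, smul_mul_smul_comm, mul_inv_cancel₀ ha, one_smul, one_mul]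
  exact Ring.inverse_unit ⟨gammaOp L N β, _, h2, h3⟩

lemma mem_fluct_zero_iff (ζ : Field L 1) : ζ ∈ fluct L 0 ↔ ∑ y, ζ y = 0 := by
  have h : ∀ c : ball L 0, Finset.univ.filter (fun x : ball L (0 + 1) => ballDown x = c)
      = Finset.univ := fun c => Finset.filter_true_of_mem fun x _ => Subsingleton.elim _ _
  constructor
  · intro hζ
    have := hζ ⟨0, zero_mem_ball L 0⟩
    rwa [h] at this
  · intro hζ c
    rw [h]
    exact hζ

/-- For a single block, Ξ is the kernel of one nonzero functional, the sum. So the values at all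
sites but one are coordinates on Ξ. -/
lemma finrank_fluct_add_one : Module.finrank ℂ (fluct L 0) + 1 = Fintype.card (ball L 1) := by
  set f : Module.Dual ℂ (Field L 1) := ∑ y, LinearMap.proj y with hf
  have hfa : ∀ ζ, f ζ = ∑ y, ζ y := fun ζ => by simp [hf]
  have hker : fluct L 0 = LinearMap.ker f := by
    ext ζ
    rw [mem_fluct_zero_iff, LinearMap.mem_ker, hfa]
  have hne : f ≠ 0 := by
    intro h
    have := LinearMap.congr_fun h (Pi.single (⟨0, zero_mem_ball L 1⟩ : ball L 1) 1)
    rw [hfa] at this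
    simp at this
  rw [hker, Module.Dual.finrank_ker_add_one_of_ne_zero hne]
  simp

/-- The number of fluctuation directions. -/
noncomputable abbrev fluctDim (L : ℕ) [L.AtLeastTwo] : ℕ := Module.finrank ℂ (fluct L 0)

/-- The basis of `Ξ` used for integration over the fibres. -/
noncomputable abbrev fluctBasis (L : ℕ) [L.AtLeastTwo] :
    Module.Basis (Fin (fluctDim L)) ℂ (fluct L 0) := Module.finBasis ℂ (fluct L 0)

/-- An enumeration of all sites of the block but one. -/
noncomputable def siteEquiv (i : ball L 1) :
    Fin (fluctDim L) ≃ (Finset.univ.erase i : Finset (ball L 1)) :=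
  Fintype.equivOfCardEq (by
    rw [Fintype.card_fin, Fintype.card_coe, Finset.card_erase_of_mem (Finset.mem_univ i),
      Finset.card_univ, ← finrank_fluct_add_one, Nat.add_sub_cancel])

/-- The matrix of the restriction of fluctuation fields to all sites but `i`. -/
noncomputable def siteMatrix (i : ball L 1) : Matrix (Fin (fluctDim L)) (Fin (fluctDim L)) ℂ :=
  Matrix.of fun j l => (fluctBasis L l).1 (siteEquiv i j)

lemma siteMatrix_mulVec (i : ball L 1) (z : Fin (fluctDim L) → ℂ) (j : Fin (fluctDim L)) :
    (siteMatrix i).mulVec z j = (∑ l, z l • fluctBasis L l : fluct L 0).1 (siteEquiv i j) := by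
  simp [Matrix.mulVec, dotProduct, siteMatrix, mul_comm]

/-- A field with sum zero that vanishes at all sites but one vanishes at that site too. -/
lemma det_siteMatrix_ne_zero (i : ball L 1) : (siteMatrix i).det ≠ 0 := by
  intro h
  obtain ⟨z, hz, h0⟩ := Matrix.exists_mulVec_eq_zero_iff.2 h
  refine hz ?_
  have h1 : (∑ l, z l • fluctBasis L l : fluct L 0) = 0 := by
    have hs := (mem_fluct_zero_iff _).1 (∑ l, z l • fluctBasis L l : fluct L 0).2
    have he : ∀ j, (∑ l, z l • fluctBasis L l : fluct L 0).1 (siteEquiv i j) = 0 := fun j => by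
      rw [← siteMatrix_mulVec, h0, Pi.zero_apply]
    rw [sum_eq_add_sum_equiv (siteEquiv i)] at hs
    simp only [he, Finset.sum_const_zero, add_zero] at hs
    refine Subtype.ext (funext fun y => ?_)
    by_cases hy : y = i
    · rw [hy]
      exact hs
    · have := he ((siteEquiv i).symm ⟨y, Finset.mem_erase.2 ⟨hy, Finset.mem_univ y⟩⟩)
      rwa [Equiv.apply_symm_apply] at this
  funext l
  exact Fintype.linearIndependent_iff.1 (fluctBasis L).linearIndependent z h1 l

end Fluctuations

end Hier

/-! ### The Gaussian form and the product form in the even algebra. -/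

namespace Hier

section FormAlgebra

open ExteriorAlgebra

variable {L : ℕ} [L.AtLeastTwo] {E : Type*} [AddCommGroup E] [Module ℝ E]

/-- Evaluation of a one-form at a vector. -/
noncomputable def evalDual (e : E) : Module.Dual ℂ (E →ₗ[ℝ] ℂ) where
  toFun w := w e
  map_add' _ _ := rfl
  map_smul' _ _ := rfl

/-- The constant `(2 π i)⁻¹`. -/
noncomputable def twoPiIInv : ℂ := (2 * Real.pi * Complex.I)⁻¹

/-- All factors are even, so the noncommutative product can be moved into the commutative algebra
`evenAlg`, where ordinary finite products and ring identities are available. -/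
lemma map_tauProd {N : ℕ} (f : E →ₗ[ℝ] Field L N) (g : ℝ → ℂ) (w : Field L N) :
    ExteriorAlgebra.map (dualMap f) (tauProd L N g w)
      = ((∏ y : ball L N, (algebraMap ℂ (evenAlg (E →ₗ[ℝ] ℂ)) (g (Complex.normSq (w y))) +
        (derivWithin g (Set.Ici 0) (Complex.normSq (w y)) * twoPiIInv) •
          twoForm (coord y ∘ₗ f) (coordBar y ∘ₗ f)) : evenAlg (E →ₗ[ℝ] ℂ)) : Ext E) := by
  have h1 := Finset.map_noncommProd Finset.univ _ (fun x _ y _ _ => commute_tauForm g x y)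
    (((ExteriorAlgebra.map (dualMap f) : Ext (Field L N) →ₐ[ℂ] Ext E) :
      Ext (Field L N) →* Ext E).comp (Pi.evalMonoidHom (fun _ : Field L N => Ext (Field L N)) w))
  refine h1.trans ?_
  have h2 : ∀ y : ball L N, ExteriorAlgebra.map (dualMap f) (tauForm g y w)
      = (evenAlg (E →ₗ[ℝ] ℂ)).val (algebraMap ℂ (evenAlg (E →ₗ[ℝ] ℂ)) (g (Complex.normSq (w y))) +
        (derivWithin g (Set.Ici 0) (Complex.normSq (w y)) * twoPiIInv) •
          twoForm (coord y ∘ₗ f) (coordBar y ∘ₗ f)) := by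
    intro y
    rw [tauForm, map_add, map_smul, map_mul, AlgHom.commutes, map_add, map_smul, AlgHom.commutes]
    simp only [dOf, map_apply_ι]
    rfl
  have h3 : ∀ F : ball L N → evenAlg (E →ₗ[ℝ] ℂ), ((∏ y, F y : evenAlg (E →ₗ[ℝ] ℂ)) : Ext E)
      = Finset.univ.noncommProd (fun y => (evenAlg (E →ₗ[ℝ] ℂ)).val (F y))
        (fun x _ y _ _ => (Commute.all (F x) (F y)).map (evenAlg (E →ₗ[ℝ] ℂ)).val) := by
    intro F
    rw [← Finset.noncommProd_eq_prod]
    exact Finset.map_noncommProd Finset.univ F _ (evenAlg (E →ₗ[ℝ] ℂ)).val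
  rw [h3]
  exact Finset.noncommProd_congr rfl (fun y _ => h2 y) _

/-- Inclusion of the fluctuation fields. -/
noncomputable def fluctIncl (L : ℕ) [L.AtLeastTwo] : fluct L 0 →ₗ[ℝ] Field L 1 :=
  (fluct L 0).subtype.restrictScalars ℝ

/-- By `gammaInv_eq`, S_A is 1 + β times the standard quadratic form plus the standard two-form. -/
lemma map_gaussForm {β : ℂ} (hβ : β ≠ -1) (f : E →ₗ[ℝ] fluct L 0) (ζ : fluct L 0) :
    ExteriorAlgebra.map (dualMap f) (gaussForm L 0 β ζ)
      = Complex.exp (-((1 + β) * ∑ y, (Complex.normSq (ζ.1 y) : ℂ))) •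
        ((∑ k ∈ Finset.range (Module.finrank ℝ (fluct L 0) + 1), ((k.factorial : ℂ))⁻¹ •
          (-(((1 + β) * twoPiIInv) • ∑ y, twoForm (coord y ∘ₗ fluctIncl L ∘ₗ f)
            (coordBar y ∘ₗ fluctIncl L ∘ₗ f))) ^ k : evenAlg (E →ₗ[ℝ] ℂ)) : Ext E) := by
  have hA : ∀ ζ : fluct L 0, gammaInv L 0 β ζ = (1 + β) • ζ := fun ζ => by
    rw [gammaInv_eq hβ]; rfl
  have h1 : ∀ y : ball L (0 + 1), coord y ∘ₗ (fluct L 0).subtype.restrictScalars ℝ ∘ₗ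
      (gammaInv L 0 β).restrictScalars ℝ = (1 + β) • (coord y ∘ₗ fluctIncl L) := by
    intro y
    refine LinearMap.ext fun ζ => ?_
    change (gammaInv L 0 β ζ).1 y = (1 + β) * ζ.1 y
    rw [hA]; rfl
  rw [gaussForm, map_smul]
  congr 1
  · congr 2
    rw [Finset.mul_sum]
    refine Finset.sum_congr rfl fun y _ => ?_
    have : ((gammaInv L 0 β).restrictScalars ℝ ζ).1 y = (1 + β) * ζ.1 y := by
      change (gammaInv L 0 β ζ).1 y = _
      rw [hA]; rfl
    rw [this, mul_assoc, Complex.mul_conj]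
  · rw [map_sum, AddSubmonoidClass.coe_finsetSum]
    refine Finset.sum_congr rfl fun k _ => ?_
    rw [map_smul, map_pow, map_neg, map_smul, map_sum]
    simp only [h1, dOf, map_smul, map_mul, map_apply_ι, smul_mul_assoc]
    rw [← Finset.smul_sum, smul_smul, mul_comm _ (1 + β)]
    simp only [SetLike.val_smul, SubmonoidClass.coe_pow, NegMemClass.coe_neg,
      AddSubmonoidClass.coe_finsetSum, coe_twoForm]
    rfl

end FormAlgebra

end Hier

/-! ### Exponentials of nilpotent elements. -/

section EvenAlgebra

open ExteriorAlgebra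

variable {V : Type*} [AddCommGroup V] [Module ℂ V] {ι' : Type*} [Fintype ι']

lemma twoForm_zero_left (a : V) : twoForm 0 a = 0 := by
  rw [← zero_smul ℂ (0 : V), twoForm_smul_left, zero_smul]

lemma twoForm_zero_right (a : V) : twoForm a 0 = 0 := by
  rw [← zero_smul ℂ (0 : V), twoForm_smul_right, zero_smul]

/-- The mixed terms are linear in the sums of `Z` and `Zb`, which vanish. -/
lemma sum_twoForm_add {Z Zb : ι' → V} (hZ : ∑ y, Z y = 0) (hZb : ∑ y, Zb y = 0) (s t : V) (c : ℂ) :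
    ∑ y, twoForm (c • s + Z y) (c • t + Zb y)
      = (Fintype.card ι' * (c * c)) • twoForm s t + ∑ y, twoForm (Z y) (Zb y) := by
  have h1 : ∀ y, twoForm (c • s + Z y) (c • t + Zb y) = (c * c) • twoForm s t +
      c • twoForm s (Zb y) + (c • twoForm (Z y) t + twoForm (Z y) (Zb y)) := by
    intro y
    rw [twoForm_add_left, twoForm_add_right, twoForm_add_right, twoForm_smul_left,
      twoForm_smul_right, twoForm_smul_left, twoForm_smul_right, smul_smul]
  simp only [h1, Finset.sum_add_distrib, ← Finset.smul_sum, ← twoForm_sum_left,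
    ← twoForm_sum_right, hZ, hZb, twoForm_zero_left, twoForm_zero_right, smul_zero, add_zero,
    zero_add, Finset.sum_const, Finset.card_univ]
  simp only [← Nat.cast_smul_eq_nsmul ℂ, smul_smul, mul_comm]

variable {A : Type*} [CommRing A] [Algebra ℂ A]

/-- The exponential splits into one factor for each nilpotent term, and (1 - act)(G + G'ct) = G +
(G' - aG)ct since t² = 0. This is the passage from g to e^{-at} g, whose derivative is e^{-at}(g' -
ag). In the proof the index `none` stands for the additional term `q`. -/
lemma sum_pow_mul_prod_add {t : ι' → A} {q : A} (ht : ∀ y, t y * t y = 0) (hq : q * q = 0)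
    (a c e : ℂ) {m : ℕ} (hm : Fintype.card (Option ι') ≤ m) (G G' : ι' → ℂ) :
    (∑ k ∈ Finset.range (m + 1), ((k.factorial : ℂ))⁻¹ • (-((a * c) • (∑ y, t y - e • q))) ^ k) *
        ∏ y, (algebraMap ℂ A (G y) + (G' y * c) • t y)
      = (1 + (a * c * e) • q) *
        ∏ y, (algebraMap ℂ A (G y) + ((G' y - a * G y) * c) • t y) := by
  classical
  set x : Option ι' → A := fun o => o.elim ((a * c * e) • q) fun y => (-(a * c)) • t y with hx
  have hx2 : ∀ o, x o * x o = 0 := by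
    intro o
    cases o with
    | none =>
      change (a * c * e) • q * (a * c * e) • q = 0
      rw [smul_mul_smul_comm, hq, smul_zero]
    | some y =>
      change (-(a * c)) • t y * (-(a * c)) • t y = 0
      rw [smul_mul_smul_comm, ht, smul_zero]
  have hsum : ∑ o, x o = -((a * c) • (∑ y, t y - e • q)) := by
    rw [Fintype.sum_option]
    change (a * c * e) • q + ∑ y, (-(a * c)) • t y = _
    rw [← Finset.smul_sum, smul_sub, smul_smul, neg_smul]
    abel
  have hE := sum_pow_div_factorial_eq_prod Finset.univ x hx2 m (by rwa [Finset.card_univ])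
  rw [hsum, Fintype.prod_option] at hE
  rw [hE]
  change ((1 + (a * c * e) • q) * ∏ y, (1 + (-(a * c)) • t y)) * _ = _
  rw [mul_assoc, ← Finset.prod_mul_distrib]
  congr 1
  refine Finset.prod_congr rfl fun y _ => ?_
  simp only [Algebra.smul_def, map_mul, map_sub, map_neg]
  linear_combination (-(algebraMap ℂ A a) * algebraMap ℂ A c * algebraMap ℂ A (G' y) *
    algebraMap ℂ A c) * ht y

lemma prod_smul_mul_prod_add (e : ι' → ℂ) (q : A) (G G' : ι' → ℂ) (c : ℂ) (t : ι' → A) :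
    (∏ y, e y) • (q * ∏ y, (algebraMap ℂ A (G y) + (G' y * c) • t y))
      = q * ∏ y, (algebraMap ℂ A (e y * G y) + (e y * G' y * c) • t y) := by
  rw [← mul_smul_comm, Algebra.smul_def, map_prod, ← Finset.prod_mul_distrib]
  congr 1
  refine Finset.prod_congr rfl fun y _ => ?_
  simp only [Algebra.smul_def, map_mul]
  ring

end EvenAlgebra

/-! ### Block spin and fluctuation coordinates. -/

namespace Hier

section FormAlgebra

open ExteriorAlgebra

variable {L : ℕ} [L.AtLeastTwo]

/-- The single site of `𝒢_0`. -/
abbrev origin (L : ℕ) : ball L 0 := ⟨0, zero_mem_ball L 0⟩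

/-- The field on the block as a function of the block spin field and the fluctuation field. -/
noncomputable def blockField (L : ℕ) [L.AtLeastTwo] : Field L 0 × fluct L 0 →ₗ[ℝ] Field L 1 :=
  (scaleField L 0).coprod (fluctIncl L)

lemma blockField_apply (v : Field L 0 × fluct L 0) (y : ball L 1) :
    blockField L v y = (L : ℂ)⁻¹ * v.1 (origin L) + v.2.1 y := by
  have h : ballDown (N := 0) y = origin L := Subsingleton.elim _ _
  change (L : ℂ)⁻¹ * v.1 (ballDown (N := 0) y) + v.2.1 y = _
  rw [h]

/-- The form `dw_y ∧ dw̄_y` of the block field. -/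
noncomputable def siteForm (y : ball L 1) : evenAlg (Field L 0 × fluct L 0 →ₗ[ℝ] ℂ) :=
  twoForm (coord y ∘ₗ blockField L) (coordBar y ∘ₗ blockField L)

/-- The one-form `dφ` of the block spin field. -/
noncomputable def spinCoord (L : ℕ) [L.AtLeastTwo] : Field L 0 × fluct L 0 →ₗ[ℝ] ℂ :=
  coord (origin L) ∘ₗ LinearMap.fst ℝ _ _

/-- The one-form `dφ̄` of the block spin field. -/
noncomputable def spinCoordBar (L : ℕ) [L.AtLeastTwo] : Field L 0 × fluct L 0 →ₗ[ℝ] ℂ :=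
  coordBar (origin L) ∘ₗ LinearMap.fst ℝ _ _

lemma coord_comp_blockField (y : ball L 1) :
    coord y ∘ₗ blockField L = (L : ℂ)⁻¹ • spinCoord L +
      coord y ∘ₗ fluctIncl L ∘ₗ LinearMap.snd ℝ (Field L 0) (fluct L 0) :=
  LinearMap.ext fun v => blockField_apply v y

lemma coordBar_comp_blockField (y : ball L 1) :
    coordBar y ∘ₗ blockField L = (L : ℂ)⁻¹ • spinCoordBar L +
      coordBar y ∘ₗ fluctIncl L ∘ₗ LinearMap.snd ℝ (Field L 0) (fluct L 0) := by
  refine LinearMap.ext fun v => ?_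
  change (starRingEnd ℂ) (blockField L v y) = (L : ℂ)⁻¹ * (starRingEnd ℂ) (v.1 (origin L)) +
    (starRingEnd ℂ) (v.2.1 y)
  rw [blockField_apply, map_add, map_mul, map_inv₀, Complex.conj_natCast]

lemma cast_card_ball_one : (Fintype.card (ball L 1) : ℂ) = (L : ℂ) ^ 4 := by
  rw [card_ball_one]
  push_cast
  rfl

lemma cast_ne_zero (L : ℕ) [L.AtLeastTwo] : (L : ℂ) ≠ 0 := by
  have := one_lt_cast L
  exact_mod_cast (by linarith : (L : ℝ) ≠ 0)

lemma sum_coord_comp_blockField :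
    ∑ y, coord y ∘ₗ blockField L = ((L : ℂ) ^ 3) • spinCoord L := by
  refine LinearMap.ext fun v => ?_
  rw [LinearMap.sum_apply]
  change ∑ y, blockField L v y = (L : ℂ) ^ 3 * v.1 (origin L)
  simp only [blockField_apply, Finset.sum_add_distrib, Finset.sum_const, Finset.card_univ,
    nsmul_eq_mul, (mem_fluct_zero_iff _).1 v.2.2, cast_card_ball_one]
  have := cast_ne_zero L
  field_simp
  ring

lemma sum_coordBar_comp_blockField :
    ∑ y, coordBar y ∘ₗ blockField L = ((L : ℂ) ^ 3) • spinCoordBar L := by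
  have h : ∀ v, (∑ y, coordBar y ∘ₗ blockField L) v
      = (starRingEnd ℂ) ((∑ y, coord y ∘ₗ blockField L) v) := by
    intro v
    rw [LinearMap.sum_apply, LinearMap.sum_apply, map_sum]
    rfl
  refine LinearMap.ext fun v => ?_
  rw [h, sum_coord_comp_blockField]
  change (starRingEnd ℂ) ((L : ℂ) ^ 3 * v.1 (origin L)) = (L : ℂ) ^ 3 * (starRingEnd ℂ) _
  rw [map_mul, map_pow, Complex.conj_natCast]
  rfl

lemma sum_coord_comp_fluctIncl :
    ∑ y, coord y ∘ₗ fluctIncl L ∘ₗ LinearMap.snd ℝ (Field L 0) (fluct L 0) = 0 := by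
  refine LinearMap.ext fun v => ?_
  rw [LinearMap.sum_apply]
  change ∑ y, v.2.1 y = 0
  exact (mem_fluct_zero_iff _).1 v.2.2

lemma sum_coordBar_comp_fluctIncl :
    ∑ y, coordBar y ∘ₗ fluctIncl L ∘ₗ LinearMap.snd ℝ (Field L 0) (fluct L 0) = 0 := by
  refine LinearMap.ext fun v => ?_
  rw [LinearMap.sum_apply]
  change ∑ y, (starRingEnd ℂ) (v.2.1 y) = 0
  rw [← map_sum, (mem_fluct_zero_iff _).1 v.2.2, map_zero]

/-- Constant and sum-zero fields are orthogonal. The coefficient of the block spin is L⁴ sites times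
the square of L⁻¹. -/
lemma sum_fluct_twoForm :
    ∑ y : ball L 1, twoForm (coord y ∘ₗ fluctIncl L ∘ₗ LinearMap.snd ℝ (Field L 0) (fluct L 0))
        (coordBar y ∘ₗ fluctIncl L ∘ₗ LinearMap.snd ℝ (Field L 0) (fluct L 0))
      = ∑ y, siteForm y - (L : ℂ) ^ 2 • twoForm (spinCoord L) (spinCoordBar L) := by
  have hL := cast_ne_zero L
  have h := sum_twoForm_add
    (Z := fun y : ball L 1 => coord y ∘ₗ fluctIncl L ∘ₗ LinearMap.snd ℝ (Field L 0) (fluct L 0))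
    (Zb := fun y => coordBar y ∘ₗ fluctIncl L ∘ₗ LinearMap.snd ℝ (Field L 0) (fluct L 0))
    sum_coord_comp_fluctIncl sum_coordBar_comp_fluctIncl (spinCoord L) (spinCoordBar L) (L : ℂ)⁻¹
  have h2 : (L : ℂ) ^ 4 * ((L : ℂ)⁻¹ * (L : ℂ)⁻¹) = (L : ℂ) ^ 2 := by field_simp
  rw [cast_card_ball_one, h2] at h
  simp only [siteForm, coord_comp_blockField, coordBar_comp_blockField]
  exact eq_sub_of_add_eq' h.symm

/-- Pythagoras, the companion of `sum_fluct_twoForm` in degree zero. As both subtract L² times the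
block spin term, the Gaussian form contributes one factor that depends on the block spin alone and
one factor for each site. -/
lemma sum_normSq_blockField (v : Field L 0 × fluct L 0) :
    ∑ y, (Complex.normSq (v.2.1 y) : ℂ) = ∑ y, (Complex.normSq (blockField L v y) : ℂ)
      - (L : ℂ) ^ 2 * Complex.normSq (v.1 (origin L)) := by
  have hL := cast_ne_zero L
  have hs := (mem_fluct_zero_iff _).1 v.2.2
  have hsb : ∑ y, (starRingEnd ℂ) (v.2.1 y) = 0 := by rw [← map_sum, hs, map_zero]
  have h1 : ∀ y, (Complex.normSq (blockField L v y) : ℂ)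
      = (L : ℂ)⁻¹ * (L : ℂ)⁻¹ * Complex.normSq (v.1 (origin L)) +
        (L : ℂ)⁻¹ * v.1 (origin L) * (starRingEnd ℂ) (v.2.1 y) +
        ((L : ℂ)⁻¹ * (starRingEnd ℂ) (v.1 (origin L)) * v.2.1 y + Complex.normSq (v.2.1 y)) := by
    intro y
    rw [blockField_apply, ← Complex.mul_conj, ← Complex.mul_conj, ← Complex.mul_conj, map_add,
      map_mul, map_inv₀, Complex.conj_natCast]
    ring
  simp only [h1, Finset.sum_add_distrib, ← Finset.mul_sum, hs, hsb, mul_zero, add_zero, zero_add,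
    Finset.sum_const, Finset.card_univ, nsmul_eq_mul, cast_card_ball_one]
  field_simp
  ring

/-- The exponential in `gaussForm` is truncated at the real dimension 2(L⁴ - 1) of Ξ. This exceeds
the L⁴ + 1 nilpotent terms to which `sum_pow_mul_prod_add` is applied. -/
lemma card_ball_one_lt_finrank :
    Fintype.card (Option (ball L 1)) ≤ Module.finrank ℝ (fluct L 0) := by
  have h1 := finrank_fluct_add_one (L := L)
  have h2 := finrank_real_of_complex (fluct L 0)
  have h3 : 2 ^ 4 ≤ Fintype.card (ball L 1) := by
    rw [card_ball_one]
    exact Nat.pow_le_pow_left Nat.AtLeastTwo.prop 4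
  rw [Fintype.card_option, h2]
  omega

variable {E : Type*} [AddCommGroup E] [Module ℝ E]

/-- The Gaussian form times a product form, in terms of the field `f'`. -/
lemma map_gaussForm_mul_map_tauProd {β : ℂ} (hβ : β ≠ -1) (g : ℝ → ℂ) (f : E →ₗ[ℝ] fluct L 0)
    (f' : E →ₗ[ℝ] Field L 1) (ζ : fluct L 0) (w : Field L 1) (e r : ℂ) (s t : E →ₗ[ℝ] ℂ)
    (hform : ∑ y, twoForm (coord y ∘ₗ fluctIncl L ∘ₗ f) (coordBar y ∘ₗ fluctIncl L ∘ₗ f)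
      = ∑ y, twoForm (coord y ∘ₗ f') (coordBar y ∘ₗ f') - e • twoForm s t)
    (hr : ∑ y, (Complex.normSq (ζ.1 y) : ℂ) = ∑ y, (Complex.normSq (w y) : ℂ) - e * r) :
    ExteriorAlgebra.map (dualMap f) (gaussForm L 0 β ζ) *
      ExteriorAlgebra.map (dualMap f') (tauProd L 1 g w)
    = Complex.exp ((1 + β) * e * r) •
      (((1 + ((1 + β) * twoPiIInv * e) • twoForm s t) *
        ∏ y, (algebraMap ℂ (evenAlg (E →ₗ[ℝ] ℂ))
          (Complex.exp (-(1 + β) * Complex.normSq (w y)) * g (Complex.normSq (w y))) +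
          (Complex.exp (-(1 + β) * Complex.normSq (w y)) *
            (derivWithin g (Set.Ici 0) (Complex.normSq (w y)) -
              (1 + β) * g (Complex.normSq (w y))) * twoPiIInv) •
            twoForm (coord y ∘ₗ f') (coordBar y ∘ₗ f')) :
        evenAlg (E →ₗ[ℝ] ℂ)) : Ext E) := by
  have hexp : Complex.exp (-((1 + β) * ∑ y, (Complex.normSq (ζ.1 y) : ℂ)))
      = Complex.exp ((1 + β) * e * r) *
        ∏ y, Complex.exp (-(1 + β) * Complex.normSq (w y)) := by
    rw [hr, ← Complex.exp_sum, ← Complex.exp_add, ← Finset.mul_sum]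
    congr 1
    ring
  have h1 := sum_pow_mul_prod_add (t := fun y => twoForm (coord y ∘ₗ f') (coordBar y ∘ₗ f'))
    (q := twoForm s t) (fun y => twoForm_sq _ _) (twoForm_sq _ _)
    (1 + β) twoPiIInv e card_ball_one_lt_finrank
    (fun y => g (Complex.normSq (w y)))
    (fun y => derivWithin g (Set.Ici 0) (Complex.normSq (w y)))
  rw [map_gaussForm hβ, map_tauProd, hform, hexp, ← prod_smul_mul_prod_add, ← h1,
    SetLike.val_smul, MulMemClass.coe_mul, ← smul_smul, smul_mul_assoc, smul_mul_assoc]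

end FormAlgebra

end Hier

section ExteriorContraction

open ExteriorAlgebra

variable {V : Type*} [AddCommGroup V] [Module ℂ V]

/-- The forms `s` and `t` pass through the contractions, and their product annihilates itself. So
the additional factor only adds `e` times the scalar part to the coefficient of `s ∧ t`. -/
lemma contractPairs_one_add_mul_prod_add {k : ℕ} (d d' : Fin k → Module.Dual ℂ V) {ι' : Type*}
    [Fintype ι'] [DecidableEq ι'] (hcard : Fintype.card ι' = k + 1) (x y : ι' → V) (s t : V)
    (hs : ∀ j, d j s = 0) (hs' : ∀ j, d' j s = 0) (ht : ∀ j, d j t = 0) (ht' : ∀ j, d' j t = 0)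
    (c : ℂ) (hx : ∑ i, x i = c • s) (hy : ∑ i, y i = c • t) (J : ι' → ℂ)
    (hJ : ∀ i, contractPairs d d'
      ((∏ j ∈ Finset.univ.erase i, twoForm (x j) (y j) : evenAlg V) : ExteriorAlgebra ℂ V)
        = algebraMap ℂ _ (J i)) (α γ : ι' → ℂ) (e : ℂ) (i₀ : ι') :
    contractPairs d d' (((1 + e • twoForm s t) *
        ∏ i, (algebraMap ℂ (evenAlg V) (α i) + γ i • twoForm (x i) (y i)) :
        evenAlg V) : ExteriorAlgebra ℂ V)
      = algebraMap ℂ _ (∑ i, α i * (∏ j ∈ Finset.univ.erase i, γ j) * J i)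
        + (e * (∑ i, α i * (∏ j ∈ Finset.univ.erase i, γ j) * J i)
          + c * c * ((∏ j, γ j) * J i₀)) • (ι ℂ s * ι ℂ t) := by
  have hQ := contractPairs_prod_add d d' hcard x y (c • s) (c • t)
    (fun j => by rw [map_smul, hs, smul_zero]) (fun j => by rw [map_smul, hs', smul_zero])
    (fun j => by rw [map_smul, ht, smul_zero]) (fun j => by rw [map_smul, ht', smul_zero])
    hx hy J hJ α γ i₀
  set Q : evenAlg V := ∏ i, (algebraMap ℂ (evenAlg V) (α i) + γ i • twoForm (x i) (y i))
  set A := ∑ i, α i * (∏ j ∈ Finset.univ.erase i, γ j) * J i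
  have h1 : (((1 + e • twoForm s t) * Q : evenAlg V) : ExteriorAlgebra ℂ V)
      = (Q : ExteriorAlgebra ℂ V) + e • (ι ℂ s * (ι ℂ t * Q)) := by
    rw [add_mul, one_mul, smul_mul_assoc]
    change (Q : ExteriorAlgebra ℂ V) + e • (ι ℂ s * ι ℂ t * Q) = _
    rw [mul_assoc]
  have h2 : ι ℂ s * (ι ℂ t * (ι ℂ s * ι ℂ t)) = 0 := by
    have := congrArg (Subtype.val) (twoForm_sq s t)
    rw [← mul_assoc]
    exact this
  rw [h1, map_add, map_smul, contractPairs_ι_mul d d' hs hs', contractPairs_ι_mul d d' ht ht', hQ]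
  rw [map_smul, map_smul, smul_mul_smul_comm, smul_smul, mul_add, mul_add, mul_smul_comm,
    mul_smul_comm, h2, smul_zero, add_zero, ← Algebra.commutes, ← Algebra.smul_def, mul_smul_comm,
    smul_smul, add_assoc, ← add_smul]
  congr 2
  ring

end ExteriorContraction

/-! ### Contraction along the fibre. -/

namespace Hier

section FormAlgebra

open ExteriorAlgebra

variable {L : ℕ} [L.AtLeastTwo] {E : Type*} [AddCommGroup E] [Module ℝ E]

/-- Contraction with all fluctuation directions, as in the definition of the fibre integral. -/
noncomputable def contractFluct (E : Type*) [AddCommGroup E] [Module ℝ E] (L : ℕ)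
    [L.AtLeastTwo] : Module.End ℂ (Ext (E × fluct L 0)) :=
  contractPairs (fun j => evalDual ((0 : E), fluctBasis L j))
    (fun j => evalDual ((0 : E), Complex.I • fluctBasis L j))

/-- Only the components of the forms along the fibre count. There the fields at the sites other than
`i` are linear in the basis coordinates, with matrix `siteMatrix i`. -/
lemma contractFluct_prod_erase (f : E × fluct L 0 →ₗ[ℝ] Field L 1)
    (hf : ∀ ζ : fluct L 0, f (0, ζ) = ζ.1) (i : ball L 1) :
    contractFluct E L ((∏ y ∈ Finset.univ.erase i, twoForm (coord y ∘ₗ f) (coordBar y ∘ₗ f) :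
        evenAlg (E × fluct L 0 →ₗ[ℝ] ℂ)) : Ext (E × fluct L 0))
      = algebraMap ℂ _ ((Complex.normSq (siteMatrix i).det : ℂ) *
          (-2 * Complex.I) ^ fluctDim L) := by
  have hI : ∀ i j, (fluctBasis L).coord i (fluctBasis L j) = if i = j then (1 : ℂ) else 0 := by
    intro i j
    rw [Module.Basis.coord_apply, Module.Basis.repr_self, Finsupp.single_apply]
    simp only [eq_comm]
  have hsum : ∀ (j : Fin (fluctDim L)) (ζ : fluct L 0), ζ.1 (siteEquiv i j)
      = ∑ l, siteMatrix i j l * (fluctBasis L).coord l ζ := by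
    intro j ζ
    conv_lhs => rw [← (fluctBasis L).sum_repr ζ]
    rw [← siteMatrix_mulVec]
    rfl
  refine contractPairs_prod_twoForm_eq (dualMap (LinearMap.inr ℝ E (fluct L 0)))
    (fun j => evalDual (fluctBasis L j)) (fun j => evalDual (Complex.I • fluctBasis L j))
    (fun l => ((fluctBasis L).coord l).restrictScalars ℝ)
    (fun l => Complex.conjAe.toLinearMap ∘ₗ ((fluctBasis L).coord l).restrictScalars ℝ)
    (fun l j => hI l j) (fun l j => ?_) (fun l j => ?_) (fun l j => ?_) (Finset.univ.erase i)
    (siteEquiv i) _ _ (siteMatrix i) (fun j => LinearMap.ext fun ζ => ?_)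
    (fun j => LinearMap.ext fun ζ => ?_)
  · change (starRingEnd ℂ) ((fluctBasis L).coord l (fluctBasis L j)) = _
    rw [hI]
    split_ifs <;> simp
  · change (fluctBasis L).coord l (Complex.I • fluctBasis L j) = _
    rw [map_smul, hI]
    split_ifs <;> simp
  · change (starRingEnd ℂ) ((fluctBasis L).coord l (Complex.I • fluctBasis L j)) = _
    rw [map_smul, hI]
    split_ifs <;> simp
  · rw [LinearMap.sum_apply]
    change f (0, ζ) (siteEquiv i j) = ∑ l, siteMatrix i j l * (fluctBasis L).coord l ζ
    rw [hf, hsum]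
  · rw [LinearMap.sum_apply]
    change (starRingEnd ℂ) (f (0, ζ) (siteEquiv i j))
      = ∑ l, (starRingEnd ℂ) (siteMatrix i j l) * (starRingEnd ℂ) ((fluctBasis L).coord l ζ)
    rw [hf, hsum, map_sum]
    simp only [map_mul]

end FormAlgebra

end Hier

namespace Hier

section FormAlgebra

open ExteriorAlgebra

variable {L : ℕ} [L.AtLeastTwo]

lemma twoPiIInv_mul : twoPiIInv * (-2 * Complex.I) = -(Real.pi : ℂ)⁻¹ := by
  have h : (Real.pi : ℂ) ≠ 0 := by exact_mod_cast Real.pi_ne_zero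
  rw [twoPiIInv]
  field_simp

/-- The Jacobian of the coordinates of all sites but `i`, in the normalization of forms. -/
noncomputable def jacobian (i : ball L 1) : ℂ :=
  (-(Real.pi : ℂ)⁻¹) ^ fluctDim L * Complex.normSq (siteMatrix i).det

lemma twoPiIInv_pow_mul (i : ball L 1) : twoPiIInv ^ fluctDim L *
    ((Complex.normSq (siteMatrix i).det : ℂ) * (-2 * Complex.I) ^ fluctDim L) = jacobian i := by
  rw [jacobian, ← twoPiIInv_mul, mul_pow]
  ring

/-- The factor L⁶ is the square of L³, the coefficient of the block spin in the sum of all fields of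
the block. -/
lemma contractFluct_one_add_mul_prod (a e : ℂ) (α γ : ball L 1 → ℂ) (i₀ : ball L 1) :
    contractFluct (Field L 0) L (((1 + (a * twoPiIInv * e) •
        twoForm (spinCoord L) (spinCoordBar L)) *
        ∏ y, (algebraMap ℂ (evenAlg (Field L 0 × fluct L 0 →ₗ[ℝ] ℂ)) (α y) +
          (γ y * twoPiIInv) • twoForm (coord y ∘ₗ blockField L) (coordBar y ∘ₗ blockField L)) :
        evenAlg (Field L 0 × fluct L 0 →ₗ[ℝ] ℂ)) : Ext (Field L 0 × fluct L 0))
      = algebraMap ℂ _ (∑ i, α i * (∏ j ∈ Finset.univ.erase i, γ j) * jacobian i)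
        + ((a * e * (∑ i, α i * (∏ j ∈ Finset.univ.erase i, γ j) * jacobian i)
          + (L : ℂ) ^ 6 * ((∏ j, γ j) * jacobian i₀)) * twoPiIInv) •
          (ι ℂ (spinCoord L) * ι ℂ (spinCoordBar L)) := by
  have hcard : Fintype.card (ball L 1) = fluctDim L + 1 := finrank_fluct_add_one.symm
  have h := contractPairs_one_add_mul_prod_add
    (fun j => evalDual ((0 : Field L 0), fluctBasis L j))
    (fun j => evalDual ((0 : Field L 0), Complex.I • fluctBasis L j)) hcard
    (fun y => coord y ∘ₗ blockField L) (fun y => coordBar y ∘ₗ blockField L)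
    (spinCoord L) (spinCoordBar L) (fun _ => rfl) (fun _ => rfl)
    (fun _ => map_zero (starRingEnd ℂ)) (fun _ => map_zero (starRingEnd ℂ)) ((L : ℂ) ^ 3)
    sum_coord_comp_blockField sum_coordBar_comp_blockField
    (fun i => (Complex.normSq (siteMatrix i).det : ℂ) * (-2 * Complex.I) ^ fluctDim L)
    (fun i => contractFluct_prod_erase (blockField L) (fun ζ => ?_) i) α
    (fun y => γ y * twoPiIInv) (a * twoPiIInv * e) i₀
  · have h1 : ∀ i : ball L 1, α i * (∏ j ∈ Finset.univ.erase i, γ j * twoPiIInv) *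
        ((Complex.normSq (siteMatrix i).det : ℂ) * (-2 * Complex.I) ^ fluctDim L)
        = α i * (∏ j ∈ Finset.univ.erase i, γ j) * jacobian i := by
      intro i
      rw [Finset.prod_mul_distrib, Finset.prod_const, Finset.card_erase_of_mem (Finset.mem_univ i),
        Finset.card_univ, hcard, Nat.add_sub_cancel, ← twoPiIInv_pow_mul]
      ring
    have h2 : (∏ j, γ j * twoPiIInv) *
        ((Complex.normSq (siteMatrix i₀).det : ℂ) * (-2 * Complex.I) ^ fluctDim L)
        = (∏ j, γ j) * jacobian i₀ * twoPiIInv := by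
      rw [Finset.prod_mul_distrib, Finset.prod_const, Finset.card_univ, hcard, pow_succ,
        ← twoPiIInv_pow_mul]
      ring
    refine Eq.trans h ?_
    simp only [h1, h2]
    congr 2
    ring
  · funext y
    rw [blockField_apply]
    simp

/-- The integrand of the fluctuation integral, as a form in the block spin. -/
lemma map_inl_contractFluct {β : ℂ} (hβ : β ≠ -1) (g : ℝ → ℂ) (φ : Field L 0) (ζ : fluct L 0)
    (i₀ : ball L 1) {w : Field L 1} (hw : w = blockField L (φ, ζ)) {F F' : ℝ → ℂ}
    (hF : ∀ y, F (Complex.normSq (w y)) =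
      Complex.exp (-(1 + β) * Complex.normSq (w y)) * g (Complex.normSq (w y)))
    (hF' : ∀ y, F' (Complex.normSq (w y)) = Complex.exp (-(1 + β) * Complex.normSq (w y)) *
            (derivWithin g (Set.Ici 0) (Complex.normSq (w y)) -
              (1 + β) * g (Complex.normSq (w y)))) :
    ExteriorAlgebra.map (dualMap (LinearMap.inl ℝ (Field L 0) (fluct L 0)))
      (contractFluct (Field L 0) L
        (ExteriorAlgebra.map (dualMap (LinearMap.snd ℝ (Field L 0) (fluct L 0)))
          (gaussForm L 0 β ζ) * ExteriorAlgebra.map (dualMap (blockField L)) (tauProd L 1 g w)))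
      = Complex.exp ((1 + β) * (L : ℂ) ^ 2 * Complex.normSq (φ (origin L))) •
        (algebraMap ℂ _ (∑ i, F (Complex.normSq (w i)) *
            (∏ y ∈ Finset.univ.erase i, F' (Complex.normSq (w y))) * jacobian i)
        + (((1 + β) * (L : ℂ) ^ 2 * (∑ i, F (Complex.normSq (w i)) *
            (∏ y ∈ Finset.univ.erase i, F' (Complex.normSq (w y))) * jacobian i)
          + (L : ℂ) ^ 6 * ((∏ y, F' (Complex.normSq (w y))) * jacobian i₀)) * twoPiIInv) •
          (dOf (coord (origin L)) * dOf (coordBar (origin L)))) := by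
  subst hw
  have h1 := map_gaussForm_mul_map_tauProd hβ g (LinearMap.snd ℝ (Field L 0) (fluct L 0))
    (blockField L) ζ (blockField L (φ, ζ)) ((L : ℂ) ^ 2) (Complex.normSq (φ (origin L)))
    (spinCoord L) (spinCoordBar L) sum_fluct_twoForm (sum_normSq_blockField (φ, ζ))
  simp only [← hF, ← hF'] at h1
  have h2 := contractFluct_one_add_mul_prod (L := L) (1 + β) ((L : ℂ) ^ 2)
    (fun y => F (Complex.normSq (blockField L (φ, ζ) y)))
    (fun y => F' (Complex.normSq (blockField L (φ, ζ) y))) i₀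
  have h3 := congrArg (contractFluct (Field L 0) L) h1
  rw [map_smul, h2] at h3
  refine (congrArg (ExteriorAlgebra.map (dualMap (LinearMap.inl ℝ (Field L 0) (fluct L 0))))
    h3).trans ?_
  rw [map_smul, map_add, map_smul, map_mul, AlgHom.commutes, map_apply_ι, map_apply_ι]
  rfl

lemma map_dualMap_map_dualMap {E₁ E₂ E₃ : Type*} [AddCommGroup E₁] [Module ℝ E₁]
    [AddCommGroup E₂] [Module ℝ E₂] [AddCommGroup E₃] [Module ℝ E₃] (f : E₁ →ₗ[ℝ] E₂)
    (f' : E₂ →ₗ[ℝ] E₃) (x : Ext E₃) :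
    ExteriorAlgebra.map (dualMap f) (ExteriorAlgebra.map (dualMap f') x)
      = ExteriorAlgebra.map (dualMap (f' ∘ₗ f)) x := by
  rw [← AlgHom.comp_apply, ExteriorAlgebra.map_comp_map]
  rfl

/-- A linear map of the base leaves the fibre directions alone, so it commutes with contraction
along them and with restriction to the base. -/
lemma map_contractFluct {E₁ E₂ : Type*} [AddCommGroup E₁] [Module ℝ E₁]
    [AddCommGroup E₂] [Module ℝ E₂] (f : E₁ →ₗ[ℝ] E₂) (x : Ext (E₂ × fluct L 0)) :
    ExteriorAlgebra.map (dualMap f) (ExteriorAlgebra.map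
      (dualMap (LinearMap.inl ℝ E₂ (fluct L 0))) (contractFluct E₂ L x))
      = ExteriorAlgebra.map (dualMap (LinearMap.inl ℝ E₁ (fluct L 0)))
        (contractFluct E₁ L (ExteriorAlgebra.map
          (dualMap (f.prodMap (LinearMap.id : fluct L 0 →ₗ[ℝ] fluct L 0))) x)) := by
  have hd : ∀ e : fluct L 0, evalDual ((0 : E₁), e) ∘ₗ
      dualMap (f.prodMap (LinearMap.id : fluct L 0 →ₗ[ℝ] fluct L 0)) = evalDual ((0 : E₂), e) := by
    intro e
    refine LinearMap.ext fun w => ?_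
    change w (f 0, e) = w (0, e)
    rw [map_zero]
  have hc := map_contractPairs
    (dualMap (f.prodMap (LinearMap.id : fluct L 0 →ₗ[ℝ] fluct L 0)))
    (fun j => evalDual ((0 : E₁), fluctBasis L j))
    (fun j => evalDual ((0 : E₁), Complex.I • fluctBasis L j)) x
  simp only [hd] at hc
  refine Eq.trans ?_ (congrArg (ExteriorAlgebra.map (dualMap (LinearMap.inl ℝ E₁ (fluct L 0)))) hc)
  rw [map_dualMap_map_dualMap, map_dualMap_map_dualMap]
  have h : LinearMap.inl ℝ E₂ (fluct L 0) ∘ₗ f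
      = f.prodMap (LinearMap.id : fluct L 0 →ₗ[ℝ] fluct L 0) ∘ₗ LinearMap.inl ℝ E₁ (fluct L 0) :=
    LinearMap.ext fun v => rfl
  rw [h]
  rfl

/-- The pullback of the integrand of the fluctuation integral. -/
lemma map_scaleField_contractFluct (β : ℂ) (g : ℝ → ℂ) (φ : Field L 0) (ζ : fluct L 0) :
    ExteriorAlgebra.map (dualMap (scaleField L 0))
      (ExteriorAlgebra.map (dualMap (LinearMap.inl ℝ (Field L 1) (fluct L 0)))
      (contractFluct (Field L 1) L
        ((pullback (LinearMap.snd ℝ (Field L 1) (fluct L 0)) (gaussForm L 0 β) *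
          pullback (LinearMap.coprod LinearMap.id (fluctIncl L)) (tauProd L 1 g))
            (scaleField L 0 φ, ζ))))
      = ExteriorAlgebra.map (dualMap (LinearMap.inl ℝ (Field L 0) (fluct L 0)))
      (contractFluct (Field L 0) L
        (ExteriorAlgebra.map (dualMap (LinearMap.snd ℝ (Field L 0) (fluct L 0)))
          (gaussForm L 0 β ζ) * ExteriorAlgebra.map (dualMap (blockField L))
            (tauProd L 1 g (blockField L (φ, ζ))))) := by
  have h1 : LinearMap.coprod LinearMap.id (fluctIncl L) ∘ₗ
      (scaleField L 0).prodMap (LinearMap.id : fluct L 0 →ₗ[ℝ] fluct L 0) = blockField L :=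
    LinearMap.ext fun v => rfl
  have h2 : LinearMap.snd ℝ (Field L 1) (fluct L 0) ∘ₗ
      (scaleField L 0).prodMap (LinearMap.id : fluct L 0 →ₗ[ℝ] fluct L 0)
      = LinearMap.snd ℝ (Field L 0) (fluct L 0) :=
    LinearMap.ext fun v => rfl
  refine (map_contractFluct (scaleField L 0) _).trans ?_
  congr 2
  refine (map_mul _ _ _).trans ?_
  refine congrArg₂ (· * ·) ?_ ?_
  · refine (map_dualMap_map_dualMap _ _ _).trans ?_
    exact congrArg (fun f => ExteriorAlgebra.map (dualMap f) (gaussForm L 0 β ζ)) h2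
  · refine (map_dualMap_map_dualMap _ _ _).trans ?_
    exact congrArg (fun f => ExteriorAlgebra.map (dualMap f)
      (tauProd L 1 g (blockField L (φ, ζ)))) h1

end FormAlgebra

end Hier

/-! ### Vector valued integrals and integration over the fluctuation coordinates. -/

namespace Hier

section VecIntegral

variable {X V W : Type*} [MeasurableSpace X] [AddCommGroup V] [Module ℂ V] [AddCommGroup W]
  [Module ℂ W] {μ : Measure X} {f : X → V} {v v' : V}

/-- Linear functionals separate the points of a complex vector space, also in infinite dimension. -/
lemma IsVecIntegral.unique (h : IsVecIntegral μ f v) (h' : IsVecIntegral μ f v') : v = v' := by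
  rw [← sub_eq_zero, ← Module.forall_dual_apply_eq_zero_iff ℂ]
  intro l
  rw [map_sub, ← (h l).2, ← (h' l).2, sub_self]

lemma IsVecIntegral.vecIntegral_eq (h : IsVecIntegral μ f v) : vecIntegral μ f = v := by
  have he : ∃ v, IsVecIntegral μ f v := ⟨v, h⟩
  rw [vecIntegral, dif_pos he]
  exact he.choose_spec.unique h

lemma IsVecIntegral.map (T : V →ₗ[ℂ] W) (h : IsVecIntegral μ f v) :
    IsVecIntegral μ (fun x => T (f x)) (T v) := fun l => h (l ∘ₗ T)

lemma isVecIntegral_sum_smul {ι : Type*} (s : Finset ι) (c : ι → X → ℂ) (e : ι → V)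
    (hc : ∀ i ∈ s, Integrable (c i) μ) :
    IsVecIntegral μ (fun x => ∑ i ∈ s, c i x • e i) (∑ i ∈ s, (∫ x, c i x ∂μ) • e i) := by
  intro l
  simp only [map_sum, map_smul, smul_eq_mul]
  refine ⟨integrable_finsetSum _ fun i hi => (hc i hi).mul_const _, ?_⟩
  rw [integral_finsetSum _ fun i hi => (hc i hi).mul_const _]
  simp only [integral_mul_const]

lemma isVecIntegral_smul_add_smul {p q : X → ℂ} (hp : Integrable p μ) (hq : Integrable q μ)
    (a b : V) : IsVecIntegral μ (fun x => p x • a + q x • b)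
      ((∫ x, p x ∂μ) • a + (∫ x, q x ∂μ) • b) := by
  intro l
  simp only [map_add, map_smul, smul_eq_mul]
  refine ⟨(hp.mul_const _).add (hq.mul_const _), ?_⟩
  rw [integral_add (hp.mul_const _) (hq.mul_const _), integral_mul_const, integral_mul_const]

/-- Expanding the product gives finitely many fixed vectors with scalar coefficients, so
integrability of the coefficients suffices. Existence must be proved, because `vecIntegral` is 0
otherwise. -/
lemma exists_isVecIntegral_mul_prod_add {ι : Type*} [Fintype ι] [DecidableEq ι]
    (A : ExteriorAlgebra ℂ V →ₗ[ℂ] W) (Y : evenAlg V) (t : ι → evenAlg V) (α γ : ι → X → ℂ)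
    (h : ∀ S : Finset ι, Integrable (fun x => (∏ i ∈ S, α i x) * ∏ i ∈ Finset.univ \ S, γ i x) μ) :
    ∃ w, IsVecIntegral μ (fun x => A ((Y * ∏ i, (algebraMap ℂ (evenAlg V) (α i x) + γ i x • t i) :
      evenAlg V) : ExteriorAlgebra ℂ V)) w := by
  have he : ∀ x, A ((Y * ∏ i, (algebraMap ℂ (evenAlg V) (α i x) + γ i x • t i) : evenAlg V) :
      ExteriorAlgebra ℂ V)
      = ∑ S ∈ Finset.univ.powerset, ((∏ i ∈ S, α i x) * ∏ i ∈ Finset.univ \ S, γ i x) •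
        A ((Y * ∏ i ∈ Finset.univ \ S, t i : evenAlg V) : ExteriorAlgebra ℂ V) := by
    intro x
    rw [Finset.prod_add, Finset.mul_sum, AddSubmonoidClass.coe_finsetSum, map_sum]
    refine Finset.sum_congr rfl fun S _ => ?_
    rw [← map_smul, ← SetLike.val_smul]
    congr 2
    simp only [Algebra.smul_def, Finset.prod_mul_distrib, map_prod, map_mul]
    ring
  simp only [he]
  exact ⟨_, isVecIntegral_sum_smul _ _ _ fun S _ => h S⟩

end VecIntegral

section Fluctuations

variable {L : ℕ} [L.AtLeastTwo]

/-- The field on the block with fluctuation coordinates `z`. -/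
noncomputable def blockSpin (φ : Field L 0) (z : Fin (fluctDim L) → ℂ) : Field L 1 :=
  blockField L (φ, ∑ j, z j • fluctBasis L j)

lemma blockSpin_apply (φ : Field L 0) (z : Fin (fluctDim L) → ℂ) (y : ball L 1) :
    blockSpin φ z y = (L : ℂ)⁻¹ * φ (origin L) + ∑ j, z j * (fluctBasis L j).1 y := by
  rw [blockSpin, blockField_apply]
  congr 1
  simp

lemma continuous_blockSpin (φ : Field L 0) (y : ball L 1) :
    Continuous fun z => blockSpin φ z y := by
  simp only [blockSpin_apply]
  fun_prop

/-- The constant contribution of the block spin to the field on the block. -/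
noncomputable def spinShift (φ : Field L 0) : Fin (fluctDim L) → ℂ :=
  fun _ => (L : ℂ)⁻¹ * φ (origin L)

lemma blockSpin_siteEquiv (φ : Field L 0) (z : Fin (fluctDim L) → ℂ) (i : ball L 1)
    (j : Fin (fluctDim L)) : blockSpin φ z (siteEquiv i j)
      = (spinShift φ + (siteMatrix i).mulVec z) j := by
  rw [Pi.add_apply, siteMatrix_mulVec, blockSpin, blockField_apply]
  rfl

lemma sum_blockSpin (φ : Field L 0) (z : Fin (fluctDim L) → ℂ) :
    ∑ y, blockSpin φ z y = (L : ℂ) ^ 3 * φ (origin L) := by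
  have h := LinearMap.congr_fun (sum_coord_comp_blockField (L := L))
    (φ, ∑ j, z j • fluctBasis L j)
  rw [LinearMap.sum_apply] at h
  exact h

lemma blockSpin_self (φ : Field L 0) (z : Fin (fluctDim L) → ℂ) (i : ball L 1) :
    blockSpin φ z i = (L : ℂ) ^ 3 * φ (origin L) -
      ∑ j, (spinShift φ + (siteMatrix i).mulVec z) j := by
  rw [← sum_blockSpin φ z, sum_eq_add_sum_equiv (siteEquiv i)]
  simp only [blockSpin_siteEquiv, add_sub_cancel_right]

/-- The fields at all sites but one are an affine change of variables from `z`; their Gaussian decay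
dominates, and the exponential at the remaining site is at most one. -/
lemma integrable_prod_blockSpin (φ : Field L 0) {δ C : ℝ} (hδ : 0 < δ)
    {h : ball L 1 → (Fin (fluctDim L) → ℂ) → ℂ} (hc : ∀ y, Continuous (h y))
    (hb : ∀ y z, ‖h y z‖ ≤ C * Real.exp (-δ * Complex.normSq (blockSpin φ z y))) :
    Integrable fun z => ∏ y, h y z := by
  set i : ball L 1 := ⟨0, zero_mem_ball L 1⟩
  have hC : 0 ≤ C := by
    have := (norm_nonneg _).trans (hb i 0)
    exact nonneg_of_mul_nonneg_left this (Real.exp_pos _)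
  have hI := integrable_comp_add_mulVec (siteMatrix i) (det_siteMatrix_ne_zero i)
    (spinShift φ)
    (integrable_prod_exp_neg_normSq (k := fluctDim L) hδ).ofReal
  refine (hI.norm.const_mul (C ^ Fintype.card (ball L 1))).mono'
    (continuous_finsetProd _ fun y _ => hc y).aestronglyMeasurable
    (Filter.Eventually.of_forall fun z => ?_)
  rw [norm_prod]
  refine (Finset.prod_le_prod (fun y _ => norm_nonneg _) fun y _ => hb y z).trans ?_
  rw [Finset.prod_mul_distrib, Finset.prod_const, Finset.card_univ]
  refine mul_le_mul_of_nonneg_left ?_ (pow_nonneg hC _)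
  rw [prod_eq_mul_prod_equiv (siteEquiv i)]
  simp only [blockSpin_siteEquiv]
  rw [RCLike.norm_ofReal, abs_of_nonneg (Finset.prod_nonneg fun _ _ => (Real.exp_pos _).le)]
  refine mul_le_of_le_one_left (Finset.prod_nonneg fun _ _ => (Real.exp_pos _).le) ?_
  rw [Real.exp_le_one_iff]
  nlinarith [mul_nonneg hδ.le (Complex.normSq_nonneg (blockSpin φ z i))]

/-- Change of variables from fluctuations to the field at all sites but `i`. -/
lemma integral_blockSpin (φ : Field L 0) (i : ball L 1) {F F' : ℝ → ℂ} :
    ∫ z, F (Complex.normSq (blockSpin φ z i)) *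
        (∏ y ∈ Finset.univ.erase i, F' (Complex.normSq (blockSpin φ z y))) * jacobian i
      = (-(Real.pi : ℂ)⁻¹) ^ fluctDim L * ∫ w : Fin (fluctDim L) → ℂ,
          F (Complex.normSq ((L : ℂ) ^ 3 * φ (origin L) - ∑ j, w j)) *
            ∏ j, F' (Complex.normSq (w j)) := by
  have h := integral_comp_add_mulVec (siteMatrix i) (det_siteMatrix_ne_zero i)
    (spinShift φ)
    (fun w => F (Complex.normSq ((L : ℂ) ^ 3 * φ (origin L) - ∑ j, w j)) *
            ∏ j, F' (Complex.normSq (w j)))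
  rw [← h, ← mul_assoc, ← jacobian, integral_mul_const, mul_comm]
  congr 1
  refine integral_congr_ae (Filter.Eventually.of_forall fun z => ?_)
  simp only
  rw [← Finset.prod_coe_sort, ← Equiv.prod_comp (siteEquiv i)]
  simp only [blockSpin_siteEquiv, ← blockSpin_self]

end Fluctuations

end Hier

section Superposition

open Set Filter Topology

variable {Ω : Type*} [MeasurableSpace Ω] {μ : Measure Ω} {ρ v : Ω → ℂ}

lemma expSuperposition_const_add (a : ℂ) (t : ℝ) :
    expSuperposition μ ρ (fun q => a + v q) t
      = Complex.exp (-a * t) * expSuperposition μ ρ v t := by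
  rw [expSuperposition, expSuperposition, ← integral_const_mul]
  congr 1
  funext q
  rw [neg_add, add_mul, Complex.exp_add]
  ring

lemma norm_expSuperposition_le {δ : ℝ} (hδ : ∀ q, δ ≤ (v q).re) (hρ : Integrable ρ μ) {t : ℝ}
    (ht : 0 ≤ t) :
    ‖expSuperposition μ ρ v t‖ ≤ (∫ q, ‖ρ q‖ ∂μ) * Real.exp (-δ * t) := by
  rw [expSuperposition, ← integral_mul_const]
  refine norm_integral_le_of_norm_le (hρ.norm.mul_const _) (Eventually.of_forall fun q => ?_)
  rw [norm_mul]
  exact mul_le_mul_of_nonneg_left (norm_cexp_neg_mul_le (hδ q) ht) (norm_nonneg _)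

lemma continuousOn_expSuperposition (hv : AEStronglyMeasurable v μ) (hv0 : ∀ q, 0 ≤ (v q).re)
    (hρ : Integrable ρ μ) : ContinuousOn (expSuperposition μ ρ v) (Ici 0) := by
  refine continuousOn_of_dominated (bound := fun q => ‖ρ q‖) (fun t ht => ?_) (fun t ht => ?_)
    hρ.norm (Eventually.of_forall fun q => ?_)
  · exact (integrable_expSuperposition hv hv0 hρ ht).aestronglyMeasurable
  · refine Eventually.of_forall fun q => ?_
    rw [norm_mul]
    refine mul_le_of_le_one_right (norm_nonneg _) ?_
    have := norm_cexp_neg_mul_le (hv0 q) ht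
    simpa using this
  · refine Continuous.continuousOn ?_
    have := Complex.continuous_ofReal
    fun_prop

end Superposition

/-! ### Fluctuation integrals of superpositions. -/

namespace Hier

section RGForm

open Set

variable {L : ℕ} [L.AtLeastTwo] {Ω : Type*} [MeasurableSpace Ω] {μ : Measure Ω} [SigmaFinite μ]
  {ρ D : Ω → ℂ} {δ : ℝ}

lemma continuous_normSq_blockSpin (φ : Field L 0) (y : ball L 1) :
    Continuous fun z => Complex.normSq (blockSpin φ z y) :=
  Complex.continuous_normSq.comp (continuous_blockSpin φ y)

omit [SigmaFinite μ] in
lemma continuous_expSuperposition_blockSpin (hD : Measurable D) (hδ : 0 < δ)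
    (hDδ : ∀ q, δ ≤ (D q).re) (hρ : Integrable ρ μ) (φ : Field L 0) (y : ball L 1) :
    Continuous fun z => expSuperposition μ ρ D (Complex.normSq (blockSpin φ z y)) :=
  (continuousOn_expSuperposition hD.aestronglyMeasurable (fun q => hδ.le.trans (hDδ q))
    hρ).comp_continuous (continuous_normSq_blockSpin φ y) fun _ => Complex.normSq_nonneg _

omit [SigmaFinite μ] in
/-- The integrals that occur as coefficients in the fluctuation integral. -/
lemma integrable_prod_expSuperposition_blockSpin (hD : Measurable D) (hδ : 0 < δ)
    (hDδ : ∀ q, δ ≤ (D q).re) {ρ : ball L 1 → Ω → ℂ} (hρ : ∀ y, Integrable (ρ y) μ)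
    (φ : Field L 0) :
    Integrable fun z => ∏ y, expSuperposition μ (ρ y) D (Complex.normSq (blockSpin φ z y)) := by
  refine integrable_prod_blockSpin φ (C := ∑ y, ∫ q, ‖ρ y q‖ ∂μ) hδ
    (fun y => continuous_expSuperposition_blockSpin hD hδ hDδ (hρ y) φ y) fun y z => ?_
  refine (norm_expSuperposition_le hDδ (hρ y) (Complex.normSq_nonneg _)).trans ?_
  refine mul_le_mul_of_nonneg_right ?_ (Real.exp_pos _).le
  exact Finset.single_le_sum (f := fun y => ∫ q, ‖ρ y q‖ ∂μ)
    (fun y _ => integral_nonneg fun q => norm_nonneg _) (Finset.mem_univ y)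

omit [L.AtLeastTwo] in
lemma normSq_cube_mul (φ : Field L 0) :
    (Complex.normSq ((L : ℂ) ^ 3 * φ (origin L)) : ℂ)
      = (L : ℂ) ^ 6 * Complex.normSq (φ (origin L)) := by
  rw [map_mul, map_pow, Complex.normSq_natCast]
  push_cast
  ring

/-- The constrained Gaussian integral with u = ∑ w_y = L³ φ. The factor |L³|² = L⁶ is the one that
appears in `blockRate`. -/
lemma integral_blockSpin_expSuperposition (hD : Measurable D) (hδ : 0 < δ)
    (hDδ : ∀ q, δ ≤ (D q).re) {ρ₀ : Ω → ℂ} (hρ₀ : Integrable ρ₀ μ)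
    (hDρ : Integrable (fun q => -D q * ρ q) μ) (φ : Field L 0) (i : ball L 1) :
    Integrable (fun z => expSuperposition μ ρ₀ D (Complex.normSq (blockSpin φ z i)) *
        (∏ y ∈ Finset.univ.erase i, expSuperposition μ (fun q => -D q * ρ q) D
          (Complex.normSq (blockSpin φ z y))) * jacobian i) ∧
    ∫ z, expSuperposition μ ρ₀ D (Complex.normSq (blockSpin φ z i)) *
        (∏ y ∈ Finset.univ.erase i, expSuperposition μ (fun q => -D q * ρ q) D
          (Complex.normSq (blockSpin φ z y))) * jacobian i
      = ∫ o : ball L 1 → Ω, (ρ₀ (o i) * ∏ j, ρ (o (siteEquiv i j))) *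
          ((∑ y, (D (o y))⁻¹)⁻¹ / D (o i) * Complex.exp (-((L : ℂ) ^ 6 *
            (∑ y, (D (o y))⁻¹)⁻¹) * Complex.normSq (φ (origin L)))) ∂(Measure.pi fun _ => μ) := by
  constructor
  · refine Integrable.mul_const ?_ _
    have h := integrable_prod_expSuperposition_blockSpin hD hδ hDδ
      (ρ := fun y => if y = i then ρ₀ else fun q => -D q * ρ q)
      (fun y => by split_ifs; exacts [hρ₀, hDρ]) φ
    refine h.congr (Filter.Eventually.of_forall fun z => ?_)
    simp only
    rw [← Finset.mul_prod_erase _ _ (Finset.mem_univ i), if_pos rfl]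
    congr 1
    refine Finset.prod_congr rfl fun y hy => ?_
    rw [if_neg (Finset.ne_of_mem_erase hy)]
  · rw [integral_blockSpin φ i (F := expSuperposition μ ρ₀ D)
      (F' := expSuperposition μ (fun q => -D q * ρ q) D),
      (integral_prod_expSuperposition hD hδ hDδ hρ₀ hDρ (siteEquiv i) _).2]
    congr 1
    funext o
    rw [normSq_cube_mul]
    congr 3
    ring

end RGForm

end Hier

namespace Hier

section RGForm

open Set

variable {L : ℕ} [L.AtLeastTwo] {Ω : Type*} [MeasurableSpace Ω] {μ : Measure Ω} [SigmaFinite μ]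
  {ρ D : Ω → ℂ} {δ : ℝ}

/-- The harmonic sum `(∑_y D_y⁻¹)⁻¹` over the block. -/
noncomputable def harmonicSum (D : ball L 1 → ℂ) : ℂ := (∑ y, (D y)⁻¹)⁻¹

instance : Nonempty (ball L 1) := ⟨⟨0, zero_mem_ball L 1⟩⟩

/-- The term in which site `i` contributes its scalar part carries the weight H / D_i, where H is
the harmonic sum. These weights add up to one, so no prefactor is left: the supersymmetric
normalization of the integral. -/
lemma integral_sum_blockSpin (hD : Measurable D) (hδ : 0 < δ)
    (hDδ : ∀ q, δ ≤ (D q).re) (hρ : Integrable ρ μ)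
    (hDρ : Integrable (fun q => -D q * ρ q) μ) (φ : Field L 0) :
    Integrable (fun z => ∑ i, expSuperposition μ ρ D (Complex.normSq (blockSpin φ z i)) *
        (∏ y ∈ Finset.univ.erase i, expSuperposition μ (fun q => -D q * ρ q) D
          (Complex.normSq (blockSpin φ z y))) * jacobian i) ∧
    ∫ z, ∑ i, expSuperposition μ ρ D (Complex.normSq (blockSpin φ z i)) *
        (∏ y ∈ Finset.univ.erase i, expSuperposition μ (fun q => -D q * ρ q) D
          (Complex.normSq (blockSpin φ z y))) * jacobian i
      = expSuperposition (Measure.pi fun _ : ball L 1 => μ) (fun o => ∏ y, ρ (o y))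
        (fun o => (L : ℂ) ^ 6 * harmonicSum fun y => D (o y))
          (Complex.normSq (φ (origin L))) := by
  have h := fun i => integral_blockSpin_expSuperposition hD hδ hDδ hρ hDρ φ i
  refine ⟨integrable_finsetSum _ fun i _ => (h i).1, ?_⟩
  rw [integral_finsetSum _ fun i _ => (h i).1]
  simp only [(h _).2]
  rw [← integral_finsetSum]
  · rw [expSuperposition]
    congr 1
    funext o
    simp only [← prod_eq_mul_prod_equiv (siteEquiv _) fun y => ρ (o y)]
    rw [← Finset.mul_sum, ← Finset.sum_mul]
    have hne := sum_inv_ne_zero (D := fun y : ball L 1 => D (o y)) fun y => hδ.trans_le (hDδ _)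
    have h1 : ∑ i, (∑ y, (D (o y))⁻¹)⁻¹ / D (o i) = 1 := by
      simp only [div_eq_mul_inv]
      rw [← Finset.mul_sum, inv_mul_cancel₀ hne]
    rw [h1, one_mul, harmonicSum]
  · intro i _
    have h2 := (integral_prod_expSuperposition hD hδ hDδ hρ hDρ (siteEquiv i)
      ((L : ℂ) ^ 3 * φ (origin L))).1
    refine h2.congr (Filter.Eventually.of_forall fun o => ?_)
    simp only
    rw [normSq_cube_mul]
    congr 3
    ring

omit [MeasurableSpace Ω] in
lemma neg_mul_prod_mul_div (hδ : 0 < δ) (hDδ : ∀ q, δ ≤ (D q).re) (i : ball L 1)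
    (o : ball L 1 → Ω) (x : ℂ) :
    (-D (o i) * ρ (o i) * ∏ j, ρ (o (siteEquiv i j))) * ((∑ y, (D (o y))⁻¹)⁻¹ / D (o i) * x)
      = -(harmonicSum fun y => D (o y)) * (∏ y, ρ (o y)) * x := by
  have hD0 : D (o i) ≠ 0 := fun h => by
    have := hδ.trans_le (hDδ (o i))
    rw [h] at this
    simp at this
  rw [prod_eq_mul_prod_equiv (siteEquiv i) fun y => ρ (o y), harmonicSum]
  field_simp

/-- The integrability half of `integral_prod_expSuperposition`, taken at u = 0 and with -Dρ also at
the distinguished site. -/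
lemma integrable_harmonicSum_mul_prod (hD : Measurable D) (hδ : 0 < δ)
    (hDδ : ∀ q, δ ≤ (D q).re) (hDρ : Integrable (fun q => -D q * ρ q) μ) :
    Integrable (fun o : ball L 1 → Ω => -(harmonicSum fun y => D (o y)) * ∏ y, ρ (o y))
      (Measure.pi fun _ => μ) := by
  have h := (integral_prod_expSuperposition hD hδ hDδ hDρ hDρ (siteEquiv ⟨0, zero_mem_ball L 1⟩) 0).1
  refine h.congr (Filter.Eventually.of_forall fun o => ?_)
  simp only
  rw [neg_mul_prod_mul_div hδ hDδ]
  simp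

/-- With -D also at the distinguished site, its weight H / D_i turns into -H. Up to L⁶ this is the
factor that differentiation brings down from the superposition in `integral_sum_blockSpin`. -/
lemma integral_prod_blockSpin (hD : Measurable D) (hδ : 0 < δ)
    (hDδ : ∀ q, δ ≤ (D q).re)
    (hDρ : Integrable (fun q => -D q * ρ q) μ) (φ : Field L 0) (i : ball L 1) :
    Integrable (fun z => (∏ y, expSuperposition μ (fun q => -D q * ρ q) D
          (Complex.normSq (blockSpin φ z y))) * jacobian i) ∧
    ∫ z, (∏ y, expSuperposition μ (fun q => -D q * ρ q) D
          (Complex.normSq (blockSpin φ z y))) * jacobian i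
      = expSuperposition (Measure.pi fun _ : ball L 1 => μ)
        (fun o => -(harmonicSum fun y => D (o y)) * ∏ y, ρ (o y))
        (fun o => (L : ℂ) ^ 6 * harmonicSum fun y => D (o y))
          (Complex.normSq (φ (origin L))) := by
  have h := integral_blockSpin_expSuperposition hD hδ hDδ hDρ hDρ φ i
  have hp : ∀ z, expSuperposition μ (fun q => -D q * ρ q) D (Complex.normSq (blockSpin φ z i)) *
        (∏ y ∈ Finset.univ.erase i, expSuperposition μ (fun q => -D q * ρ q) D
          (Complex.normSq (blockSpin φ z y)))
      = ∏ y, expSuperposition μ (fun q => -D q * ρ q) D (Complex.normSq (blockSpin φ z y)) :=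
    fun z => Finset.mul_prod_erase _ (fun y => expSuperposition μ (fun q => -D q * ρ q) D
      (Complex.normSq (blockSpin φ z y))) (Finset.mem_univ i)
  simp only [hp] at h
  refine ⟨h.1, h.2.trans ?_⟩
  rw [expSuperposition]
  simp only [neg_mul_prod_mul_div hδ hDδ]
  congr 1

end RGForm

end Hier

namespace Hier

section RGForm

open Set ExteriorAlgebra

variable {L : ℕ} [L.AtLeastTwo] {Ω : Type*} [MeasurableSpace Ω] {μ : Measure Ω} [SigmaFinite μ]
  {ρ v : Ω → ℂ} {δ : ℝ}

/-- The integrand of the fluctuation integral. -/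
noncomputable def fluctIntegrand (L : ℕ) [L.AtLeastTwo] (β : ℂ) (g : ℝ → ℂ) (φ : Field L 0)
    (z : Fin (fluctDim L) → ℂ) : Ext (Field L 1) :=
  ExteriorAlgebra.map (dualMap (LinearMap.inl ℝ (Field L 1) (fluct L 0)))
    (contractFluct (Field L 1) L
      ((pullback (LinearMap.snd ℝ (Field L 1) (fluct L 0)) (gaussForm L 0 β) *
        pullback (LinearMap.coprod LinearMap.id (fluctIncl L)) (tauProd L 1 g))
          (scaleField L 0 φ, ∑ j, z j • fluctBasis L j)))

lemma rgForm_tauProd_apply (β : ℂ) (g : ℝ → ℂ) (φ : Field L 0) :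
    rgForm L 0 β (tauProd L 1 g) φ = ExteriorAlgebra.map (dualMap (scaleField L 0))
      (vecIntegral volume (fluctIntegrand L β g φ)) := rfl

/-- This serves only the existence of the integral before rescaling. The fluctuation two-form stays
inside a constant `Y`, as only the dependence of the scalar coefficients on ζ matters. -/
lemma map_gaussForm_mul_map_tauProd_eq {E : Type*} [AddCommGroup E] [Module ℝ E] {β : ℂ}
    (hβ : β ≠ -1) (g : ℝ → ℂ) (f : E →ₗ[ℝ] fluct L 0) (f' : E →ₗ[ℝ] Field L 1) (φ : Field L 0) :
    ∃ Y : evenAlg (E →ₗ[ℝ] ℂ), ∀ ζ : fluct L 0, ∀ w : Field L 1, w = blockField L (φ, ζ) →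
      ExteriorAlgebra.map (dualMap f) (gaussForm L 0 β ζ) *
      ExteriorAlgebra.map (dualMap f') (tauProd L 1 g w)
    = ((Y * ∏ y, (algebraMap ℂ (evenAlg (E →ₗ[ℝ] ℂ))
          (Complex.exp (-(1 + β) * Complex.normSq (w y)) * g (Complex.normSq (w y))) +
          (Complex.exp (-(1 + β) * Complex.normSq (w y)) *
            derivWithin g (Set.Ici 0) (Complex.normSq (w y)) * twoPiIInv) •
            twoForm (coord y ∘ₗ f') (coordBar y ∘ₗ f')) :
        evenAlg (E →ₗ[ℝ] ℂ)) : Ext E) := by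
  refine ⟨Complex.exp ((1 + β) * (L : ℂ) ^ 2 * Complex.normSq (φ (origin L))) •
    ∑ k ∈ Finset.range (Module.finrank ℝ (fluct L 0) + 1), ((k.factorial : ℂ))⁻¹ •
          (-(((1 + β) * twoPiIInv) • ∑ y, twoForm (coord y ∘ₗ fluctIncl L ∘ₗ f)
            (coordBar y ∘ₗ fluctIncl L ∘ₗ f))) ^ k, ?_⟩
  rintro ζ w rfl
  have hexp : Complex.exp (-((1 + β) * ∑ y, (Complex.normSq (ζ.1 y) : ℂ)))
      = Complex.exp ((1 + β) * (L : ℂ) ^ 2 * Complex.normSq (φ (origin L))) *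
        ∏ y, Complex.exp (-(1 + β) * Complex.normSq (blockField L (φ, ζ) y)) := by
    rw [sum_normSq_blockField (φ, ζ), ← Complex.exp_sum, ← Complex.exp_add, ← Finset.mul_sum]
    congr 1
    ring
  rw [map_gaussForm hβ, map_tauProd, hexp, smul_mul_assoc, smul_mul_assoc, ← smul_smul,
    ← MulMemClass.coe_mul, ← SetLike.val_smul, ← SetLike.val_smul, prod_smul_mul_prod_add]

lemma exists_isVecIntegral_fluctIntegrand {β : ℂ} (hβ : β ≠ -1) {g : ℝ → ℂ} {F F₁ : ℝ → ℂ}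
    (hF : ∀ t : ℝ, 0 ≤ t → F t = Complex.exp (-(1 + β) * t) * g t)
    (hF₁ : ∀ t : ℝ, 0 ≤ t → F₁ t = Complex.exp (-(1 + β) * t) * derivWithin g (Set.Ici 0) t *
      twoPiIInv) (hFc : ContinuousOn F (Ici 0)) (hF₁c : ContinuousOn F₁ (Ici 0)) {C : ℝ}
    (hδ : 0 < δ) (hFb : ∀ t, 0 ≤ t → ‖F t‖ ≤ C * Real.exp (-δ * t))
    (hF₁b : ∀ t, 0 ≤ t → ‖F₁ t‖ ≤ C * Real.exp (-δ * t)) (φ : Field L 0) :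
    ∃ v, IsVecIntegral volume (fluctIntegrand L β g φ) v := by
  obtain ⟨Y, hY⟩ := map_gaussForm_mul_map_tauProd_eq hβ g
    (LinearMap.snd ℝ (Field L 1) (fluct L 0)) (LinearMap.coprod LinearMap.id (fluctIncl L)) φ
  have h := exists_isVecIntegral_mul_prod_add (μ := volume)
    ((ExteriorAlgebra.map (dualMap (LinearMap.inl ℝ (Field L 1) (fluct L 0)))).toLinearMap ∘ₗ
      contractFluct (Field L 1) L) Y (fun y => twoForm (coord y ∘ₗ LinearMap.coprod LinearMap.id
        (fluctIncl L)) (coordBar y ∘ₗ LinearMap.coprod LinearMap.id (fluctIncl L)))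
    (fun y z => F (Complex.normSq (blockSpin φ z y)))
    (fun y z => F₁ (Complex.normSq (blockSpin φ z y))) (fun S => ?_)
  · obtain ⟨w, hw⟩ := h
    refine ⟨w, ?_⟩
    convert hw using 2 with z
    simp only [hF _ (Complex.normSq_nonneg _), hF₁ _ (Complex.normSq_nonneg _)]
    exact congrArg (fun x => ExteriorAlgebra.map (dualMap (LinearMap.inl ℝ (Field L 1)
      (fluct L 0))) (contractFluct (Field L 1) L x)) (hY (∑ j, z j • fluctBasis L j) _ rfl)
  · have h2 := integrable_prod_blockSpin φ (C := C) hδ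
      (h := fun y z => if y ∈ S then F (Complex.normSq (blockSpin φ z y)) else
        F₁ (Complex.normSq (blockSpin φ z y))) (fun y => ?_) (fun y z => ?_)
    · refine h2.congr (Filter.Eventually.of_forall fun z => ?_)
      simp only
      rw [Finset.prod_ite, Finset.filter_mem_eq_inter, Finset.univ_inter]
      congr 2
      ext y
      simp
    · split_ifs
      · exact hFc.comp_continuous (continuous_normSq_blockSpin φ y) fun _ =>
          Complex.normSq_nonneg _
      · exact hF₁c.comp_continuous (continuous_normSq_blockSpin φ y) fun _ =>
          Complex.normSq_nonneg _
    · split_ifs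
      · exact hFb _ (Complex.normSq_nonneg _)
      · exact hF₁b _ (Complex.normSq_nonneg _)

end RGForm

end Hier

/-! ### The renormalization map on superpositions of exponentials. -/

namespace Hier

section RGForm

open Set ExteriorAlgebra

variable {L : ℕ} [L.AtLeastTwo] {Ω : Type*} [MeasurableSpace Ω] {μ : Measure Ω} [SigmaFinite μ]
  {ρ v : Ω → ℂ} {δ : ℝ}

/-- The rate of the superposition of exponentials after a renormalization step, as a function of
the rates in the block. -/
noncomputable def blockRate (L : ℕ) [L.AtLeastTwo] (a : ℂ) (v : ball L 1 → ℂ) : ℂ :=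
  -(a * (L : ℂ) ^ 2) + (L : ℂ) ^ 6 * harmonicSum fun y => a + v y

omit [SigmaFinite μ] in
lemma derivWithin_eq_expSuperposition (hv : Measurable v) {M : ℝ} (hM : ∀ q, M ≤ (v q).re)
    (hρ : Integrable ρ μ) (hvρ : Integrable (fun q => -v q * ρ q) μ) {g : ℝ → ℂ}
    (hg : ∀ t, 0 ≤ t → g t = expSuperposition μ ρ v t) {t : ℝ} (ht : 0 ≤ t) :
    derivWithin g (Ici 0) t = expSuperposition μ (fun q => -v q * ρ q) v t :=
  ((hasDerivWithinAt_expSuperposition hv.aestronglyMeasurable hM hρ hvρ ht).congr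
    (fun s hs => hg s hs) (hg t ht)).derivWithin (uniqueDiffOn_Ici 0 t ht)

omit [SigmaFinite μ] in
lemma expSuperposition_neg_add_mul (hv : Measurable v) {M : ℝ} (hM : ∀ q, M ≤ (v q).re)
    (hρ : Integrable ρ μ) (hvρ : Integrable (fun q => -v q * ρ q) μ) (a : ℂ) {t : ℝ}
    (ht : 0 ≤ t) :
    expSuperposition μ (fun q => -(a + v q) * ρ q) v t
      = expSuperposition μ (fun q => -v q * ρ q) v t - a * expSuperposition μ ρ v t := by
  rw [expSuperposition, expSuperposition, expSuperposition, ← integral_const_mul,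
    ← integral_sub (integrable_expSuperposition hv.aestronglyMeasurable hM hvρ ht)
      ((integrable_expSuperposition hv.aestronglyMeasurable hM hρ ht).const_mul a)]
  congr 1
  funext q
  ring

omit [L.AtLeastTwo] in
lemma tauForm_apply_eq {N : ℕ} {h : ℝ → ℂ} (x : ball L N) (φ : Field L N) :
    tauForm h x φ = h (Complex.normSq (φ x)) • (1 : Ext (Field L N)) +
      (derivWithin h (Ici 0) (Complex.normSq (φ x)) * twoPiIInv) •
        (dOf (coord x) * dOf (coordBar x)) := by
  rw [← Algebra.algebraMap_eq_smul_one]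
  rfl

/-- The block has L⁴ sites, so L⁶ times the harmonic sum is L² times a harmonic mean, and harmonic
means stay in the half plane. -/
lemma le_re_harmonicSum {D : ball L 1 → ℂ} (hδ : 0 < δ) (hD : ∀ y, δ ≤ (D y).re) :
    (L : ℝ) ^ 2 * δ ≤ ((L : ℂ) ^ 6 * harmonicSum D).re := by
  have h := le_re_harmonicMean hδ hD
  rw [cast_card_ball_one] at h
  have h2 : (L : ℂ) ^ 6 * harmonicSum D
      = (((L : ℝ) ^ 2 : ℝ) : ℂ) * ((L : ℂ) ^ 4 * (∑ y, (D y)⁻¹)⁻¹) := by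
    rw [harmonicSum]
    push_cast
    ring
  rw [h2, Complex.re_ofReal_mul]
  exact mul_le_mul_of_nonneg_left h (by positivity)

lemma measurable_harmonicSum {D : Ω → ℂ} (hD : Measurable D) :
    Measurable fun o : ball L 1 → Ω => harmonicSum fun y => D (o y) :=
  (Finset.measurable_fun_sum _ fun y _ => (hD.comp (measurable_pi_apply y)).inv).inv

lemma measurable_blockRate (a : ℂ) (hv : Measurable v) :
    Measurable fun o : ball L 1 → Ω => blockRate L a fun y => v (o y) :=
  measurable_const.add (measurable_const.mul
    (measurable_harmonicSum (D := fun q => a + v q) (measurable_const.add hv)))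

lemma le_re_blockRate {a : ℂ} {v : ball L 1 → ℂ} (hδ : 0 < δ) (hv : ∀ y, δ ≤ (a + v y).re) :
    (L : ℝ) ^ 2 * (δ - a.re) ≤ (blockRate L a v).re := by
  have h := le_re_harmonicSum hδ hv
  have h2 : (a * (L : ℂ) ^ 2).re = (L : ℝ) ^ 2 * a.re := by
    have : a * (L : ℂ) ^ 2 = (((L : ℝ) ^ 2 : ℝ) : ℂ) * a := by push_cast; ring
    rw [this, Complex.re_ofReal_mul]
  rw [blockRate, Complex.add_re, Complex.neg_re, h2]
  linarith

omit [SigmaFinite μ] in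
lemma expSuperposition_const_mul (a : ℂ) (t : ℝ) :
    expSuperposition μ (fun q => a * ρ q) v t = a * expSuperposition μ ρ v t := by
  rw [expSuperposition, expSuperposition, ← integral_const_mul]
  simp only [mul_assoc]

omit [SigmaFinite μ] in
lemma expSuperposition_blockRate (a : ℂ) (r : ℝ) :
    expSuperposition (Measure.pi fun _ : ball L 1 => μ) (fun o => ∏ y, ρ (o y))
        (fun o => blockRate L a fun y => v (o y)) r
      = Complex.exp (a * (L : ℂ) ^ 2 * r) *
        expSuperposition (Measure.pi fun _ : ball L 1 => μ) (fun o => ∏ y, ρ (o y))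
          (fun o => (L : ℂ) ^ 6 * harmonicSum fun y => a + v (o y)) r := by
  refine (expSuperposition_const_add (v := fun o : ball L 1 → Ω => (L : ℂ) ^ 6 *
    harmonicSum fun y => a + v (o y)) (-(a * (L : ℂ) ^ 2)) r).trans ?_
  rw [neg_neg]

omit [SigmaFinite μ] in
lemma integrable_add_mul (hρ : Integrable ρ μ) (hvρ : Integrable (fun q => -v q * ρ q) μ) (a : ℂ) :
    Integrable (fun q => -(a + v q) * ρ q) μ := by
  refine (hvρ.sub (hρ.const_mul a)).congr (Filter.Eventually.of_forall fun q => ?_)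
  simp only [Pi.sub_apply]
  ring

omit [SigmaFinite μ] in
lemma derivWithin_expSuperposition_neg_add {V : Ω → ℂ} (hV : Measurable V) {M : ℝ} {b k : ℂ}
    (hM : ∀ q, M ≤ (k * V q).re) (hρ : Integrable ρ μ) (hVρ : Integrable (fun q => -V q * ρ q) μ)
    {r : ℝ} (hr : 0 ≤ r) :
    derivWithin (expSuperposition μ ρ fun q => -b + k * V q) (Ici 0) r
      = Complex.exp (b * r) * (b * expSuperposition μ ρ (fun q => k * V q) r +
        k * expSuperposition μ (fun q => -V q * ρ q) (fun q => k * V q) r) := by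
  have hVρ' : Integrable (fun q => -(k * V q) * ρ q) μ := by
    refine (hVρ.const_mul k).congr (Filter.Eventually.of_forall fun q => ?_)
    simp only
    ring
  have hM' : ∀ q, M - b.re ≤ (-b + k * V q).re := fun q => by
    rw [Complex.add_re, Complex.neg_re]
    linarith [hM q]
  rw [derivWithin_eq_expSuperposition (v := fun q => -b + k * V q)
    (measurable_const.add (hV.const_mul k)) hM' hρ
    (integrable_add_mul hρ hVρ' (-b)) (fun t _ => rfl) hr, expSuperposition_const_add, neg_neg,
    expSuperposition_neg_add_mul (hV.const_mul k) hM hρ hVρ' _ hr, ← expSuperposition_const_mul k]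
  have h : (fun q => -(k * V q) * ρ q) = fun q => k * (-V q * ρ q) := by
    funext q
    ring
  rw [h]
  ring

/-- The two terms have the shape of the (1,1)-part of the fluctuation integral: (1 + β) L² comes
from the Gaussian form and L⁶ from the contraction of the top product. -/
lemma derivWithin_expSuperposition_blockRate {a : ℂ} (hv : Measurable v) (hδ : 0 < δ)
    (hvδ : ∀ q, δ ≤ (a + v q).re) (hρ : Integrable ρ μ)
    (hvρ : Integrable (fun q => -v q * ρ q) μ) {r : ℝ} (hr : 0 ≤ r) :
    derivWithin (expSuperposition (Measure.pi fun _ : ball L 1 => μ) (fun o => ∏ y, ρ (o y))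
        (fun o => blockRate L a fun y => v (o y))) (Ici 0) r
      = Complex.exp (a * (L : ℂ) ^ 2 * r) * (a * (L : ℂ) ^ 2 *
          expSuperposition (Measure.pi fun _ : ball L 1 => μ) (fun o => ∏ y, ρ (o y))
            (fun o => (L : ℂ) ^ 6 * harmonicSum fun y => a + v (o y)) r + (L : ℂ) ^ 6 *
          expSuperposition (Measure.pi fun _ : ball L 1 => μ)
            (fun o => -(harmonicSum fun y => a + v (o y)) * ∏ y, ρ (o y))
            (fun o => (L : ℂ) ^ 6 * harmonicSum fun y => a + v (o y)) r) := by
  exact derivWithin_expSuperposition_neg_add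
    (measurable_harmonicSum (D := fun q => a + v q) (measurable_const.add hv))
    (fun o => le_re_harmonicSum hδ fun y => hvδ (o y))
    (Integrable.fintype_prod (f := fun _ => ρ) fun _ => hρ)
    (integrable_harmonicSum_mul_prod (D := fun q => a + v q) (measurable_const.add hv) hδ hvδ
      (integrable_add_mul hρ hvρ a)) hr

/-- The renormalization group map on superpositions of exponentials. -/
theorem rgForm_tauProd {β : ℂ} (hβ : β ≠ -1) (hv : Measurable v) (hδ : 0 < δ)
    (hvδ : ∀ q, δ ≤ (1 + β + v q).re) (hρ : Integrable ρ μ)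
    (hvρ : Integrable (fun q => -v q * ρ q) μ) {g : ℝ → ℂ}
    (hg : ∀ t, 0 ≤ t → g t = expSuperposition μ ρ v t) :
    rgForm L 0 β (tauProd L 1 g) = tauForm (expSuperposition (Measure.pi fun _ : ball L 1 => μ)
      (fun o => ∏ y, ρ (o y)) (fun o => blockRate L (1 + β) fun y => v (o y))) (origin L) := by
  have hM : ∀ q, δ - (1 + β).re ≤ (v q).re := fun q => by
    have := hvδ q
    rw [Complex.add_re] at this
    linarith
  have hD : Measurable fun q => 1 + β + v q := measurable_const.add hv
  have hDρ : Integrable (fun q => -(1 + β + v q) * ρ q) μ := integrable_add_mul hρ hvρ _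
  set F := expSuperposition μ ρ (fun q => 1 + β + v q) with hFdef
  set F' := expSuperposition μ (fun q => -(1 + β + v q) * ρ q) (fun q => 1 + β + v q) with hF'def
  have hF : ∀ t : ℝ, 0 ≤ t → F t = Complex.exp (-(1 + β) * t) * g t := fun t ht => by
    rw [hFdef, expSuperposition_const_add, hg t ht]
  have hF' : ∀ t : ℝ, 0 ≤ t → F' t = Complex.exp (-(1 + β) * t) *
      (derivWithin g (Ici 0) t - (1 + β) * g t) := fun t ht => by
    rw [hF'def, expSuperposition_const_add, expSuperposition_neg_add_mul hv hM hρ hvρ _ ht,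
      hg t ht, derivWithin_eq_expSuperposition hv hM hρ hvρ hg ht]
  have hFc : ContinuousOn F (Ici 0) := continuousOn_expSuperposition hD.aestronglyMeasurable
    (fun q => hδ.le.trans (hvδ q)) hρ
  have hF'c : ContinuousOn F' (Ici 0) := continuousOn_expSuperposition hD.aestronglyMeasurable
    (fun q => hδ.le.trans (hvδ q)) hDρ
  have hFb : ∀ t, 0 ≤ t → ‖F t‖ ≤ (∫ q, ‖ρ q‖ ∂μ) * Real.exp (-δ * t) := fun t ht =>
    norm_expSuperposition_le hvδ hρ ht
  have hF'b : ∀ t, 0 ≤ t → ‖F' t‖ ≤ (∫ q, ‖-(1 + β + v q) * ρ q‖ ∂μ) * Real.exp (-δ * t) :=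
    fun t ht => norm_expSuperposition_le hvδ hDρ ht
  set C₀ := ∫ q, ‖ρ q‖ ∂μ
  set C₁ := ∫ q, ‖-(1 + β + v q) * ρ q‖ ∂μ
  have hC₀ : 0 ≤ C₀ := integral_nonneg fun _ => norm_nonneg _
  have hC₁ : 0 ≤ C₁ := integral_nonneg fun _ => norm_nonneg _
  set P := Measure.pi fun _ : ball L 1 => μ
  set V : (ball L 1 → Ω) → ℂ := fun o => harmonicSum fun y => 1 + β + v (o y) with hV
  funext φ
  -- `rgForm` integrates before it pulls back along the scaling map, so existence is needed for the
  -- integrand with values in the forms on the full block.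
  have hex : ∃ w, IsVecIntegral volume (fluctIntegrand L β g φ) w := by
    refine exists_isVecIntegral_fluctIntegrand hβ (F := F)
      (F₁ := fun t => (F' t + (1 + β) * F t) * twoPiIInv)
      (C := max C₀ ((C₁ + ‖1 + β‖ * C₀) * ‖twoPiIInv‖)) hF (fun t ht => ?_) hFc
      ((hF'c.add (continuousOn_const.mul hFc)).mul continuousOn_const) hδ (fun t ht => ?_)
      (fun t ht => ?_) φ
    · rw [hF t ht, hF' t ht]
      ring
    · exact (hFb t ht).trans (mul_le_mul_of_nonneg_right (le_max_left _ _) (Real.exp_pos _).le)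
    · refine le_trans ?_ (mul_le_mul_of_nonneg_right (le_max_right _ _) (Real.exp_pos _).le)
      rw [norm_mul, mul_right_comm]
      refine mul_le_mul_of_nonneg_right ((norm_add_le _ _).trans ?_) (norm_nonneg _)
      rw [norm_mul, add_mul, mul_assoc]
      exact add_le_add (hF'b t ht) (mul_le_mul_of_nonneg_left (hFb t ht) (norm_nonneg _))
  obtain ⟨w, hw⟩ := hex
  rw [rgForm_tauProd_apply, hw.vecIntegral_eq]
  have hw2 := hw.map (ExteriorAlgebra.map (dualMap (scaleField L 0))).toLinearMap
  obtain ⟨i0, i1⟩ := integral_sum_blockSpin hD hδ hvδ hρ hDρ φ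
  obtain ⟨j0, j1⟩ := integral_prod_blockSpin hD hδ hvδ hDρ φ ⟨0, zero_mem_ball L 1⟩
  set p : (Fin (fluctDim L) → ℂ) → ℂ := fun z => ∑ i, F (Complex.normSq (blockSpin φ z i)) *
        (∏ y ∈ Finset.univ.erase i, F' (Complex.normSq (blockSpin φ z y))) * jacobian i with hp
  set q : (Fin (fluctDim L) → ℂ) → ℂ := fun z =>
    (∏ y, F' (Complex.normSq (blockSpin φ z y))) * jacobian ⟨0, zero_mem_ball L 1⟩ with hq
  set r := Complex.normSq (φ (origin L))
  set E0 := Complex.exp ((1 + β) * (L : ℂ) ^ 2 * r) with hE0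
  have hpt : ∀ z, (ExteriorAlgebra.map (dualMap (scaleField L 0))).toLinearMap
      (fluctIntegrand L β g φ z) = (E0 * p z) • (1 : Ext (Field L 0)) +
        (E0 * ((1 + β) * (L : ℂ) ^ 2 * p z + (L : ℂ) ^ 6 * q z) * twoPiIInv) •
          (dOf (coord (origin L)) * dOf (coordBar (origin L))) := by
    intro z
    refine (map_scaleField_contractFluct β g φ _).trans ?_
    refine (map_inl_contractFluct hβ g φ _ ⟨0, zero_mem_ball L 1⟩ rfl
      (F := F) (F' := F') (fun y => hF _ (Complex.normSq_nonneg _))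
      (fun y => hF' _ (Complex.normSq_nonneg _))).trans ?_
    rw [smul_add, smul_smul, Algebra.algebraMap_eq_smul_one, smul_smul, mul_assoc E0]
    rfl
  simp only [hpt] at hw2
  have hw3 := hw2.unique (isVecIntegral_smul_add_smul (i0.const_mul E0)
    ((((i0.const_mul ((1 + β) * (L : ℂ) ^ 2)).add (j0.const_mul ((L : ℂ) ^ 6))).const_mul
      E0).mul_const twoPiIInv) _ _)
  refine Eq.trans hw3 ?_
  -- The scalar parts compare the integral with the new function, and the coefficients of dφ ∧ dφ̄
  -- compare it with its derivative.
  rw [tauForm_apply_eq]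
  refine congrArg₂ (· + ·) (congrArg (· • (1 : Ext (Field L 0))) ?_)
    (congrArg (· • (dOf (coord (origin L)) * dOf (coordBar (origin L)))) ?_)
  · rw [integral_const_mul]
    exact (congrArg (E0 * ·) i1).trans (expSuperposition_blockRate (1 + β) r).symm
  · rw [derivWithin_expSuperposition_blockRate hv hδ hvδ hρ hvρ (Complex.normSq_nonneg _),
      integral_mul_const, integral_const_mul, integral_add' (i0.const_mul _) (j0.const_mul _),
      integral_const_mul, integral_const_mul, i1, j1]

end RGForm

end Hier

/-! ### Elimination of a scale from the resolvent. -/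

namespace Hier

section BlockResolvent

variable {L : ℕ} [L.AtLeastTwo]

/-- The ball `𝒢_{N+1}` as a union of cosets of `𝒢_1`. -/
noncomputable def blockEquiv (L N : ℕ) : ball L 1 × ball L N ≃ ball L (N + 1) :=
  haveI : Unique (ball L 0) := ⟨⟨⟨0, zero_mem_ball L 0⟩⟩, fun _ => Subsingleton.elim _ _⟩
  (((ballEquiv L 0).symm.trans (Equiv.prodUnique _ _)).prodCongr (Equiv.refl _)).trans
    (ballEquiv L N)

omit [L.AtLeastTwo] in
lemma ballDown_blockEquiv {N : ℕ} (b : ball L 1) (Y : ball L N) :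
    ballDown (blockEquiv L N (b, Y)) = Y := ballDown_ballEquiv _ _

lemma sum_blockEquiv {M : Type*} [AddCommMonoid M] {N : ℕ} (f : ball L (N + 1) → M) :
    ∑ x, f x = ∑ Y : ball L N, ∑ b : ball L 1, f (blockEquiv L N (b, Y)) := by
  rw [← (blockEquiv L N).sum_comp, Fintype.sum_prod_type, Finset.sum_comm]

lemma prod_blockEquiv {M : Type*} [CommMonoid M] {N : ℕ} (f : ball L (N + 1) → M) :
    ∏ x, f x = ∏ Y : ball L N, ∏ b : ball L 1, f (blockEquiv L N (b, Y)) := by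
  rw [← (blockEquiv L N).prod_comp, Fintype.prod_prod_type, Finset.prod_comm]

/-- The term 1_{z=0} of `generator_eq` joins the potential. For u = β + v the diagonal is then 1 + β
+ v, the rate of the Gaussian integral. -/
lemma killedMatrix_succ_apply {N : ℕ} (u : ball L (N + 1) → ℂ) (x y : ball L (N + 1)) :
    killedMatrix (N + 1) u x y = (if x = y then 1 + u x else 0)
      - ((L : ℂ) ^ 4)⁻¹ * (if ballDown x = ballDown y then 1 else 0)
      + ((L : ℂ) ^ 6)⁻¹ * (generator ((ballDown x).1 - (ballDown y).1) : ℂ) := by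
  have h1 : x.1 - y.1 = 0 ↔ x = y := by rw [sub_eq_zero, Subtype.ext_iff]
  have h2 : down (x.1 - y.1) = 0 ↔ ballDown x = ballDown y := (ballDown_eq_iff x y).symm
  have h3 : down (x.1 - y.1) = (ballDown x).1 - (ballDown y).1 := down_sub _ _
  rw [killedMatrix, Matrix.of_apply, generator_eq, ← h3]
  simp only [h1, h2]
  split_ifs <;> push_cast <;> ring

lemma killedMatrix_succ_mulVec {N : ℕ} (u : ball L (N + 1) → ℂ) (h : ball L (N + 1) → ℂ)
    (x : ball L (N + 1)) :
    (killedMatrix (N + 1) u).mulVec h x = (1 + u x) * h x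
      - ((L : ℂ) ^ 4)⁻¹ * ∑ b, h (blockEquiv L N (b, ballDown x))
      + ((L : ℂ) ^ 6)⁻¹ * ∑ Y : ball L N, (generator ((ballDown x).1 - Y.1) : ℂ) *
        ∑ b, h (blockEquiv L N (b, Y)) := by
  simp only [Matrix.mulVec, dotProduct, killedMatrix_succ_apply, add_mul, sub_mul,
    Finset.sum_add_distrib, Finset.sum_sub_distrib, mul_assoc]
  congr 1
  · congr 1
    · simp only [ite_mul, zero_mul, Finset.sum_ite_eq, Finset.mem_univ, if_true]
      ring
    · rw [← Finset.mul_sum, sum_blockEquiv]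
      simp [ballDown_blockEquiv, ite_mul]
  · rw [← Finset.mul_sum, sum_blockEquiv]
    simp only [ballDown_blockEquiv, Finset.mul_sum]

lemma killedMatrix_mulVec {N : ℕ} (u h : ball L N → ℂ) (x : ball L N) :
    (killedMatrix N u).mulVec h x = ∑ y : ball L N, (generator (x.1 - y.1) : ℂ) * h y
      + u x * h x := by
  simp [Matrix.mulVec, dotProduct, killedMatrix, add_mul, Finset.sum_add_distrib, ite_mul]

/-- The sum of the resolvent over blocks is the resolvent on the coarser lattice. -/
lemma sum_inv_killedMatrix {N : ℕ} {u : ball L (N + 1) → ℂ} {u' : ball L N → ℂ}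
    (hD : ∀ x, 1 + u x ≠ 0)
    (hs : ∀ Y, ∑ b, (1 + u (blockEquiv L N (b, Y)))⁻¹ ≠ 0)
    (hu' : ∀ Y, u' Y = (L : ℂ) ^ 6 * (∑ b, (1 + u (blockEquiv L N (b, Y)))⁻¹)⁻¹ - (L : ℂ) ^ 2)
    (hdet : (killedMatrix (N + 1) u).det ≠ 0) (hdet' : (killedMatrix N u').det ≠ 0)
    (Y X : ball L N) :
    ∑ b', ∑ b, (killedMatrix (N + 1) u)⁻¹ (blockEquiv L N (b, Y)) (blockEquiv L N (b', X))
      = (L : ℂ) ^ 6 * (killedMatrix N u')⁻¹ Y X := by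
  have hL : (L : ℂ) ≠ 0 := cast_ne_zero L
  have hunit : IsUnit (killedMatrix (N + 1) u).det := isUnit_iff_ne_zero.2 hdet
  have hunit' : IsUnit (killedMatrix N u').det := isUnit_iff_ne_zero.2 hdet'
  set s : ball L N → ℂ := fun Y => ∑ b, (1 + u (blockEquiv L N (b, Y)))⁻¹ with hsdef
  have key : ∀ b', ∑ b, (killedMatrix (N + 1) u)⁻¹ (blockEquiv L N (b, Y))
      (blockEquiv L N (b', X))
      = (L : ℂ) ^ 6 * (s X)⁻¹ * (killedMatrix N u')⁻¹ Y X *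
        (1 + u (blockEquiv L N (b', X)))⁻¹ := by
    intro b'
    set x := blockEquiv L N (b', X)
    set h : ball L (N + 1) → ℂ := fun y => (killedMatrix (N + 1) u)⁻¹ y x with hh
    set m : ball L N → ℂ := fun Y => ∑ b, h (blockEquiv L N (b, Y)) with hm
    have h1 : ∀ z, (killedMatrix (N + 1) u).mulVec h z = if z = x then 1 else 0 := by
      intro z
      have := congrFun (congrFun (Matrix.mul_nonsing_inv _ hunit) z) x
      rw [Matrix.one_apply] at this
      exact this
    have h2 : ∀ Z, (killedMatrix N u').mulVec m Z
        = if Z = X then (L : ℂ) ^ 6 * (s X)⁻¹ * (1 + u x)⁻¹ else 0 := by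
      intro Z
      set w := ∑ Y : ball L N, (generator (Z.1 - Y.1) : ℂ) * m Y with hw
      -- Solved for `h`, the row of a site involves the other sites only through the block sums `m`
      -- and their image `w` under the coarse generator.
      have h3 : ∀ b, h (blockEquiv L N (b, Z)) - (1 + u (blockEquiv L N (b, Z)))⁻¹ *
          (((L : ℂ) ^ 4)⁻¹ * m Z - ((L : ℂ) ^ 6)⁻¹ * w)
          = if b = b' then (if Z = X then (1 + u x)⁻¹ else 0) else 0 := by
        intro b
        have h4 := h1 (blockEquiv L N (b, Z))
        rw [killedMatrix_succ_mulVec, ballDown_blockEquiv] at h4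
        have h5 : h (blockEquiv L N (b, Z)) - (1 + u (blockEquiv L N (b, Z)))⁻¹ *
          (((L : ℂ) ^ 4)⁻¹ * m Z - ((L : ℂ) ^ 6)⁻¹ * w)
            = (1 + u (blockEquiv L N (b, Z)))⁻¹ *
              (if blockEquiv L N (b, Z) = x then 1 else 0) := by
          rw [← h4]
          have := hD (blockEquiv L N (b, Z))
          field_simp
          ring
        rw [h5]
        simp only [x, EmbeddingLike.apply_eq_iff_eq, Prod.mk.injEq]
        by_cases hb : b = b' <;> by_cases hZ : Z = X <;> simp [hb, hZ]
      -- Summation over the block closes the equation for `m`; multiplied by L⁶ / s(Z) it is the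
      -- resolvent equation on the coarser lattice.
      have h6 := Finset.sum_congr (rfl : (Finset.univ : Finset (ball L 1)) = _)
        (fun b _ => h3 b)
      rw [Finset.sum_sub_distrib, ← Finset.sum_mul, Finset.sum_ite_eq', if_pos (Finset.mem_univ _)]
        at h6
      change m Z - s Z * _ = _ at h6
      rw [killedMatrix_mulVec, hu', ← hw]
      have hsZ := hs Z
      change s Z ≠ 0 at hsZ
      have h7 : (if Z = X then (L : ℂ) ^ 6 * (s X)⁻¹ * (1 + u x)⁻¹ else 0)
          = (L : ℂ) ^ 6 * (s Z)⁻¹ * (if Z = X then (1 + u x)⁻¹ else 0) := by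
        split_ifs with hZ
        · rw [hZ]
        · simp
      rw [h7, ← h6]
      change w + ((L : ℂ) ^ 6 * (s Z)⁻¹ - (L : ℂ) ^ 2) * m Z = _
      field_simp
      ring
    have h8 : m = (killedMatrix N u')⁻¹.mulVec ((killedMatrix N u').mulVec m) := by
      rw [Matrix.mulVec_mulVec, Matrix.nonsing_inv_mul _ hunit', Matrix.one_mulVec]
    have h9 := congrFun h8 Y
    rw [funext h2] at h9
    refine h9.trans ?_
    simp only [Matrix.mulVec, dotProduct, mul_ite, mul_zero, Finset.sum_ite_eq', Finset.mem_univ,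
      if_true]
    ring
  simp only [key]
  -- Summing the source over its block restores s(X), which cancels the inverse.
  rw [← Finset.mul_sum]
  change _ * s X = _
  have := hs X
  change s X ≠ 0 at this
  field_simp

end BlockResolvent

end Hier

/-! ### Averaging the resolvent over the rates. -/

namespace Hier

section BlockIntegral

variable {L : ℕ} [L.AtLeastTwo] {Ω : Type*} [MeasurableSpace Ω] {μ : Measure Ω} [SigmaFinite μ]
  {ρ v : Ω → ℂ} {N : ℕ}

/-- A family of configurations on blocks as a configuration on the large ball. -/
noncomputable def unblock (o : ball L N → ball L 1 → Ω) (x : ball L (N + 1)) : Ω :=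
  o ((blockEquiv L N).symm x).2 ((blockEquiv L N).symm x).1

omit [L.AtLeastTwo] [MeasurableSpace Ω] in
lemma unblock_blockEquiv (o : ball L N → ball L 1 → Ω) (b : ball L 1) (Y : ball L N) :
    unblock o (blockEquiv L N (b, Y)) = o Y b := by
  rw [unblock, Equiv.symm_apply_apply]

lemma measurePreserving_unblock :
    MeasurePreserving (unblock : (ball L N → ball L 1 → Ω) → ball L (N + 1) → Ω)
      (Measure.pi fun _ => Measure.pi fun _ => μ) (Measure.pi fun _ => μ) where
  measurable := measurable_pi_iff.2 fun x => by
    unfold unblock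
    fun_prop
  map_eq := by
    refine (Measure.pi_eq fun s hs => ?_).symm
    have hm : Measurable (unblock : (ball L N → ball L 1 → Ω) → ball L (N + 1) → Ω) :=
      measurable_pi_iff.2 fun x => by
        unfold unblock
        fun_prop
    rw [Measure.map_apply hm (MeasurableSet.univ_pi hs)]
    have h : unblock ⁻¹' Set.univ.pi s = Set.univ.pi fun Y : ball L N =>
        Set.univ.pi fun b : ball L 1 => s (blockEquiv L N (b, Y)) := by
      ext o
      simp only [Set.mem_preimage, Set.mem_univ_pi]
      constructor
      · intro ho Y b
        have := ho (blockEquiv L N (b, Y))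
        rwa [unblock_blockEquiv] at this
      · intro ho x
        obtain ⟨⟨b, Y⟩, rfl⟩ := (blockEquiv L N).surjective x
        rw [unblock_blockEquiv]
        exact ho Y b
    rw [h, Measure.pi_pi, prod_blockEquiv]
    simp only [Measure.pi_pi]

/-- Resolvents are equivariant under permutations that preserve the generator. -/
lemma inv_killedMatrix_comp {u : ball L N → ℂ} (σ : Equiv.Perm (ball L N))
    (hσ : ∀ x y, generator ((σ x).1 - (σ y).1) = generator (x.1 - y.1)) (x y : ball L N) :
    (killedMatrix N fun z => u (σ z))⁻¹ x y = (killedMatrix N u)⁻¹ (σ x) (σ y) := by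
  have h : (killedMatrix N fun z => u (σ z)) = (killedMatrix N u).submatrix σ σ := by
    ext x y
    simp [killedMatrix, hσ]
  rw [h, Matrix.inv_submatrix_equiv]
  rfl

/-- By `generator_eq` the generator sees only whether two points coincide and in which blocks they
lie. -/
lemma generator_comp (σ : Equiv.Perm (ball L (N + 1)))
    (hσ : ∀ x, ballDown (σ x) = ballDown x) (x y : ball L (N + 1)) :
    generator ((σ x).1 - (σ y).1) = generator (x.1 - y.1) := by
  have h1 : ∀ x y : ball L (N + 1), x.1 - y.1 = 0 ↔ x = y := fun x y => by
    rw [sub_eq_zero, Subtype.ext_iff]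
  have h3 : ∀ x y : ball L (N + 1), down (x.1 - y.1) = (ballDown x).1 - (ballDown y).1 :=
    fun x y => down_sub _ _
  rw [generator_eq, generator_eq (x.1 - y.1)]
  simp only [h1, h3, hσ, EmbeddingLike.apply_eq_iff_eq]

/-- The rates at different sites have the same weight, so relabelling the sites preserves the
product measure and the integrand's product of weights. -/
lemma integral_inv_killedMatrix_comp {β : ℂ} (σ : Equiv.Perm (ball L N))
    (hσ : ∀ x y, generator ((σ x).1 - (σ y).1) = generator (x.1 - y.1)) (x y : ball L N) :
    ∫ o : ball L N → Ω, (∏ z, ρ (o z)) * (killedMatrix N fun z => β + v (o z))⁻¹ (σ x) (σ y)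
        ∂(Measure.pi fun _ => μ)
      = ∫ o : ball L N → Ω, (∏ z, ρ (o z)) * (killedMatrix N fun z => β + v (o z))⁻¹ x y
        ∂(Measure.pi fun _ => μ) := by
  have hp := measurePreserving_piCongrLeft (α := fun _ : ball L N => Ω) (fun _ => μ) σ
  rw [← hp.integral_comp' (g := fun o : ball L N → Ω => (∏ z, ρ (o z)) *
    (killedMatrix N fun z => β + v (o z))⁻¹ (σ x) (σ y))]
  refine integral_congr_ae (Filter.Eventually.of_forall fun o => ?_)
  have h1 : ∀ z, (MeasurableEquiv.piCongrLeft (fun _ : ball L N => Ω) σ) o (σ z) = o z := fun z =>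
    Equiv.piCongrLeft_apply_apply (fun _ => Ω) σ o z
  simp only
  rw [← inv_killedMatrix_comp σ hσ x y
    (u := fun z => β + v ((MeasurableEquiv.piCongrLeft (fun _ : ball L N => Ω) σ) o z)),
    ← Equiv.prod_comp σ]
  simp only [h1]

omit [L.AtLeastTwo] in
-- For different blocks the two transpositions do not interfere. In a single block this would fail,
-- since a permutation cannot exchange diagonal and off-diagonal pairs.
lemma exists_perm_block {X Y : ball L N} (h : Y ≠ X) (b c b' c' : ball L 1) :
    ∃ σ : Equiv.Perm (ball L (N + 1)), (∀ x, ballDown (σ x) = ballDown x) ∧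
      σ (blockEquiv L N (b, Y)) = blockEquiv L N (c, Y) ∧
      σ (blockEquiv L N (b', X)) = blockEquiv L N (c', X) := by
  classical
  refine ⟨Equiv.swap (blockEquiv L N (b, Y)) (blockEquiv L N (c, Y)) *
    Equiv.swap (blockEquiv L N (b', X)) (blockEquiv L N (c', X)), ?_, ?_, ?_⟩
  · have hs : ∀ (Z : ball L N) (d e : ball L 1) (x : ball L (N + 1)),
        ballDown (Equiv.swap (blockEquiv L N (d, Z)) (blockEquiv L N (e, Z)) x) = ballDown x := by
      intro Z d e x
      rw [Equiv.swap_apply_def]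
      split_ifs with h1 h2
      · rw [h1, ballDown_blockEquiv, ballDown_blockEquiv]
      · rw [h2, ballDown_blockEquiv, ballDown_blockEquiv]
      · rfl
    intro x
    rw [Equiv.Perm.mul_apply, hs, hs]
  · have h1 : Equiv.swap (blockEquiv L N (b', X)) (blockEquiv L N (c', X))
        (blockEquiv L N (b, Y)) = blockEquiv L N (b, Y) :=
      Equiv.swap_apply_of_ne_of_ne (by simp [h]) (by simp [h])
    rw [Equiv.Perm.mul_apply, h1, Equiv.swap_apply_left]
  · rw [Equiv.Perm.mul_apply, Equiv.swap_apply_left]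
    exact Equiv.swap_apply_of_ne_of_ne (by simp [h.symm]) (by simp [h.symm])

/-- With this, the condition for convergence of the Green's function implies Re(1 + β) + κ > 0, the
condition for convergence of the fluctuation integral. -/
lemma jumpRate_mul_lt_one (N : ℕ) : jumpRate L * ((L : ℝ) ^ (2 * N))⁻¹ < 1 := by
  have hL := one_lt_cast L
  have hr : jumpRate L < 1 := by
    have h6 : ((L : ℝ) ^ 6)⁻¹ < 1 := inv_lt_one_of_one_lt₀ (one_lt_pow₀ hL (by norm_num))
    have h46 : ((L : ℝ) ^ 6)⁻¹ < ((L : ℝ) ^ 4)⁻¹ :=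
      inv_strictAnti₀ (by positivity) (pow_lt_pow_right₀ hL (by norm_num))
    rw [jumpRate, div_lt_one (by linarith)]
    linarith
  refine (mul_le_of_le_one_right (jumpRate_pos L).le ?_).trans_lt hr
  exact inv_le_one_of_one_le₀ (one_le_pow₀ hL.le)

/-- The convergence condition is scale covariant: multiplication by L² turns it into the one on the
coarser ball. -/
lemma sq_mul_add_pos {b : ℝ} (hb : 0 < b + jumpRate L * ((L : ℝ) ^ (2 * (N + 1)))⁻¹) :
    0 < (L : ℝ) ^ 2 * b + jumpRate L * ((L : ℝ) ^ (2 * N))⁻¹ := by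
  have hL := one_lt_cast L
  have h : (L : ℝ) ^ 2 * b + jumpRate L * ((L : ℝ) ^ (2 * N))⁻¹
      = (L : ℝ) ^ 2 * (b + jumpRate L * ((L : ℝ) ^ (2 * (N + 1)))⁻¹) := by
    rw [mul_add 2, pow_add]
    field_simp
    ring
  rw [h]
  positivity

/-- The harmonic mean keeps the bound 1 + Re β + κ up to the factor L², and the subtraction of (1 +
β) L² in `blockRate` removes the 1. -/
lemma le_re_add_blockRate {β : ℂ} {κ : ℝ} (hδ : 0 < 1 + β.re + κ) {v : ball L 1 → ℂ}
    (hκ : ∀ y, κ ≤ (v y).re) :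
    (L : ℝ) ^ 2 * (β.re + κ) ≤ ((L : ℂ) ^ 2 * β + blockRate L (1 + β) v).re := by
  have h := le_re_blockRate (L := L) (a := 1 + β) (v := v) hδ fun y => by
    rw [Complex.add_re, Complex.add_re, Complex.one_re]
    linarith [hκ y]
  have h2 : ((L : ℂ) ^ 2 * β).re = (L : ℝ) ^ 2 * β.re := by
    have : (L : ℂ) ^ 2 * β = (((L : ℝ) ^ 2 : ℝ) : ℂ) * β := by push_cast; ring
    rw [this, Complex.re_ofReal_mul]
  rw [Complex.add_re, h2]
  simp only [Complex.add_re, Complex.one_re] at h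
  linarith

/-- The resolvent with a block potential, averaged, is the resolvent on the coarser lattice. -/
theorem integral_inv_killedMatrix_succ (hρ : Integrable ρ μ) (hv : Measurable v) {κ : ℝ}
    (hκ : ∀ q, κ ≤ (v q).re) {β : ℂ}
    (hb : 0 < β.re + κ + jumpRate L * ((L : ℝ) ^ (2 * (N + 1)))⁻¹) {y x : ball L (N + 1)}
    (hyx : ballDown y ≠ ballDown x) :
    ∫ o : ball L (N + 1) → Ω, (∏ z, ρ (o z)) * (killedMatrix (N + 1) fun z => β + v (o z))⁻¹ y x
        ∂(Measure.pi fun _ => μ)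
      = ((L : ℂ) ^ 2)⁻¹ * ∫ o : ball L N → ball L 1 → Ω, (∏ Y, ∏ b, ρ (o Y b)) *
          (killedMatrix N fun Y => (L : ℂ) ^ 2 * β +
            blockRate L (1 + β) fun b => v (o Y b))⁻¹ (ballDown y) (ballDown x)
        ∂(Measure.pi fun _ => Measure.pi fun _ => μ) := by
  have hL := cast_ne_zero L
  have hδ : 0 < 1 + β.re + κ := by linarith [jumpRate_mul_lt_one (L := L) (N + 1)]
  have hvδ : ∀ q, 1 + β.re + κ ≤ (1 + β + v q).re := fun q => by
    rw [Complex.add_re, Complex.add_re, Complex.one_re]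
    linarith [hκ q]
  obtain ⟨⟨b₀, Y⟩, rfl⟩ := (blockEquiv L N).surjective y
  obtain ⟨⟨c₀, X⟩, rfl⟩ := (blockEquiv L N).surjective x
  rw [ballDown_blockEquiv, ballDown_blockEquiv] at hyx ⊢
  set I : ball L (N + 1) → ball L (N + 1) → ℂ := fun y x =>
    ∫ o : ball L (N + 1) → Ω, (∏ z, ρ (o z)) * (killedMatrix (N + 1) fun z => β + v (o z))⁻¹ y x
        ∂(Measure.pi fun _ => μ) with hI
  -- Averaging restores the symmetry that fixed rates break, so the sum over two different blocks is
  -- a multiple of any one entry.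
  have hconst : ∀ b c, I (blockEquiv L N (b, Y)) (blockEquiv L N (c, X))
      = I (blockEquiv L N (b₀, Y)) (blockEquiv L N (c₀, X)) := by
    intro b c
    obtain ⟨σ, h1, h2, h3⟩ := exists_perm_block hyx b₀ b c₀ c
    have := integral_inv_killedMatrix_comp (μ := μ) (ρ := ρ) (v := v) (β := β) σ
      (generator_comp σ h1) (blockEquiv L N (b₀, Y)) (blockEquiv L N (c₀, X))
    rwa [h2, h3] at this
  have hsum : ∑ c, ∑ b, I (blockEquiv L N (b, Y)) (blockEquiv L N (c, X))
      = (L : ℂ) ^ 8 * I (blockEquiv L N (b₀, Y)) (blockEquiv L N (c₀, X)) := by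
    simp only [hconst, Finset.sum_const, Finset.card_univ, nsmul_eq_mul, cast_card_ball_one]
    ring
  have hint := fun y x => integrable_prod_mul_inv_killedMatrix hρ hv hκ hb (x₀ := y) (x := x)
  have hpt : ∀ o : ball L N → ball L 1 → Ω, ∑ c, ∑ b, (∏ z, ρ (unblock o z)) *
      (killedMatrix (N + 1) fun z => β + v (unblock o z))⁻¹ (blockEquiv L N (b, Y))
        (blockEquiv L N (c, X))
      = (L : ℂ) ^ 6 * ((∏ Y, ∏ b, ρ (o Y b)) *
          (killedMatrix N fun Y => (L : ℂ) ^ 2 * β +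
            blockRate L (1 + β) fun b => v (o Y b))⁻¹ Y X) := by
    intro o
    simp only [← Finset.mul_sum]
    rw [sum_inv_killedMatrix (u' := fun Y => (L : ℂ) ^ 2 * β +
            blockRate L (1 + β) fun b => v (o Y b))]
    · rw [prod_blockEquiv]
      simp only [unblock_blockEquiv]
      ring
    · intro z h
      have := hvδ (unblock o z)
      rw [add_assoc 1 β, h, Complex.zero_re] at this
      linarith
    · intro Z
      simp only [← add_assoc]
      exact sum_inv_ne_zero fun b => hδ.trans_le (hvδ _)
    · intro Z
      simp only [blockRate, harmonicSum, unblock_blockEquiv, ← add_assoc]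
      ring
    · refine det_killedMatrix_ne_zero hb fun z => ?_
      rw [Complex.add_re]
      linarith [hκ (unblock o z)]
    · exact det_killedMatrix_ne_zero (sq_mul_add_pos hb)
        fun Z => le_re_add_blockRate hδ fun b => hκ (o Z b)
  have hmain : ∑ c, ∑ b, I (blockEquiv L N (b, Y)) (blockEquiv L N (c, X))
      = (L : ℂ) ^ 6 * ∫ o : ball L N → ball L 1 → Ω, (∏ Y, ∏ b, ρ (o Y b)) *
          (killedMatrix N fun Y => (L : ℂ) ^ 2 * β +
            blockRate L (1 + β) fun b => v (o Y b))⁻¹ Y X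
        ∂(Measure.pi fun _ => Measure.pi fun _ => μ) := by
    simp only [hI]
    rw [← integral_const_mul]
    simp only [← hpt]
    have hp := measurePreserving_unblock (L := L) (N := N) (μ := μ)
    have h1 : ∀ c b, Integrable (fun o : ball L N → ball L 1 → Ω => (∏ z, ρ (unblock o z)) *
      (killedMatrix (N + 1) fun z => β + v (unblock o z))⁻¹ (blockEquiv L N (b, Y))
        (blockEquiv L N (c, X))) (Measure.pi fun _ => Measure.pi fun _ => μ) := fun c b =>
      hp.integrable_comp_of_integrable (hint _ _)
    rw [integral_finsetSum _ fun c _ => integrable_finsetSum _ fun b _ => h1 c b]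
    refine Finset.sum_congr rfl fun c _ => ?_
    rw [integral_finsetSum _ fun b _ => h1 c b]
    refine Finset.sum_congr rfl fun b _ => ?_
    have h2 := hint (blockEquiv L N (b, Y)) (blockEquiv L N (c, X))
    rw [← hp.map_eq] at h2
    conv_lhs => rw [← hp.map_eq]
    exact integral_map hp.measurable.aemeasurable h2.aestronglyMeasurable
  rw [hmain] at hsum
  change I _ _ = _
  -- There are L⁴ · L⁴ equal entries, while eliminating a scale produces L⁶; the quotient is the
  -- scaling factor L⁻².
  have h8 : (L : ℂ) ^ 8 = (L : ℂ) ^ 6 * (L : ℂ) ^ 2 := by ring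
  rw [h8, mul_assoc] at hsum
  rw [mul_left_cancel₀ (pow_ne_zero 6 hL) hsum, inv_mul_cancel_left₀ (pow_ne_zero 2 hL)]

end BlockIntegral

end Hier

/-! ### The normalization condition as a condition on value and derivative at 0. -/

section Calculus

open Set Filter Topology Asymptotics

lemma isBigO_sq_of_contDiffOn {f : ℝ → ℂ} (hf : ContDiffOn ℝ 2 f (Ici 0)) (h0 : f 0 = 1)
    (h1 : HasDerivWithinAt f 0 (Ici 0) 0) :
    (fun t : ℝ => f t - 1) =O[𝓝[≥] 0] fun t : ℝ => t ^ 2 := by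
  have hf' : ContDiffOn ℝ ((1 : ℕ) + 1) f (Icc 0 1) := (hf.mono Icc_subset_Ici_self).of_le (by
    norm_num)
  obtain ⟨C, hC⟩ := exists_taylor_mean_remainder_bound zero_le_one hf'
  have hd : derivWithin f (Icc 0 1) 0 = 0 :=
    (h1.mono Icc_subset_Ici_self).derivWithin (uniqueDiffOn_Icc zero_lt_one 0 (by simp))
  refine IsBigO.of_bound C ?_
  have hmem : Icc (0 : ℝ) 1 ∈ 𝓝[≥] (0 : ℝ) := Icc_mem_nhdsGE zero_lt_one
  filter_upwards [hmem] with t ht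
  have h2 := hC t ht
  rw [taylorWithinEval_succ, taylor_within_zero_eval, zero_add, iteratedDerivWithin_one, hd,
    smul_zero, add_zero, h0, sub_zero] at h2
  rwa [Real.norm_of_nonneg (sq_nonneg t)]

lemma hasDerivWithinAt_zero_of_isBigO_sq {f : ℝ → ℂ} (h0 : f 0 = 1)
    (h : (fun t : ℝ => f t - 1) =O[𝓝[≥] 0] fun t : ℝ => t ^ 2) :
    HasDerivWithinAt f 0 (Ici 0) 0 := by
  rw [hasDerivWithinAt_iff_isLittleO]
  simp only [h0, sub_zero, smul_zero]
  refine h.trans_isLittleO ?_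
  refine IsLittleO.mono ?_ nhdsWithin_le_nhds
  simpa using isLittleO_pow_id (𝕜 := ℝ) one_lt_two

end Calculus

/-! ### Forms in one variable and the functions that define them. -/

namespace Hier

section TauForm

open Set ExteriorAlgebra

variable {L N : ℕ}

/-- The degree zero part, evaluated at the constant field √t, recovers the function on the half
line. -/
lemma eqOn_of_tauForm_eq {f f' : ℝ → ℂ} {x : ball L N} (h : tauForm f x = tauForm f' x) :
    EqOn f f' (Ici 0) := by
  intro t ht
  have h1 := congrArg (ExteriorAlgebra.algebraMapInv (R := ℂ))
    (congrFun h (fun _ => ((Real.sqrt t : ℝ) : ℂ)))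
  have h2 : Complex.normSq ((Real.sqrt t : ℝ) : ℂ) = t := by
    rw [Complex.normSq_ofReal, Real.mul_self_sqrt ht]
  have h3 : ∀ f : ℝ → ℂ, ExteriorAlgebra.algebraMapInv (R := ℂ)
      (tauForm f x (fun _ => ((Real.sqrt t : ℝ) : ℂ))) = f t := by
    intro f
    simp only [tauForm, map_add, map_smul, map_mul, dOf, h2]
    rw [AlgHom.commutes]
    simp [ExteriorAlgebra.algebraMapInv]
  rwa [h3, h3] at h1

/-- The (1,1)-form squares to zero, so multiplying the two Taylor expansions gives exactly the
product rule. -/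
lemma tauForm_mul {f f' : ℝ → ℂ} (hf : ∀ t, 0 ≤ t → DifferentiableWithinAt ℝ f (Ici 0) t)
    (hf' : ∀ t, 0 ≤ t → DifferentiableWithinAt ℝ f' (Ici 0) t) (x : ball L N) :
    tauForm f x * tauForm f' x = tauForm (fun t => f t * f' t) x := by
  funext φ
  have ht := Complex.normSq_nonneg (φ x)
  have hd := derivWithin_fun_mul (hf _ ht) (hf' _ ht)
  have hsq : dOf (coord x) * dOf (coordBar x) * (dOf (coord x) * dOf (coordBar x)) = 0 :=
    congrArg Subtype.val (twoForm_sq (coord x) (coordBar x))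
  change tauForm f x φ * tauForm f' x φ = _
  simp only [tauForm, hd]
  rw [add_mul, mul_add, mul_add, smul_mul_smul_comm, hsq, smul_zero, add_zero, ← map_mul,
    ← Algebra.smul_def, smul_smul, ← Algebra.commutes, ← Algebra.smul_def, smul_smul, add_assoc,
    ← add_smul]
  congr 2
  ring

end TauForm

end Hier

/-! ### Moments of the block rate. -/

namespace Hier

section SmoothStep

open Set

variable {L : ℕ} [L.AtLeastTwo]

lemma norm_blockRate_le {a : ℂ} {δ : ℝ} (hδ : 0 < δ) {v : ball L 1 → ℂ}
    (hv : ∀ y, δ ≤ (a + v y).re) (i : ball L 1) :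
    ‖blockRate L a v‖ ≤ ‖a‖ * (L : ℝ) ^ 2 + (L : ℝ) ^ 6 * (‖a + v i‖ ^ 2 / δ) := by
  rw [blockRate]
  refine (norm_add_le _ _).trans ?_
  rw [norm_neg, norm_mul, norm_mul, norm_pow, norm_pow, Complex.norm_natCast]
  gcongr
  exact norm_inv_sum_inv_le hδ hv i

lemma norm_add_laplaceExponent_le (a : ℂ) (κ x : ℝ) :
    ‖a + laplaceExponent κ x‖ ≤ (‖a‖ + |κ| + 2 * Real.pi) * (1 + |x|) := by
  have h1 : ‖laplaceExponent κ x‖ ≤ |κ| + 2 * Real.pi * |x| := by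
    rw [laplaceExponent]
    refine (norm_add_le _ _).trans ?_
    rw [norm_mul, Complex.norm_I, mul_one, Complex.norm_real, Complex.norm_real, norm_mul,
      Real.norm_eq_abs, Real.norm_eq_abs, Real.norm_eq_abs, abs_of_pos Real.two_pi_pos]
  refine (norm_add_le _ _).trans ((add_le_add_right h1 _).trans ?_)
  nlinarith [norm_nonneg a, abs_nonneg κ, abs_nonneg x, Real.pi_pos,
    mul_nonneg (norm_nonneg a) (abs_nonneg x), mul_nonneg (abs_nonneg κ) (abs_nonneg x)]

lemma integrable_pow_mul_of_le {ρ : ℝ → ℂ} (hm : AEStronglyMeasurable ρ) {K j : ℕ} (hj : j ≤ K)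
    (hρ : Integrable fun x : ℝ => (1 + |x|) ^ K * ‖ρ x‖) {c : ℝ → ℂ} (hc : Continuous c) {C : ℝ}
    (hC : ∀ x, ‖c x‖ ≤ C * (1 + |x|) ^ j) : Integrable fun x => c x * ρ x := by
  refine (hρ.const_mul C).mono' (hc.aestronglyMeasurable.mul hm)
    (Filter.Eventually.of_forall fun x => ?_)
  rw [norm_mul, ← mul_assoc]
  refine mul_le_mul_of_nonneg_right ((hC x).trans ?_) (norm_nonneg _)
  have h1 : 1 ≤ 1 + |x| := by linarith [abs_nonneg x]
  have hC0 : 0 ≤ C := nonneg_of_mul_nonneg_left ((norm_nonneg _).trans (hC x)) (by positivity)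
  exact mul_le_mul_of_nonneg_left (pow_le_pow_right₀ h1 hj) hC0

/-- By `norm_blockRate_le` the block rate is at most quadratic in the frequency of one chosen site.
Its `j`-th power therefore uses `2 * j` moments of ρ there, and plain integrability at the other
sites. -/
lemma integrable_pow_blockRate {ρ : ℝ → ℂ} (hm : AEStronglyMeasurable ρ) {K j : ℕ} (hj : 2 * j ≤ K)
    (hρ : Integrable fun x : ℝ => (1 + |x|) ^ K * ‖ρ x‖) {a : ℂ} {κ δ : ℝ} (hδ : 0 < δ)
    (hκ : δ ≤ a.re + κ) :
    Integrable (fun o : ball L 1 → ℝ =>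
      (-blockRate L a fun y => laplaceExponent κ (o y)) ^ j * ∏ y, ρ (o y))
      (Measure.pi fun _ => volume) := by
  set i : ball L 1 := ⟨0, zero_mem_ball L 1⟩
  have hv : ∀ x, δ ≤ (a + laplaceExponent κ x).re := fun x => by
    rw [Complex.add_re, laplaceExponent_re]
    exact hκ
  set A := ‖a‖ + |κ| + 2 * Real.pi with hA
  set C := ‖a‖ * (L : ℝ) ^ 2 + (L : ℝ) ^ 6 * (A ^ 2 / δ) with hC
  have hbound : ∀ o : ball L 1 → ℝ, ‖blockRate L a fun y => laplaceExponent κ (o y)‖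
      ≤ C * (1 + |o i|) ^ 2 := by
    intro o
    refine (norm_blockRate_le hδ (fun y => hv (o y)) i).trans ?_
    have h1 : 1 ≤ (1 + |o i|) ^ 2 := one_le_pow₀ (by linarith [abs_nonneg (o i)])
    have h2 : ‖a + laplaceExponent κ (o i)‖ ^ 2 ≤ A ^ 2 * (1 + |o i|) ^ 2 := by
      rw [← mul_pow]
      exact pow_le_pow_left₀ (norm_nonneg _) (norm_add_laplaceExponent_le a κ (o i)) 2
    rw [hC, add_mul]
    refine add_le_add (le_mul_of_one_le_right (by positivity) h1) ?_
    rw [mul_assoc, div_mul_eq_mul_div]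
    gcongr
  have hρ0 : Integrable ρ := by
    simpa using integrable_pow_mul_of_le hm (zero_le (a := K)) hρ (c := fun _ => 1)
      continuous_const (C := 1) (fun x => by simp)
  have hI : Integrable (fun o : ball L 1 → ℝ => ∏ y, (fun y x => if y = i then
      (1 + |x|) ^ K * ‖ρ x‖ else ‖ρ x‖) y (o y)) (Measure.pi fun _ => volume) := by
    refine Integrable.fintype_prod (f := fun y x => if y = i then
      (1 + |x|) ^ K * ‖ρ x‖ else ‖ρ x‖) fun y => ?_
    by_cases h : y = i
    · simpa only [if_pos h] using hρ
    · simpa only [if_neg h] using hρ0.norm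
  have hmeas : AEStronglyMeasurable (fun o : ball L 1 → ℝ => ∏ y, ρ (o y))
      (Measure.pi fun _ => volume) :=
    (Integrable.fintype_prod (f := fun _ => ρ) fun _ => hρ0).aestronglyMeasurable
  refine (hI.const_mul (C ^ j)).mono' (((measurable_blockRate a
    (continuous_laplaceExponent κ).measurable).neg.pow_const j).aestronglyMeasurable.mul hmeas)
    (Filter.Eventually.of_forall fun o => ?_)
  have h1 : 1 ≤ 1 + |o i| := by linarith [abs_nonneg (o i)]
  have h3 : ∏ y, (fun y x => if y = i then (1 + |x|) ^ K * ‖ρ x‖ else ‖ρ x‖) y (o y)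
      = (1 + |o i|) ^ K * ∏ y, ‖ρ (o y)‖ := by
    rw [← Finset.mul_prod_erase _ _ (Finset.mem_univ i), ← Finset.mul_prod_erase _
      (fun y => ‖ρ (o y)‖) (Finset.mem_univ i)]
    beta_reduce
    rw [if_pos rfl, mul_assoc]
    congr 2
    refine Finset.prod_congr rfl fun y hy => ?_
    simp only [if_neg (Finset.ne_of_mem_erase hy)]
  rw [h3, norm_mul, norm_prod, norm_pow, norm_neg, ← mul_assoc]
  refine mul_le_mul_of_nonneg_right ?_ (Finset.prod_nonneg fun _ _ => norm_nonneg _)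
  calc ‖blockRate L a fun y => laplaceExponent κ (o y)‖ ^ j ≤ (C * (1 + |o i|) ^ 2) ^ j :=
        pow_le_pow_left₀ (norm_nonneg _) (hbound o) j
    _ = C ^ j * (1 + |o i|) ^ (2 * j) := by rw [mul_pow, ← pow_mul]
    _ ≤ C ^ j * (1 + |o i|) ^ K := by
        have : 0 ≤ C := by positivity
        gcongr

end SmoothStep

end Hier

/-! ### Assembly: smoothness, existence and uniqueness of the step, and the identity. -/

namespace Hier

section Main

open Set

variable {L : ℕ} [L.AtLeastTwo]

lemma exists_superposition (L : ℕ) [L.AtLeastTwo] {g : ℝ → ℂ} (hg : ContDiffOn ℝ ∞ g (Ici 0))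
    {κ κ' : ℝ} (hκ : κ' < κ)
    (hdecay : ∀ k : ℕ, ∃ C : ℝ, ∀ t : ℝ, 0 ≤ t →
      ‖iteratedDerivWithin k g (Ici 0) t‖ ≤ C * Real.exp (-κ * t))
    {a : ℂ} (ha : 0 < a.re + κ') (K : ℕ) :
    ∃ ρ : ℝ → ℂ, Integrable ρ ∧ Integrable (fun x => -laplaceExponent κ' x * ρ x) ∧
      (∀ t, 0 ≤ t → g t = expSuperposition volume ρ (laplaceExponent κ') t) ∧
      ∀ j, j ≤ K + 1 → Integrable (fun o : ball L 1 → ℝ =>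
        (-blockRate L a fun y => laplaceExponent κ' (o y)) ^ j * ∏ y, ρ (o y))
        (Measure.pi fun _ => volume) := by
  have hG : ∀ k t, 0 ≤ t → HasDerivWithinAt (iteratedDerivWithin k g (Ici 0))
      (iteratedDerivWithin (k + 1) g (Ici 0) t) (Ici 0) t := by
    intro k t ht
    rw [iteratedDerivWithin_succ]
    exact ((hg.differentiableOn_iteratedDerivWithin (m := k) (by exact_mod_cast WithTop.coe_lt_top _)
      (uniqueDiffOn_Ici 0)) t ht).hasDerivWithinAt
  -- `K + 1` powers of a block rate that grows quadratically require `2 * (K + 1)` moments.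
  obtain ⟨ρ, hm, hρ, hrep⟩ := exists_laplace_representation hκ
    (fun k => iteratedDerivWithin k g (Ici 0)) hG hdecay (2 * (K + 1))
  refine ⟨ρ, ?_, ?_, ?_, fun j hj => ?_⟩
  · simpa using integrable_pow_mul_of_le hm (zero_le (a := 2 * (K + 1))) hρ (c := fun _ => 1)
      continuous_const (C := 1) (fun x => by simp)
  · refine integrable_pow_mul_of_le hm (j := 1) (by omega) hρ
      (continuous_laplaceExponent κ').neg (C := ‖(0 : ℂ)‖ + |κ'| + 2 * Real.pi) fun x => ?_
    rw [norm_neg, pow_one]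
    simpa only [zero_add] using norm_add_laplaceExponent_le 0 κ' x
  · intro t ht
    have h := hrep t ht
    rw [iteratedDerivWithin_zero] at h
    exact h
  · exact integrable_pow_blockRate hm (by omega) hρ ha le_rfl

/-- The renormalization group map in terms of a smooth function. -/
lemma exists_rgForm_eq_tauForm {β : ℂ} (hβ : β ≠ -1) {g : ℝ → ℂ}
    (hg : ContDiffOn ℝ ∞ g (Ici 0)) {κ κ' : ℝ} (hκ : κ' < κ)
    (hdecay : ∀ k : ℕ, ∃ C : ℝ, ∀ t : ℝ, 0 ≤ t →
      ‖iteratedDerivWithin k g (Ici 0) t‖ ≤ C * Real.exp (-κ * t)) (ha : 0 < 1 + β.re + κ') :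
    ∃ (ρ : ℝ → ℂ) (h : ℝ → ℂ), Integrable ρ ∧
      (∀ t, 0 ≤ t → g t = expSuperposition volume ρ (laplaceExponent κ') t) ∧
      (∀ t, h t = expSuperposition (Measure.pi fun _ : ball L 1 => volume)
        (fun o => ∏ y, ρ (o y))
        (fun o => blockRate L (1 + β) fun y => laplaceExponent κ' (o y)) t) ∧
      ContDiffOn ℝ ∞ h (Ici 0) ∧ rgForm L 0 β (tauProd L 1 g) = tauForm h (origin L) := by
  have ha' : 0 < (1 + β).re + κ' := by rwa [Complex.add_re, Complex.one_re]
  have hv : Measurable (laplaceExponent κ') := (continuous_laplaceExponent κ').measurable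
  have hvδ : ∀ x, (1 + β).re + κ' ≤ (1 + β + laplaceExponent κ' x).re := fun x => by
    rw [Complex.add_re (1 + β), laplaceExponent_re]
  -- The weight depends on `K`, but the renormalized form does not. Hence the functions built from
  -- different weights agree on the half line, and the one built from `ρ 0` has `K` continuous
  -- derivatives for every `K`.
  choose ρ h1 h2 h3 h4 using exists_superposition L hg hκ hdecay ha'
  have h5 := fun K => rgForm_tauProd (L := L) hβ hv ha' hvδ (h1 K) (h2 K) (h3 K)
  refine ⟨ρ 0, _, h1 0, h3 0, fun t => rfl, ?_, h5 0⟩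
  rw [contDiffOn_infty]
  intro K
  refine (contDiffOn_expSuperposition (measurable_blockRate (1 + β) hv).aestronglyMeasurable
    (fun o => le_re_blockRate ha' fun y => hvδ (o y)) K _ (h4 K)).congr fun t ht => ?_
  exact eqOn_of_tauForm_eq ((h5 0).symm.trans (h5 K)) ht

/-- If 0 and `x` lay in the same block, `x` would belong to 𝒢_1 and have norm at most L. -/
lemma ballDown_zero_ne {N : ℕ} {x : Hier L} (hx : x ∈ ball L (N + 1)) (h : (L : ℝ) < hnorm x) :
    ballDown (N := N) ⟨0, zero_mem_ball L (N + 1)⟩ ≠ ballDown ⟨x, hx⟩ := by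
  intro he
  have h1 : down x = 0 := by
    have := congrArg Subtype.val he
    change down 0 = down x at this
    rw [← this, down_zero]
  have h2 : x ∈ ball L 1 := by
    rw [mem_ball_succ_iff, h1]
    exact zero_mem_ball L 0
  have hL := one_lt_cast L
  rw [hnorm] at h
  split_ifs at h with h0
  · linarith
  · have h3 : sInf {k : ℕ | x ∈ ball L k} ≤ 1 := Nat.sInf_le h2
    have := pow_le_pow_right₀ hL.le h3
    linarith

end Main

end Hier

namespace Hier

section RGStep

open Set

variable {L : ℕ} [L.AtLeastTwo] {β : ℂ} {g h : ℝ → ℂ}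

lemma hasDerivAt_cexp_mul (ν : ℂ) (t : ℝ) :
    HasDerivAt (fun t : ℝ => Complex.exp (ν * t)) (Complex.exp (ν * t) * ν) t := by
  have h1 : HasDerivAt (fun s : ℝ => ν * (s : ℂ)) ν t := by
    simpa using ((hasDerivAt_id t).ofReal_comp).const_mul ν
  exact h1.cexp

lemma hasDerivWithinAt_cexp_mul_mul (hs : ContDiffOn ℝ ∞ h (Ici 0)) (h0 : h 0 = 1) (ν : ℂ) :
    HasDerivWithinAt (fun t : ℝ => Complex.exp (ν * t) * h t)
      (ν + derivWithin h (Ici 0) 0) (Ici 0) 0 := by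
  have h2 := ((hs.differentiableOn (by simp)) 0 self_mem_Ici).hasDerivWithinAt
  refine ((hasDerivAt_cexp_mul ν 0).hasDerivWithinAt.mul h2).congr_deriv ?_
  simp [h0]

omit [L.AtLeastTwo] in
lemma tauForm_cexp_mul (hs : ContDiffOn ℝ ∞ h (Ici 0)) (ν : ℂ) :
    tauForm (fun t : ℝ => Complex.exp (ν * t)) (origin L) * tauForm h (origin L)
      = tauForm (fun t => Complex.exp (ν * t) * h t) (origin L) :=
  tauForm_mul (fun t _ => (hasDerivAt_cexp_mul ν t).hasDerivWithinAt.differentiableWithinAt)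
    (fun t ht => (hs.differentiableOn (by simp)) t ht) _

lemma contDiffOn_cexp_mul_mul (hs : ContDiffOn ℝ ∞ h (Ici 0)) (ν : ℂ) :
    ContDiffOn ℝ ∞ (fun t : ℝ => Complex.exp (ν * t) * h t) (Ici 0) := by
  refine ContDiffOn.mul (ContDiff.contDiffOn ?_) hs
  exact (contDiff_const.mul Complex.ofRealCLM.contDiff).cexp

lemma isRGStep_of_rgForm_eq (hs : ContDiffOn ℝ ∞ h (Ici 0)) (h0 : h 0 = 1)
    (hrg : rgForm L 0 β (tauProd L 1 g) = tauForm h (origin L)) :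
    IsRGStep L β g (-derivWithin h (Ici 0) 0)
      (fun t => Complex.exp (-derivWithin h (Ici 0) 0 * t) * h t) where
  smooth := contDiffOn_cexp_mul_mul hs _
  form_eq := by rw [hrg, tauForm_cexp_mul hs]
  normalized := by
    refine isBigO_sq_of_contDiffOn
      (contDiffOn_infty.1 (contDiffOn_cexp_mul_mul hs _) 2) (by simp [h0]) ?_
    exact (hasDerivWithinAt_cexp_mul_mul hs h0 _).congr_deriv (neg_add_cancel _)

/-- The form equation forces the new function to be e^{νt} h on the half line; its linear
coefficient ν + h'(0) must then vanish. -/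
lemma IsRGStep.eq_of_rgForm_eq (hs : ContDiffOn ℝ ∞ h (Ici 0)) (h0 : h 0 = 1)
    (hrg : rgForm L 0 β (tauProd L 1 g) = tauForm h (origin L)) {ν : ℂ} {g' : ℝ → ℂ}
    (hg' : IsRGStep L β g ν g') : ν = -derivWithin h (Ici 0) 0 ∧
      EqOn g' (fun t => Complex.exp (-derivWithin h (Ici 0) 0 * t) * h t) (Ici 0) := by
  have h1 := hg'.form_eq
  rw [hrg, tauForm_cexp_mul hs] at h1
  have h2 := eqOn_of_tauForm_eq h1
  have h3 : g' 0 = 1 := by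
    rw [h2 self_mem_Ici]
    simp [h0]
  have h4 := hasDerivWithinAt_zero_of_isBigO_sq h3 hg'.normalized
  have h5 := (hasDerivWithinAt_cexp_mul_mul hs h0 ν).congr h2 (h2 self_mem_Ici)
  have h6 : ν + derivWithin h (Ici 0) 0 = 0 :=
    (uniqueDiffOn_Ici (0 : ℝ) 0 self_mem_Ici).eq_deriv _ h5 h4
  have h7 := eq_neg_of_add_eq_zero_left h6
  exact ⟨h7, h7 ▸ h2⟩

end RGStep

end Hier

theorem mainTheorem5 (L : ℕ) [L.AtLeastTwo] (N : ℕ) (β : ℂ) (hβ : β ≠ -1)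
    (g : ℝ → ℂ) (hg : ContDiffOn ℝ ∞ g (Set.Ici 0)) (hg0 : g 0 = 1)
    (κ : ℝ) (hκ : 0 < β.re + κ + Hier.jumpRate L * ((L : ℝ) ^ (2 * (N + 1)))⁻¹)
    (hdecay : ∀ k : ℕ, ∃ C : ℝ, ∀ t : ℝ, 0 ≤ t →
      ‖iteratedDerivWithin k g (Set.Ici 0) t‖ ≤ C * Real.exp (-κ * t)) :
    ∃ (ν' : ℂ) (g' : ℝ → ℂ), Hier.IsRGStep L β g ν' g' ∧
      (∀ (ν'' : ℂ) (g'' : ℝ → ℂ), Hier.IsRGStep L β g ν'' g'' →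
        ν'' = ν' ∧ Set.EqOn g'' g' (Set.Ici 0)) ∧
      ∀ x ∈ Hier.ball L (N + 1), (L : ℝ) < Hier.hnorm x →
        Hier.GreenConverges L (N + 1) g β x ∧
        Hier.GreenConverges L N g' ((L : ℂ) ^ 2 * β + ν') (Hier.down x) ∧
        Hier.green L (N + 1) g β x =
          Hier.scaleFun (Hier.green L N g' ((L : ℂ) ^ 2 * β + ν')) x := by
  set s := Hier.jumpRate L * ((L : ℝ) ^ (2 * (N + 1)))⁻¹ with hs
  -- Half of the slack in `hκ` is given up, to leave room for the strictly smaller decay rate of the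
  -- exponentials.
  obtain ⟨κ', hκ', hb⟩ : ∃ κ' < κ, 0 < β.re + κ' + s :=
    ⟨κ - (β.re + κ + s) / 2, by linarith, by linarith⟩
  have ha : 0 < 1 + β.re + κ' := by linarith [Hier.jumpRate_mul_lt_one (L := L) (N + 1)]
  obtain ⟨ρ, h, hρ, hgρ, hhρ, hsmooth, hrg⟩ :=
    Hier.exists_rgForm_eq_tauForm (L := L) hβ hg hκ' hdecay ha
  have hone : ∫ x, ρ x = 1 := by
    have := hgρ 0 le_rfl
    rw [hg0, expSuperposition] at this
    simpa using this.symm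
  -- At t = 0 the superposition is the integral of ∏ ρ over the block, a power of g(0).
  have h0 : h 0 = 1 := by
    rw [hhρ, expSuperposition]
    have := integral_fintype_prod_eq_prod (μ := fun _ : Hier.ball L 1 => (volume : Measure ℝ))
      (f := fun _ => ρ)
    simpa [hone] using this
  set ν : ℂ := -derivWithin h (Set.Ici 0) 0 with hν
  refine ⟨ν, _, Hier.isRGStep_of_rgForm_eq hsmooth h0 hrg,
    fun ν'' g'' hg'' => hg''.eq_of_rgForm_eq hsmooth h0 hrg, fun x hx hxL => ?_⟩
  have hv : Measurable (laplaceExponent κ') := (continuous_laplaceExponent κ').measurable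
  have hvκ : ∀ q, κ' ≤ (laplaceExponent κ' q).re := fun q => (laplaceExponent_re κ' q).ge
  obtain ⟨c1, e1⟩ := Hier.green_eq_integral hρ hv hvκ hb hgρ ⟨x, hx⟩
  set c : (Hier.ball L 1 → ℝ) → ℂ := fun o =>
    Hier.blockRate L (1 + β) fun y => laplaceExponent κ' (o y) with hc
  have hcm : Measurable fun o => c o - ν := (Hier.measurable_blockRate (1 + β) hv).sub_const ν
  have hre : ∀ z : ℂ, ((L : ℂ) ^ 2 * z).re = (L : ℝ) ^ 2 * z.re := fun z => by
    have : (L : ℂ) ^ 2 * z = (((L : ℝ) ^ 2 : ℝ) : ℂ) * z := by push_cast; ring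
    rw [this, Complex.re_ofReal_mul]
  -- The factor e^{νt} lowers every rate by ν while β' contains +ν, so the matrices being inverted
  -- are those with potential L²β plus the block rate.
  obtain ⟨c2, e2⟩ := Hier.green_eq_integral (L := L) (N := N)
    (μ := Measure.pi fun _ : Hier.ball L 1 => (volume : Measure ℝ))
    (ρ := fun o => ∏ y, ρ (o y)) (v := fun o => c o - ν)
    (κ := (L : ℝ) ^ 2 * κ' - ν.re) (β := (L : ℂ) ^ 2 * β + ν)
    (g := fun t => Complex.exp (ν * t) * h t)
    (Integrable.fintype_prod (f := fun _ => ρ) fun _ => hρ) hcm (fun o => by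
      have h1 := Hier.le_re_add_blockRate (L := L) ha (v := fun y => laplaceExponent κ' (o y))
        fun y => hvκ _
      rw [Complex.add_re, hre, mul_add] at h1
      rw [Complex.sub_re]
      linarith) (by
      have h1 := Hier.sq_mul_add_pos hb
      rw [Complex.add_re, hre]
      linarith) (fun t _ => by
      have h1 := expSuperposition_const_add
        (μ := Measure.pi fun _ : Hier.ball L 1 => (volume : Measure ℝ))
        (ρ := fun o => ∏ y, ρ (o y)) (v := c) (-ν) t
      rw [neg_neg, ← hhρ] at h1
      rw [← h1, expSuperposition]
      simp only [hν, sub_neg_eq_add, add_comm]) (Hier.ballDown ⟨x, hx⟩)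
  refine ⟨c1, c2, e1.trans ?_⟩
  rw [Hier.integral_inv_killedMatrix_succ hρ hv hvκ hb (Hier.ballDown_zero_ne hx hxL),
    Hier.scaleFun]
  congr 1
  refine Eq.trans ?_ e2.symm
  have hz : Hier.ballDown (N := N) ⟨0, Hier.zero_mem_ball L (N + 1)⟩
      = ⟨0, Hier.zero_mem_ball L N⟩ := Subtype.ext Hier.down_zero
  rw [hz]
  simp only [add_add_sub_cancel, hc]
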